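/- **Setting.** Let $V$ be a set of vertices and $q=(q_k)_{k\in V}$ the coordinate process on $\Omega=[0,\infty]^V$ with a probability measure $\mathbb P$. Put $X(\omega)=\{k: q_k(\omega)<\infty\}$. Let $H_0$ be a bounded operator on $\ell^2(V)$ with real symmetric matrix elements $H_0(k,j)=\langle\delta_k,H_0\delta_j\rangle$, and let $X^\infty(\omega)$ be the union of the infinite components of $X(\omega)$ with respect to paths whose steps $(k,j)$ satisfy $H_0(k,j)\ne0$. The random Hamiltonian on $\ell^2(X(\omega))$ is $(H_\omega f)(k)=q_k(\omega)f(k)+\sum_{j\in X(\omega)}H_0(k,j)f(j)$, and $H_\omega^\infty$ is its restriction to $\ell^2(X^\infty(\omega))$. Let $\sigma_{fin}(\cdot)$ denote the set of eigenvalues having a finitely supported eigenfunction, and $$\Sigma_{fin}=\{E\in\mathbb R: E\in\sigma_{fin}(H_\omega)\text{ for a.e. }\omega\},\qquad \Sigma^\infty_{fin}=\{E\in\mathbb R: E\in\sigma_{fin}(H^\infty_\omega)\text{ for a.e. }\omega\}.$$ Let $\tilde\Sigma$ be the set of eigenvalues of the restrictions $H_0^G$ of $H_0$ to $\ell^2(G)$,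 $G\subset V$ finite. Given finite sets $\Lambda_L\subset V$ ($L\in\mathbb N$), let $N_\omega^L(E)$ (respectively $N_\omega^{\infty,L}(E)$) be the number of eigenvalues smaller than $E$, with multiplicity, of the restriction of $H_\omega$ to $\ell^2(\Lambda_L\cap X(\omega))$ (respectively $\ell^2(\Lambda_L\cap X^\infty(\omega))$), divided by $|\Lambda_L|$. A finite measure $\nu$ on $\mathbb R$ is the *IDS measure* of $(H_\omega)$ along $(\Lambda_L)$ if for a.e. $\omega$ one has $N_\omega^L(E)\to N(E):=\nu(]-\infty,E[)$ at all continuity points $E$ of $N$; the IDS measure $\nu^\infty$ of $(H^\infty_\omega)$ is defined in the same way with $N_\omega^{\infty,L}$. Write $\operatorname{supp}\nu_{pp}=\{E:\nu(\{E\})\neq0\}$ for the set of atoms of $\nu$. **A. The lattice.** Let $d\ge1$, $V=\mathbb Z^d$, let the $q_k$ be iid, let $H_0$ be invariant under translations with $H_0(k,j)=0$ whenever $\|k-j\|_1\ge R$, for some $R\in\mathbb N$, and let $\Lambda_L=[-L,L]^d$. Then each $E\in\mathbb R$ belongs to $\sigma_{fin}(H_\omega)$ with probability $0$ or $1$, and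 likewise to $\sigma_{fin}(H_\omega^\infty)$. The IDS measures $\nu$ of $(H_\omega)$ and $\nu^\infty$ of $(H_\omega^\infty)$ along $(\Lambda_L)$ exist, and: 1. $\Sigma_{fin}=\operatorname{supp}\nu_{pp}$. 2. If $q_0$ takes only the values $0$ and $\infty$ and is non-trivial (both have positive probability), then $\Sigma_{fin}=\tilde\Sigma$; moreover, almost surely, $\sigma_{fin}(H_\omega)=\tilde\Sigma$ and the spectrum of $H_\omega$ is the closure of $\tilde\Sigma$, so that $\tilde\Sigma$ is dense in the almost sure spectrum. If, in addition, $H_0$ is the adjacency operator ($H_0(k,j)=1$ if $\|k-j\|_1=1$, and $0$ otherwise), then all elements of $\tilde\Sigma$ are algebraic integers. 3. If $X^\infty(\omega)\neq\emptyset$ almost surely, then $\Sigma^\infty_{fin}=\operatorname{supp}\nu^\infty_{pp}$. 4. If $X^\infty(\omega)\neq\emptyset$ almost surely and $H_0$ is the adjacency operator, then $\Sigma^\infty_{fin}=\Sigma_{fin}$. **B. Graphs.** Let $X$ be a connected, locally finite graph with vertex set $V$ on which a group $\Gamma$ acts by graph automorphisms with finite vertex stabilisers, and let $F\subset V$ be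 a finite set meeting every $\Gamma$-orbit. Let $\Gamma$ be amenable and let $(I_L)$ be any Følner sequence: the $I_L\subset\Gamma$ are finite and non-empty, and for every finite non-empty $K\subset\Gamma$ and every $\epsilon>0$ one has $|I_L\,\triangle\,KI_L|\le\epsilon|I_L|$ for all large $L$. Put $\Lambda_L=\bigcup_{\gamma\in I_L^{-1}}\gamma F$. Let $\mathbb P$ be invariant and ergodic under the shifts $(\tau_\gamma\omega)_k=\omega_{\gamma^{-1}k}$, $\gamma\in\Gamma$, and let $H_0$ satisfy $H_0(\gamma k,\gamma j)=H_0(k,j)$ for all $\gamma\in\Gamma$ and $H_0(k,j)=0$ whenever $\operatorname{dist}(k,j)\ge R$, for some $R\in\mathbb N$. Then each $E\in\mathbb R$ belongs to $\sigma_{fin}(H_\omega)$ with probability $0$ or $1$, and likewise to $\sigma_{fin}(H_\omega^\infty)$. The IDS measures of $(H_\omega)$ and of $(H_\omega^\infty)$ exist along some subsequence of $(\Lambda_L)$, and: 1. If $\nu$ is the IDS measure of $(H_\omega)$ along $(\Lambda_L)$, then $\Sigma_{fin}=\operatorname{supp}\nu_{pp}$. 2. If the $q_k$ take only the values $0$ and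 $\infty$, then $\Sigma_{fin}\subset\tilde\Sigma$, and $\sigma_{fin}(H_\omega)=\Sigma_{fin}$ almost surely. If, moreover, the $q_k$ are independent and non-trivial (each takes both values with positive probability), then $\Sigma_{fin}=\tilde\Sigma$, and almost surely the spectrum of $H_\omega$ is the closure of $\tilde\Sigma$; if, in addition, $H_0$ is the adjacency operator of $X$, then all elements of $\tilde\Sigma$ are algebraic integers. 3. If $X^\infty(\omega)\neq\emptyset$ almost surely and $\nu^\infty$ is the IDS measure of $(H^\infty_\omega)$ along $(\Lambda_L)$, then $\Sigma^\infty_{fin}=\operatorname{supp}\nu^\infty_{pp}$. -/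

import Mathlib

open scoped ENNReal Pointwise Topology
open MeasureTheory Filter

noncomputable section

namespace Percolation

/-- The Hilbert space `ℓ²(V)`. -/
abbrev L2 (V : Type*) : Type _ := lp (fun _ : V => ℂ) 2

open Classical in
/-- The unit vector `δ_k` of `ℓ²(V)`. -/
def delta {V : Type*} (k : V) : L2 V := lp.single 2 k 1

/-- The matrix element `⟨δ_k, H₀ δ_j⟩`. -/
def entry {V : Type*} (H₀ : L2 V →L[ℂ] L2 V) (k j : V) : ℂ :=
  inner ℂ (delta k) (H₀ (delta j))

/-- The matrix element `H₀(k,j)` as a real number (used only for operators whose matrix elements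
are real). -/
def hop {V : Type*} (H₀ : L2 V →L[ℂ] L2 V) (k j : V) : ℝ := (entry H₀ k j).re

/-- Finite hopping range operators on a graph `G`, invariant under a group `Γ`. -/
structure IsGraphHopping {V : Type*} (G : SimpleGraph V) (Γ : Type*) [Group Γ] [MulAction Γ V]
    (H₀ : L2 V →L[ℂ] L2 V) : Prop where
  real : ∀ k j, (entry H₀ k j).im = 0
  symm : ∀ k j, entry H₀ k j = entry H₀ j k
  invariant : ∀ (γ : Γ) (k j : V), entry H₀ (γ • k) (γ • j) = entry H₀ k j
  finite_range : ∃ R : ℕ, ∀ k j, R ≤ G.dist k j → entry H₀ k j = 0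

/-- The distance `‖k - j‖₁` on `ℤ^d`. -/
def l1dist {d : ℕ} (k j : Fin d → ℤ) : ℕ := ∑ i, (k i - j i).natAbs

/-- Finite hopping range operators on `ℤ^d`. -/
structure IsLatticeHopping {d : ℕ} (H₀ : L2 (Fin d → ℤ) →L[ℂ] L2 (Fin d → ℤ)) : Prop where
  real : ∀ k j, (entry H₀ k j).im = 0
  symm : ∀ k j, entry H₀ k j = entry H₀ j k
  invariant : ∀ l k j, entry H₀ (k + l) (j + l) = entry H₀ k j
  finite_range : ∃ R : ℕ, ∀ k j, R ≤ l1dist k j → entry H₀ k j = 0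

open Classical in
/-- `H₀` is the adjacency operator of the graph `G`. -/
def IsAdjacencyOperator {V : Type*} (G : SimpleGraph V) (H₀ : L2 V →L[ℂ] L2 V) : Prop :=
  ∀ k j, entry H₀ k j = if G.Adj k j then 1 else 0

/-- `H₀` is the adjacency operator of `ℤ^d`. -/
def IsLatticeAdjacencyOperator {d : ℕ} (H₀ : L2 (Fin d → ℤ) →L[ℂ] L2 (Fin d → ℤ)) : Prop :=
  ∀ k j, entry H₀ k j = if l1dist k j = 1 then 1 else 0

/-- The set `X(ω)` of active vertices of the configuration `q`. -/
def active {V : Type*} (q : V → ℝ≥0∞) : Set V := {k | q k < ∞}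

/-- The set `X^∞(ω)`: the union of the infinite `H₀`-path connected components of the set of
active vertices. -/
def infCluster {V : Type*} (H₀ : L2 V →L[ℂ] L2 V) (q : V → ℝ≥0∞) : Set V :=
  {k | k ∈ active q ∧
    {j | Relation.ReflTransGen (fun a b => b ∈ active q ∧ hop H₀ a b ≠ 0) k j}.Infinite}

/-- The set of eigenvalues with a finitely supported eigenfunction of the restriction to
`ℓ²(Y)` of the Hamiltonian with hopping part `H₀` and potential `q`; here `Y ⊆ active q`. -/
def sigmaFin {V : Type*} (H₀ : L2 V →L[ℂ] L2 V) (q : V → ℝ≥0∞) (Y : Set V) : Set ℝ :=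
  {E | ∃ f : V →₀ ℂ, f ≠ 0 ∧ (f.support : Set V) ⊆ Y ∧
    ∀ k ∈ Y, ((q k).toReal : ℂ) * f k + f.sum (fun j z => (hop H₀ k j : ℂ) * z) = (E : ℂ) * f k}

/-- The energies that are almost surely eigenvalues, with a finitely supported eigenfunction, of
the Hamiltonian restricted to the random vertex set `Y ω`. -/
def SigmaFin {V : Type*} (P : Measure (V → ℝ≥0∞)) (H₀ : L2 V →L[ℂ] L2 V)
    (Y : (V → ℝ≥0∞) → Set V) : Set ℝ :=
  {E | ∀ᵐ ω ∂P, E ∈ sigmaFin H₀ ω (Y ω)}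

/-- Each energy is almost surely or almost surely not an eigenvalue with a finitely supported
eigenfunction. -/
def NonrandomSigmaFin {V : Type*} (P : Measure (V → ℝ≥0∞)) (H₀ : L2 V →L[ℂ] L2 V)
    (Y : (V → ℝ≥0∞) → Set V) : Prop :=
  ∀ E : ℝ, (∀ᵐ ω ∂P, E ∈ sigmaFin H₀ ω (Y ω)) ∨ (∀ᵐ ω ∂P, E ∉ sigmaFin H₀ ω (Y ω))

open Classical in
/-- The matrix of the Hamiltonian with hopping part `H₀` and potential `q`, restricted to the
finite set `A` of active vertices. -/
def hamMatrix {V : Type*} (H₀ : L2 V →L[ℂ] L2 V) (q : V → ℝ≥0∞) (A : Finset V) :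
    Matrix A A ℝ :=
  Matrix.diagonal (fun k : A => (q k).toReal) + Matrix.of (fun k j : A => hop H₀ k j)

open Classical in
/-- The normalised eigenvalue counting function: the number of eigenvalues below `E`, counted with
multiplicity, of the Hamiltonian restricted to `Λ ∩ Y`, divided by the number of vertices of `Λ`.
The matrix is real symmetric, so its eigenvalues with multiplicity are the real roots of its
characteristic polynomial. -/
def countingFunction {V : Type*} (H₀ : L2 V →L[ℂ] L2 V) (q : V → ℝ≥0∞) (Y : Set V)
    (Λ : Finset V) (E : ℝ) : ℝ :=
  ((hamMatrix H₀ q (Λ.filter (· ∈ Y))).charpoly.roots.countP (· < E) : ℝ) / (Λ.card : ℝ)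

/-- `ν` is the density of states measure: `N(E) = ν(]-∞, E[)` is the integrated density of states
of the random Hamiltonian restricted to `Y ω`, along the exhaustion `Λ`. -/
def IsIDS {V : Type*} (P : Measure (V → ℝ≥0∞)) (H₀ : L2 V →L[ℂ] L2 V)
    (Y : (V → ℝ≥0∞) → Set V) (Λ : ℕ → Finset V) (ν : Measure ℝ) : Prop :=
  IsFiniteMeasure ν ∧
    ∀ᵐ ω ∂P, ∀ E : ℝ, ContinuousAt (fun E' => ν.real (Set.Iio E')) E →
      Tendsto (fun L => countingFunction H₀ ω (Y ω) (Λ L) E) atTop (𝓝 (ν.real (Set.Iio E)))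

/-- The support of the pure point part of `ν`, that is, the set of atoms. -/
def atoms (ν : Measure ℝ) : Set ℝ := {E | ν {E} ≠ 0}

open Classical in
/-- The set of eigenvalues of the restrictions of `H₀` to finite sets of vertices. -/
def finiteEigenvalues {V : Type*} (H₀ : L2 V →L[ℂ] L2 V) : Set ℝ :=
  {E | ∃ A : Finset V, ∃ f : A → ℂ, f ≠ 0 ∧
    ∀ k : A, ∑ j : A, (hop H₀ k j : ℂ) * f j = (E : ℂ) * f k}

/-- The subspace `ℓ²(Y)` of `ℓ²(V)`. -/
def l2On {V : Type*} (Y : Set V) : Submodule ℂ (L2 V) where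
  carrier := {f | ∀ k, k ∉ Y → f k = 0}
  zero_mem' := fun _ _ => rfl
  add_mem' := by
    intro f g hf hg k hk
    simp [hf k hk, hg k hk]
  smul_mem' := by
    intro c f hf k hk
    simp [hf k hk]

theorem isClosed_l2On {V : Type*} (Y : Set V) : IsClosed (l2On Y : Set (L2 V)) := by
  have h : (l2On Y : Set (L2 V)) =
      ⋂ k ∈ Yᶜ, {f : L2 V | lp.evalCLM ℂ (fun _ : V => ℂ) 2 k f = 0} := by
    ext f
    simp only [Set.mem_iInter, Set.mem_compl_iff, Set.mem_ofPred_eq]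
    exact Iff.rfl
  rw [h]
  exact isClosed_biInter fun k _ => isClosed_eq (ContinuousLinearMap.continuous _) continuous_const

instance completeSpace_l2On {V : Type*} (Y : Set V) : CompleteSpace (l2On Y) :=
  (isClosed_l2On Y).completeSpace_coe

/-- The restriction (compression) of `H₀` to `ℓ²(Y)`. If all potential values are `0` or `∞`, the
Hamiltonian of the configuration `q` is the restriction of `H₀` to `ℓ²(active q)`. -/
def restrictOp {V : Type*} (H₀ : L2 V →L[ℂ] L2 V) (Y : Set V) : l2On Y →L[ℂ] l2On Y :=
  (l2On Y).orthogonalProjectionOnto ∘L H₀ ∘L (l2On Y).subtypeL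

/-- The box `[-L, L]^d`. -/
def box (d : ℕ) (L : ℕ) : Finset (Fin d → ℤ) := Finset.Icc (fun _ => -(L : ℤ)) (fun _ => (L : ℤ))

/-- `X` is a connected, locally finite graph on which `Γ` acts by graph automorphisms, with finite
stabilisers and finite quotient; every vertex has a `Γ`-translate in the finite set `F`. -/
structure IsCocompactAction {V : Type*} (X : SimpleGraph V) (Γ : Type*) [Group Γ] [MulAction Γ V]
    (F : Finset V) : Prop where
  connected : X.Connected
  locally_finite : ∀ v, (X.neighborSet v).Finite
  automorphism : ∀ (γ : Γ) (v w : V), X.Adj (γ • v) (γ • w) ↔ X.Adj v w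
  finite_stabilizer : ∀ v : V, (MulAction.stabilizer Γ v : Set Γ).Finite
  covers : ∀ v : V, ∃ γ : Γ, γ • v ∈ F

open Classical in
/-- Følner sequences of finite subsets of the group `Γ`. -/
def IsFolner {Γ : Type*} [Group Γ] (I : ℕ → Finset Γ) : Prop :=
  (∀ L, (I L).Nonempty) ∧
    ∀ K : Finset Γ, K.Nonempty → ∀ ε : ℝ, 0 < ε →
      ∀ᶠ L in atTop, ((symmDiff (I L) (K * I L)).card : ℝ) ≤ ε * ((I L).card : ℝ)

open Classical in
/-- The exhaustion `Λ_L = ⋃_{γ ∈ I_L⁻¹} γ F`. -/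
def exhaustion {V Γ : Type*} [Group Γ] [MulAction Γ V] (F : Finset V) (I : ℕ → Finset Γ) (L : ℕ) :
    Finset V :=
  (I L)⁻¹ • F

/-- The shift `(τ_γ ω)_k = ω_{γ⁻¹ k}`. -/
def shift {V Γ : Type*} [Group Γ] [MulAction Γ V] (γ : Γ) (ω : V → ℝ≥0∞) : V → ℝ≥0∞ :=
  fun k => ω (γ⁻¹ • k)

/-- The law `P` of the potential is stationary and ergodic with respect to `Γ`. -/
def IsStationaryErgodic {V : Type*} (Γ : Type*) [Group Γ] [MulAction Γ V]
    (P : Measure (V → ℝ≥0∞)) : Prop :=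
  (∀ γ : Γ, MeasurePreserving (shift (V := V) γ) P P) ∧
    ∀ A : Set (V → ℝ≥0∞), MeasurableSet A → (∀ γ : Γ, shift γ ⁻¹' A = A) → P A = 0 ∨ P A = 1

end Percolation

end

/-! Atoms and finitely supported eigenfunctions are linked by the eigenprojection. If the potential
is bounded, `ν {E}` is the mean, per vertex, of the diagonal element `⟨δ_k, p δ_k⟩` of the
projection `p` onto the eigenspace at `E` of the infinite-volume operator. Indeed, a polynomial of
the operator has finite propagation, so its finite-volume trace agrees, up to boundary terms, with a
sum of equivariant local observables and converges per volume by an ergodic theorem. The polynomials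
`avgPoly` tend boundedly to the indicator of `{E}` on the spectrum and, by von Neumann's mean
ergodic theorem, strongly to `p`. Comparison with counting functions gives `vmean_obsEig_le` and
`atom_le_vmean_obsEig`.

If the mean is positive, the eigenspace restricted to a large volume has dimension at least
proportional to the volume (`sum_norm_sq_starProjection_delta_le`), whereas vanishing near the
boundary costs only a small proportion of linear conditions. Some eigenfunction satisfies them all,
and its truncation is an eigenfunction of finite support (`mem_sigmaFin_of_card_lt`). Conversely, a
finitely supported eigenfunction makes a diagonal element of `p` positive, which almost surely does
not happen if `E` is not an atom (`ae_notMem_sigmaFin_of_not_atom`). Each energy falls under one of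
these two almost sure statements, which also proves nonrandomness.

An unbounded potential is cut off: vertices with potential above `K` are removed. By eigenvalue
interlacing this changes the normalised counting functions by at most the density of removed
vertices, which tends to zero as `K` grows.

For a general Følner sequence only the mean ergodic theorem is used. It gives almost sure
convergence along a subsequence, which is enough because an IDS along a sequence is one along every
subsequence. Existence of the IDS along all boxes of the lattice needs the pointwise theorem
`avgConv_boxGroup`, proved from a maximal inequality based on Vitali covering.

If the potential takes only the values `0` and `∞`, a finite set of vertices surrounded by deleted
ones carries the eigenvalues of its finite matrix. Independence gives this pattern positive
probability, and nonrandomness makes the eigenvalue almost sure. The spectrum is no larger than the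
closure of these eigenvalues because finitely supported vectors are dense.

For the infinite clusters of the nearest neighbour lattice, an eigenfunction on a finite cluster `C`
is combined with its mirror image. If both sets are attached to an infinite cluster through the same
single vertex `m`, a linear combination cancels at `m` and solves the eigenvalue equation on the
infinite cluster. The required configuration has positive probability because its parts concern
disjoint sets of sites; in dimension one, infinite clusters exclude deleted sites
(`measure_top_eq_zero_of_dim_one`). -/

noncomputable section

namespace Percolation

/-! ### Real symmetric matrices: traces and eigenvalue counts -/

section Matrices

open Matrix

variable {n m : Type*} [Fintype n] [DecidableEq n] [Fintype m] [DecidableEq m]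

theorem exists_orthogonal_diagonalization {M : Matrix n n ℝ} (hM : M.IsHermitian) :
    ∃ U : Matrix n n ℝ, Uᵀ * U = 1 ∧ U * Uᵀ = 1 ∧ M = U * diagonal hM.eigenvalues * Uᵀ := by
  have hs : (star (hM.eigenvectorUnitary : Matrix n n ℝ)) =
      (hM.eigenvectorUnitary : Matrix n n ℝ)ᵀ := by
    rw [star_eq_conjTranspose, conjTranspose_eq_transpose_of_trivial]
  refine ⟨hM.eigenvectorUnitary, ?_, ?_, ?_⟩
  · rw [← hs]; exact Unitary.coe_star_mul_self _
  · rw [← hs]; exact Unitary.coe_mul_star_self _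
  · conv_lhs => rw [hM.spectral_theorem, Unitary.conjStarAlgAut_apply]
    rw [← hs]
    rfl

theorem countP_roots_charpoly {M : Matrix n n ℝ} (hM : M.IsHermitian) (E : ℝ) :
    M.charpoly.roots.countP (· < E) = (Finset.univ.filter fun i => hM.eigenvalues i < E).card := by
  rw [hM.roots_charpoly_eq_eigenvalues, Multiset.countP_map]
  rfl

theorem trace_pow_eq_sum_eigenvalues {M : Matrix n n ℝ} (hM : M.IsHermitian) (p : ℕ) :
    (M ^ p).trace = ∑ i, hM.eigenvalues i ^ p := by
  obtain ⟨U, h1, h2, h3⟩ := exists_orthogonal_diagonalization hM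
  have hp : M ^ p = U * diagonal hM.eigenvalues ^ p * Uᵀ := by
    induction p with
    | zero => simp [h2]
    | succ p ih =>
      rw [pow_succ, ih]
      nth_rw 2 [h3]
      calc U * diagonal hM.eigenvalues ^ p * Uᵀ * (U * diagonal hM.eigenvalues * Uᵀ)
          = U * diagonal hM.eigenvalues ^ p * (Uᵀ * U) * diagonal hM.eigenvalues * Uᵀ := by
            simp only [Matrix.mul_assoc]
        _ = _ := by rw [h1, Matrix.mul_one, pow_succ, Matrix.mul_assoc U]
  rw [hp, Matrix.mul_assoc, Matrix.trace_mul_comm, Matrix.mul_assoc, h1, Matrix.mul_one,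
    diagonal_pow, trace_diagonal]
  rfl

theorem trace_aeval_eq_sum_eigenvalues {M : Matrix n n ℝ} (hM : M.IsHermitian)
    (p : Polynomial ℝ) :
    (Polynomial.aeval M p).trace = ∑ i, p.eval (hM.eigenvalues i) := by
  rw [Polynomial.aeval_eq_sum_range, Matrix.trace_sum]
  simp_rw [Matrix.trace_smul, trace_pow_eq_sum_eigenvalues hM, Polynomial.eval_eq_sum_range,
    smul_eq_mul, Finset.mul_sum]
  exact Finset.sum_comm

theorem dotProduct_mulVec_eigenvalues {M : Matrix n n ℝ} (hM : M.IsHermitian) :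
    ∃ U : Matrix n n ℝ, (∀ x, Uᵀ *ᵥ x = 0 → x = 0) ∧
      (∀ x, x ⬝ᵥ x = ∑ i, (Uᵀ *ᵥ x) i ^ 2) ∧
      ∀ x, x ⬝ᵥ M *ᵥ x = ∑ i, hM.eigenvalues i * (Uᵀ *ᵥ x) i ^ 2 := by
  obtain ⟨U, h1, h2, h3⟩ := exists_orthogonal_diagonalization hM
  have hx : ∀ x, x = U *ᵥ (Uᵀ *ᵥ x) := fun x => by rw [mulVec_mulVec, h2, one_mulVec]
  refine ⟨U, fun x h => by rw [hx x, h, mulVec_zero], fun x => ?_, fun x => ?_⟩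
  · have : x ⬝ᵥ x = (Uᵀ *ᵥ x) ⬝ᵥ (Uᵀ *ᵥ x) := by
      conv_lhs => rw [hx x]
      rw [dotProduct_mulVec, vecMul_mulVec, ← mulVec_transpose, h1]
      simp
    rw [this]
    simp [dotProduct, sq]
  · have : x ⬝ᵥ M *ᵥ x = (Uᵀ *ᵥ x) ⬝ᵥ (diagonal hM.eigenvalues *ᵥ (Uᵀ *ᵥ x)) := by
      conv_lhs => rw [h3]
      rw [← mulVec_mulVec, ← mulVec_mulVec, dotProduct_mulVec, ← mulVec_transpose]
    rw [this]
    simp only [dotProduct, mulVec_diagonal]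
    exact Finset.sum_congr rfl fun i _ => by ring

section Interlacing

variable {M : Matrix n n ℝ} {M' : Matrix m m ℝ} {e : m ↪ n}

/-- `P` is extension by zero along `e`, and `Pᵀ` is restriction to the range of `e`. -/
theorem exists_extension_matrix (e : m ↪ n) :
    ∃ P : Matrix n m ℝ, Pᵀ * P = 1 ∧ (∀ M : Matrix n n ℝ, M.submatrix e e = Pᵀ * M * P) ∧
      ∀ x : n → ℝ, (∀ i, i ∉ Set.range e → x i = 0) → P *ᵥ (Pᵀ *ᵥ x) = x := by
  classical
  refine ⟨(1 : Matrix n n ℝ).submatrix id e, ?_, fun M => ?_, fun x hx => ?_⟩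
  · ext i j
    simp [mul_apply, one_apply, e.injective.eq_iff]
  · ext i j
    simp [mul_apply, one_apply]
  · ext i
    simp only [mulVec, dotProduct, submatrix_apply, transpose_apply, id, one_apply, ite_mul,
      one_mul, zero_mul, Finset.sum_ite_eq', Finset.mem_univ, if_true]
    by_cases hi : i ∈ Set.range e
    · obtain ⟨j, rfl⟩ := hi
      simp [e.injective.eq_iff]
    · rw [hx i hi]
      refine Finset.sum_eq_zero fun j _ => ?_
      rw [if_neg]
      rintro rfl
      exact hi ⟨j, rfl⟩

/-- Dimension count. `Θ` records the components of `y` along eigenvectors of `M'` with eigenvalue at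
least `E` and those of `P y` along eigenvectors of `M` with eigenvalue below `E`. If all of them
vanish, the common quadratic form is at least `E ‖y‖²`, and below it unless `y = 0`; hence `Θ` is
injective. -/
theorem card_eigenvalues_lt_submatrix_le (hM : M.IsHermitian) (hM' : M'.IsHermitian)
    (hsub : M' = M.submatrix e e) (E : ℝ) :
    (Finset.univ.filter fun i => hM'.eigenvalues i < E).card ≤
      (Finset.univ.filter fun i => hM.eigenvalues i < E).card := by
  classical
  obtain ⟨U, hU0, hU1, hU2⟩ := dotProduct_mulVec_eigenvalues hM
  obtain ⟨U', hU'0, hU'1, hU'2⟩ := dotProduct_mulVec_eigenvalues hM'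
  obtain ⟨P, hP1, hP2, -⟩ := exists_extension_matrix e
  let Θ : (m → ℝ) →ₗ[ℝ] ({j // ¬ hM'.eigenvalues j < E} → ℝ) × ({i // hM.eigenvalues i < E} → ℝ) :=
    ((LinearMap.funLeft ℝ ℝ Subtype.val).comp U'ᵀ.mulVecLin).prod
      ((LinearMap.funLeft ℝ ℝ Subtype.val).comp (Uᵀ * P).mulVecLin)
  have hΘ : Function.Injective Θ := by
    rw [← LinearMap.ker_eq_bot, LinearMap.ker_eq_bot']
    intro y hy
    have h1 : ∀ j, ¬ hM'.eigenvalues j < E → (U'ᵀ *ᵥ y) j = 0 := fun j hj =>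
      congrFun (congrArg Prod.fst hy) ⟨j, hj⟩
    have h2 : ∀ i, hM.eigenvalues i < E → (Uᵀ *ᵥ (P *ᵥ y)) i = 0 := fun i hi => by
      have := congrFun (congrArg Prod.snd hy) ⟨i, hi⟩
      rw [mulVec_mulVec]
      exact this
    have e1 : (P *ᵥ y) ⬝ᵥ (P *ᵥ y) = y ⬝ᵥ y := by
      rw [dotProduct_mulVec, vecMul_mulVec, hP1, vecMul_one]
    have e2 : (P *ᵥ y) ⬝ᵥ M *ᵥ (P *ᵥ y) = y ⬝ᵥ M' *ᵥ y := by
      rw [hsub, hP2, ← mulVec_mulVec, ← mulVec_mulVec, dotProduct_mulVec y, vecMul_transpose]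
    rw [hU1, hU'1] at e1
    rw [hU2, hU'2] at e2
    have h3 : E * ∑ i, (Uᵀ *ᵥ (P *ᵥ y)) i ^ 2 ≤
        ∑ i, hM.eigenvalues i * (Uᵀ *ᵥ (P *ᵥ y)) i ^ 2 := by
      rw [Finset.mul_sum]
      refine Finset.sum_le_sum fun i _ => ?_
      by_cases hi : hM.eigenvalues i < E
      · simp [h2 i hi]
      · exact mul_le_mul_of_nonneg_right (not_lt.1 hi) (sq_nonneg _)
    rw [e1, e2, Finset.mul_sum] at h3
    apply hU'0
    have h4 : ∀ i ∈ Finset.univ, hM'.eigenvalues i * (U'ᵀ *ᵥ y) i ^ 2 ≤ E * (U'ᵀ *ᵥ y) i ^ 2 := by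
      intro i _
      by_cases hi : hM'.eigenvalues i < E
      · exact mul_le_mul_of_nonneg_right hi.le (sq_nonneg _)
      · simp [h1 i hi]
    have h5 := (Finset.sum_eq_sum_iff_of_le h4).1 (le_antisymm (Finset.sum_le_sum h4) h3)
    ext i
    by_cases hi : hM'.eigenvalues i < E
    · have := h5 i (Finset.mem_univ _)
      have h6 : (E - hM'.eigenvalues i) * (U'ᵀ *ᵥ y) i ^ 2 = 0 := by linarith
      rcases mul_eq_zero.1 h6 with h | h
      · linarith
      · simpa using h
    · exact h1 i hi
  have hcard := LinearMap.finrank_le_finrank_of_injective hΘ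
  rw [Module.finrank_prod, Module.finrank_fintype_fun_eq_card, Module.finrank_fintype_fun_eq_card,
    Module.finrank_fintype_fun_eq_card, Fintype.card_subtype, Fintype.card_subtype] at hcard
  have := Finset.card_filter_add_card_filter_not (s := (Finset.univ : Finset m))
    (fun j => hM'.eigenvalues j < E)
  rw [Finset.card_univ] at this
  omega

/-- The same count with the roles of the two matrices exchanged. The coordinates outside the range
of `e` are added to the constraints, so that on the kernel `x` is the extension of `Pᵀ x` and the
two quadratic forms agree. -/
theorem card_eigenvalues_lt_le_submatrix_add (hM : M.IsHermitian) (hM' : M'.IsHermitian)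
    (hsub : M' = M.submatrix e e) (E : ℝ) :
    (Finset.univ.filter fun i => hM.eigenvalues i < E).card + Fintype.card m ≤
      (Finset.univ.filter fun i => hM'.eigenvalues i < E).card + Fintype.card n := by
  classical
  obtain ⟨U, hU0, hU1, hU2⟩ := dotProduct_mulVec_eigenvalues hM
  obtain ⟨U', hU'0, hU'1, hU'2⟩ := dotProduct_mulVec_eigenvalues hM'
  obtain ⟨P, hP1, hP2, hP3⟩ := exists_extension_matrix e
  let Θ : (n → ℝ) →ₗ[ℝ] ({j // ¬ hM.eigenvalues j < E} → ℝ) ×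
      ({i // hM'.eigenvalues i < E} → ℝ) × ({i // i ∉ Set.range e} → ℝ) :=
    ((LinearMap.funLeft ℝ ℝ Subtype.val).comp Uᵀ.mulVecLin).prod
      (((LinearMap.funLeft ℝ ℝ Subtype.val).comp (U'ᵀ * Pᵀ).mulVecLin).prod
        (LinearMap.funLeft ℝ ℝ Subtype.val))
  have hΘ : Function.Injective Θ := by
    rw [← LinearMap.ker_eq_bot, LinearMap.ker_eq_bot']
    intro x hx
    have h1 : ∀ j, ¬ hM.eigenvalues j < E → (Uᵀ *ᵥ x) j = 0 := fun j hj =>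
      congrFun (congrArg Prod.fst hx) ⟨j, hj⟩
    have h2 : ∀ i, hM'.eigenvalues i < E → (U'ᵀ *ᵥ (Pᵀ *ᵥ x)) i = 0 := fun i hi => by
      have := congrFun (congrArg (fun z => z.2.1) hx) ⟨i, hi⟩
      rw [mulVec_mulVec]
      exact this
    have h0 : P *ᵥ (Pᵀ *ᵥ x) = x := hP3 x fun i hi =>
      congrFun (congrArg (fun z => z.2.2) hx) ⟨i, hi⟩
    have e1 : x ⬝ᵥ x = (Pᵀ *ᵥ x) ⬝ᵥ (Pᵀ *ᵥ x) := by
      nth_rw 2 [← h0]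
      rw [dotProduct_mulVec, ← mulVec_transpose]
    have e2 : x ⬝ᵥ M *ᵥ x = (Pᵀ *ᵥ x) ⬝ᵥ M' *ᵥ (Pᵀ *ᵥ x) := by
      rw [hsub, hP2, ← mulVec_mulVec, ← mulVec_mulVec, h0, dotProduct_mulVec _ Pᵀ,
        vecMul_transpose, h0]
    rw [hU1, hU'1] at e1
    rw [hU2, hU'2] at e2
    have h3 : E * ∑ i, (U'ᵀ *ᵥ (Pᵀ *ᵥ x)) i ^ 2 ≤
        ∑ i, hM'.eigenvalues i * (U'ᵀ *ᵥ (Pᵀ *ᵥ x)) i ^ 2 := by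
      rw [Finset.mul_sum]
      refine Finset.sum_le_sum fun i _ => ?_
      by_cases hi : hM'.eigenvalues i < E
      · simp [h2 i hi]
      · exact mul_le_mul_of_nonneg_right (not_lt.1 hi) (sq_nonneg _)
    rw [← e1, ← e2, Finset.mul_sum] at h3
    apply hU0
    have h4 : ∀ i ∈ Finset.univ, hM.eigenvalues i * (Uᵀ *ᵥ x) i ^ 2 ≤ E * (Uᵀ *ᵥ x) i ^ 2 := by
      intro i _
      by_cases hi : hM.eigenvalues i < E
      · exact mul_le_mul_of_nonneg_right hi.le (sq_nonneg _)
      · simp [h1 i hi]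
    have h5 := (Finset.sum_eq_sum_iff_of_le h4).1 (le_antisymm (Finset.sum_le_sum h4) h3)
    ext i
    by_cases hi : hM.eigenvalues i < E
    · have := h5 i (Finset.mem_univ _)
      have h6 : (E - hM.eigenvalues i) * (Uᵀ *ᵥ x) i ^ 2 = 0 := by linarith
      rcases mul_eq_zero.1 h6 with h | h
      · linarith
      · simpa using h
    · exact h1 i hi
  have hcard := LinearMap.finrank_le_finrank_of_injective hΘ
  rw [Module.finrank_prod, Module.finrank_prod, Module.finrank_fintype_fun_eq_card,
    Module.finrank_fintype_fun_eq_card, Module.finrank_fintype_fun_eq_card,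
    Module.finrank_fintype_fun_eq_card, Fintype.card_subtype, Fintype.card_subtype,
    Fintype.card_subtype_compl] at hcard
  have hr : Fintype.card {x // x ∈ Set.range e} = Fintype.card m :=
    (Fintype.card_congr (Equiv.ofInjective e e.injective)).symm
  rw [hr] at hcard
  have hle := Fintype.card_le_of_embedding e
  have := Finset.card_filter_add_card_filter_not (s := (Finset.univ : Finset n))
    (fun j => hM.eigenvalues j < E)
  rw [Finset.card_univ] at this
  omega

end Interlacing

end Matrices

/-! ### Hopping operators, their compressions and a local recursion for powers -/

section Operators

variable {V : Type*}

open Classical in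
theorem delta_apply (k i : V) : (delta k : L2 V) i = if i = k then 1 else 0 := by
  rw [delta, lp.single_apply, Pi.single_apply]

theorem norm_delta (k : V) : ‖(delta k : L2 V)‖ = 1 := by
  classical
  rw [delta, lp.norm_single (by norm_num)]
  simp

theorem inner_delta_left (k : V) (f : L2 V) : inner ℂ (delta k) f = f k := by
  classical
  rw [delta, lp.inner_single_left]
  simp

theorem hasSum_smul_delta (f : L2 V) : HasSum (fun j => f j • delta j) f := by
  classical
  convert! lp.hasSum_single (p := 2) (by norm_num) f using 1
  ext1 j
  rw [delta, ← lp.single_smul]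
  simp

theorem hasSum_entry (A : L2 V →L[ℂ] L2 V) (f : L2 V) (i : V) :
    HasSum (fun j => entry A i j * f j) (A f i) := by
  have h := ((innerSL ℂ (delta i)).comp A).hasSum (hasSum_smul_delta f)
  simp only [ContinuousLinearMap.comp_apply, innerSL_apply_apply, inner_delta_left, map_smul,
    smul_eq_mul] at h
  refine h.congr_fun fun j => ?_
  rw [entry, inner_delta_left, mul_comm]

theorem ext_entry {A B : L2 V →L[ℂ] L2 V} (h : ∀ i j, entry A i j = entry B i j) : A = B := by
  ext f i
  refine (hasSum_entry A f i).unique ?_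
  simp_rw [h]
  exact hasSum_entry B f i

theorem entry_adjoint (A : L2 V →L[ℂ] L2 V) (i j : V) :
    entry (ContinuousLinearMap.adjoint A) i j = starRingEnd ℂ (entry A j i) := by
  rw [entry, ContinuousLinearMap.adjoint_inner_right, entry, inner_conj_symm]

/-- `H₀` has a real symmetric matrix with finitely many nonzero entries in each row. -/
structure IsHopping (H₀ : L2 V →L[ℂ] L2 V) : Prop where
  real : ∀ k j, (entry H₀ k j).im = 0
  symm : ∀ k j, entry H₀ k j = entry H₀ j k
  finite_row : ∀ k, {j | hop H₀ k j ≠ 0}.Finite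

variable {H₀ : L2 V →L[ℂ] L2 V}

theorem entry_eq_hop (hr : ∀ k j, (entry H₀ k j).im = 0) (k j : V) :
    entry H₀ k j = hop H₀ k j := by
  apply Complex.ext <;> simp [hop, hr k j]

theorem IsHopping.hop_symm (hH : IsHopping H₀) (k j : V) : hop H₀ k j = hop H₀ j k := by
  rw [hop, hop, hH.symm]

theorem isSelfAdjoint_of_entry (hr : ∀ k j, (entry H₀ k j).im = 0)
    (hs : ∀ k j, entry H₀ k j = entry H₀ j k) : IsSelfAdjoint H₀ := by
  rw [ContinuousLinearMap.isSelfAdjoint_iff']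
  refine ext_entry fun i j => ?_
  rw [entry_adjoint, hs j i, Complex.conj_eq_iff_im.2 (hr i j)]

open Classical in
/-- The finite set of vertices `j` with `H₀(k,j) ≠ 0`. -/
def row (H₀ : L2 V →L[ℂ] L2 V) (k : V) : Finset V :=
  if h : {j | hop H₀ k j ≠ 0}.Finite then h.toFinset else ∅

theorem IsHopping.mem_row (hH : IsHopping H₀) {k j : V} : j ∈ row H₀ k ↔ hop H₀ k j ≠ 0 := by
  rw [row, dif_pos (hH.finite_row k)]
  simp

theorem IsHopping.mem_row_comm (hH : IsHopping H₀) {k j : V} : j ∈ row H₀ k ↔ k ∈ row H₀ j := by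
  rw [hH.mem_row, hH.mem_row, hH.hop_symm]

theorem IsHopping.apply_eq_sum (hH : IsHopping H₀) (f : L2 V) (i : V) :
    H₀ f i = ∑ j ∈ row H₀ i, (hop H₀ i j : ℂ) * f j := by
  refine (hasSum_entry H₀ f i).unique ?_
  simp_rw [entry_eq_hop hH.real]
  refine hasSum_sum_of_ne_finset_zero fun j hj => ?_
  rw [hH.mem_row, not_not] at hj
  simp [hj]

/-- The operator of multiplication by a bounded real function. -/
def diagOp (d : V → ℝ) (C : ℝ) (hd : ∀ k, |d k| ≤ C) : L2 V →L[ℂ] L2 V :=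
  LinearMap.mkContinuous
    { toFun := fun f => ⟨fun k => (d k : ℂ) * f k,
        ((lp.memℓp f).const_smul (C : ℂ)).mono' fun k => by
          simp only [norm_mul, Complex.norm_real, Real.norm_eq_abs, Pi.smul_apply, smul_eq_mul]
          exact mul_le_mul_of_nonneg_right ((hd k).trans (le_abs_self C)) (norm_nonneg _)⟩
      map_add' := fun f g => by
        ext k
        exact mul_add _ _ _
      map_smul' := fun c f => by
        ext k
        exact mul_left_comm _ _ _ } C fun f => by
    by_cases hV : Nonempty V
    · obtain ⟨k₀⟩ := hV
      have hC : 0 ≤ C := (abs_nonneg _).trans (hd k₀)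
      have : C * ‖f‖ = ‖(C : ℂ) • f‖ := by
        rw [norm_smul, Complex.norm_real, Real.norm_eq_abs, abs_of_nonneg hC]
      rw [this]
      refine lp.norm_mono (by norm_num) fun k => ?_
      simp only [LinearMap.coe_mk, AddHom.coe_mk, norm_mul, Complex.norm_real, Real.norm_eq_abs,
        lp.coeFn_smul, Pi.smul_apply, smul_eq_mul]
      exact mul_le_mul_of_nonneg_right ((hd k).trans (le_abs_self C)) (norm_nonneg _)
    -- If there are no vertices, `C` may be negative; the bound holds because the space is trivial.
    · have h1 : f = 0 := by
        ext k
        exact (hV ⟨k⟩).elim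
      subst h1
      rw [map_zero]
      simp

theorem diagOp_apply (d : V → ℝ) (C : ℝ) (hd : ∀ k, |d k| ≤ C) (f : L2 V) (k : V) :
    diagOp d C hd f k = (d k : ℂ) * f k := rfl

theorem norm_diagOp_le (d : V → ℝ) {C : ℝ} (hC : 0 ≤ C) (hd : ∀ k, |d k| ≤ C) :
    ‖diagOp d C hd‖ ≤ C :=
  LinearMap.mkContinuous_norm_le _ hC _

theorem isSelfAdjoint_diagOp (d : V → ℝ) (C : ℝ) (hd : ∀ k, |d k| ≤ C) :
    IsSelfAdjoint (diagOp d C hd) := by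
  classical
  apply isSelfAdjoint_of_entry
  · intro k j
    rw [entry, inner_delta_left, diagOp_apply, delta_apply]
    split_ifs <;> simp
  · intro k j
    simp only [entry, inner_delta_left, diagOp_apply, delta_apply]
    by_cases h : k = j
    · subst h; rfl
    · rw [if_neg h, if_neg (Ne.symm h)]; simp

open Classical in
theorem abs_indicator_one_le (Z : Set V) (k : V) : |Z.indicator (fun _ => (1 : ℝ)) k| ≤ 1 := by
  by_cases h : k ∈ Z <;> simp [h]

theorem abs_indicator_le {Z : Set V} {v : V → ℝ} {C : ℝ} (hC : 0 ≤ C) (hv : ∀ k ∈ Z, |v k| ≤ C)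
    (k : V) : |Z.indicator v k| ≤ C := by
  by_cases h : k ∈ Z
  · simpa [h] using hv k h
  · simpa [h] using hC

/-- The compression of `H₀ + v` to the vertex set `Z`, as an operator on `ℓ²(V)`; here `v` is
bounded by `C` on `Z`. -/
def cutOp (H₀ : L2 V →L[ℂ] L2 V) (Z : Set V) (v : V → ℝ) (C : ℝ) (hC : 0 ≤ C)
    (hv : ∀ k ∈ Z, |v k| ≤ C) : L2 V →L[ℂ] L2 V :=
  diagOp (Z.indicator fun _ => 1) 1 (abs_indicator_one_le Z) * H₀ *
    diagOp (Z.indicator fun _ => 1) 1 (abs_indicator_one_le Z) +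
    diagOp (Z.indicator v) C (abs_indicator_le hC hv)

variable {Z : Set V} {v : V → ℝ} {C : ℝ} {hC : 0 ≤ C} {hv : ∀ k ∈ Z, |v k| ≤ C}

theorem norm_cutOp_le : ‖cutOp H₀ Z v C hC hv‖ ≤ ‖H₀‖ + C := by
  set P := diagOp (Z.indicator fun _ => 1) 1 (abs_indicator_one_le Z) with hP
  have h1 : ‖P‖ ≤ 1 := norm_diagOp_le _ zero_le_one _
  have h2 : ‖P * H₀ * P‖ ≤ ‖H₀‖ := by
    calc ‖P * H₀ * P‖ ≤ ‖P‖ * ‖H₀‖ * ‖P‖ :=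
          (norm_mul_le _ _).trans (mul_le_mul_of_nonneg_right (norm_mul_le _ _) (norm_nonneg _))
      _ ≤ 1 * ‖H₀‖ * 1 := by gcongr
      _ = ‖H₀‖ := by ring
  exact (norm_add_le _ _).trans (add_le_add h2 (norm_diagOp_le _ hC _))

theorem isSelfAdjoint_cutOp (hH : IsHopping H₀) : IsSelfAdjoint (cutOp H₀ Z v C hC hv) := by
  have h0 := isSelfAdjoint_of_entry hH.real hH.symm
  have h1 := isSelfAdjoint_diagOp (Z.indicator fun _ => 1) 1 (abs_indicator_one_le Z)
  have h2 := isSelfAdjoint_diagOp (Z.indicator v) C (abs_indicator_le hC hv)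
  refine IsSelfAdjoint.add ?_ h2
  rw [IsSelfAdjoint, star_mul, star_mul, h0.star_eq, h1.star_eq, mul_assoc]

open Classical in
theorem cutOp_apply (hH : IsHopping H₀) (f : L2 V) (i : V) :
    cutOp H₀ Z v C hC hv f i =
      if i ∈ Z then (∑ j ∈ row H₀ i, if j ∈ Z then (hop H₀ i j : ℂ) * f j else 0) + v i * f i
      else 0 := by
  simp only [cutOp, _root_.add_apply, mul_apply_eq_comp, lp.coeFn_add,
    Pi.add_apply, diagOp_apply, hH.apply_eq_sum, Set.indicator_apply]
  split_ifs with hi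
  · simp only [Complex.ofReal_one, one_mul]
    congr 1
    refine Finset.sum_congr rfl fun j _ => ?_
    split_ifs <;> simp
  · simp

/-- The image of `δ_k` under a power of the compressed operator, computed by a local recursion
over the real numbers. -/
def locStep (H₀ : L2 V →L[ℂ] L2 V) (Z : Set V) (v f : V → ℝ) (i : V) : ℝ :=
  open Classical in
  if i ∈ Z then (∑ j ∈ row H₀ i, if j ∈ Z then hop H₀ i j * f j else 0) + v i * f i else 0

open Classical in
/-- The coordinates of `T ^ p δ_k`, `T` being the compression of `H₀ + v` to `Z`. -/
def locPow (H₀ : L2 V →L[ℂ] L2 V) (Z : Set V) (v : V → ℝ) (k : V) : ℕ → V → ℝ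
  | 0 => Pi.single k 1
  | p + 1 => locStep H₀ Z v (locPow H₀ Z v k p)

/-- Powers of the compression act on `δ_k` by a recursion with finite sums of real numbers. In this
form measurability in the configuration, equivariance and comparison with finite volumes can be
proved coordinatewise by induction, while the operator supplies the norm bounds and the spectral
theory. -/
theorem cutOp_pow_delta (hH : IsHopping H₀) (k : V) (p : ℕ) (i : V) :
    (cutOp H₀ Z v C hC hv ^ p) (delta k) i = locPow H₀ Z v k p i := by
  classical
  induction p generalizing i with
  | zero =>
    simp only [pow_zero, one_apply_eq_self, locPow, delta_apply, Pi.single_apply]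
    split_ifs <;> simp
  | succ p ih =>
    have hs : (cutOp H₀ Z v C hC hv ^ (p + 1)) (delta k) =
        cutOp H₀ Z v C hC hv ((cutOp H₀ Z v C hC hv ^ p) (delta k)) := by rw [pow_succ']; rfl
    rw [hs, cutOp_apply hH, locPow, locStep]
    split_ifs
    · rw [ih, Complex.ofReal_add, Complex.ofReal_sum, Complex.ofReal_mul]
      congr 1
      refine Finset.sum_congr rfl fun j _ => ?_
      rw [ih]
      split_ifs <;> simp
    · simp

/-- The diagonal matrix element at `k` of a polynomial in the compression of `H₀ + v` to `Z`. -/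
def locPoly (H₀ : L2 V →L[ℂ] L2 V) (Z : Set V) (v : V → ℝ) (q : Polynomial ℝ) (k : V) : ℝ :=
  ∑ p ∈ Finset.range (q.natDegree + 1), q.coeff p * locPow H₀ Z v k p k

theorem aeval_cutOp_delta (hH : IsHopping H₀) (q : Polynomial ℝ) (k : V) :
    (Polynomial.aeval (cutOp H₀ Z v C hC hv) q) (delta k) k = locPoly H₀ Z v q k := by
  rw [Polynomial.aeval_eq_sum_range, locPoly]
  simp only [_root_.sum_apply, lp.coeFn_sum, Finset.sum_apply,
    _root_.smul_apply, lp.coeFn_smul, Pi.smul_apply, cutOp_pow_delta hH]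
  push_cast
  exact Finset.sum_congr rfl fun p _ => by simp

end Operators

/-! ### Eigenprojections as strong limits of polynomials -/

section Projections

open Polynomial

/-- A quadratic polynomial with values in `[0,1]` on `[E - D, E + D]`, equal to `1` only at `E`. -/
def bumpPoly (E D : ℝ) : ℝ[X] := 1 - C (D⁻¹ ^ 2) * (X - C E) ^ 2

/-- The average of the first `n` powers of `bumpPoly`; it converges to the indicator of `{E}`. -/
def avgPoly (E D : ℝ) (n : ℕ) : ℝ[X] := C (n : ℝ)⁻¹ * ∑ j ∈ Finset.range n, bumpPoly E D ^ j

variable {H : Type*} [NormedAddCommGroup H] [InnerProductSpace ℂ H]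

/-- The eigenspace of `T` at the real number `E`. -/
def eigSpace (T : H →L[ℂ] H) (E : ℝ) : Submodule ℂ H :=
  (T - algebraMap ℝ (H →L[ℂ] H) E).ker

theorem mem_eigSpace {T : H →L[ℂ] H} {E : ℝ} {x : H} : x ∈ eigSpace T E ↔ T x = (E : ℂ) • x := by
  rw [eigSpace, LinearMap.mem_ker]
  have : (T - algebraMap ℝ (H →L[ℂ] H) E) x = T x - (E : ℂ) • x := by
    rw [_root_.sub_apply, Algebra.algebraMap_eq_smul_one, _root_.smul_apply]
    rfl
  rw [← sub_eq_zero (a := T x), ← this]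
  rfl

theorem aeval_bumpPoly (T : H →L[ℂ] H) (E D : ℝ) :
    aeval T (bumpPoly E D) = 1 - (D⁻¹ ^ 2) • (T - algebraMap ℝ (H →L[ℂ] H) E) ^ 2 := by
  simp [bumpPoly, Algebra.smul_def]

theorem aeval_avgPoly_apply (T : H →L[ℂ] H) (E D : ℝ) (n : ℕ) (x : H) :
    (aeval T (avgPoly E D n)) x =
      birkhoffAverage ℂ (aeval T (bumpPoly E D)) _root_.id n x := by
  rw [avgPoly, map_mul, aeval_C, map_sum, birkhoffAverage, birkhoffSum,
    Algebra.algebraMap_eq_smul_one, smul_mul_assoc, one_mul, _root_.smul_apply, _root_.sum_apply]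
  simp only [map_pow, id]
  have : ∀ j, (aeval T (bumpPoly E D) ^ j) x = (aeval T (bumpPoly E D))^[j] x := by
    intro j
    induction j with
    | zero => rfl
    | succ j ih =>
      rw [Function.iterate_succ_apply', ← ih, pow_succ']
      rfl
  simp_rw [this]
  rw [← Complex.coe_smul]
  push_cast
  rfl

variable [CompleteSpace H]

instance (T : H →L[ℂ] H) (E : ℝ) : CompleteSpace (eigSpace T E) :=
  ContinuousLinearMap.completeSpace_ker _

/-- On expanding the square, the cross term contributes `-2 D⁻² ‖B x‖²`, and `‖B‖ ≤ D` bounds the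
last term by `D⁻² ‖B x‖²`. The remaining gain shows both that the operator is a contraction and that
its fixed vectors lie in the kernel of `B`. -/
theorem norm_sq_bump_apply_le {B : H →L[ℂ] H} (hB : IsSelfAdjoint B) {D : ℝ} (hD : 0 < D)
    (hBD : ‖B‖ ≤ D) (x : H) :
    ‖x - (D⁻¹ ^ 2) • B (B x)‖ ^ 2 ≤ ‖x‖ ^ 2 - D⁻¹ ^ 2 * ‖B x‖ ^ 2 := by
  have hsymm : ∀ y z, inner ℂ (B y) z = inner ℂ y (B z) := hB.isSymmetric
  have h1 : RCLike.re (inner ℂ x ((D⁻¹ ^ 2) • B (B x)) : ℂ) = D⁻¹ ^ 2 * ‖B x‖ ^ 2 := by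
    rw [inner_smul_right_eq_smul, ← hsymm, RCLike.smul_re, inner_self_eq_norm_sq]
  have h2 : ‖(D⁻¹ ^ 2) • B (B x)‖ ^ 2 ≤ D⁻¹ ^ 2 * ‖B x‖ ^ 2 := by
    have h3 : ‖(D⁻¹ ^ 2) • B (B x)‖ ≤ D⁻¹ * ‖B x‖ := by
      rw [norm_smul, Real.norm_eq_abs, abs_of_nonneg (by positivity)]
      calc D⁻¹ ^ 2 * ‖B (B x)‖ ≤ D⁻¹ ^ 2 * (D * ‖B x‖) := by
            gcongr
            exact B.le_of_opNorm_le hBD _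
        _ = D⁻¹ * ‖B x‖ := by field_simp
    calc ‖(D⁻¹ ^ 2) • B (B x)‖ ^ 2 ≤ (D⁻¹ * ‖B x‖) ^ 2 := by gcongr
      _ = _ := by ring
  rw [@norm_sub_sq ℂ, h1]
  linarith

theorem norm_one_sub_sq_le {B : H →L[ℂ] H} (hB : IsSelfAdjoint B) {D : ℝ} (hD : 0 < D)
    (hBD : ‖B‖ ≤ D) : ‖1 - (D⁻¹ ^ 2) • B ^ 2‖ ≤ 1 := by
  refine ContinuousLinearMap.opNorm_le_bound _ zero_le_one fun x => ?_
  have h := norm_sq_bump_apply_le hB hD hBD x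
  have h0 : (1 - (D⁻¹ ^ 2) • B ^ 2 : H →L[ℂ] H) x = x - (D⁻¹ ^ 2) • B (B x) := by
    rw [sq B]; rfl
  rw [h0, one_mul]
  refine le_of_sq_le_sq ?_ (norm_nonneg _)
  nlinarith [sq_nonneg ‖B x‖, sq_nonneg D⁻¹]

theorem eqLocus_one_sub_sq {T : H →L[ℂ] H} (hT : IsSelfAdjoint T) {E D : ℝ} (hD : 0 < D)
    (hTD : ‖T - algebraMap ℝ (H →L[ℂ] H) E‖ ≤ D) :
    (aeval T (bumpPoly E D)).eqLocus (1 : H →L[ℂ] H) = eigSpace T E := by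
  set B := T - algebraMap ℝ (H →L[ℂ] H) E with hBdef
  have hB : IsSelfAdjoint B := hT.sub (IsSelfAdjoint.algebraMap _ (.all E))
  ext x
  have h0 : (aeval T (bumpPoly E D)) x = x - (D⁻¹ ^ 2) • B (B x) := by
    rw [aeval_bumpPoly, ← hBdef, sq B]; rfl
  have h1 : x ∈ eigSpace T E ↔ B x = 0 := by rw [eigSpace, ← hBdef]; rfl
  have h2 : x ∈ (aeval T (bumpPoly E D)).eqLocus (1 : H →L[ℂ] H) ↔
      (aeval T (bumpPoly E D)) x = x := Iff.rfl
  rw [h1, h2, h0]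
  constructor
  · intro h
    have h3 := norm_sq_bump_apply_le hB hD hTD x
    rw [h] at h3
    have h4 : 0 < D⁻¹ ^ 2 := by positivity
    have h5 : ‖B x‖ ^ 2 ≤ 0 := by
      by_contra hc
      push Not at hc
      nlinarith [mul_pos h4 hc]
    exact norm_eq_zero.1 (pow_eq_zero_iff two_ne_zero |>.1 (le_antisymm h5 (sq_nonneg _)))
  · intro h
    rw [h, map_zero, smul_zero, sub_zero]

/-- `avgPoly` evaluated at `T` is a Birkhoff average of powers of the contraction `1 - D⁻² (T -
E)²`. The mean ergodic theorem gives convergence to the projection onto its fixed vectors, which are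
the eigenvectors of `T` at `E`. -/
theorem tendsto_aeval_avgPoly {T : H →L[ℂ] H} (hT : IsSelfAdjoint T) {E D : ℝ} (hD : 0 < D)
    (hTD : ‖T - algebraMap ℝ (H →L[ℂ] H) E‖ ≤ D) (x : H) :
    Tendsto (fun n => (aeval T (avgPoly E D n)) x) atTop
      (𝓝 ((eigSpace T E).starProjection x)) := by
  have hB : IsSelfAdjoint (T - algebraMap ℝ (H →L[ℂ] H) E) :=
    hT.sub (IsSelfAdjoint.algebraMap _ (.all E))
  have h := (aeval T (bumpPoly E D)).tendsto_birkhoffAverage_orthogonalProjection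
    (by rw [aeval_bumpPoly]; exact norm_one_sub_sq_le hB hD hTD) x
  simp_rw [aeval_avgPoly_apply]
  -- The projection depends on the submodule and on an instance, so the equality of the two
  -- submodules is used through substitution of variables.
  have key : ∀ (W W' : Submodule ℂ H) [W.HasOrthogonalProjection] [W'.HasOrthogonalProjection],
      W = W' → (W.orthogonalProjectionOnto x : H) = W'.starProjection x := by
    intro W W' _ _ h
    subst h
    rfl
  rw [key _ _ (eqLocus_one_sub_sq hT hD hTD)] at h
  exact h

theorem norm_aeval_avgPoly_apply_le {T : H →L[ℂ] H} (hT : IsSelfAdjoint T) {E D : ℝ} (hD : 0 < D)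
    (hTD : ‖T - algebraMap ℝ (H →L[ℂ] H) E‖ ≤ D) (n : ℕ) (x : H) :
    ‖(aeval T (avgPoly E D n)) x‖ ≤ ‖x‖ := by
  have hB : IsSelfAdjoint (T - algebraMap ℝ (H →L[ℂ] H) E) :=
    hT.sub (IsSelfAdjoint.algebraMap _ (.all E))
  have hS : ‖aeval T (bumpPoly E D)‖ ≤ 1 := by
    rw [aeval_bumpPoly]; exact norm_one_sub_sq_le hB hD hTD
  rw [aeval_avgPoly_apply, birkhoffAverage, birkhoffSum, norm_smul]
  have h1 : ∀ j, ‖(aeval T (bumpPoly E D))^[j] x‖ ≤ ‖x‖ := by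
    intro j
    induction j with
    | zero => exact le_rfl
    | succ j ih =>
      rw [Function.iterate_succ_apply']
      exact ((aeval T (bumpPoly E D)).le_of_opNorm_le hS _).trans (by rw [one_mul]; exact ih)
  have h2 : ‖∑ j ∈ Finset.range n, id ((aeval T (bumpPoly E D))^[j] x)‖ ≤ n * ‖x‖ := by
    refine (norm_sum_le_of_le _ fun j _ => h1 j).trans ?_
    simp
  calc ‖((n : ℂ)⁻¹)‖ * _ ≤ (n : ℝ)⁻¹ * (n * ‖x‖) := by
        rw [norm_inv, Complex.norm_natCast]
        exact mul_le_mul_of_nonneg_left h2 (by positivity)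
    _ ≤ ‖x‖ := by
      rcases eq_or_ne n 0 with rfl | hn
      · simp
      · rw [inv_mul_cancel_left₀ (by exact_mod_cast hn)]

theorem avgPoly_eval (E D : ℝ) (n : ℕ) (x : ℝ) :
    (avgPoly E D n).eval x =
      (n : ℝ)⁻¹ * ∑ j ∈ Finset.range n, (1 - D⁻¹ ^ 2 * (x - E) ^ 2) ^ j := by
  simp [avgPoly, bumpPoly, eval_finsetSum]

theorem bump_mem_Icc {E D x : ℝ} (hD : 0 < D) (hx : |x - E| ≤ D) :
    1 - D⁻¹ ^ 2 * (x - E) ^ 2 ∈ Set.Icc (0 : ℝ) 1 := by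
  have h : D⁻¹ ^ 2 * (x - E) ^ 2 ≤ 1 := by
    have h1 : (x - E) ^ 2 ≤ D ^ 2 := sq_le_sq' (by linarith [(abs_le.1 hx).1]) (abs_le.1 hx).2
    calc D⁻¹ ^ 2 * (x - E) ^ 2 ≤ D⁻¹ ^ 2 * D ^ 2 := by gcongr
      _ = 1 := by field_simp
  exact ⟨by linarith, by linarith [mul_nonneg (sq_nonneg D⁻¹) (sq_nonneg (x - E))]⟩

theorem avgPoly_eval_mem_Icc {E D x : ℝ} (hD : 0 < D) (hx : |x - E| ≤ D) (n : ℕ) :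
    (avgPoly E D n).eval x ∈ Set.Icc (0 : ℝ) 1 := by
  obtain ⟨h0, h1⟩ := bump_mem_Icc hD hx
  rw [avgPoly_eval]
  refine ⟨mul_nonneg (by positivity) (Finset.sum_nonneg fun j _ => pow_nonneg h0 j), ?_⟩
  have h2 : ∑ j ∈ Finset.range n, (1 - D⁻¹ ^ 2 * (x - E) ^ 2) ^ j ≤ (n : ℝ) := by
    refine (Finset.sum_le_card_nsmul _ _ (1 : ℝ) fun j _ => pow_le_one₀ h0 h1).trans ?_
    simp
  calc _ ≤ (n : ℝ)⁻¹ * n := by gcongr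
    _ ≤ 1 := by
      rcases eq_or_ne n 0 with rfl | hn
      · simp
      · rw [inv_mul_cancel₀ (by exact_mod_cast hn)]

/-- For fixed `n ≥ 1`, the polynomial is close to `1` near `E`. -/
theorem exists_avgPoly_eval_ge (E D : ℝ) {n : ℕ} (hn : n ≠ 0) {δ : ℝ} (hδ : 0 < δ) :
    ∃ ε > 0, ∀ x, |x - E| < ε → 1 - δ ≤ (avgPoly E D n).eval x := by
  have hc : ContinuousAt (fun x => (avgPoly E D n).eval x) E :=
    (avgPoly E D n).continuous.continuousAt
  have h1 : (avgPoly E D n).eval E = 1 := by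
    rw [avgPoly_eval]
    simp [hn]
  obtain ⟨ε, hε, h⟩ := Metric.continuousAt_iff.1 hc δ hδ
  refine ⟨ε, hε, fun x hx => ?_⟩
  have := h (x := x) (by rwa [Real.dist_eq])
  rw [h1, Real.dist_eq] at this
  linarith [(abs_lt.1 this).1]

/-- For large `n`, the polynomial is small away from `E`. -/
theorem exists_avgPoly_eval_le (E : ℝ) {D : ℝ} (hD : 0 < D) {ε δ : ℝ} (hε : 0 < ε) (hδ : 0 < δ) :
    ∃ n₀, ∀ n ≥ n₀, ∀ x, |x - E| ≤ D → ε ≤ |x - E| → (avgPoly E D n).eval x ≤ δ := by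
  have hpos : 0 < D⁻¹ ^ 2 * ε ^ 2 := by positivity
  -- Away from `E` the geometric sum is at most `1 / (1 - y) ≤ 1 / (D⁻² ε²)`; after division by `n`
  -- it is below `δ` once `n` exceeds this threshold.
  obtain ⟨n₀, hn₀⟩ := exists_nat_gt ((δ * (D⁻¹ ^ 2 * ε ^ 2))⁻¹)
  have hn₀0 : (0 : ℝ) < n₀ := lt_of_le_of_lt (by positivity) hn₀
  refine ⟨n₀, fun n hn x hx hxε => ?_⟩
  obtain ⟨h0, h1⟩ := bump_mem_Icc hD hx
  set y := 1 - D⁻¹ ^ 2 * (x - E) ^ 2 with hy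
  have hy1 : D⁻¹ ^ 2 * ε ^ 2 ≤ 1 - y := by
    have : ε ^ 2 ≤ (x - E) ^ 2 := by
      rw [← sq_abs (x - E)]
      gcongr
    have := mul_le_mul_of_nonneg_left this (sq_nonneg D⁻¹)
    linarith
  have hn' : (n₀ : ℝ) ≤ n := by exact_mod_cast hn
  have hnpos : (0 : ℝ) < n := hn₀0.trans_le hn'
  have hgeom : (∑ j ∈ Finset.range n, y ^ j) * (1 - y) = 1 - y ^ n := geom_sum_mul_neg y n
  have hsum : ∑ j ∈ Finset.range n, y ^ j ≤ (D⁻¹ ^ 2 * ε ^ 2)⁻¹ := by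
    rw [← one_div, le_div_iff₀ hpos]
    have hs0 : 0 ≤ ∑ j ∈ Finset.range n, y ^ j := Finset.sum_nonneg fun j _ => pow_nonneg h0 j
    calc _ ≤ (∑ j ∈ Finset.range n, y ^ j) * (1 - y) := by gcongr
      _ ≤ 1 := by rw [hgeom]; linarith [pow_nonneg h0 n]
  rw [avgPoly_eval, ← hy]
  calc _ ≤ (n : ℝ)⁻¹ * (D⁻¹ ^ 2 * ε ^ 2)⁻¹ := by gcongr
    _ ≤ δ := by
      rw [inv_mul_le_iff₀ hnpos]
      rw [mul_inv] at hn₀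
      have h3 : δ * (δ⁻¹ * (D⁻¹ ^ 2 * ε ^ 2)⁻¹) ≤ δ * n :=
        mul_le_mul_of_nonneg_left (hn₀.le.trans hn') hδ.le
      rw [mul_inv_cancel_left₀ hδ.ne'] at h3
      linarith

end Projections

/-! ### Density of an eigenspace and dimension of its restrictions -/

section Dimension

variable {V : Type*}

open Classical in
/-- The restriction of an element of `ℓ²(V)` to a finite set of vertices. -/
def restrictTo (A : Finset V) : L2 V →ₗ[ℂ] EuclideanSpace ℂ A where
  toFun f := WithLp.toLp 2 fun k : A => f k
  map_add' _ _ := rfl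
  map_smul' _ _ := rfl

theorem restrictTo_apply (A : Finset V) (f : L2 V) (k : A) : restrictTo A f k = f k := rfl

/-- Both sides are the trace of the projection, since `⟨e_k, p e_k⟩ = ‖p e_k‖²`. -/
theorem sum_norm_sq_starProjection_single {ι : Type*} [Fintype ι] [DecidableEq ι]
    (W : Submodule ℂ (EuclideanSpace ℂ ι)) :
    ∑ k, ‖W.starProjection (EuclideanSpace.single k 1)‖ ^ 2 = Module.finrank ℂ W := by
  have hproj : LinearMap.IsProj W (W.starProjection : EuclideanSpace ℂ ι →ₗ[ℂ] _) :=
    ⟨fun x => W.starProjection_apply_mem x, fun x hx => Submodule.starProjection_eq_self_iff.2 hx⟩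
  have h1 := hproj.trace
  rw [LinearMap.trace_eq_sum_inner _ (EuclideanSpace.basisFun ι ℂ)] at h1
  have h2 : ∀ k, inner ℂ (EuclideanSpace.single k (1 : ℂ))
      (W.starProjection (EuclideanSpace.single k 1)) =
      ((‖W.starProjection (EuclideanSpace.single k 1)‖ ^ 2 : ℝ) : ℂ) := by
    intro k
    have h3 := Submodule.inner_starProjection_left_eq_right W (EuclideanSpace.single k (1 : ℂ))
      (W.starProjection (EuclideanSpace.single k 1))
    rw [Submodule.starProjection_eq_self_iff.2 (W.starProjection_apply_mem _)] at h3
    rw [← h3, inner_self_eq_norm_sq_to_K]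
    push_cast
    rfl
  have h4 : ((∑ k, ‖W.starProjection (EuclideanSpace.single k 1)‖ ^ 2 : ℝ) : ℂ) =
      (Module.finrank ℂ W : ℂ) := by
    rw [← h1]
    push_cast
    refine Finset.sum_congr rfl fun k _ => ?_
    simp only [EuclideanSpace.basisFun_apply]
    rw [h2 k]
    push_cast
    rfl
  exact_mod_cast h4

/-- Termwise comparison with the projection onto `W`, the restriction of `U` to `A`. With `t = ‖p
δ_k‖` and `s` the analogous norm for `W`, the number `t²` is the value of `p δ_k` at `k`, hence the
inner product of the projected unit vector with an element of `W` of norm at most `t`. So `t² ≤ s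
t`, and the squares of the `s` sum to the dimension of `W`. -/
theorem sum_norm_sq_starProjection_delta_le (U : Submodule ℂ (L2 V)) [CompleteSpace U]
    (A : Finset V) :
    ∑ k ∈ A, ‖U.starProjection (delta k)‖ ^ 2 ≤ Module.finrank ℂ (U.map (restrictTo A)) := by
  classical
  set W := U.map (restrictTo A)
  rw [← sum_norm_sq_starProjection_single W, ← Finset.sum_coe_sort A]
  refine Finset.sum_le_sum fun k _ => ?_
  set t := ‖U.starProjection (delta (k : V))‖ with ht
  set s := ‖W.starProjection (EuclideanSpace.single k 1)‖
  have h1 : ((t ^ 2 : ℝ) : ℂ) = U.starProjection (delta (k : V)) (k : V) := by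
    have h3 := Submodule.inner_starProjection_left_eq_right U (delta (k : V))
      (U.starProjection (delta (k : V)))
    rw [Submodule.starProjection_eq_self_iff.2 (U.starProjection_apply_mem _),
      inner_delta_left, inner_self_eq_norm_sq_to_K] at h3
    rw [← h3]
    push_cast
    rfl
  have hmem : restrictTo A (U.starProjection (delta (k : V))) ∈ W :=
    Submodule.mem_map_of_mem (U.starProjection_apply_mem _)
  have h2 : inner ℂ (W.starProjection (EuclideanSpace.single k (1 : ℂ)))
      (restrictTo A (U.starProjection (delta (k : V)))) =
      U.starProjection (delta (k : V)) (k : V) := by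
    rw [Submodule.inner_starProjection_left_eq_right,
      Submodule.starProjection_eq_self_iff.2 hmem, EuclideanSpace.inner_single_left,
      restrictTo_apply]
    simp
  have h3 : ‖restrictTo A (U.starProjection (delta (k : V)))‖ ≤ t := by
    rw [EuclideanSpace.norm_eq]
    apply Real.sqrt_le_iff.2 ⟨norm_nonneg _, ?_⟩
    have := lp.sum_rpow_le_norm_rpow (p := 2) (by norm_num) (U.starProjection (delta (k : V))) A
    simp only [ENNReal.toReal_ofNat, Real.rpow_ofNat] at this
    rw [← Finset.sum_coe_sort A] at this
    exact this
  have h4 : t ^ 2 ≤ s * t := by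
    have h5 : ‖((t ^ 2 : ℝ) : ℂ)‖ = t ^ 2 := by
      rw [Complex.norm_real, Real.norm_eq_abs, abs_of_nonneg (sq_nonneg _)]
    rw [← h5, h1, ← h2]
    exact (norm_inner_le_norm _ _).trans (mul_le_mul_of_nonneg_left h3 (norm_nonneg _))
  rcases (norm_nonneg (U.starProjection (delta (k : V)))).eq_or_lt with h0 | h0
  · rw [← ht] at h0
    rw [← h0]
    simpa using sq_nonneg s
  · have h6 : t ≤ s := le_of_mul_le_mul_right (by rw [← sq]; exact h4) h0
    exact pow_le_pow_left₀ h0.le h6 2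

/-- If the density of the projection to `U` on the finite set `A` exceeds the number of linear
constraints, some element of `U` satisfies the constraints and does not vanish on `A`. -/
theorem exists_mem_ne_zero_of_card_lt (U : Submodule ℂ (L2 V)) [CompleteSpace U]
    (A : Finset V) {c : ℕ} (Φ : (EuclideanSpace ℂ A) →ₗ[ℂ] (Fin c → ℂ))
    (h : (c : ℝ) < ∑ k ∈ A, ‖U.starProjection (delta k)‖ ^ 2) :
    ∃ u ∈ U, restrictTo A u ≠ 0 ∧ Φ (restrictTo A u) = 0 := by
  have h1 := h.trans_le (sum_norm_sq_starProjection_delta_le U A)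
  have h2 : Module.finrank ℂ (Fin c → ℂ) < Module.finrank ℂ (U.map (restrictTo A)) := by
    rw [Module.finrank_fin_fun]
    exact_mod_cast h1
  have h3 := LinearMap.ker_ne_bot_of_finrank_lt (f := Φ.comp (U.map (restrictTo A)).subtype) h2
  obtain ⟨w, hw, hw0⟩ := (Submodule.ne_bot_iff _).1 h3
  obtain ⟨u, hu, huw⟩ := w.2
  refine ⟨u, hu, ?_, ?_⟩
  · rw [huw]
    simpa using hw0
  · rw [huw]
    exact hw

end Dimension

/-! ### Følner sequences and averages over the exhaustion -/

section Folner

variable {V Γ : Type*} [Group Γ] [MulAction Γ V]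

/-- The group `Γ` acts with finite stabilisers, and `F` meets every orbit. -/
structure IsFiniteQuotient (Γ : Type*) [Group Γ] [MulAction Γ V] (F : Finset V) : Prop where
  finite_stabilizer : ∀ v : V, (MulAction.stabilizer Γ v : Set Γ).Finite
  covers : ∀ v : V, ∃ γ : Γ, γ • v ∈ F
  nonempty : F.Nonempty

variable {F : Finset V} {I : ℕ → Finset Γ}

theorem mem_exhaustion {L : ℕ} {k : V} : k ∈ exhaustion F I L ↔ ∃ γ ∈ I L, γ • k ∈ F := by
  classical
  rw [exhaustion, Finset.mem_smul]
  constructor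
  · rintro ⟨γ, hγ, x, hx, rfl⟩
    rw [Finset.mem_inv] at hγ
    obtain ⟨γ', hγ', rfl⟩ := hγ
    exact ⟨γ', hγ', by simpa using hx⟩
  · rintro ⟨γ, hγ, hx⟩
    exact ⟨γ⁻¹, Finset.inv_mem_inv hγ, γ • k, hx, by simp⟩

theorem IsFiniteQuotient.finite_transporter (hF : IsFiniteQuotient Γ F) (k : V) (A : Finset V) :
    {γ : Γ | γ • k ∈ A}.Finite := by
  have h1 : {γ : Γ | γ • k ∈ A} = ⋃ x ∈ A, {γ : Γ | γ • k = x} := by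
    ext γ; simp
  rw [h1]
  refine A.finite_toSet.biUnion fun x _ => ?_
  by_cases hx : ∃ γ₀ : Γ, γ₀ • k = x
  · obtain ⟨γ₀, rfl⟩ := hx
    refine ((hF.finite_stabilizer k).image (γ₀ * ·)).subset fun γ hγ => ⟨γ₀⁻¹ * γ, ?_, by simp⟩
    simp only [SetLike.mem_coe, MulAction.mem_stabilizer_iff, mul_smul]
    rw [show γ • k = γ₀ • k from hγ, inv_smul_smul]
  · convert Set.finite_empty
    ext γ
    simpa using fun h => hx ⟨γ, h⟩

/-- The number of group elements moving `k` into `F`. -/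
def mult (Γ : Type*) [Group Γ] [MulAction Γ V] (F : Finset V) (k : V) : ℕ :=
  {γ : Γ | γ • k ∈ F}.ncard

theorem IsFiniteQuotient.mult_pos (hF : IsFiniteQuotient Γ F) (k : V) : 0 < mult Γ F k := by
  rw [mult, Set.ncard_pos (hF.finite_transporter k F)]
  exact hF.covers k

theorem mult_smul (σ : Γ) (k : V) : mult Γ F (σ • k) = mult Γ F k := by
  refine Set.ncard_congr (fun γ _ => γ * σ) ?_ ?_ ?_
  · intro γ hγ
    simpa [mul_smul] using hγ
  · intro a b _ _ h
    exact mul_right_cancel h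
  · intro γ hγ
    exact ⟨γ * σ⁻¹, by simpa [mul_smul] using hγ, by simp⟩

open Classical in
/-- The elements of `I L` moved out of `I L` by `σ`. -/
def leaving (I : ℕ → Finset Γ) (σ : Γ) (L : ℕ) : Finset Γ := (I L).filter fun γ => σ * γ ∉ I L

theorem IsFolner.card_pos (hI : IsFolner I) (L : ℕ) : 0 < ((I L).card : ℝ) := by
  exact_mod_cast (hI.1 L).card_pos

theorem IsFolner.tendsto_leaving (hI : IsFolner I) (σ : Γ) :
    Tendsto (fun L => ((leaving I σ L).card : ℝ) / (I L).card) atTop (𝓝 0) := by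
  classical
  rw [Metric.tendsto_atTop']
  intro ε hε
  -- An element `γ` with `σ γ ∉ I L` lies in `I L` but not in `σ⁻¹ I L`, so the Følner condition
  -- applies with `K = {σ⁻¹}`.
  obtain ⟨N, hN⟩ := eventually_atTop.1 (hI.2 {σ⁻¹} (Finset.singleton_nonempty _) (ε / 2) (by positivity))
  refine ⟨N, fun L hL => ?_⟩
  have h1 : leaving I σ L ⊆ symmDiff (I L) ({σ⁻¹} * I L) := by
    intro γ hγ
    rw [leaving, Finset.mem_filter] at hγ
    rw [Finset.mem_symmDiff]
    refine Or.inl ⟨hγ.1, fun h => hγ.2 ?_⟩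
    rw [Finset.singleton_mul] at h
    obtain ⟨γ', h', rfl⟩ := Finset.mem_image.1 h
    simpa using h'
  have h2 : ((leaving I σ L).card : ℝ) ≤ ε / 2 * (I L).card := by
    have h4 : ((leaving I σ L).card : ℝ) ≤ (symmDiff (I L) ({σ⁻¹} * I L)).card := by
      exact_mod_cast Finset.card_le_card h1
    exact h4.trans (by convert hN L hL.le)
  have h3 := hI.card_pos L
  rw [Real.dist_eq, sub_zero, abs_of_nonneg (by positivity), div_lt_iff₀ h3]
  nlinarith

theorem IsFolner.comp_strictMono (hI : IsFolner I) {φ : ℕ → ℕ} (hφ : StrictMono φ) :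
    IsFolner (I ∘ φ) :=
  ⟨fun L => hI.1 (φ L), fun K hK ε hε => hφ.tendsto_atTop.eventually (hI.2 K hK ε hε)⟩

open Classical in
/-- The vertices of the exhaustion that are close to its boundary, as measured by `S`. -/
def bdry (F : Finset V) (I : ℕ → Finset Γ) (S : Finset Γ) (L : ℕ) : Finset V :=
  (exhaustion F I L).filter fun k => ∃ γ ∈ I L, ∃ σ ∈ S, γ • k ∈ F ∧ σ * γ ∉ I L

theorem card_bdry_le (S : Finset Γ) (L : ℕ) :
    (bdry F I S L).card ≤ ∑ σ ∈ S, (leaving I σ L).card * F.card := by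
  classical
  have h1 : bdry F I S L ⊆ S.biUnion fun σ =>
      (leaving I σ L ×ˢ F).image fun p => p.1⁻¹ • p.2 := by
    intro k hk
    rw [bdry, Finset.mem_filter] at hk
    obtain ⟨-, γ, hγ, σ, hσ, hk, hout⟩ := hk
    refine Finset.mem_biUnion.2 ⟨σ, hσ, Finset.mem_image.2 ⟨(γ, γ • k), ?_, by simp⟩⟩
    exact Finset.mem_product.2 ⟨Finset.mem_filter.2 ⟨hγ, hout⟩, hk⟩
  refine (Finset.card_le_card h1).trans (Finset.card_biUnion_le.trans ?_)
  refine Finset.sum_le_sum fun σ _ => ?_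
  exact Finset.card_image_le.trans (Finset.card_product _ _).le

theorem IsFolner.tendsto_bdry (hI : IsFolner I) (S : Finset Γ) :
    Tendsto (fun L => ((bdry F I S L).card : ℝ) / (I L).card) atTop (𝓝 0) := by
  have h1 : Tendsto (fun L => ∑ σ ∈ S, ((leaving I σ L).card : ℝ) / (I L).card * F.card) atTop
      (𝓝 0) := by
    have := tendsto_finsetSum S fun σ _ => (hI.tendsto_leaving σ).mul_const (F.card : ℝ)
    simpa using this
  refine squeeze_zero (fun L => by positivity) (fun L => ?_) h1
  have h2 : ((bdry F I S L).card : ℝ) ≤ ∑ σ ∈ S, ((leaving I σ L).card : ℝ) * F.card := by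
    exact_mod_cast card_bdry_le S L
  calc _ ≤ (∑ σ ∈ S, ((leaving I σ L).card : ℝ) * F.card) / (I L).card := by gcongr
    _ = _ := by
      rw [Finset.sum_div]
      exact Finset.sum_congr rfl fun σ _ => by ring

open Classical in
/-- The self-transporter of `F`. -/
def selfTransporter (hF : IsFiniteQuotient Γ F) : Finset Γ :=
  F.biUnion fun x => (hF.finite_transporter x F).toFinset

/-- The group average over `I L` of the weighted sum of `g` over `F`. -/
def groupAvg (F : Finset V) (I : ℕ → Finset Γ) (g : V → ℝ) (L : ℕ) : ℝ :=
  (∑ γ ∈ I L, ∑ x ∈ F, g (γ⁻¹ • x) / mult Γ F x) / (I L).card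

/-- Double counting: `k` is hit by `γ⁻¹ • x` once for every `γ ∈ I L` that moves `k` into `F`, and
`mult` is constant on orbits. The resulting weight of `k` is the proportion, among all group
elements moving `k` into `F`, of those in `I L`. -/
theorem sum_groupAvg (g : V → ℝ) (L : ℕ) :
    open Classical in
    ∑ γ ∈ I L, ∑ x ∈ F, g (γ⁻¹ • x) / mult Γ F x =
      ∑ k ∈ exhaustion F I L,
        g k * (((I L).filter fun γ => γ • k ∈ F).card / mult Γ F k : ℝ) := by
  classical
  symm
  have h1 : ∀ k ∈ exhaustion F I L,
      g k * (((I L).filter fun γ => γ • k ∈ F).card / mult Γ F k : ℝ) =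
      ∑ γ ∈ I L, if γ • k ∈ F then g k / mult Γ F k else 0 := by
    intro k _
    rw [← Finset.sum_filter, Finset.sum_const, nsmul_eq_mul]
    ring
  rw [Finset.sum_congr rfl h1, Finset.sum_comm]
  refine Finset.sum_congr rfl fun γ hγ => ?_
  rw [← Finset.sum_filter]
  symm
  refine Finset.sum_bij (fun x _ => γ⁻¹ • x) ?_ ?_ ?_ ?_
  · intro x hx
    rw [Finset.mem_filter, mem_exhaustion]
    exact ⟨⟨γ, hγ, by simpa using hx⟩, by simpa using hx⟩
  · intro a _ b _ h
    simpa using h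
  · intro k hk
    exact ⟨γ • k, (Finset.mem_filter.1 hk).2, by simp⟩
  · intro x _
    rw [mult_smul]

/-- A vertex has weight different from `1` only if some `γ ∉ I L` moves it into `F`. If `γ₀ ∈ I L`
also does so, then `γ γ₀⁻¹` carries a point of `F` into `F`, so the vertex is in the boundary
measured by the self-transporter. -/
theorem abs_sum_exhaustion_sub_le (hF : IsFiniteQuotient Γ F) {g : V → ℝ} {C : ℝ}
    (hg : ∀ k, |g k| ≤ C) (L : ℕ) :
    |∑ k ∈ exhaustion F I L, g k - ∑ γ ∈ I L, ∑ x ∈ F, g (γ⁻¹ • x) / mult Γ F x| ≤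
      C * (bdry F I (selfTransporter hF) L).card := by
  classical
  rw [sum_groupAvg, ← Finset.sum_sub_distrib]
  have h1 : ∀ k ∈ exhaustion F I L,
      |g k - g k * (((I L).filter fun γ => γ • k ∈ F).card / mult Γ F k : ℝ)| ≤
        if k ∈ bdry F I (selfTransporter hF) L then C else 0 := by
    intro k hk
    have hm := hF.mult_pos k
    have hm' : (0 : ℝ) < mult Γ F k := by exact_mod_cast hm
    have hsub : (((I L).filter fun γ => γ • k ∈ F : Finset Γ) : Set Γ) ⊆ {γ : Γ | γ • k ∈ F} := by
      intro γ hγ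
      exact (Finset.mem_filter.1 hγ).2
    have hle : ((I L).filter fun γ => γ • k ∈ F).card ≤ mult Γ F k := by
      rw [mult, ← Set.ncard_coe_finset]
      exact Set.ncard_le_ncard hsub (hF.finite_transporter k F)
    have hle' : ((((I L).filter fun γ => γ • k ∈ F).card : ℝ) / mult Γ F k) ≤ 1 := by
      rw [div_le_one hm']
      exact_mod_cast hle
    have hfac : g k - g k * (((I L).filter fun γ => γ • k ∈ F).card / mult Γ F k : ℝ) =
      g k * (1 - (((I L).filter fun γ => γ • k ∈ F).card / mult Γ F k : ℝ)) := by ring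
    rw [hfac, abs_mul, abs_of_nonneg (sub_nonneg.2 hle')]
    split_ifs with hb
    · have h0 : (0 : ℝ) ≤ (((I L).filter fun γ => γ • k ∈ F).card / mult Γ F k : ℝ) := by
        positivity
      calc |g k| * _ ≤ C * 1 := by
            refine mul_le_mul (hg k) (by linarith) (by linarith) ((abs_nonneg _).trans (hg k))
        _ = C := mul_one C
    · have heq : (((I L).filter fun γ => γ • k ∈ F : Finset Γ) : Set Γ) = {γ : Γ | γ • k ∈ F} := by
        refine hsub.antisymm fun γ hγ => ?_
        rw [Finset.coe_filter]
        refine ⟨?_, hγ⟩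
        by_contra hout
        apply hb
        obtain ⟨γ₀, h₀, hx⟩ := mem_exhaustion.1 hk
        rw [bdry, Finset.mem_filter]
        refine ⟨hk, γ₀, h₀, γ * γ₀⁻¹, ?_, hx, by simpa using hout⟩
        rw [selfTransporter, Finset.mem_biUnion]
        refine ⟨γ₀ • k, hx, ?_⟩
        simpa [mul_smul] using hγ
      have : ((I L).filter fun γ => γ • k ∈ F).card = mult Γ F k := by
        rw [mult, ← heq, Set.ncard_coe_finset]
      rw [this, div_self hm'.ne', sub_self, mul_zero]
  calc _ ≤ ∑ k ∈ exhaustion F I L,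
        |g k - g k * (((I L).filter fun γ => γ • k ∈ F).card / mult Γ F k : ℝ)| :=
        Finset.abs_sum_le_sum_abs _ _
    _ ≤ ∑ k ∈ exhaustion F I L, if k ∈ bdry F I (selfTransporter hF) L then C else 0 :=
        Finset.sum_le_sum h1
    _ = C * (bdry F I (selfTransporter hF) L).card := by
      rw [← Finset.sum_filter, Finset.sum_const, nsmul_eq_mul, mul_comm]
      congr 3
      ext k
      simp only [Finset.mem_filter, bdry]
      tauto

theorem tendsto_sum_exhaustion_div (hF : IsFiniteQuotient Γ F) (hI : IsFolner I) {g : V → ℝ}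
    {C a : ℝ} (hg : ∀ k, |g k| ≤ C) (h : Tendsto (groupAvg F I g) atTop (𝓝 a)) :
    Tendsto (fun L => (∑ k ∈ exhaustion F I L, g k) / (I L).card) atTop (𝓝 a) := by
  have h1 : Tendsto (fun L => (∑ k ∈ exhaustion F I L, g k) / (I L).card - groupAvg F I g L)
      atTop (𝓝 0) := by
    have h2 := (hI.tendsto_bdry (F := F) (selfTransporter hF)).const_mul C
    rw [mul_zero] at h2
    refine squeeze_zero_norm (fun L => ?_) h2
    have h3 := hI.card_pos L
    rw [groupAvg, ← sub_div, Real.norm_eq_abs, abs_div, abs_of_pos h3, ← mul_div_assoc]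
    gcongr
    exact abs_sum_exhaustion_sub_le hF hg L
  simpa using h1.add h

/-- The number of orbits, weighted by the inverse orders of the stabilisers. -/
def covolume (Γ : Type*) [Group Γ] [MulAction Γ V] (F : Finset V) : ℝ :=
  ∑ x ∈ F, (mult Γ F x : ℝ)⁻¹

theorem IsFiniteQuotient.covolume_pos (hF : IsFiniteQuotient Γ F) : 0 < covolume Γ F :=
  Finset.sum_pos (fun x _ => inv_pos.2 (by exact_mod_cast hF.mult_pos x)) hF.nonempty

theorem tendsto_card_exhaustion_div (hF : IsFiniteQuotient Γ F) (hI : IsFolner I) :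
    Tendsto (fun L => ((exhaustion F I L).card : ℝ) / (I L).card) atTop
      (𝓝 (covolume Γ F)) := by
  have h1 : groupAvg F I (fun _ => 1) = fun _ => covolume Γ F := by
    ext L
    have := hI.card_pos L
    simp only [groupAvg, one_div, Finset.sum_const, nsmul_eq_mul]
    rw [mul_div_assoc, mul_div_left_comm, div_self this.ne', mul_one, covolume]
  have h2 := tendsto_sum_exhaustion_div hF hI (g := fun _ => 1) (C := 1) (by simp)
    (h1 ▸ tendsto_const_nhds)
  simpa using h2

theorem card_exhaustion_pos (hF : IsFiniteQuotient Γ F) (hI : IsFolner I) (L : ℕ) :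
    0 < ((exhaustion F I L).card : ℝ) := by
  obtain ⟨x, hx⟩ := hF.nonempty
  obtain ⟨γ, hγ⟩ := hI.1 L
  have : γ⁻¹ • x ∈ exhaustion F I L := mem_exhaustion.2 ⟨γ, hγ, by simpa using hx⟩
  exact_mod_cast Finset.card_pos.2 ⟨_, this⟩

theorem tendsto_vertex_avg (hF : IsFiniteQuotient Γ F) (hI : IsFolner I) {g : V → ℝ}
    {C a : ℝ} (hg : ∀ k, |g k| ≤ C) (h : Tendsto (groupAvg F I g) atTop (𝓝 a)) :
    Tendsto (fun L => (∑ k ∈ exhaustion F I L, g k) / (exhaustion F I L).card) atTop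
      (𝓝 (a / covolume Γ F)) := by
  refine ((tendsto_sum_exhaustion_div hF hI hg h).div (tendsto_card_exhaustion_div hF hI)
    hF.covolume_pos.ne').congr fun L => ?_
  have := hI.card_pos L
  exact div_div_div_cancel_right₀ this.ne' _ _

/-- For an equivariant neighbourhood system, only few vertices of the exhaustion have a
neighbourhood that is not contained in the exhaustion. -/
theorem tendsto_card_not_subset (hF : IsFiniteQuotient Γ F) (hI : IsFolner I)
    {N : V → Finset V} (hN : ∀ (γ : Γ) k j, j ∈ N k → γ • j ∈ N (γ • k)) :
    open Classical in
    Tendsto (fun L => (((exhaustion F I L).filter fun k => ¬ N k ⊆ exhaustion F I L).card : ℝ) /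
      (exhaustion F I L).card) atTop (𝓝 0) := by
  classical
  choose σ hσ using hF.covers
  -- Equivariance moves a bad vertex into `F`, so only neighbourhoods of points of `F` matter. `S`
  -- consists of finitely many elements, one for each vertex of these neighbourhoods, that return
  -- the vertex to `F`.
  set S : Finset Γ := (F.biUnion N).image σ
  have hsub : ∀ L, ((exhaustion F I L).filter fun k => ¬ N k ⊆ exhaustion F I L) ⊆
      bdry F I S L := by
    intro L k hk
    rw [Finset.mem_filter] at hk
    obtain ⟨hk, hnot⟩ := hk
    obtain ⟨j, hj, hjout⟩ := Finset.not_subset.1 hnot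
    obtain ⟨γ, hγ, hx⟩ := mem_exhaustion.1 hk
    rw [bdry, Finset.mem_filter]
    refine ⟨hk, γ, hγ, σ (γ • j), ?_, hx, fun hin => hjout ?_⟩
    · exact Finset.mem_image_of_mem _ (Finset.mem_biUnion.2 ⟨γ • k, hx, hN γ k j hj⟩)
    · exact mem_exhaustion.2 ⟨_, hin, by rw [mul_smul]; exact hσ _⟩
  have h1 := (hI.tendsto_bdry (F := F) S).div (tendsto_card_exhaustion_div hF hI)
    hF.covolume_pos.ne'
  rw [zero_div] at h1
  refine squeeze_zero (fun L => by positivity) (fun L => ?_) h1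
  have := hI.card_pos L
  simp only [Pi.div_apply]
  rw [div_div_div_cancel_right₀ this.ne']
  gcongr
  exact hsub L

end Folner

/-! ### Coboundaries and invariant functions -/

section Ergodic

variable {V Γ : Type*} [Group Γ] [MulAction Γ V] {P : Measure (V → ℝ≥0∞)} {I : ℕ → Finset Γ}

theorem shift_mul (γ σ : Γ) (ω : V → ℝ≥0∞) : shift (γ * σ) ω = shift γ (shift σ ω) := by
  ext k
  simp [shift, mul_smul]

theorem shift_one (ω : V → ℝ≥0∞) : shift (1 : Γ) ω = ω := by
  ext k
  simp [shift]

theorem measurable_shift (γ : Γ) : Measurable (shift (V := V) γ) :=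
  measurable_pi_lambda _ fun _ => measurable_pi_apply _

/-- The average of the translates of `h` over `I L`. -/
def ergAvg (I : ℕ → Finset Γ) (h : (V → ℝ≥0∞) → ℝ) (L : ℕ) (ω : V → ℝ≥0∞) : ℝ :=
  (∑ γ ∈ I L, h (shift γ ω)) / (I L).card

/-- The averages of `h` converge almost surely to the expectation of `h`. -/
def AvgConv (P : Measure (V → ℝ≥0∞)) (I : ℕ → Finset Γ) (h : (V → ℝ≥0∞) → ℝ) : Prop :=
  ∀ᵐ ω ∂P, Tendsto (fun L => ergAvg I h L ω) atTop (𝓝 (∫ ω, h ω ∂P))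

theorem ergAvg_sub (h h' : (V → ℝ≥0∞) → ℝ) (L : ℕ) (ω : V → ℝ≥0∞) :
    ergAvg I (fun ω => h ω - h' ω) L ω = ergAvg I h L ω - ergAvg I h' L ω := by
  simp only [ergAvg, Finset.sum_sub_distrib, sub_div]

theorem ergAvg_add (h h' : (V → ℝ≥0∞) → ℝ) (L : ℕ) (ω : V → ℝ≥0∞) :
    ergAvg I (fun ω => h ω + h' ω) L ω = ergAvg I h L ω + ergAvg I h' L ω := by
  simp only [ergAvg, Finset.sum_add_distrib, add_div]

theorem ergAvg_const_mul (c : ℝ) (h : (V → ℝ≥0∞) → ℝ) (L : ℕ) (ω : V → ℝ≥0∞) :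
    ergAvg I (fun ω => c * h ω) L ω = c * ergAvg I h L ω := by
  simp only [ergAvg, ← Finset.mul_sum, mul_div_assoc]

theorem ergAvg_const (hI : IsFolner I) (c : ℝ) (L : ℕ) (ω : V → ℝ≥0∞) :
    ergAvg I (fun _ => c) L ω = c := by
  have := hI.card_pos L
  simp only [ergAvg, Finset.sum_const, nsmul_eq_mul]
  field_simp

theorem measurable_ergAvg {h : (V → ℝ≥0∞) → ℝ} (hh : Measurable h) (L : ℕ) :
    Measurable (ergAvg I h L) :=
  (Finset.measurable_sum _ fun γ _ => hh.comp (measurable_shift γ)).div_const _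

theorem abs_ergAvg_le (h : (V → ℝ≥0∞) → ℝ) (L : ℕ) (ω : V → ℝ≥0∞) :
    |ergAvg I h L ω| ≤ ergAvg I (fun ω => |h ω|) L ω := by
  rw [ergAvg, abs_div, Nat.abs_cast, ergAvg]
  gcongr
  exact Finset.abs_sum_le_sum_abs _ _

/-- A bounded measurable function whose averages tend to zero uniformly. -/
structure IsUnifNull (I : ℕ → Finset Γ) (u : (V → ℝ≥0∞) → ℝ) : Prop where
  measurable : Measurable u
  bounded : ∃ C, ∀ ω, |u ω| ≤ C
  null : ∀ ε > 0, ∀ᶠ L in atTop, ∀ ω, |ergAvg I u L ω| ≤ ε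

theorem IsUnifNull.add {u u' : (V → ℝ≥0∞) → ℝ} (hu : IsUnifNull I u) (hu' : IsUnifNull I u') :
    IsUnifNull I fun ω => u ω + u' ω := by
  obtain ⟨C, hC⟩ := hu.bounded
  obtain ⟨C', hC'⟩ := hu'.bounded
  refine ⟨hu.measurable.add hu'.measurable, ⟨C + C', fun ω => ?_⟩, fun ε hε => ?_⟩
  · exact (abs_add_le _ _).trans (add_le_add (hC ω) (hC' ω))
  · filter_upwards [hu.null (ε / 2) (by positivity), hu'.null (ε / 2) (by positivity)]
      with L h1 h2 ω
    rw [ergAvg_add]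
    linarith [abs_add_le (ergAvg I u L ω) (ergAvg I u' L ω), h1 ω, h2 ω]

theorem IsUnifNull.const_mul {u : (V → ℝ≥0∞) → ℝ} (hu : IsUnifNull I u) (c : ℝ) :
    IsUnifNull I fun ω => c * u ω := by
  obtain ⟨C, hC⟩ := hu.bounded
  refine ⟨hu.measurable.const_mul c, ⟨|c| * C, fun ω => ?_⟩, fun ε hε => ?_⟩
  · rw [abs_mul]
    exact mul_le_mul_of_nonneg_left (hC ω) (abs_nonneg c)
  · filter_upwards [hu.null (ε / (|c| + 1)) (by positivity)] with L h ω
    rw [ergAvg_const_mul, abs_mul]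
    calc |c| * |ergAvg I u L ω| ≤ (|c| + 1) * (ε / (|c| + 1)) := by
          gcongr
          · linarith
          · exact h ω
      _ = ε := by field_simp

/-- The sums over `σ I L` and `I L` cancel on the intersection. What remains is counted by `leaving
I σ` and `leaving I σ⁻¹`, independently of the configuration. -/
theorem isUnifNull_coboundary (hI : IsFolner I) (σ : Γ) {A : Set (V → ℝ≥0∞)}
    (hA : MeasurableSet A) :
    IsUnifNull I fun ω => A.indicator (fun _ => (1 : ℝ)) (shift σ ω) -
      A.indicator (fun _ => (1 : ℝ)) ω := by
  classical
  set χ : (V → ℝ≥0∞) → ℝ := A.indicator fun _ => (1 : ℝ) with hχ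
  have hχm : Measurable χ := measurable_const.indicator hA
  have hχ0 : ∀ ω, 0 ≤ χ ω ∧ χ ω ≤ 1 := by
    intro ω
    by_cases h : ω ∈ A <;> simp [hχ, h]
  refine ⟨(hχm.comp (measurable_shift σ)).sub hχm, ⟨1, fun ω => ?_⟩, fun ε hε => ?_⟩
  · rw [abs_le]
    constructor <;> linarith [(hχ0 ω).1, (hχ0 ω).2, (hχ0 (shift σ ω)).1, (hχ0 (shift σ ω)).2]
  · have h1 := hI.tendsto_leaving σ
    have h2 := hI.tendsto_leaving σ⁻¹
    have h3 := h1.add h2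
    rw [add_zero] at h3
    filter_upwards [h3.eventually_le_const hε] with L hL ω
    refine le_trans ?_ hL
    have hpos := hI.card_pos L
    rw [ergAvg, abs_div, Nat.abs_cast, ← add_div]
    gcongr
    rw [Finset.sum_sub_distrib]
    have e1 : ∑ γ ∈ I L, χ (shift σ (shift γ ω)) =
        ∑ γ ∈ (I L).image (σ * ·), χ (shift γ ω) := by
      rw [Finset.sum_image fun a _ b _ h => mul_left_cancel h]
      simp_rw [shift_mul]
    rw [e1]
    set J := (I L).image (σ * ·)
    have e2 : ∑ γ ∈ J, χ (shift γ ω) - ∑ γ ∈ I L, χ (shift γ ω) =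
        ∑ γ ∈ J \ I L, χ (shift γ ω) - ∑ γ ∈ I L \ J, χ (shift γ ω) := by
      have := Finset.sum_sdiff_sub_sum_sdiff (s₁ := I L) (s₂ := J) (f := fun γ => χ (shift γ ω))
      linarith
    have c1 : (J \ I L).card ≤ (leaving I σ L).card := by
      refine (Finset.card_le_card (t := (leaving I σ L).image (σ * ·)) ?_).trans
        Finset.card_image_le
      intro γ hγ
      rw [Finset.mem_sdiff, Finset.mem_image] at hγ
      obtain ⟨⟨γ', hγ', rfl⟩, hout⟩ := hγ
      exact Finset.mem_image_of_mem _ (Finset.mem_filter.2 ⟨hγ', hout⟩)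
    have c2 : (I L \ J).card ≤ (leaving I σ⁻¹ L).card := by
      refine Finset.card_le_card fun γ hγ => ?_
      rw [Finset.mem_sdiff] at hγ
      refine Finset.mem_filter.2 ⟨hγ.1, fun h => hγ.2 ?_⟩
      exact Finset.mem_image.2 ⟨_, h, by simp⟩
    have b1 : ∀ S : Finset Γ, 0 ≤ ∑ γ ∈ S, χ (shift γ ω) ∧ ∑ γ ∈ S, χ (shift γ ω) ≤ S.card := by
      intro S
      refine ⟨Finset.sum_nonneg fun γ _ => (hχ0 _).1, ?_⟩
      refine (Finset.sum_le_card_nsmul _ _ (1 : ℝ) fun γ _ => (hχ0 _).2).trans ?_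
      simp
    rw [e2, abs_le]
    have c1' : ((J \ I L).card : ℝ) ≤ (leaving I σ L).card := by exact_mod_cast c1
    have c2' : ((I L \ J).card : ℝ) ≤ (leaving I σ⁻¹ L).card := by exact_mod_cast c2
    have := b1 (J \ I L)
    have := b1 (I L \ J)
    constructor <;> linarith

section Invariant

/-- Ergodicity is formulated for strictly invariant sets. The intersection of the countably many
translates of `A` is strictly invariant and agrees with `A` almost everywhere. -/
theorem IsStationaryErgodic.measure_eq_zero_or_one [Countable Γ] (hP : IsStationaryErgodic Γ P)
    {A : Set (V → ℝ≥0∞)} (hA : MeasurableSet A)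
    (hinv : ∀ γ : Γ, (shift γ ⁻¹' A : Set (V → ℝ≥0∞)) =ᵐ[P] A) : P A = 0 ∨ P A = 1 := by
  have h1 : (⋂ γ : Γ, (shift γ ⁻¹' A : Set (V → ℝ≥0∞))) =ᵐ[P] A := by
    have := Filter.EventuallyEq.countable_iInter hinv
    simpa [Set.iInter_const] using this
  rw [← measure_congr h1]
  refine hP.2 _ (MeasurableSet.iInter fun γ => measurable_shift γ hA) fun σ => ?_
  ext ω
  simp only [Set.mem_preimage, Set.mem_iInter, ← shift_mul]
  exact ⟨fun h γ => by simpa using h (γ * σ⁻¹), fun h γ => h (γ * σ)⟩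

/-- The sets where `f` exceeds, or falls below, its mean have measure zero or one; measure one would
make the integral of `f - c` nonzero. -/
theorem IsStationaryErgodic.ae_eq_integral [Countable Γ] [IsProbabilityMeasure P]
    (hP : IsStationaryErgodic Γ P) {f : (V → ℝ≥0∞) → ℝ} (hf : Measurable f)
    (hfi : Integrable f P) (hinv : ∀ γ : Γ, (fun ω => f (shift γ ω)) =ᵐ[P] f) :
    f =ᵐ[P] fun _ => ∫ ω, f ω ∂P := by
  set c := ∫ ω, f ω ∂P with hc
  have hset : ∀ s : Set ℝ, MeasurableSet s → P (f ⁻¹' s) = 0 ∨ P (f ⁻¹' s) = 1 := by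
    intro s hs
    refine hP.measure_eq_zero_or_one (hf hs) fun γ => ?_
    filter_upwards [hinv γ] with ω hω
    apply propext
    change f (shift γ ω) ∈ s ↔ f ω ∈ s
    rw [hω]
  have hint : Integrable (fun ω => f ω - c) P := hfi.sub (integrable_const c)
  have h0 : ∫ ω, (f ω - c) ∂P = 0 := by
    rw [integral_sub hfi (integrable_const c)]
    simp [hc]
  have hpos : P (f ⁻¹' Set.Ioi c) = 0 := by
    rcases hset _ measurableSet_Ioi with h | h
    · exact h
    · exfalso
      have hae : ∀ᵐ ω ∂P, 0 < f ω - c := by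
        rw [← prob_compl_eq_zero_iff (hf measurableSet_Ioi)] at h
        filter_upwards [measure_eq_zero_iff_ae_notMem.1 h] with ω hω
        simpa using hω
      have := (integral_pos_iff_support_of_nonneg_ae (hae.mono fun ω h => h.le) hint).2 (by
        have hs : P (Function.support fun ω => f ω - c)ᶜ = 0 := by
          rw [measure_eq_zero_iff_ae_notMem]
          filter_upwards [hae] with ω hω
          simpa using hω.ne'
        have := measure_add_measure_compl (μ := P)
          (measurableSet_support (hf.sub_const c))
        rw [hs, add_zero, measure_univ] at this
        rw [this]
        exact one_pos)
      linarith
  have hneg : P (f ⁻¹' Set.Iio c) = 0 := by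
    rcases hset _ measurableSet_Iio with h | h
    · exact h
    · exfalso
      have hae : ∀ᵐ ω ∂P, 0 < -(f ω - c) := by
        rw [← prob_compl_eq_zero_iff (hf measurableSet_Iio)] at h
        filter_upwards [measure_eq_zero_iff_ae_notMem.1 h] with ω hω
        simpa using hω
      have := (integral_pos_iff_support_of_nonneg_ae (hae.mono fun ω h => h.le) hint.neg).2 (by
        have hs : P (Function.support fun ω => -(f ω - c))ᶜ = 0 := by
          rw [measure_eq_zero_iff_ae_notMem]
          filter_upwards [hae] with ω hω
          simpa using fun h => hω.ne' (by linarith)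
        have := measure_add_measure_compl (μ := P)
          (measurableSet_support (f := fun ω => -(f ω - c)) (hf.sub_const c).neg)
        rw [hs, add_zero, measure_univ] at this
        change 0 < P (Function.support fun ω => -(f ω - c))
        rw [this]
        exact one_pos)
      have h2 : ∫ ω, -(f ω - c) ∂P = 0 := by rw [integral_neg, h0, neg_zero]
      exact absurd h2 this.ne'
  filter_upwards [measure_eq_zero_iff_ae_notMem.1 hpos, measure_eq_zero_iff_ae_notMem.1 hneg]
    with ω h1 h2
  simp only [Set.mem_preimage, Set.mem_Ioi, Set.mem_Iio, not_lt] at h1 h2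
  exact le_antisymm h1 h2

end Invariant

end Ergodic

/-! ### The mean ergodic theorem and almost sure convergence along subsequences -/

section MeanErgodic

variable {V Γ : Type*} [Group Γ] [MulAction Γ V] {P : Measure (V → ℝ≥0∞)} {I : ℕ → Finset Γ}

theorem integrable_of_bounded [IsFiniteMeasure P] {u : (V → ℝ≥0∞) → ℝ} (hu : Measurable u) {C : ℝ}
    (hC : ∀ ω, |u ω| ≤ C) : Integrable u P :=
  Integrable.of_bound hu.aestronglyMeasurable C (Eventually.of_forall hC)

theorem memLp_of_bounded [IsFiniteMeasure P] {u : (V → ℝ≥0∞) → ℝ} (hu : Measurable u) {C : ℝ}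
    (hC : ∀ ω, |u ω| ≤ C) : MemLp u 2 P :=
  MemLp.of_bound hu.aestronglyMeasurable C (Eventually.of_forall hC)

/-- The subspace of `L²` of functions whose averages tend to zero uniformly. -/
def unifNullSubmodule (P : Measure (V → ℝ≥0∞)) (I : ℕ → Finset Γ) :
    Submodule ℝ (Lp ℝ 2 P) where
  carrier := {f | ∃ u, IsUnifNull I u ∧ f =ᵐ[P] u}
  zero_mem' := ⟨fun _ => 0, ⟨measurable_const, ⟨0, by simp⟩, fun ε hε =>
    Eventually.of_forall fun L ω => by simp [ergAvg, hε.le]⟩, Lp.coeFn_zero ..⟩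
  add_mem' := by
    rintro f g ⟨u, hu, hfu⟩ ⟨u', hu', hgu⟩
    refine ⟨_, hu.add hu', ?_⟩
    filter_upwards [Lp.coeFn_add f g, hfu, hgu] with ω h1 h2 h3
    rw [h1, Pi.add_apply, h2, h3]
  smul_mem' := by
    rintro c f ⟨u, hu, hfu⟩
    refine ⟨_, hu.const_mul c, ?_⟩
    filter_upwards [Lp.coeFn_smul c f, hfu] with ω h1 h2
    rw [h1, Pi.smul_apply, h2, smul_eq_mul]

/-- Orthogonality to the coboundaries of indicators says that `f` has the same integral over a set
and over its translates. Hence `f` is invariant almost everywhere, and ergodicity makes it constant.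
-/
theorem ae_const_of_mem_orthogonal [Countable Γ] [IsProbabilityMeasure P] (hI : IsFolner I)
    (hP : IsStationaryErgodic Γ P) {f : Lp ℝ 2 P} (hf : f ∈ (unifNullSubmodule P I)ᗮ) :
    ∃ c : ℝ, f =ᵐ[P] fun _ => c := by
  obtain ⟨g, hgm, hfg⟩ := (Lp.stronglyMeasurable f).aestronglyMeasurable
  have hgm' := hgm.measurable
  have hfi : Integrable f P := (Lp.memLp f).integrable (by norm_num)
  have hgi : Integrable g P := hfi.congr hfg
  refine ⟨∫ ω, g ω ∂P, hfg.trans (hP.ae_eq_integral hgm' hgi fun σ => ?_)⟩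
  have hσ := hP.1 σ
  have hσi : Integrable (fun ω => g (shift σ ω)) P := hσ.integrable_comp_of_integrable hgi
  refine hσi.ae_eq_of_forall_setIntegral_eq _ _ hgi fun A hA _ => ?_
  -- The inverse is needed: the change of variables by `σ` turns the integral of `g` over `shift σ⁻¹
  -- ⁻¹' A` into that of `g ∘ shift σ` over `A`.
  have hu := isUnifNull_coboundary hI σ⁻¹ hA
  obtain ⟨C, hC⟩ := hu.bounded
  have hL := memLp_of_bounded (P := P) hu.measurable hC
  have h0 : inner ℝ (hL.toLp _) f = 0 := hf _ ⟨_, hu, hL.coeFn_toLp⟩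
  rw [L2.inner_def] at h0
  have hAσ : MeasurableSet (shift σ⁻¹ ⁻¹' A : Set (V → ℝ≥0∞)) := measurable_shift _ hA
  have h1 : ∫ ω, inner ℝ ((hL.toLp _ : Lp ℝ 2 P) ω) (f ω) ∂P =
      ∫ ω, ((shift σ⁻¹ ⁻¹' A : Set (V → ℝ≥0∞)).indicator g ω - A.indicator g ω) ∂P := by
    refine integral_congr_ae ?_
    filter_upwards [hL.coeFn_toLp, hfg] with ω h1 h2
    rw [h1, h2]
    by_cases ha : shift σ⁻¹ ω ∈ A <;> by_cases hb : ω ∈ A <;> simp [Set.indicator, ha, hb]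
  rw [h1, integral_sub (hgi.indicator hAσ) (hgi.indicator hA), integral_indicator hAσ,
    integral_indicator hA, sub_eq_zero] at h0
  rw [← h0]
  have h2 := setIntegral_map (μ := P) (g := shift (V := V) σ) hAσ
    (f := g) (by rw [hσ.map_eq]; exact hgm.aestronglyMeasurable) hσ.measurable.aemeasurable
  rw [hσ.map_eq] at h2
  rw [h2]
  have h3 : (shift σ ⁻¹' (shift σ⁻¹ ⁻¹' A) : Set (V → ℝ≥0∞)) = A := by
    ext ω
    simp only [Set.mem_preimage, ← shift_mul, inv_mul_cancel, shift_one]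
  rw [h3]

/-- Every bounded function is, up to a constant and a small error, a function whose averages tend
to zero uniformly. -/
theorem exists_isUnifNull_approx [Countable Γ] [IsProbabilityMeasure P] (hI : IsFolner I)
    (hP : IsStationaryErgodic Γ P) {h : (V → ℝ≥0∞) → ℝ} (hh : Measurable h) {C : ℝ}
    (hC : ∀ ω, |h ω| ≤ C) {ε : ℝ} (hε : 0 < ε) :
    ∃ u, IsUnifNull I u ∧ ∫ ω, |h ω - ∫ ω', h ω' ∂P - u ω| ∂P ≤ ε := by
  set c := ∫ ω', h ω' ∂P with hc
  have hi := integrable_of_bounded (P := P) hh hC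
  have hL : MemLp (fun ω => h ω - c) 2 P :=
    (memLp_of_bounded hh hC).sub (memLp_const c)
  -- The closure is the double orthogonal complement. Elements of the complement are constants, and
  -- `h - c` has mean zero.
  have hmem : hL.toLp _ ∈ (unifNullSubmodule P I).topologicalClosure := by
    rw [← Submodule.orthogonal_orthogonal_eq_closure]
    intro f hf
    obtain ⟨c', hc'⟩ := ae_const_of_mem_orthogonal hI hP hf
    rw [L2.inner_def]
    have : ∫ ω, inner ℝ (f ω) ((hL.toLp _ : Lp ℝ 2 P) ω) ∂P = ∫ ω, c' * (h ω - c) ∂P := by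
      refine integral_congr_ae ?_
      filter_upwards [hL.coeFn_toLp, hc'] with ω h1 h2
      rw [h1, h2]
      simp [mul_comm]
    rw [this, integral_const_mul, integral_sub hi (integrable_const c)]
    simp [hc]
  obtain ⟨f, ⟨u, hu, hfu⟩, hdist⟩ := Metric.mem_closure_iff.1 hmem ε hε
  refine ⟨u, hu, ?_⟩
  obtain ⟨C', hC'⟩ := hu.bounded
  have hwm : Measurable fun ω => h ω - c - u ω := (hh.sub_const c).sub hu.measurable
  rw [dist_eq_norm, Lp.norm_def] at hdist
  have h1 : eLpNorm (fun ω => h ω - c - u ω) 2 P = eLpNorm (hL.toLp _ - f : Lp ℝ 2 P) 2 P := by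
    refine eLpNorm_congr_ae ?_
    filter_upwards [Lp.coeFn_sub (hL.toLp _) f, hL.coeFn_toLp, hfu] with ω e1 e2 e3
    rw [e1, Pi.sub_apply, e2, e3]
  -- On a probability space the `L¹` norm is at most the `L²` norm; the error is needed in `L¹`.
  have h2 : eLpNorm (fun ω => h ω - c - u ω) 1 P ≤ eLpNorm (fun ω => h ω - c - u ω) 2 P :=
    eLpNorm_le_eLpNorm_of_exponent_le (by norm_num) hwm.aestronglyMeasurable
  have h3 : ∫ ω, |h ω - c - u ω| ∂P = (eLpNorm (fun ω => h ω - c - u ω) 1 P).toReal := by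
    rw [eLpNorm_one_eq_lintegral_enorm, ← integral_norm_eq_lintegral_enorm
      hwm.aestronglyMeasurable]
    rfl
  rw [h3]
  refine le_trans (ENNReal.toReal_mono ?_ h2) ?_
  · rw [h1]
    exact Lp.eLpNorm_ne_top _
  · rw [h1]
    exact hdist.le

theorem integral_ergAvg (hI : IsFolner I) (hP : ∀ γ : Γ, MeasurePreserving (shift (V := V) γ) P P)
    {w : (V → ℝ≥0∞) → ℝ} (hw : Measurable w) (hwi : Integrable w P) (L : ℕ) :
    Integrable (ergAvg I w L) P ∧ ∫ ω, ergAvg I w L ω ∂P = ∫ ω, w ω ∂P := by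
  have h1 : ∀ γ : Γ, Integrable (fun ω => w (shift γ ω)) P := fun γ =>
    (hP γ).integrable_comp_of_integrable hwi
  have h2 : ∀ γ : Γ, ∫ ω, w (shift γ ω) ∂P = ∫ ω, w ω ∂P := fun γ => by
    have := integral_map (μ := P) (φ := shift (V := V) γ) (measurable_shift γ).aemeasurable
      (f := w) hw.aestronglyMeasurable
    rw [(hP γ).map_eq] at this
    exact this.symm
  refine ⟨(integrable_finsetSum _ fun γ _ => h1 γ).div_const _, ?_⟩
  have hpos := hI.card_pos L
  simp only [ergAvg]
  rw [integral_div, integral_finsetSum _ fun γ _ => h1 γ, Finset.sum_congr rfl fun γ _ => h2 γ,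
    Finset.sum_const, nsmul_eq_mul]
  field_simp

/-- Decompose `h = c + u + w`. The averages of `u` are uniformly small, and by stationarity
averaging does not increase the `L¹` norm of `w`. -/
theorem tendsto_integral_abs_ergAvg_sub [Countable Γ] [IsProbabilityMeasure P] (hI : IsFolner I)
    (hP : IsStationaryErgodic Γ P) {h : (V → ℝ≥0∞) → ℝ} (hh : Measurable h) {C : ℝ}
    (hC : ∀ ω, |h ω| ≤ C) :
    Tendsto (fun L => ∫ ω, |ergAvg I h L ω - ∫ ω', h ω' ∂P| ∂P) atTop (𝓝 0) := by
  rw [Metric.tendsto_atTop']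
  intro ε hε
  obtain ⟨u, hu, hdist⟩ := exists_isUnifNull_approx hI hP hh hC (ε := ε / 4) (by positivity)
  obtain ⟨N, hN⟩ := eventually_atTop.1 (hu.null (ε / 4) (by positivity))
  refine ⟨N, fun L hL => ?_⟩
  set c := ∫ ω', h ω' ∂P with hc
  set w : (V → ℝ≥0∞) → ℝ := fun ω => h ω - c - u ω with hw
  have hwm : Measurable w := (hh.sub_const c).sub hu.measurable
  obtain ⟨C', hC'⟩ := hu.bounded
  have hwi : Integrable w P := ((integrable_of_bounded hh hC).sub (integrable_const c)).sub
    (integrable_of_bounded hu.measurable hC')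
  have h1 : ∀ ω, |ergAvg I h L ω - c| ≤ ergAvg I (fun ω => |w ω|) L ω + ε / 4 := by
    intro ω
    have e1 : ergAvg I h L ω - c = ergAvg I w L ω + ergAvg I u L ω := by
      rw [hw, ergAvg_sub, ergAvg_sub, ergAvg_const hI]
      ring
    rw [e1]
    refine (abs_add_le _ _).trans (add_le_add (abs_ergAvg_le _ _ _) (hN L hL.le ω))
  obtain ⟨i1, i2⟩ := integral_ergAvg hI hP.1 hwm.abs hwi.abs L
  have h2 : ∫ ω, |ergAvg I h L ω - c| ∂P ≤ ∫ ω, (ergAvg I (fun ω => |w ω|) L ω + ε / 4) ∂P := by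
    refine integral_mono ?_ (i1.add (integrable_const _)) h1
    refine Integrable.abs (Integrable.sub ?_ (integrable_const c))
    exact (integral_ergAvg hI hP.1 hh (integrable_of_bounded hh hC) L).1
  rw [integral_add i1 (integrable_const _), i2] at h2
  simp only [integral_const, probReal_univ, smul_eq_mul, one_mul] at h2
  rw [Real.dist_eq, sub_zero, abs_of_nonneg (integral_nonneg fun ω => abs_nonneg _)]
  linarith

/-- For countably many bounded functions, the averages converge almost surely along a common
subsequence. -/
theorem exists_subseq_avgConv [Countable Γ] [IsProbabilityMeasure P] (hI : IsFolner I)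
    (hP : IsStationaryErgodic Γ P) {h : ℕ → (V → ℝ≥0∞) → ℝ} (hh : ∀ i, Measurable (h i))
    (hC : ∀ i, ∃ C, ∀ ω, |h i ω| ≤ C) :
    ∃ φ : ℕ → ℕ, StrictMono φ ∧ ∀ i, AvgConv P (I ∘ φ) (h i) := by
  choose C hC using hC
  set d : ℕ → ℕ → (V → ℝ≥0∞) → ℝ := fun i L ω => |ergAvg I (h i) L ω - ∫ ω', h i ω' ∂P| with hd
  have hdm : ∀ i L, Measurable (d i L) := fun i L => ((measurable_ergAvg (hh i) L).sub_const _).abs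
  have hdi : ∀ i L, Integrable (d i L) P := fun i L =>
    ((integral_ergAvg hI hP.1 (hh i) (integrable_of_bounded (hh i) (hC i)) L).1.sub
      (integrable_const _)).abs
  -- Diagonal choice: the `n`-th index of the subsequence serves the first `n + 1` functions with a
  -- summable error.
  have hev : ∀ n : ℕ, ∀ᶠ L in atTop, ∀ i ∈ Finset.range (n + 1),
      ∫ ω, d i L ω ∂P ≤ (1 / 2 : ℝ) ^ n := by
    intro n
    rw [Filter.eventually_all_finset]
    intro i _
    exact (tendsto_integral_abs_ergAvg_sub hI hP (hh i) (hC i)).eventually_le_const (by positivity)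
  obtain ⟨φ, hφ, hb⟩ := extraction_forall_of_eventually hev
  refine ⟨φ, hφ, fun i => ?_⟩
  -- The error bound for the `i`-th function is available only from index `i` on, hence the shift by
  -- `i`. A summable sequence of `L¹` errors converges to zero almost surely.
  have hsum : ∑' n, ∫⁻ ω, ENNReal.ofReal (d i (φ (n + i)) ω) ∂P ≠ ∞ := by
    have h1 : ∀ n, ∫⁻ ω, ENNReal.ofReal (d i (φ (n + i)) ω) ∂P ≤
        ENNReal.ofReal ((1 / 2 : ℝ) ^ n) := by
      intro n
      rw [← ofReal_integral_eq_lintegral_ofReal (hdi _ _)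
        (Eventually.of_forall fun ω => abs_nonneg _)]
      refine ENNReal.ofReal_le_ofReal ((hb (n + i) i ?_).trans ?_)
      · rw [Finset.mem_range]; omega
      · exact pow_le_pow_of_le_one (by norm_num) (by norm_num) (by omega)
    refine ne_top_of_le_ne_top ?_ (ENNReal.tsum_le_tsum h1)
    rw [← ENNReal.ofReal_tsum_of_nonneg (fun n => by positivity)
      (summable_geometric_of_lt_one (by norm_num) (by norm_num))]
    exact ENNReal.ofReal_ne_top
  rw [← lintegral_tsum fun n => (hdm _ _).ennreal_ofReal.aemeasurable] at hsum
  have hae := ae_lt_top' (AEMeasurable.tsum fun n =>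
    (hdm _ _).ennreal_ofReal.aemeasurable) hsum
  filter_upwards [hae] with ω hω
  have h1 := ENNReal.tendsto_atTop_zero_of_tsum_ne_top hω.ne
  have h2 : Tendsto (fun n => d i (φ (n + i)) ω) atTop (𝓝 0) := by
    have := (ENNReal.tendsto_toReal ENNReal.zero_ne_top).comp h1
    refine (this.congr fun n => ?_)
    exact ENNReal.toReal_ofReal (abs_nonneg _)
  have h3 : Tendsto (fun n => d i (φ n) ω) atTop (𝓝 0) := (tendsto_add_atTop_iff_nat i).1 h2
  rw [tendsto_iff_dist_tendsto_zero]
  exact h3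

end MeanErgodic

/-! ### Equivariant observables, the potential cutoff and diagonal elements -/

section Observables

variable {V Γ : Type*} [Group Γ] [MulAction Γ V] {P : Measure (V → ℝ≥0∞)} {I : ℕ → Finset Γ}
  {F : Finset V}

/-- A bounded measurable function of configurations and vertices that is invariant under the
diagonal action. -/
structure IsObservable (Γ : Type*) [Group Γ] [MulAction Γ V] (g : (V → ℝ≥0∞) → V → ℝ) : Prop where
  measurable : ∀ k, Measurable fun ω => g ω k
  bounded : ∃ C, ∀ ω k, |g ω k| ≤ C
  equivariant : ∀ (γ : Γ) ω k, g (shift γ ω) (γ • k) = g ω k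

/-- The weighted sum of an observable over `F`. -/
def siteFun (Γ : Type*) [Group Γ] [MulAction Γ V] (F : Finset V) (g : (V → ℝ≥0∞) → V → ℝ)
    (ω : V → ℝ≥0∞) : ℝ :=
  ∑ x ∈ F, g ω x / mult Γ F x

/-- The mean of an observable per vertex. -/
def vmean (Γ : Type*) [Group Γ] [MulAction Γ V] (P : Measure (V → ℝ≥0∞)) (F : Finset V)
    (g : (V → ℝ≥0∞) → V → ℝ) : ℝ :=
  (∫ ω, siteFun Γ F g ω ∂P) / covolume Γ F

variable {g : (V → ℝ≥0∞) → V → ℝ}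

theorem IsObservable.measurable_siteFun (hg : IsObservable Γ g) : Measurable (siteFun Γ F g) :=
  Finset.measurable_sum _ fun x _ => (hg.measurable x).div_const _

theorem IsObservable.bounded_siteFun (hg : IsObservable Γ g) :
    ∃ C, ∀ ω, |siteFun Γ F g ω| ≤ C := by
  obtain ⟨C, hC⟩ := hg.bounded
  refine ⟨∑ x ∈ F, C / mult Γ F x, fun ω => (Finset.abs_sum_le_sum_abs _ _).trans ?_⟩
  refine Finset.sum_le_sum fun x _ => ?_
  rw [abs_div, Nat.abs_cast]
  gcongr
  exact hC ω x

/-- Equivariance transfers the translation from the vertex to the configuration. This turns a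
spatial average for a fixed configuration into an ergodic average of a function of the
configuration. -/
theorem IsObservable.groupAvg_eq (hg : IsObservable Γ g) (ω : V → ℝ≥0∞) (L : ℕ) :
    groupAvg F I (g ω) L = ergAvg I (siteFun Γ F g) L ω := by
  rw [groupAvg, ergAvg]
  congr 1
  refine Finset.sum_congr rfl fun γ _ => Finset.sum_congr rfl fun x _ => ?_
  rw [← hg.equivariant γ ω (γ⁻¹ • x), smul_inv_smul]

/-- The average of an observable over the exhaustion. -/
def volAvg (F : Finset V) (I : ℕ → Finset Γ) (f : V → ℝ) (L : ℕ) : ℝ :=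
  (∑ k ∈ exhaustion F I L, f k) / (exhaustion F I L).card

theorem IsObservable.tendsto_volAvg (hg : IsObservable Γ g) (hF : IsFiniteQuotient Γ F)
    (hI : IsFolner I) (h : AvgConv P I (siteFun Γ F g)) :
    ∀ᵐ ω ∂P, Tendsto (volAvg F I (g ω)) atTop (𝓝 (vmean Γ P F g)) := by
  obtain ⟨C, hC⟩ := hg.bounded
  filter_upwards [h] with ω hω
  refine tendsto_vertex_avg hF hI (hC ω) ?_
  simp_rw [← hg.groupAvg_eq] at hω
  exact hω

theorem IsObservable.integrable [IsFiniteMeasure P] (hg : IsObservable Γ g) (x : V) :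
    Integrable (fun ω => g ω x) P := by
  obtain ⟨C, hC⟩ := hg.bounded
  exact integrable_of_bounded (hg.measurable x) (C := C) fun ω => hC ω x

theorem IsObservable.vmean_eq [IsFiniteMeasure P] (hg : IsObservable Γ g) :
    vmean Γ P F g = (∑ x ∈ F, (∫ ω, g ω x ∂P) / mult Γ F x) / covolume Γ F := by
  rw [vmean]
  congr 1
  simp only [siteFun]
  rw [integral_finsetSum _ fun x _ => (hg.integrable x).div_const _]
  exact Finset.sum_congr rfl fun x _ => integral_div _ _

/-- An equivariant measurable random set of active vertices. -/
structure IsRandomSet (Γ : Type*) [Group Γ] [MulAction Γ V] (Y : (V → ℝ≥0∞) → Set V) : Prop where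
  subset : ∀ ω, Y ω ⊆ active ω
  measurable : ∀ k, MeasurableSet {ω | k ∈ Y ω}
  equivariant : ∀ (γ : Γ) ω k, γ • k ∈ Y (shift γ ω) ↔ k ∈ Y ω

theorem shift_smul (γ : Γ) (ω : V → ℝ≥0∞) (k : V) : shift γ ω (γ • k) = ω k := by
  simp [shift]

/-- The real potential of a configuration. -/
def pot (ω : V → ℝ≥0∞) (k : V) : ℝ := (ω k).toReal

/-- The vertices of a random set with potential at most `K`. -/
def cutoff (Y : (V → ℝ≥0∞) → Set V) (K : ℕ) (ω : V → ℝ≥0∞) : Set V := {k | k ∈ Y ω ∧ ω k ≤ K}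

variable {Y : (V → ℝ≥0∞) → Set V} {K : ℕ}

theorem abs_pot_le (ω : V → ℝ≥0∞) : ∀ k ∈ cutoff Y K ω, |pot ω k| ≤ (K : ℝ) := by
  intro k hk
  rw [pot, abs_of_nonneg ENNReal.toReal_nonneg]
  have := ENNReal.toReal_mono (ENNReal.natCast_ne_top K) hk.2
  simpa using this

theorem IsRandomSet.cutoff (hY : IsRandomSet Γ Y) (K : ℕ) : IsRandomSet Γ (cutoff Y K) where
  subset ω := fun _ hk => hY.subset ω hk.1
  measurable k := (hY.measurable k).inter (measurableSet_le (measurable_pi_apply k) measurable_const)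
  equivariant γ ω k := by
    simp only [Percolation.cutoff, Set.mem_ofPred_eq, hY.equivariant, shift_smul]

theorem isRandomSet_active : IsRandomSet Γ (active (V := V)) where
  subset _ := le_rfl
  measurable k := measurableSet_lt (measurable_pi_apply k) measurable_const
  equivariant γ ω k := by simp only [active, Set.mem_ofPred_eq, shift_smul]

variable {H₀ : L2 V →L[ℂ] L2 V}

/-- A hopping operator that is invariant under `Γ`. -/
structure IsInvariantHopping (Γ : Type*) [Group Γ] [MulAction Γ V] (H₀ : L2 V →L[ℂ] L2 V) : Prop
    extends IsHopping H₀ where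
  invariant : ∀ (γ : Γ) k j, hop H₀ (γ • k) (γ • j) = hop H₀ k j

theorem IsInvariantHopping.smul_mem_row (hH : IsInvariantHopping Γ H₀) (γ : Γ) (k j : V) :
    γ • j ∈ row H₀ (γ • k) ↔ j ∈ row H₀ k := by
  rw [hH.mem_row, hH.mem_row, hH.invariant]

theorem IsInvariantHopping.sum_row (hH : IsInvariantHopping Γ H₀) (γ : Γ) (k : V) (f : V → ℝ) :
    ∑ j ∈ row H₀ (γ • k), f j = ∑ j ∈ row H₀ k, f (γ • j) := by
  symm
  refine Finset.sum_bij (fun j _ => γ • j) (fun j hj => (hH.smul_mem_row γ k j).2 hj)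
    (fun a _ b _ h => MulAction.injective γ h) (fun j hj => ⟨γ⁻¹ • j, ?_, by simp⟩) fun _ _ => rfl
  rw [← hH.smul_mem_row γ]
  simpa using hj

theorem locPow_smul (hH : IsInvariantHopping Γ H₀) (γ : Γ) {Z Z' : Set V} {v v' : V → ℝ}
    (hZ : ∀ k, γ • k ∈ Z' ↔ k ∈ Z) (hv : ∀ k, v' (γ • k) = v k) (k : V) (p : ℕ) (i : V) :
    locPow H₀ Z' v' (γ • k) p (γ • i) = locPow H₀ Z v k p i := by
  classical
  induction p generalizing i with
  | zero => simp [locPow, Pi.single_apply]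
  | succ p ih =>
    simp only [locPow, locStep]
    rw [hH.sum_row, hv, ih]
    simp only [hZ, hH.invariant, ih]

theorem measurable_locPow (hY : IsRandomSet Γ Y) (k : V) (p : ℕ) (i : V) :
    Measurable fun ω => locPow H₀ (Y ω) (pot ω) k p i := by
  classical
  induction p generalizing i with
  | zero => exact measurable_const
  | succ p ih =>
    simp only [locPow, locStep]
    refine Measurable.ite (hY.measurable i) ?_ measurable_const
    refine Measurable.add (Finset.measurable_sum _ fun j _ => ?_) ?_
    · exact Measurable.ite (hY.measurable j) ((ih j).const_mul _) measurable_const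
    · exact ((measurable_pi_apply i).ennreal_toReal).mul (ih i)

/-- The bound comes from the operator norm of the compression, which is controlled uniformly in the
set `Z`, rather than from the recursion. -/
theorem abs_locPow_le (hH : IsHopping H₀) {Z : Set V} {v : V → ℝ} {C : ℝ} (hC : 0 ≤ C)
    (hv : ∀ k ∈ Z, |v k| ≤ C) (k : V) (p : ℕ) (i : V) :
    |locPow H₀ Z v k p i| ≤ (‖H₀‖ + C) ^ p := by
  set T := cutOp H₀ Z v C hC hv
  have h1 := cutOp_pow_delta (hC := hC) (hv := hv) hH k p i
  have h2 : |locPow H₀ Z v k p i| = ‖(T ^ p) (delta k) i‖ := by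
    rw [h1, Complex.norm_real, Real.norm_eq_abs]
  rw [h2]
  calc ‖(T ^ p) (delta k) i‖ ≤ ‖(T ^ p) (delta k)‖ := lp.norm_apply_le_norm (by norm_num) _ _
    _ ≤ ‖T ^ p‖ * ‖(delta k : L2 V)‖ := (T ^ p).le_opNorm _
    _ ≤ ‖T‖ ^ p * 1 := by
      rw [norm_delta]
      have : ‖T ^ p‖ ≤ ‖T‖ ^ p := by
        rcases Nat.eq_zero_or_pos p with rfl | hp
        · rw [pow_zero, pow_zero]
          exact ContinuousLinearMap.norm_id_le
        · exact norm_pow_le' T hp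
      gcongr
    _ ≤ (‖H₀‖ + C) ^ p := by
      rw [mul_one]
      exact pow_le_pow_left₀ (norm_nonneg _) norm_cutOp_le p

open Classical in
/-- The diagonal elements of the powers of the Hamiltonian on the random set `Y`. -/
def obsPow (H₀ : L2 V →L[ℂ] L2 V) (Y : (V → ℝ≥0∞) → Set V) (p : ℕ) (ω : V → ℝ≥0∞) (k : V) : ℝ :=
  if k ∈ Y ω then locPow H₀ (Y ω) (pot ω) k p k else 0

open Classical in
/-- The diagonal elements of a polynomial of the Hamiltonian on the random set `Y`. -/
def obsPoly (H₀ : L2 V →L[ℂ] L2 V) (Y : (V → ℝ≥0∞) → Set V) (q : Polynomial ℝ) (ω : V → ℝ≥0∞)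
    (k : V) : ℝ :=
  if k ∈ Y ω then locPoly H₀ (Y ω) (pot ω) q k else 0

theorem obsPoly_eq_sum (q : Polynomial ℝ) (ω : V → ℝ≥0∞) (k : V) :
    obsPoly H₀ Y q ω k =
      ∑ p ∈ Finset.range (q.natDegree + 1), q.coeff p * obsPow H₀ Y p ω k := by
  rw [obsPoly]
  split_ifs with h
  · rw [locPoly]
    exact Finset.sum_congr rfl fun p _ => by rw [obsPow, if_pos h]
  · symm
    exact Finset.sum_eq_zero fun p _ => by rw [obsPow, if_neg h, mul_zero]

theorem isObservable_obsPow (hH : IsInvariantHopping Γ H₀) (hY : IsRandomSet Γ Y) (K p : ℕ) :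
    IsObservable Γ (obsPow H₀ (cutoff Y K) p) where
  measurable k := by
    classical
    exact Measurable.ite ((hY.cutoff K).measurable k) (measurable_locPow (hY.cutoff K) k p k)
      measurable_const
  bounded := by
    refine ⟨(‖H₀‖ + K) ^ p, fun ω k => ?_⟩
    rw [obsPow]
    split_ifs
    · exact abs_locPow_le hH.toIsHopping (Nat.cast_nonneg K) (abs_pot_le ω) k p k
    · rw [abs_zero]; positivity
  equivariant γ ω k := by
    classical
    refine if_congr ((hY.cutoff K).equivariant γ ω k) ?_ rfl
    exact locPow_smul hH γ (fun k => (hY.cutoff K).equivariant γ ω k)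
      (fun k => congrArg ENNReal.toReal (shift_smul γ ω k)) k p k

theorem isObservable_obsPoly (hH : IsInvariantHopping Γ H₀) (hY : IsRandomSet Γ Y) (K : ℕ)
    (q : Polynomial ℝ) : IsObservable Γ (obsPoly H₀ (cutoff Y K) q) where
  measurable k := by
    simp_rw [obsPoly_eq_sum]
    exact Finset.measurable_sum _ fun p _ => ((isObservable_obsPow hH hY K p).measurable k).const_mul _
  bounded := by
    refine ⟨∑ p ∈ Finset.range (q.natDegree + 1), |q.coeff p| * (‖H₀‖ + K) ^ p, fun ω k => ?_⟩
    rw [obsPoly_eq_sum]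
    refine (Finset.abs_sum_le_sum_abs _ _).trans (Finset.sum_le_sum fun p _ => ?_)
    rw [abs_mul]
    gcongr
    rw [obsPow]
    split_ifs
    · exact abs_locPow_le hH.toIsHopping (Nat.cast_nonneg K) (abs_pot_le ω) k p k
    · rw [abs_zero]; positivity
  equivariant γ ω k := by
    simp only [obsPoly_eq_sum, (isObservable_obsPow hH hY K _).equivariant]

theorem vmean_obsPoly [IsFiniteMeasure P] (hH : IsInvariantHopping Γ H₀) (hY : IsRandomSet Γ Y)
    (q : Polynomial ℝ) :
    vmean Γ P F (obsPoly H₀ (cutoff Y K) q) =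
      ∑ p ∈ Finset.range (q.natDegree + 1),
        q.coeff p * vmean Γ P F (obsPow H₀ (cutoff Y K) p) := by
  rw [(isObservable_obsPoly hH hY K q).vmean_eq]
  simp_rw [(isObservable_obsPow hH hY K _).vmean_eq, obsPoly_eq_sum]
  have h1 : ∀ x, ∫ ω, ∑ p ∈ Finset.range (q.natDegree + 1),
      q.coeff p * obsPow H₀ (cutoff Y K) p ω x ∂P =
      ∑ p ∈ Finset.range (q.natDegree + 1),
        q.coeff p * ∫ ω, obsPow H₀ (cutoff Y K) p ω x ∂P := by
    intro x
    rw [integral_finsetSum _ fun p _ => ((isObservable_obsPow hH hY K p).integrable x).const_mul _]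
    exact Finset.sum_congr rfl fun p _ => integral_const_mul _ _
  simp_rw [h1, Finset.sum_div, Finset.mul_sum]
  rw [Finset.sum_comm]
  simp only [mul_div_assoc]

open Classical in
/-- The indicator of the vertices removed by the cutoff. -/
def obsHigh (Y : (V → ℝ≥0∞) → Set V) (K : ℕ) (ω : V → ℝ≥0∞) (k : V) : ℝ :=
  if k ∈ Y ω ∧ k ∉ cutoff Y K ω then 1 else 0

theorem isObservable_obsHigh (hY : IsRandomSet Γ Y) (K : ℕ) : IsObservable Γ (obsHigh Y K) where
  measurable k := by
    classical
    exact Measurable.ite ((hY.measurable k).inter ((hY.cutoff K).measurable k).compl)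
      measurable_const measurable_const
  bounded := ⟨1, fun ω k => by rw [obsHigh]; split_ifs <;> simp⟩
  equivariant γ ω k := by
    classical
    exact if_congr (and_congr (hY.equivariant γ ω k)
      (not_congr ((hY.cutoff K).equivariant γ ω k))) rfl rfl

/-- The density of the vertices removed by the cutoff tends to zero. -/
theorem tendsto_vmean_obsHigh [IsFiniteMeasure P] (hY : IsRandomSet Γ Y) :
    Tendsto (fun K => vmean Γ P F (obsHigh Y K)) atTop (𝓝 0) := by
  simp_rw [(isObservable_obsHigh hY _).vmean_eq]
  have h1 : ∀ x, Tendsto (fun K => ∫ ω, obsHigh Y K ω x ∂P) atTop (𝓝 0) := by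
    intro x
    have h2 := tendsto_integral_of_dominated_convergence (μ := P)
      (F := fun K ω => obsHigh Y K ω x) (f := fun _ => 0) (fun _ => 1)
      (fun K => ((isObservable_obsHigh hY K).measurable x).aestronglyMeasurable)
      (integrable_const _)
      (fun K => Eventually.of_forall fun ω => by simp only [obsHigh]; split_ifs <;> simp)
      (Eventually.of_forall fun ω => ?_)
    · simpa using h2
    · refine tendsto_const_nhds.congr' ?_
      by_cases hx : x ∈ Y ω
      · obtain ⟨n, hn⟩ := ENNReal.exists_nat_gt (hY.subset ω hx).ne
        filter_upwards [eventually_ge_atTop n] with K hK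
        rw [obsHigh, if_neg]
        rintro ⟨-, h⟩
        exact h ⟨hx, hn.le.trans (by exact_mod_cast hK)⟩
      · exact Eventually.of_forall fun K => (if_neg fun h => hx h.1).symm
  have h3 := (tendsto_finsetSum F fun x _ => (h1 x).div_const (mult Γ F x : ℝ)).div_const
    (covolume Γ F)
  simpa using h3

/-- The diagonal elements of the eigenprojection, at energy `E`, of the Hamiltonian on the cutoff
set. -/
def obsEig (H₀ : L2 V →L[ℂ] L2 V) (Y : (V → ℝ≥0∞) → Set V) (E : ℝ) (K : ℕ) (ω : V → ℝ≥0∞)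
    (k : V) : ℝ :=
  open Classical in
  if k ∈ cutoff Y K ω then
    ‖(eigSpace (cutOp H₀ (cutoff Y K ω) (pot ω) K (Nat.cast_nonneg K) (abs_pot_le ω))
      E).starProjection (delta k)‖ ^ 2
  else 0

/-- A bound for the distance between `E` and the spectrum of the cut off Hamiltonians. -/
def specRadius (H₀ : L2 V →L[ℂ] L2 V) (K : ℕ) (E : ℝ) : ℝ := ‖H₀‖ + K + |E| + 1

theorem specRadius_pos (H₀ : L2 V →L[ℂ] L2 V) (K : ℕ) (E : ℝ) : 0 < specRadius H₀ K E := by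
  rw [specRadius]; positivity

theorem norm_cutOp_sub_le {Z : Set V} {v : V → ℝ} (hv : ∀ k ∈ Z, |v k| ≤ (K : ℝ)) (E : ℝ) :
    ‖cutOp H₀ Z v K (Nat.cast_nonneg K) hv - algebraMap ℝ (L2 V →L[ℂ] L2 V) E‖ ≤
      specRadius H₀ K E := by
  refine (norm_sub_le _ _).trans ?_
  have h1 : ‖algebraMap ℝ (L2 V →L[ℂ] L2 V) E‖ ≤ |E| := by
    rw [Algebra.algebraMap_eq_smul_one, norm_smul, Real.norm_eq_abs]
    exact mul_le_of_le_one_right (abs_nonneg E) ContinuousLinearMap.norm_id_le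
  have h2 : ‖cutOp H₀ Z v K (Nat.cast_nonneg K) hv‖ ≤ ‖H₀‖ + K := norm_cutOp_le
  rw [specRadius]
  linarith

theorem inner_starProjection_delta {U : Submodule ℂ (L2 V)} [CompleteSpace U] (k : V) :
    U.starProjection (delta k) k = ((‖U.starProjection (delta k)‖ ^ 2 : ℝ) : ℂ) := by
  have h3 := Submodule.inner_starProjection_left_eq_right U (delta k)
    (U.starProjection (delta k))
  rw [Submodule.starProjection_eq_self_iff.2 (U.starProjection_apply_mem _),
    inner_delta_left, inner_self_eq_norm_sq_to_K] at h3
  rw [← h3]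
  push_cast
  rfl

/-- The diagonal element of the eigenprojection does not depend on finitely many sites, but it is a
pointwise limit of local observables. This is the source of its measurability, its equivariance and,
with dominated convergence, its mean. -/
theorem tendsto_obsPoly_avgPoly (hH : IsHopping H₀) (E : ℝ) (ω : V → ℝ≥0∞) (k : V) :
    Tendsto (fun n => obsPoly H₀ (cutoff Y K) (avgPoly E (specRadius H₀ K E) n) ω k) atTop
      (𝓝 (obsEig H₀ Y E K ω k)) := by
  simp only [obsPoly, obsEig]
  split_ifs with hk
  · set T := cutOp H₀ (cutoff Y K ω) (pot ω) K (Nat.cast_nonneg K) (abs_pot_le ω) with hT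
    have h1 := tendsto_aeval_avgPoly (isSelfAdjoint_cutOp hH : IsSelfAdjoint T)
      (specRadius_pos H₀ K E) (norm_cutOp_sub_le (abs_pot_le ω) E) (delta k)
    have h2 : Tendsto (fun n => inner ℂ (delta k)
        ((Polynomial.aeval T (avgPoly E (specRadius H₀ K E) n)) (delta k))) atTop
        (𝓝 (inner ℂ (delta k) ((eigSpace T E).starProjection (delta k)))) :=
      Tendsto.inner tendsto_const_nhds h1
    simp_rw [inner_delta_left, inner_starProjection_delta, hT, aeval_cutOp_delta hH] at h2
    have h3 := (Complex.continuous_re.tendsto _).comp h2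
    simp only [Function.comp_def, Complex.ofReal_re] at h3
    exact h3
  · exact tendsto_const_nhds

theorem abs_obsPoly_avgPoly_le (hH : IsHopping H₀) (E : ℝ) (n : ℕ) (ω : V → ℝ≥0∞) (k : V) :
    |obsPoly H₀ (cutoff Y K) (avgPoly E (specRadius H₀ K E) n) ω k| ≤ 1 := by
  rw [obsPoly]
  split_ifs with hk
  · set T := cutOp H₀ (cutoff Y K ω) (pot ω) K (Nat.cast_nonneg K) (abs_pot_le ω) with hT
    have h1 := norm_aeval_avgPoly_apply_le (isSelfAdjoint_cutOp hH : IsSelfAdjoint T)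
      (specRadius_pos H₀ K E) (norm_cutOp_sub_le (abs_pot_le ω) E) n (delta k)
    rw [norm_delta] at h1
    have h2 := aeval_cutOp_delta (Z := cutoff Y K ω) (hC := Nat.cast_nonneg K)
      (hv := abs_pot_le ω) hH
      (avgPoly E (specRadius H₀ K E) n) k
    rw [← Real.norm_eq_abs, ← Complex.norm_real, ← h2]
    exact (lp.norm_apply_le_norm (by norm_num) _ _).trans h1
  · simp

theorem isObservable_obsEig (hH : IsInvariantHopping Γ H₀) (hY : IsRandomSet Γ Y) (E : ℝ)
    (K : ℕ) : IsObservable Γ (obsEig H₀ Y E K) where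
  measurable k := measurable_of_tendsto_metrizable
    (fun n => (isObservable_obsPoly hH hY K (avgPoly E (specRadius H₀ K E) n)).measurable k)
    (tendsto_pi_nhds.2 fun ω => tendsto_obsPoly_avgPoly hH.toIsHopping E ω k)
  bounded := ⟨1, fun ω k => le_of_tendsto (tendsto_obsPoly_avgPoly hH.toIsHopping E ω k).abs
    (Eventually.of_forall fun n => abs_obsPoly_avgPoly_le hH.toIsHopping E n ω k)⟩
  equivariant γ ω k := by
    refine tendsto_nhds_unique
      (tendsto_obsPoly_avgPoly (Y := Y) (K := K) hH.toIsHopping E (shift γ ω) (γ • k)) ?_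
    simp_rw [(isObservable_obsPoly hH hY K _).equivariant]
    exact tendsto_obsPoly_avgPoly hH.toIsHopping E ω k

theorem tendsto_vmean_avgPoly [IsFiniteMeasure P] (hH : IsInvariantHopping Γ H₀)
    (hY : IsRandomSet Γ Y) (E : ℝ) :
    Tendsto (fun n => vmean Γ P F (obsPoly H₀ (cutoff Y K) (avgPoly E (specRadius H₀ K E) n)))
      atTop (𝓝 (vmean Γ P F (obsEig H₀ Y E K))) := by
  simp_rw [(isObservable_obsPoly hH hY K _).vmean_eq, (isObservable_obsEig hH hY E K).vmean_eq]
  refine Tendsto.div_const (tendsto_finsetSum F fun x _ => Tendsto.div_const ?_ _) _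
  exact tendsto_integral_of_dominated_convergence (fun _ => 1)
    (fun n => ((isObservable_obsPoly hH hY K _).measurable x).aestronglyMeasurable)
    (integrable_const _)
    (fun n => Eventually.of_forall fun ω => abs_obsPoly_avgPoly_le hH.toIsHopping E n ω x)
    (Eventually.of_forall fun ω => tendsto_obsPoly_avgPoly hH.toIsHopping E ω x)

end Observables

/-! ### Finite-volume matrices, traces and the effect of the cutoff -/

section FiniteVolume

variable {V : Type*} {H₀ : L2 V →L[ℂ] L2 V} {q : V → ℝ≥0∞}

open Classical in
/-- The multiset of eigenvalues of the Hamiltonian restricted to a finite set. -/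
def spec (H₀ : L2 V →L[ℂ] L2 V) (q : V → ℝ≥0∞) (A : Finset V) : Multiset ℝ :=
  (hamMatrix H₀ q A).charpoly.roots

open Classical in
theorem countingFunction_eq (Y : Set V) (Λ : Finset V) (E : ℝ) :
    countingFunction H₀ q Y Λ E =
      ((spec H₀ q (Λ.filter (· ∈ Y))).countP (· < E) : ℝ) / (Λ.card : ℝ) := rfl

open Classical in
theorem hamMatrix_apply (A : Finset V) (i j : A) :
    hamMatrix H₀ q A i j = (if i = j then pot q i else 0) + hop H₀ i j := by
  rw [hamMatrix, Matrix.add_apply, Matrix.diagonal_apply, Matrix.of_apply]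
  rfl

theorem isHermitian_hamMatrix (hH : IsHopping H₀) (A : Finset V) :
    (hamMatrix H₀ q A).IsHermitian := by
  classical
  ext i j
  rw [Matrix.conjTranspose_apply, hamMatrix_apply, hamMatrix_apply, hH.hop_symm j i]
  by_cases h : i = j
  · subst h; simp
  · simp [h, Ne.symm h]

theorem hamMatrix_submatrix {A' A : Finset V} (h : A' ⊆ A) :
    hamMatrix H₀ q A' = (hamMatrix H₀ q A).submatrix
      (Subtype.impEmbedding (· ∈ A') (· ∈ A) h) (Subtype.impEmbedding (· ∈ A') (· ∈ A) h) := by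
  classical
  ext i j
  rw [Matrix.submatrix_apply, hamMatrix_apply, hamMatrix_apply]
  by_cases hij : i = j
  · subst hij
    rw [if_pos rfl, if_pos rfl]
    rfl
  · rw [if_neg hij, if_neg fun h' => hij ((Subtype.impEmbedding _ _ h).injective h')]
    rfl

theorem countP_spec_mono (hH : IsHopping H₀) {A' A : Finset V} (h : A' ⊆ A) (E : ℝ) :
    (spec H₀ q A').countP (· < E) ≤ (spec H₀ q A).countP (· < E) := by
  classical
  rw [spec, spec, countP_roots_charpoly (isHermitian_hamMatrix hH A'),
    countP_roots_charpoly (isHermitian_hamMatrix hH A)]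
  exact card_eigenvalues_lt_submatrix_le _ _ (hamMatrix_submatrix h) E

theorem countP_spec_le_add (hH : IsHopping H₀) {A' A : Finset V} (h : A' ⊆ A) (E : ℝ) :
    (spec H₀ q A).countP (· < E) + A'.card ≤ (spec H₀ q A').countP (· < E) + A.card := by
  classical
  rw [spec, spec, countP_roots_charpoly (isHermitian_hamMatrix hH A'),
    countP_roots_charpoly (isHermitian_hamMatrix hH A)]
  have := card_eigenvalues_lt_le_submatrix_add (isHermitian_hamMatrix (q := q) hH A)
    (isHermitian_hamMatrix hH A') (hamMatrix_submatrix h) E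
  simpa using this

theorem card_spec (hH : IsHopping H₀) (A : Finset V) : (spec H₀ q A).card = A.card := by
  classical
  rw [spec, (isHermitian_hamMatrix hH A).roots_charpoly_eq_eigenvalues, Multiset.card_map]
  exact Multiset.card_attach

theorem sum_ite_mem_eq {M : Type*} [AddCommMonoid M] (R A : Finset V) {p : V → Prop}
    {_ : DecidablePred p} (hp : ∀ j, p j ↔ j ∈ A) (c : V → M) (hc : ∀ j ∉ R, c j = 0) :
    ∑ j ∈ R, (if p j then c j else 0) = ∑ j ∈ A, c j := by
  classical
  rw [← Finset.sum_filter]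
  refine Finset.sum_subset (fun j hj => (hp j).1 (Finset.mem_filter.1 hj).2) fun j hj hj' => ?_
  refine hc j fun hR => hj' (Finset.mem_filter.2 ⟨hR, (hp j).2 hj⟩)

theorem IsHopping.hop_eq_zero (hH : IsHopping H₀) {i j : V} (h : j ∉ row H₀ i) : hop H₀ i j = 0 := by
  rwa [hH.mem_row, not_not] at h

/-- Matrix powers satisfy the recursion of `locPow` with `Z = A`, so finite and infinite volume are
described by the same quantity. -/
theorem hamMatrix_pow_apply (hH : IsHopping H₀) (A : Finset V) (p : ℕ) (i k : A) :
    open Classical in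
    (hamMatrix H₀ q A ^ p) i k = locPow H₀ A (pot q) k p i := by
  classical
  induction p generalizing i with
  | zero =>
    rw [pow_zero, Matrix.one_apply, locPow, Pi.single_apply]
    exact if_congr Subtype.ext_iff rfl rfl
  | succ p ih =>
    rw [pow_succ', Matrix.mul_apply, locPow, locStep, if_pos (Finset.mem_coe.2 i.2)]
    simp_rw [ih, hamMatrix_apply, add_mul, ite_mul, zero_mul]
    rw [Finset.sum_add_distrib, Finset.sum_ite_eq, if_pos (Finset.mem_univ i), add_comm]
    congr 1
    rw [Finset.sum_coe_sort A (fun j => hop H₀ i j * locPow H₀ A (pot q) k p j)]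
    exact (sum_ite_mem_eq (row H₀ (i : V)) A (fun _ => Finset.mem_coe)
      (fun j => hop H₀ i j * locPow H₀ A (pot q) k p j)
      fun j hj => by rw [hH.hop_eq_zero hj, zero_mul]).symm

theorem sum_map_spec (hH : IsHopping H₀) (A : Finset V) (f : Polynomial ℝ) :
    ((spec H₀ q A).map fun x => f.eval x).sum = ∑ k ∈ A, locPoly H₀ A (pot q) f k := by
  classical
  have h1 := trace_aeval_eq_sum_eigenvalues (isHermitian_hamMatrix (q := q) hH A) f
  rw [spec, (isHermitian_hamMatrix hH A).roots_charpoly_eq_eigenvalues, Multiset.map_map]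
  have h2 : (Multiset.map ((fun x => f.eval x) ∘ RCLike.ofReal ∘
      (isHermitian_hamMatrix (q := q) hH A).eigenvalues) Finset.univ.val).sum =
      ∑ i, f.eval ((isHermitian_hamMatrix (q := q) hH A).eigenvalues i) := rfl
  rw [h2, ← h1, Matrix.trace, ← Finset.sum_coe_sort A]
  refine Finset.sum_congr rfl fun k _ => ?_
  rw [Matrix.diag_apply, Polynomial.aeval_eq_sum_range, Matrix.sum_apply, locPoly]
  refine Finset.sum_congr rfl fun p _ => ?_
  rw [Matrix.smul_apply, hamMatrix_pow_apply hH, smul_eq_mul]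

/-- An eigenvector of the matrix, extended by zero, is an eigenvector of the compression to `A`,
whose norm is at most `‖H₀‖ + C`. -/
theorem abs_le_of_mem_spec (hH : IsHopping H₀) (A : Finset V) {C : ℝ} (hC : 0 ≤ C)
    (hq : ∀ k ∈ A, |pot q k| ≤ C) {x : ℝ} (hx : x ∈ spec H₀ q A) : |x| ≤ ‖H₀‖ + C := by
  classical
  have hM := isHermitian_hamMatrix (q := q) hH A
  rw [spec, hM.roots_charpoly_eq_eigenvalues, Multiset.mem_map] at hx
  obtain ⟨i, -, rfl⟩ := hx
  simp only [Function.comp_apply, RCLike.ofReal_real_eq_id, id]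
  have hb := hM.mulVec_eigenvectorBasis i
  have hne : (hM.eigenvectorBasis i) ≠ 0 := hM.eigenvectorBasis.orthonormal.ne_zero i
  set x : A → ℝ := ⇑(hM.eigenvectorBasis i) with hxdef
  set t := hM.eigenvalues i
  have hv : ∀ k ∈ (A : Set V), |pot q k| ≤ C := fun k hk => hq k hk
  set T := cutOp H₀ A (pot q) C hC hv with hT
  set f : L2 V := ∑ k : A, (x k : ℂ) • delta (k : V) with hf
  have hfa : ∀ i : V, f i = if h : i ∈ A then (x ⟨i, h⟩ : ℂ) else 0 := by
    intro i
    rw [hf, lp.coeFn_sum, Finset.sum_apply]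
    simp only [lp.coeFn_smul, Pi.smul_apply, delta_apply, smul_eq_mul, mul_ite, mul_one, mul_zero]
    split_ifs with h
    · rw [Finset.sum_eq_single ⟨i, h⟩]
      · simp
      · intro j _ hj
        rw [if_neg]
        intro h'
        exact hj (Subtype.ext h'.symm)
      · simp
    · refine Finset.sum_eq_zero fun j _ => if_neg ?_
      rintro rfl
      exact h j.2
  have hTf : T f = (t : ℂ) • f := by
    ext i
    rw [hT, cutOp_apply hH, lp.coeFn_smul, Pi.smul_apply, smul_eq_mul, hfa]
    simp only [Finset.mem_coe]
    split_ifs with h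
    · have h1 := congrFun hb ⟨i, h⟩
      rw [Matrix.mulVec, dotProduct, Pi.smul_apply, smul_eq_mul] at h1
      have h2 : (t : ℂ) * (x ⟨i, h⟩ : ℂ) = ((t * x ⟨i, h⟩ : ℝ) : ℂ) := by push_cast; rfl
      rw [h2, ← h1]
      simp_rw [hamMatrix_apply, add_mul, ite_mul, zero_mul]
      rw [Finset.sum_add_distrib, Finset.sum_ite_eq, if_pos (Finset.mem_univ _), add_comm,
        Complex.ofReal_add, Complex.ofReal_mul]
      congr 1
      have h3 : ∀ j : A, ((hop H₀ i j * x j : ℝ) : ℂ) = (hop H₀ i j : ℂ) * f j := by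
        intro j
        rw [hfa, dif_pos j.2, Complex.ofReal_mul]
      rw [Complex.ofReal_sum]
      simp_rw [h3]
      rw [Finset.sum_coe_sort A (fun j => (hop H₀ i j : ℂ) * f j)]
      exact sum_ite_mem_eq _ A (fun _ => Iff.rfl) _
        fun j hj => by rw [hH.hop_eq_zero hj, Complex.ofReal_zero, zero_mul]
    · rw [mul_zero]
  have hf0 : f ≠ 0 := by
    intro h0
    apply hne
    ext j
    have h1 := hfa j
    rw [h0, dif_pos j.2] at h1
    have h2 : ((0 : L2 V) : V → ℂ) j = 0 := rfl
    rw [h2] at h1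
    exact (Complex.ofReal_eq_zero.1 h1.symm)
  have h4 : |t| * ‖f‖ ≤ (‖H₀‖ + C) * ‖f‖ := by
    calc |t| * ‖f‖ = ‖T f‖ := by rw [hTf, norm_smul, Complex.norm_real, Real.norm_eq_abs]
      _ ≤ ‖T‖ * ‖f‖ := T.le_opNorm f
      _ ≤ (‖H₀‖ + C) * ‖f‖ := by
        gcongr
        exact norm_cutOp_le
  exact le_of_mul_le_mul_right h4 (norm_pos_iff.2 hf0)

open Classical in
/-- The vertices that can be reached from `k` by at most `p` steps. -/
def nbh (H₀ : L2 V →L[ℂ] L2 V) (k : V) : ℕ → Finset V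
  | 0 => {k}
  | p + 1 => nbh H₀ k p ∪ (nbh H₀ k p).biUnion (row H₀)

theorem nbh_subset_succ (k : V) (p : ℕ) : nbh H₀ k p ⊆ nbh H₀ k (p + 1) := by
  classical
  exact Finset.subset_union_left

theorem nbh_mono (k : V) : Monotone (nbh H₀ k) :=
  monotone_nat_of_le_succ (nbh_subset_succ k)

theorem mem_nbh_self (k : V) (p : ℕ) : k ∈ nbh H₀ k p :=
  nbh_mono k (Nat.zero_le p) (Finset.mem_singleton_self k)

theorem mem_nbh_succ_of_mem_row {k i j : V} {p : ℕ} (hi : i ∈ nbh H₀ k p) (hj : j ∈ row H₀ i) :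
    j ∈ nbh H₀ k (p + 1) := by
  classical
  exact Finset.mem_union_right _ (Finset.mem_biUnion.2 ⟨i, hi, hj⟩)

theorem locPow_eq_zero_of_notMem_nbh (hH : IsHopping H₀) {Z : Set V} {v : V → ℝ} {k : V} (p : ℕ)
    {i : V} (hi : i ∉ nbh H₀ k p) : locPow H₀ Z v k p i = 0 := by
  classical
  induction p generalizing i with
  | zero =>
    rw [locPow, Pi.single_apply, if_neg]
    rintro rfl
    exact hi (mem_nbh_self _ _)
  | succ p ih =>
    rw [locPow, locStep]
    split_ifs
    · rw [ih fun h => hi (nbh_subset_succ k p h), mul_zero, add_zero]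
      refine Finset.sum_eq_zero fun j hj => ?_
      rw [ih fun h => hi (mem_nbh_succ_of_mem_row h (hH.mem_row_comm.1 hj)), mul_zero, ite_self]
    · rfl

open Classical in
-- Finite propagation: `p` steps from `k` do not leave `nbh H₀ k p`, so they do not notice the
-- vertices outside `Λ`.
theorem locPow_filter_eq (hH : IsHopping H₀) {Z : Set V} {v : V → ℝ} {Λ : Finset V} {k : V}
    (p : ℕ) (hk : nbh H₀ k p ⊆ Λ) (i : V) :
    locPow H₀ (Λ.filter (· ∈ Z) : Finset V) v k p i = locPow H₀ Z v k p i := by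
  induction p generalizing i with
  | zero => rfl
  | succ p ih =>
    have hk' := (nbh_subset_succ k p).trans hk
    by_cases hi : i ∈ Λ
    · simp only [locPow, locStep, Finset.coe_filter, Set.mem_ofPred_eq, hi, true_and]
      simp only [Finset.coe_filter] at ih
      rw [ih hk']
      simp only [ih hk']
      split_ifs
      · congr 1
        refine Finset.sum_congr rfl fun j _ => ?_
        by_cases hj : j ∈ Λ
        · simp [hj]
        · rw [locPow_eq_zero_of_notMem_nbh hH p fun h => hj (hk' h)]
          simp
      · rfl
    · rw [locPow_eq_zero_of_notMem_nbh hH (p + 1) fun h => hi (hk h),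
        locPow_eq_zero_of_notMem_nbh hH (p + 1) fun h => hi (hk h)]

variable {Γ : Type*} [Group Γ] [MulAction Γ V] {P : Measure (V → ℝ≥0∞)} {I : ℕ → Finset Γ}
  {F : Finset V} {Y : (V → ℝ≥0∞) → Set V} {K : ℕ}

theorem smul_mem_nbh (hH : IsInvariantHopping Γ H₀) (p : ℕ) (γ : Γ) (k j : V)
    (hj : j ∈ nbh H₀ k p) : γ • j ∈ nbh H₀ (γ • k) p := by
  classical
  induction p generalizing j with
  | zero => simpa [nbh] using hj
  | succ p ih =>
    rcases Finset.mem_union.1 hj with h | h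
    · exact nbh_subset_succ _ _ (ih j h)
    · obtain ⟨i, hi, hji⟩ := Finset.mem_biUnion.1 h
      exact mem_nbh_succ_of_mem_row (ih i hi) ((hH.smul_mem_row γ i j).2 hji)

open Classical in
theorem abs_sum_locPow_sub_le (hH : IsHopping H₀) (ω : V → ℝ≥0∞) (Λ : Finset V) (p : ℕ) :
    |∑ k ∈ Λ.filter (· ∈ cutoff Y K ω),
        locPow H₀ (Λ.filter (· ∈ cutoff Y K ω) : Finset V) (pot ω) k p k -
      ∑ k ∈ Λ, obsPow H₀ (cutoff Y K) p ω k| ≤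
      2 * (‖H₀‖ + K) ^ p * (Λ.filter fun k => ¬ nbh H₀ k p ⊆ Λ).card := by
  have h1 : ∀ k ∈ Λ, |(if k ∈ cutoff Y K ω then
      locPow H₀ (Λ.filter (· ∈ cutoff Y K ω) : Finset V) (pot ω) k p k else 0) -
      obsPow H₀ (cutoff Y K) p ω k| ≤
      if ¬ nbh H₀ k p ⊆ Λ then 2 * (‖H₀‖ + K) ^ p else 0 := by
    intro k _
    rw [obsPow]
    by_cases hk : k ∈ cutoff Y K ω
    · rw [if_pos hk, if_pos hk]
      by_cases hn : nbh H₀ k p ⊆ Λ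
      · rw [locPow_filter_eq hH p hn, sub_self, abs_zero, if_neg (not_not.2 hn)]
      · rw [if_pos hn]
        have b1 := abs_locPow_le (v := pot ω) hH (Nat.cast_nonneg K) (abs_pot_le (Y := Y) ω) k p k
        have b2 := abs_locPow_le (Z := (Λ.filter (· ∈ cutoff Y K ω) : Finset V)) (v := pot ω) hH
          (Nat.cast_nonneg K) (fun j hj => abs_pot_le (Y := Y) ω j (Finset.mem_filter.1 hj).2) k p k
        exact (abs_sub _ _).trans (by linarith)
    · rw [if_neg hk, if_neg hk, sub_self, abs_zero]
      split_ifs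
      · exact le_rfl
      · positivity
  rw [Finset.sum_filter, ← Finset.sum_sub_distrib]
  refine (Finset.abs_sum_le_sum_abs _ _).trans ((Finset.sum_le_sum h1).trans_eq ?_)
  rw [← Finset.sum_filter, Finset.sum_const, nsmul_eq_mul, mul_comm]

open Classical in
/-- The part of the exhaustion that lies in the cut off random set. -/
def cutVol (F : Finset V) (I : ℕ → Finset Γ) (Y : (V → ℝ≥0∞) → Set V) (K : ℕ) (ω : V → ℝ≥0∞)
    (L : ℕ) : Finset V :=
  (exhaustion F I L).filter (· ∈ cutoff Y K ω)

/-- One exceptional null set serves all polynomials, because they are linear combinations of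
countably many powers. Boundary vertices, whose `p`-neighbourhood leaves the volume, have density
zero. -/
theorem tendsto_trace (hF : IsFiniteQuotient Γ F) (hI : IsFolner I)
    (hH : IsInvariantHopping Γ H₀) (hY : IsRandomSet Γ Y) [IsFiniteMeasure P]
    (hA : ∀ p, AvgConv P I (siteFun Γ F (obsPow H₀ (cutoff Y K) p))) :
    ∀ᵐ ω ∂P, ∀ f : Polynomial ℝ,
      Tendsto (fun L => ((spec H₀ ω (cutVol F I Y K ω L)).map fun x => f.eval x).sum /
        (exhaustion F I L).card) atTop (𝓝 (vmean Γ P F (obsPoly H₀ (cutoff Y K) f))) := by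
  classical
  have h1 := ae_all_iff.2 fun p => (isObservable_obsPow hH hY K p).tendsto_volAvg hF hI (hA p)
  filter_upwards [h1] with ω hω f
  have h2 : ∀ p, Tendsto (fun L => (∑ k ∈ cutVol F I Y K ω L,
      locPow H₀ (cutVol F I Y K ω L : Finset V) (pot ω) k p k) / (exhaustion F I L).card) atTop
      (𝓝 (vmean Γ P F (obsPow H₀ (cutoff Y K) p))) := by
    intro p
    have h3 : Tendsto (fun L => (∑ k ∈ cutVol F I Y K ω L,
        locPow H₀ (cutVol F I Y K ω L : Finset V) (pot ω) k p k) / (exhaustion F I L).card -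
        volAvg F I (obsPow H₀ (cutoff Y K) p ω) L) atTop (𝓝 0) := by
      have h4 := (tendsto_card_not_subset hF hI (N := fun k => nbh H₀ k p)
        (fun γ k j hj => smul_mem_nbh hH p γ k j hj)).const_mul (2 * (‖H₀‖ + K) ^ p)
      rw [mul_zero] at h4
      refine squeeze_zero_norm (fun L => ?_) h4
      have h5 := card_exhaustion_pos hF hI L
      rw [volAvg, ← sub_div, Real.norm_eq_abs, abs_div, abs_of_pos h5, ← mul_div_assoc]
      gcongr
      exact abs_sum_locPow_sub_le hH.toIsHopping ω (exhaustion F I L) p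
    simpa using h3.add (hω p)
  rw [vmean_obsPoly hH hY]
  have h6 := tendsto_finsetSum (Finset.range (f.natDegree + 1))
    fun p _ => (h2 p).const_mul (f.coeff p)
  refine h6.congr fun L => ?_
  rw [sum_map_spec hH.toIsHopping]
  simp only [locPoly]
  rw [Finset.sum_comm, Finset.sum_div]
  refine Finset.sum_congr rfl fun p _ => ?_
  rw [← mul_div_assoc, Finset.mul_sum]

theorem cutVol_subset (ω : V → ℝ≥0∞) (L : ℕ) :
    open Classical in cutVol F I Y K ω L ⊆ (exhaustion F I L).filter (· ∈ Y ω) := by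
  classical
  intro k hk
  rw [cutVol, Finset.mem_filter] at hk
  exact Finset.mem_filter.2 ⟨hk.1, hk.2.1⟩

/-- The normalised eigenvalue counting function of the cut off Hamiltonian. -/
def cutCount (H₀ : L2 V →L[ℂ] L2 V) (F : Finset V) (I : ℕ → Finset Γ) (Y : (V → ℝ≥0∞) → Set V)
    (K : ℕ) (ω : V → ℝ≥0∞) (L : ℕ) (E : ℝ) : ℝ :=
  open Classical in
  ((spec H₀ ω (cutVol F I Y K ω L)).countP (· < E) : ℝ) / (exhaustion F I L).card

theorem cutCount_le (hH : IsHopping H₀) (ω : V → ℝ≥0∞) (L : ℕ) (E : ℝ) :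
    cutCount H₀ F I Y K ω L E ≤ countingFunction H₀ ω (Y ω) (exhaustion F I L) E := by
  classical
  rw [cutCount, countingFunction_eq]
  refine div_le_div_of_nonneg_right (Nat.cast_le.2 ?_) (by positivity)
  convert countP_spec_mono (q := ω) hH
    (cutVol_subset (F := F) (I := I) (Y := Y) (K := K) ω L) E

/-- Interlacing: each vertex removed by the cutoff lowers the number of eigenvalues below `E` by at
most one. -/
theorem countingFunction_le (hH : IsHopping H₀) (ω : V → ℝ≥0∞) (L : ℕ) (E : ℝ) :
    countingFunction H₀ ω (Y ω) (exhaustion F I L) E ≤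
      cutCount H₀ F I Y K ω L E + volAvg F I (obsHigh Y K ω) L := by
  classical
  rw [cutCount, countingFunction_eq, volAvg, ← add_div]
  gcongr
  have h1 := countP_spec_le_add (q := ω) hH (cutVol_subset (F := F) (I := I) (Y := Y) (K := K) ω L) E
  have h2 : ∑ k ∈ exhaustion F I L, obsHigh Y K ω k =
      (((exhaustion F I L).filter (· ∈ Y ω)).card : ℝ) - (cutVol F I Y K ω L).card := by
    rw [← Nat.cast_sub (Finset.card_le_card (cutVol_subset ω L)),
      ← Finset.card_sdiff_of_subset (cutVol_subset ω L)]
    simp only [obsHigh, Finset.sum_boole]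
    congr 2
    ext k
    simp only [cutVol, Finset.mem_filter, Finset.mem_sdiff]
    tauto
  rw [h2]
  have h3 : ((((spec H₀ ω ((exhaustion F I L).filter (· ∈ Y ω))).countP (· < E) : ℕ) : ℝ)) +
      (cutVol F I Y K ω L).card ≤ ((spec H₀ ω (cutVol F I Y K ω L)).countP (· < E) : ℕ) +
      (((exhaustion F I L).filter (· ∈ Y ω)).card : ℝ) := by
    exact_mod_cast (by convert h1)
  linarith

theorem countingFunction_mono (H₀ : L2 V →L[ℂ] L2 V) (q : V → ℝ≥0∞) (Y : Set V) (Λ : Finset V) :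
    Monotone (countingFunction H₀ q Y Λ) := by
  classical
  intro E E' h
  rw [countingFunction_eq, countingFunction_eq]
  gcongr
  rw [Multiset.countP_eq_card_filter, Multiset.countP_eq_card_filter]
  exact Multiset.card_le_card (Multiset.monotone_filter_right _ fun x hx => lt_of_lt_of_le hx h)

theorem countingFunction_mem_Icc (hH : IsHopping H₀) (q : V → ℝ≥0∞) (Y : Set V) (Λ : Finset V)
    (E : ℝ) : countingFunction H₀ q Y Λ E ∈ Set.Icc (0 : ℝ) 1 := by
  classical
  rw [countingFunction_eq]
  refine ⟨by positivity, div_le_one_of_le₀ ?_ (by positivity)⟩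
  have h1 := (Multiset.countP_le_card (p := (· < E))
    (spec H₀ q (Λ.filter (· ∈ Y)))).trans ((card_spec hH _).le.trans (Finset.card_filter_le _ _))
  exact_mod_cast h1

end FiniteVolume

/-! ### Existence of the integrated density of states -/

section DensityOfStates

theorem exists_polynomial_between {E' E : ℝ} (h : E' < E) (B : ℝ) {η : ℝ} (hη : 0 < η) :
    ∃ p : Polynomial ℝ, ∀ x, |x| ≤ B →
      (if x < E' then 1 else 0) ≤ p.eval x + η ∧ p.eval x ≤ (if x < E then 1 else 0) + η := by
  set ψ : ℝ → ℝ := fun x => max 0 (min 1 ((E - x) / (E - E'))) with hψ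
  have hc : Continuous ψ := by fun_prop
  have hpos : 0 < E - E' := sub_pos.2 h
  obtain ⟨p, hp⟩ := exists_polynomial_near_of_continuousOn (-B) B ψ hc.continuousOn η hη
  refine ⟨p, fun x hx => ?_⟩
  have h1 := abs_lt.1 (hp x (abs_le.1 hx))
  have h2 : (if x < E' then (1 : ℝ) else 0) ≤ ψ x := by
    split_ifs with hx'
    · refine le_max_of_le_right (le_min le_rfl ?_)
      rw [le_div_iff₀ hpos]
      linarith
    · exact le_max_left _ _
  have h3 : ψ x ≤ (if x < E then (1 : ℝ) else 0) := by
    split_ifs with hx'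
    · exact max_le zero_le_one (min_le_left _ _)
    · refine max_le le_rfl ((min_le_right _ _).trans ?_)
      exact div_nonpos_of_nonpos_of_nonneg (by linarith) hpos.le
  constructor <;> linarith [h1.1, h1.2]

theorem countP_lt_le_sum_map {s : Multiset ℝ} {f : ℝ → ℝ} {E η : ℝ}
    (h : ∀ x ∈ s, (if x < E then (1 : ℝ) else 0) ≤ f x + η) :
    (s.countP (· < E) : ℝ) ≤ (s.map f).sum + η * s.card := by
  induction s using Multiset.induction_on with
  | empty => simp
  | cons a s ih =>
    have h1 := ih fun x hx => h x (Multiset.mem_cons_of_mem hx)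
    have h2 := h a (Multiset.mem_cons_self a s)
    rw [Multiset.countP_cons, Multiset.map_cons, Multiset.sum_cons, Multiset.card_cons]
    split_ifs at h2 ⊢ <;> push_cast <;> linarith

theorem sum_map_le_countP_lt {s : Multiset ℝ} {f : ℝ → ℝ} {E η : ℝ}
    (h : ∀ x ∈ s, f x ≤ (if x < E then (1 : ℝ) else 0) + η) :
    (s.map f).sum ≤ (s.countP (· < E) : ℝ) + η * s.card := by
  induction s using Multiset.induction_on with
  | empty => simp
  | cons a s ih =>
    have h1 := ih fun x hx => h x (Multiset.mem_cons_of_mem hx)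
    have h2 := h a (Multiset.mem_cons_self a s)
    rw [Multiset.countP_cons, Multiset.map_cons, Multiset.sum_cons, Multiset.card_cons]
    split_ifs at h2 ⊢ <;> push_cast <;> linarith

/-- The measure has the right limits of `G` as its distribution function, so the mass of `Iio E` is
a left limit of these. Without regularity of `G` it can only be squeezed between values of `G` to
the left of `E` and at `E`. -/
theorem exists_measure_Iio_between {G : ℝ → ℝ} (hG : Monotone G) (h01 : ∀ x, G x ∈ Set.Icc (0 : ℝ) 1)
    (h0 : Tendsto G atBot (𝓝 0)) :
    ∃ ν : Measure ℝ, IsFiniteMeasure ν ∧ (∀ E, ν.real (Set.Iio E) ≤ G E) ∧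
      ∀ E' E, E' < E → G E' ≤ ν.real (Set.Iio E) := by
  set f := hG.stieltjesFunction with hf
  have hle : ∀ x, G x ≤ f x := fun x => by
    rw [hf, Monotone.stieltjesFunction_eq]; exact hG.le_rightLim le_rfl
  have hge : ∀ x y, x < y → f x ≤ G y := fun x y hxy => by
    rw [hf, Monotone.stieltjesFunction_eq]; exact hG.rightLim_le hxy
  have hf0 : Tendsto f atBot (𝓝 0) := by
    refine tendsto_of_tendsto_of_tendsto_of_le_of_le h0
      (h0.comp (tendsto_atBot_add_const_right _ (1 : ℝ) tendsto_id)) hle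
      fun x => hge x _ (by simp)
  have hfin : IsFiniteMeasure f.measure :=
    f.isFiniteMeasure_of_forall_abs_le (C := 1) fun x => by
      rw [abs_of_nonneg ((h01 x).1.trans (hle x))]
      exact (hge x (x + 1) (by linarith)).trans (h01 _).2
  have hIio : ∀ E, f.measure.real (Set.Iio E) = max 0 (Function.leftLim f E) := by
    intro E
    rw [measureReal_def, f.measure_Iio hf0, sub_zero, ENNReal.toReal_ofReal', max_comm]
  refine ⟨f.measure, hfin, fun E => ?_, fun E' E h => ?_⟩
  · rw [hIio]
    refine max_le (h01 E).1 ?_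
    refine le_of_tendsto (f.mono.tendsto_leftLim E) ?_
    filter_upwards [self_mem_nhdsWithin] with x hx using hge x E hx
  · rw [hIio]
    exact ((hle E').trans (f.mono.le_leftLim h)).trans (le_max_right _ _)

/-- Counting functions with values in `[0,1]` that are asymptotically independent of the
configuration, up to a shift of the energy, converge to the distribution function of a measure. -/
theorem exists_limit_measure {Ω : Type*} {S : Set Ω} (hS : S.Nonempty) {N : Ω → ℕ → ℝ → ℝ}
    (hmono : ∀ ω L, Monotone (N ω L)) (h01 : ∀ ω L E, N ω L E ∈ Set.Icc (0 : ℝ) 1)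
    (hcmp : ∀ E' E, E' < E → ∀ ε > 0, ∃ t : ℝ, ∀ ω ∈ S,
      ∀ᶠ L in atTop, N ω L E' ≤ t + ε ∧ t ≤ N ω L E + ε)
    (hbot : ∀ ε > 0, ∃ E, ∀ ω ∈ S, ∀ᶠ L in atTop, N ω L E ≤ ε) :
    ∃ ν : Measure ℝ, IsFiniteMeasure ν ∧ ∀ ω ∈ S, ∀ E : ℝ,
      ContinuousAt (fun E' => ν.real (Set.Iio E')) E →
        Tendsto (fun L => N ω L E) atTop (𝓝 (ν.real (Set.Iio E))) := by
  obtain ⟨ω₀, hω₀⟩ := hS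
  -- The limit is built from one reference configuration; the number `t` in `hcmp`, common to all
  -- configurations, transfers it to the others.
  set G : ℝ → ℝ := fun E => limsup (fun L => N ω₀ L E) atTop with hGdef
  have bdd : ∀ E, IsBoundedUnder (· ≤ ·) atTop fun L => N ω₀ L E := fun E =>
    isBoundedUnder_of ⟨1, fun L => (h01 ω₀ L E).2⟩
  have cobdd : ∀ E, IsCoboundedUnder (· ≤ ·) atTop fun L => N ω₀ L E := fun E =>
    (isBoundedUnder_of ⟨0, fun L => (h01 ω₀ L E).1⟩).isCoboundedUnder_le
  have hle : ∀ E t, (∀ᶠ L in atTop, N ω₀ L E ≤ t) → G E ≤ t := fun E t h =>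
    limsup_le_of_le (cobdd E) h
  have hge : ∀ E t, (∀ᶠ L in atTop, t ≤ N ω₀ L E) → t ≤ G E := fun E t h =>
    le_limsup_of_frequently_le h.frequently (bdd E)
  have hG : Monotone G := fun E E' h => limsup_le_limsup
    (Eventually.of_forall fun L => hmono ω₀ L h) (cobdd E) (bdd E')
  have hG01 : ∀ x, G x ∈ Set.Icc (0 : ℝ) 1 := fun x =>
    ⟨hge x 0 (Eventually.of_forall fun L => (h01 ω₀ L x).1),
      hle x 1 (Eventually.of_forall fun L => (h01 ω₀ L x).2)⟩
  have hG0 : Tendsto G atBot (𝓝 0) := by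
    refine tendsto_order.2 ⟨fun a ha => Eventually.of_forall fun x => ha.trans_le (hG01 x).1,
      fun a ha => ?_⟩
    obtain ⟨E, hE⟩ := hbot (a / 2) (half_pos ha)
    filter_upwards [eventually_le_atBot E] with x hx
    exact ((hG hx).trans (hle E _ (hE ω₀ hω₀))).trans_lt (half_lt_self ha)
  obtain ⟨ν, hν, h1, h2⟩ := exists_measure_Iio_between hG hG01 hG0
  refine ⟨ν, hν, fun ω hω E hE => ?_⟩
  -- Each passage through `t` costs a shift of the energy, which is harmless at continuity points.
  have up : ∀ E', E < E' → ∀ ε > 0, ∀ᶠ L in atTop, N ω L E ≤ G E' + ε := by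
    intro E' h ε hε
    obtain ⟨t, ht⟩ := hcmp E E' h (ε / 2) (half_pos hε)
    have h3 := hge E' (t - ε / 2) ((ht ω₀ hω₀).mono fun L hL => by linarith [hL.2])
    filter_upwards [ht ω hω] with L hL
    linarith [hL.1]
  have lo : ∀ E', E' < E → ∀ ε > 0, ∀ᶠ L in atTop, G E' ≤ N ω L E + ε := by
    intro E' h ε hε
    obtain ⟨t, ht⟩ := hcmp E' E h (ε / 2) (half_pos hε)
    have h3 := hle E' (t + ε / 2) ((ht ω₀ hω₀).mono fun L hL => hL.1)
    filter_upwards [ht ω hω] with L hL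
    linarith [hL.2]
  rw [Metric.tendsto_nhds]
  intro ε hε
  obtain ⟨δ, hδ, hcont⟩ := Metric.continuousAt_iff.1 hE (ε / 2) (half_pos hε)
  have c1 := hcont (x := E + δ / 2) (by rw [Real.dist_eq, add_sub_cancel_left, abs_of_pos] <;> linarith)
  have c2 := hcont (x := E - δ / 2) (by
    rw [Real.dist_eq, sub_sub_cancel_left, abs_neg, abs_of_pos] <;> linarith)
  rw [Real.dist_eq, abs_lt] at c1 c2
  -- On the upper side two shifts are needed, from `E` to `E + δ / 4` for the counting function and
  -- on to `E + δ / 2` for the measure, since `h2` requires a strict inequality.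
  filter_upwards [up (E + δ / 4) (by linarith) (ε / 4) (by linarith),
    lo (E - δ / 2) (by linarith) (ε / 4) (by linarith)] with L hu hl
  have h3 := h2 (E + δ / 4) (E + δ / 2) (by linarith)
  have h4 := h1 (E - δ / 2)
  rw [Real.dist_eq, abs_lt]
  constructor <;> linarith [c1.1, c1.2, c2.1, c2.2]

variable {V : Type*} {H₀ : L2 V →L[ℂ] L2 V} {Γ : Type*} [Group Γ] [MulAction Γ V]
  {P : Measure (V → ℝ≥0∞)} {I : ℕ → Finset Γ} {F : Finset V} {Y : (V → ℝ≥0∞) → Set V} {K : ℕ}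

/-- The ergodic averages that enter the density of states converge almost surely. -/
structure HasErgodicAverages (P : Measure (V → ℝ≥0∞)) (H₀ : L2 V →L[ℂ] L2 V) (F : Finset V)
    (I : ℕ → Finset Γ) (Y : (V → ℝ≥0∞) → Set V) : Prop where
  pow : ∀ K p, AvgConv P I (siteFun Γ F (obsPow H₀ (cutoff Y K) p))
  high : ∀ K, AvgConv P I (siteFun Γ F (obsHigh Y K))

/-- A configuration for which the traces converge to their means. -/
structure IsTypical (P : Measure (V → ℝ≥0∞)) (H₀ : L2 V →L[ℂ] L2 V) (F : Finset V)
    (I : ℕ → Finset Γ) (Y : (V → ℝ≥0∞) → Set V) (ω : V → ℝ≥0∞) : Prop where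
  trace : ∀ K, ∀ f : Polynomial ℝ,
      Tendsto (fun L => ((spec H₀ ω (cutVol F I Y K ω L)).map fun x => f.eval x).sum /
        (exhaustion F I L).card) atTop (𝓝 (vmean Γ P F (obsPoly H₀ (cutoff Y K) f)))
  high : ∀ K, Tendsto (volAvg F I (obsHigh Y K ω)) atTop (𝓝 (vmean Γ P F (obsHigh Y K)))

theorem HasErgodicAverages.ae_isTypical [IsFiniteMeasure P] (h : HasErgodicAverages P H₀ F I Y)
    (hF : IsFiniteQuotient Γ F) (hI : IsFolner I) (hH : IsInvariantHopping Γ H₀)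
    (hY : IsRandomSet Γ Y) : ∀ᵐ ω ∂P, IsTypical P H₀ F I Y ω := by
  filter_upwards [ae_all_iff.2 fun K => tendsto_trace hF hI hH hY (h.pow K),
    ae_all_iff.2 fun K => (isObservable_obsHigh hY K).tendsto_volAvg hF hI (h.high K)] with ω h1 h2
  exact ⟨h1, h2⟩

theorem abs_le_of_mem_spec_cutVol (hH : IsHopping H₀) {ω : V → ℝ≥0∞} {L : ℕ} {x : ℝ}
    (hx : x ∈ spec H₀ ω (cutVol F I Y K ω L)) : |x| ≤ ‖H₀‖ + K := by
  classical
  refine abs_le_of_mem_spec hH _ (Nat.cast_nonneg K) (fun k hk => ?_) hx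
  rw [cutVol, Finset.mem_filter] at hk
  exact abs_pot_le ω k hk.2

theorem card_spec_cutVol_div_le (hH : IsHopping H₀) (hF : IsFiniteQuotient Γ F) (hI : IsFolner I)
    (ω : V → ℝ≥0∞) (L : ℕ) :
    ((spec H₀ ω (cutVol F I Y K ω L)).card : ℝ) / (exhaustion F I L).card ≤ 1 := by
  classical
  rw [card_spec hH, div_le_one (card_exhaustion_pos hF hI L), Nat.cast_le, cutVol]
  exact Finset.card_filter_le _ _

theorem cutCount_le_trace (hH : IsHopping H₀) (hF : IsFiniteQuotient Γ F) (hI : IsFolner I)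
    {f : Polynomial ℝ} {E η : ℝ} (hη : 0 ≤ η)
    (hf : ∀ x, |x| ≤ ‖H₀‖ + K → (if x < E then 1 else 0) ≤ f.eval x + η) (ω : V → ℝ≥0∞) (L : ℕ) :
    cutCount H₀ F I Y K ω L E ≤
      ((spec H₀ ω (cutVol F I Y K ω L)).map fun x => f.eval x).sum / (exhaustion F I L).card + η := by
  have h1 := countP_lt_le_sum_map (s := spec H₀ ω (cutVol F I Y K ω L)) (f := fun x => f.eval x)
    fun x hx => hf x (abs_le_of_mem_spec_cutVol hH hx)
  have h2 := mul_le_mul_of_nonneg_left (card_spec_cutVol_div_le (Y := Y) (K := K) hH hF hI ω L) hη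
  have h3 := div_le_div_of_nonneg_right h1 (card_exhaustion_pos hF hI L).le
  rw [add_div, mul_div_assoc] at h3
  rw [cutCount]
  linarith

theorem trace_le_cutCount (hH : IsHopping H₀) (hF : IsFiniteQuotient Γ F) (hI : IsFolner I)
    {f : Polynomial ℝ} {E η : ℝ} (hη : 0 ≤ η)
    (hf : ∀ x, |x| ≤ ‖H₀‖ + K → f.eval x ≤ (if x < E then 1 else 0) + η) (ω : V → ℝ≥0∞) (L : ℕ) :
    ((spec H₀ ω (cutVol F I Y K ω L)).map fun x => f.eval x).sum / (exhaustion F I L).card ≤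
      cutCount H₀ F I Y K ω L E + η := by
  have h1 := sum_map_le_countP_lt (s := spec H₀ ω (cutVol F I Y K ω L)) (f := fun x => f.eval x)
    fun x hx => hf x (abs_le_of_mem_spec_cutVol hH hx)
  have h2 := mul_le_mul_of_nonneg_left (card_spec_cutVol_div_le (Y := Y) (K := K) hH hF hI ω L) hη
  have h3 := div_le_div_of_nonneg_right h1 (card_exhaustion_pos hF hI L).le
  rw [add_div, mul_div_assoc] at h3
  rw [cutCount]
  linarith

/-- The number `t` is the mean trace of a polynomial squeezed between the two step functions, for a
cutoff whose removed vertices have density below `ε / 3`. -/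
theorem exists_trace_between [IsFiniteMeasure P] (hF : IsFiniteQuotient Γ F) (hI : IsFolner I)
    (hH : IsInvariantHopping Γ H₀) (hY : IsRandomSet Γ Y) {E' E : ℝ} (h : E' < E) {ε : ℝ}
    (hε : 0 < ε) : ∃ t : ℝ, ∀ ω, IsTypical P H₀ F I Y ω → ∀ᶠ L in atTop,
      countingFunction H₀ ω (Y ω) (exhaustion F I L) E' ≤ t + ε ∧
        t ≤ countingFunction H₀ ω (Y ω) (exhaustion F I L) E + ε := by
  obtain ⟨K, hK⟩ := ((tendsto_order.1 (tendsto_vmean_obsHigh (P := P) (F := F) hY)).2 (ε / 3)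
    (by linarith)).exists
  obtain ⟨p, hp⟩ := exists_polynomial_between h (‖H₀‖ + K) (η := ε / 3) (by linarith)
  refine ⟨vmean Γ P F (obsPoly H₀ (cutoff Y K) p), fun ω hω => ?_⟩
  have h1 := Metric.tendsto_nhds.1 (hω.trace K p) (ε / 3) (by linarith)
  filter_upwards [h1, (tendsto_order.1 (hω.high K)).2 (ε / 3) hK] with L hL1 hL2
  rw [Real.dist_eq, abs_lt] at hL1
  have h2 := countingFunction_le (F := F) (I := I) (Y := Y) (K := K) hH.toIsHopping ω L E'
  have h3 := cutCount_le_trace (Y := Y) hH.toIsHopping hF hI (by linarith)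
    (fun x hx => (hp x hx).1) ω L
  have h4 := trace_le_cutCount (Y := Y) hH.toIsHopping hF hI (by linarith)
    (fun x hx => (hp x hx).2) ω L
  have h5 := cutCount_le (F := F) (I := I) (Y := Y) (K := K) hH.toIsHopping ω L E
  constructor <;> linarith [hL1.1, hL1.2]

/-- Below `-(‖H₀‖ + K)` the cut off matrices have no eigenvalues, so only the removed vertices
count. This prevents mass from escaping to `-∞`. -/
theorem exists_counting_le [IsFiniteMeasure P] (hH : IsInvariantHopping Γ H₀)
    (hY : IsRandomSet Γ Y) {ε : ℝ} (hε : 0 < ε) :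
    ∃ E : ℝ, ∀ ω, IsTypical P H₀ F I Y ω → ∀ᶠ L in atTop,
      countingFunction H₀ ω (Y ω) (exhaustion F I L) E ≤ ε := by
  obtain ⟨K, hK⟩ := ((tendsto_order.1 (tendsto_vmean_obsHigh (P := P) (F := F) hY)).2 ε hε).exists
  refine ⟨-(‖H₀‖ + K), fun ω hω => ?_⟩
  filter_upwards [(tendsto_order.1 (hω.high K)).2 ε hK] with L hL
  have h1 : cutCount H₀ F I Y K ω L (-(‖H₀‖ + K)) = 0 := by
    rw [cutCount, Multiset.countP_eq_zero.2, Nat.cast_zero, zero_div]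
    intro x hx
    exact not_lt.2 (neg_le_of_abs_le (abs_le_of_mem_spec_cutVol hH.toIsHopping hx))
  have h2 := countingFunction_le (F := F) (I := I) (Y := Y) (K := K) hH.toIsHopping ω L
    (-(‖H₀‖ + K))
  linarith

/-- Existence of the integrated density of states. -/
theorem HasErgodicAverages.exists_isIDS [IsProbabilityMeasure P]
    (h : HasErgodicAverages P H₀ F I Y) (hF : IsFiniteQuotient Γ F) (hI : IsFolner I)
    (hH : IsInvariantHopping Γ H₀) (hY : IsRandomSet Γ Y) :
    ∃ ν, IsIDS P H₀ Y (exhaustion F I) ν := by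
  have h1 := h.ae_isTypical hF hI hH hY
  obtain ⟨ν, hν, h2⟩ := exists_limit_measure (S := {ω | IsTypical P H₀ F I Y ω})
    (N := fun ω L E => countingFunction H₀ ω (Y ω) (exhaustion F I L) E) h1.exists
    (fun ω L => countingFunction_mono _ _ _ _)
    (fun ω L E => countingFunction_mem_Icc hH.toIsHopping _ _ _ _)
    (fun E' E hE ε hε => exists_trace_between hF hI hH hY hE hε)
    (fun ε hε => exists_counting_le hH hY hε)
  exact ⟨ν, hν, h1.mono fun ω hω => h2 ω hω⟩

end DensityOfStates

/-! ### Mass of an atom and mean of the eigenprojection -/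

section AtomMass

theorem countP_sub_countP_le_sum_map {s : Multiset ℝ} {f : ℝ → ℝ} {E₁ E₂ η : ℝ}
    (h : ∀ x ∈ s, (if x < E₂ then (1 : ℝ) else 0) - (if x < E₁ then 1 else 0) ≤ f x + η) :
    (s.countP (· < E₂) : ℝ) - s.countP (· < E₁) ≤ (s.map f).sum + η * s.card := by
  induction s using Multiset.induction_on with
  | empty => simp
  | cons a s ih =>
    have h1 := ih fun x hx => h x (Multiset.mem_cons_of_mem hx)
    have h2 := h a (Multiset.mem_cons_self a s)
    rw [Multiset.countP_cons, Multiset.countP_cons, Multiset.map_cons, Multiset.sum_cons,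
      Multiset.card_cons]
    split_ifs at h2 ⊢ <;> push_cast <;> linarith

theorem sum_map_le_countP_sub_countP {s : Multiset ℝ} {f : ℝ → ℝ} {E₁ E₂ η : ℝ}
    (h : ∀ x ∈ s, f x ≤ (if x < E₂ then (1 : ℝ) else 0) - (if x < E₁ then 1 else 0) + η) :
    (s.map f).sum ≤ (s.countP (· < E₂) : ℝ) - s.countP (· < E₁) + η * s.card := by
  induction s using Multiset.induction_on with
  | empty => simp
  | cons a s ih =>
    have h1 := ih fun x hx => h x (Multiset.mem_cons_of_mem hx)
    have h2 := h a (Multiset.mem_cons_self a s)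
    rw [Multiset.countP_cons, Multiset.countP_cons, Multiset.map_cons, Multiset.sum_cons,
      Multiset.card_cons]
    split_ifs at h2 ⊢ <;> push_cast <;> linarith

theorem dense_continuousAt_Iio (ν : Measure ℝ) [IsFiniteMeasure ν] :
    Dense {E | ContinuousAt (fun E' => ν.real (Set.Iio E')) E} := by
  have hm : Monotone fun E' => ν.real (Set.Iio E') := fun a b h =>
    measureReal_mono (Set.Iio_subset_Iio h)
  have := hm.countable_not_continuousAt.dense_compl ℝ
  convert this using 1
  ext
  simp

theorem real_Ico_eq_sub (ν : Measure ℝ) [IsFiniteMeasure ν] {E₁ E₂ : ℝ} (h : E₁ ≤ E₂) :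
    ν.real (Set.Ico E₁ E₂) = ν.real (Set.Iio E₂) - ν.real (Set.Iio E₁) := by
  have h1 : Set.Ico E₁ E₂ = Set.Iio E₂ \ Set.Iio E₁ := by
    ext x; simp
  rw [h1, measureReal_sdiff (Set.Iio_subset_Iio h) measurableSet_Iio]

theorem exists_real_Ico_lt (ν : Measure ℝ) [IsFiniteMeasure ν] (E : ℝ) {ε : ℝ} (hε : 0 < ε) :
    ∃ δ > 0, ∀ E₁ E₂, E - δ < E₁ → E₂ < E + δ → ν.real (Set.Ico E₁ E₂) ≤ ν.real {E} + ε := by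
  have h1 : ν {E} < ENNReal.ofReal (ν.real {E} + ε) := by
    rw [ENNReal.lt_ofReal_iff_toReal_lt (measure_ne_top _ _), ← measureReal_def]
    linarith
  obtain ⟨U, hEU, hU, hνU⟩ := Set.exists_isOpen_lt_of_lt {E} _ h1
  obtain ⟨δ, hδ, hball⟩ := Metric.isOpen_iff.1 hU E (hEU rfl)
  refine ⟨δ, hδ, fun E₁ E₂ h2 h3 => ?_⟩
  have h4 : Set.Ico E₁ E₂ ⊆ U := fun x hx => hball (by
    rw [Metric.mem_ball, Real.dist_eq, abs_lt]
    constructor <;> linarith [hx.1, hx.2])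
  have h5 := (measure_mono h4).trans hνU.le
  exact ENNReal.toReal_le_of_le_ofReal (by positivity) h5

variable {V : Type*} {H₀ : L2 V →L[ℂ] L2 V} {Γ : Type*} [Group Γ] [MulAction Γ V]
  {P : Measure (V → ℝ≥0∞)} {I : ℕ → Finset Γ} {F : Finset V} {Y : (V → ℝ≥0∞) → Set V} {K : ℕ}
  {ν : Measure ℝ}

theorem trace_le_of_isIDS [IsProbabilityMeasure P] (h : HasErgodicAverages P H₀ F I Y)
    (hF : IsFiniteQuotient Γ F) (hI : IsFolner I) (hH : IsInvariantHopping Γ H₀)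
    (hY : IsRandomSet Γ Y) (hν : IsIDS P H₀ Y (exhaustion F I) ν) {E₁ E₂ η : ℝ} (hE : E₁ ≤ E₂)
    (h₁ : ContinuousAt (fun E' => ν.real (Set.Iio E')) E₁)
    (h₂ : ContinuousAt (fun E' => ν.real (Set.Iio E')) E₂) (hη : 0 ≤ η) {f : Polynomial ℝ}
    (hf : ∀ x, |x| ≤ ‖H₀‖ + K →
      f.eval x ≤ (if x < E₂ then (1 : ℝ) else 0) - (if x < E₁ then 1 else 0) + η) :
    vmean Γ P F (obsPoly H₀ (cutoff Y K) f) ≤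
      ν.real (Set.Ico E₁ E₂) + vmean Γ P F (obsHigh Y K) + η := by
  have := hν.1
  obtain ⟨ω, hω, hω'⟩ := ((h.ae_isTypical hF hI hH hY).and hν.2).exists
  rw [real_Ico_eq_sub ν hE]
  refine le_of_tendsto_of_tendsto (hω.trace K f)
    ((((hω' E₂ h₂).sub (hω' E₁ h₁)).add (hω.high K)).add_const η)
    (Eventually.of_forall fun L => ?_)
  have a1 := sum_map_le_countP_sub_countP (s := spec H₀ ω (cutVol F I Y K ω L))
    (f := fun x => f.eval x)
    fun x hx => hf x (abs_le_of_mem_spec_cutVol hH.toIsHopping hx)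
  have a2 := mul_le_mul_of_nonneg_left
    (card_spec_cutVol_div_le (Y := Y) (K := K) hH.toIsHopping hF hI ω L) hη
  have a3 := div_le_div_of_nonneg_right a1 (card_exhaustion_pos hF hI L).le
  rw [add_div, mul_div_assoc, sub_div] at a3
  have a4 := countingFunction_le (F := F) (I := I) (Y := Y) (K := K) hH.toIsHopping ω L E₁
  have a5 := cutCount_le (F := F) (I := I) (Y := Y) (K := K) hH.toIsHopping ω L E₂
  rw [cutCount] at a4 a5
  dsimp only at *
  linarith

theorem le_trace_of_isIDS [IsProbabilityMeasure P] (h : HasErgodicAverages P H₀ F I Y)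
    (hF : IsFiniteQuotient Γ F) (hI : IsFolner I) (hH : IsInvariantHopping Γ H₀)
    (hY : IsRandomSet Γ Y) (hν : IsIDS P H₀ Y (exhaustion F I) ν) {E₁ E₂ η : ℝ} (hE : E₁ ≤ E₂)
    (h₁ : ContinuousAt (fun E' => ν.real (Set.Iio E')) E₁)
    (h₂ : ContinuousAt (fun E' => ν.real (Set.Iio E')) E₂) (hη : 0 ≤ η) {f : Polynomial ℝ}
    (hf : ∀ x, |x| ≤ ‖H₀‖ + K →
      (if x < E₂ then (1 : ℝ) else 0) - (if x < E₁ then 1 else 0) ≤ f.eval x + η) :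
    ν.real (Set.Ico E₁ E₂) ≤
      vmean Γ P F (obsPoly H₀ (cutoff Y K) f) + vmean Γ P F (obsHigh Y K) + η := by
  have := hν.1
  obtain ⟨ω, hω, hω'⟩ := ((h.ae_isTypical hF hI hH hY).and hν.2).exists
  rw [real_Ico_eq_sub ν hE]
  refine le_of_tendsto_of_tendsto ((hω' E₂ h₂).sub (hω' E₁ h₁))
    (((hω.trace K f).add (hω.high K)).add_const η) (Eventually.of_forall fun L => ?_)
  have a1 := countP_sub_countP_le_sum_map (s := spec H₀ ω (cutVol F I Y K ω L))
    (f := fun x => f.eval x)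
    fun x hx => hf x (abs_le_of_mem_spec_cutVol hH.toIsHopping hx)
  have a2 := mul_le_mul_of_nonneg_left
    (card_spec_cutVol_div_le (Y := Y) (K := K) hH.toIsHopping hF hI ω L) hη
  have a3 := div_le_div_of_nonneg_right a1 (card_exhaustion_pos hF hI L).le
  rw [add_div, mul_div_assoc, sub_div] at a3
  have a4 := countingFunction_le (F := F) (I := I) (Y := Y) (K := K) hH.toIsHopping ω L E₂
  have a5 := cutCount_le (F := F) (I := I) (Y := Y) (K := K) hH.toIsHopping ω L E₁
  rw [cutCount] at a4 a5
  dsimp only at *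
  linarith

theorem abs_sub_le_specRadius {x E : ℝ} (hx : |x| ≤ ‖H₀‖ + K) : |x - E| ≤ specRadius H₀ K E := by
  rw [specRadius]
  have := abs_sub x E
  linarith

/-- Choose a window around `E` whose `ν`-mass is close to that of the atom, with endpoints at
continuity points. For large `n` the polynomial is at most `1` inside and small outside, so its mean
trace is bounded by the mass of the window. -/
theorem vmean_obsEig_le [IsProbabilityMeasure P] (h : HasErgodicAverages P H₀ F I Y)
    (hF : IsFiniteQuotient Γ F) (hI : IsFolner I) (hH : IsInvariantHopping Γ H₀)
    (hY : IsRandomSet Γ Y) (hν : IsIDS P H₀ Y (exhaustion F I) ν) (E : ℝ) (K : ℕ) :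
    vmean Γ P F (obsEig H₀ Y E K) ≤ ν.real {E} + vmean Γ P F (obsHigh Y K) := by
  have := hν.1
  refine le_of_forall_pos_le_add fun ε hε => ?_
  obtain ⟨δ, hδ, hν1⟩ := exists_real_Ico_lt ν E (half_pos hε)
  obtain ⟨E₁, hE₁, a1, a2⟩ := (dense_continuousAt_Iio ν).exists_between
    (show E - δ < E by linarith)
  obtain ⟨E₂, hE₂, b1, b2⟩ := (dense_continuousAt_Iio ν).exists_between
    (show E < E + δ by linarith)
  obtain ⟨n₀, hn₀⟩ := exists_avgPoly_eval_le E (specRadius_pos H₀ K E)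
    (ε := min (E - E₁) (E₂ - E)) (lt_min (by linarith) (by linarith)) (half_pos hε)
  refine le_of_tendsto (tendsto_vmean_avgPoly hH hY E) ?_
  filter_upwards [eventually_ge_atTop n₀] with n hn
  have h1 := trace_le_of_isIDS (K := K) h hF hI hH hY hν (a2.trans b1).le hE₁ hE₂ (half_pos hε).le
    (f := avgPoly E (specRadius H₀ K E) n) (fun x hx => by
      have h2 := abs_sub_le_specRadius (E := E) hx
      have h3 := (avgPoly_eval_mem_Icc (specRadius_pos H₀ K E) h2 n).2
      by_cases hc : min (E - E₁) (E₂ - E) ≤ |x - E|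
      · have h4 := hn₀ n hn x h2 hc
        have h5 : (if x < E₁ then (1 : ℝ) else 0) ≤ if x < E₂ then 1 else 0 := by
          split_ifs <;> linarith
        linarith
      · rw [not_le, lt_min_iff, abs_lt, abs_lt] at hc
        rw [if_pos (by linarith [hc.2.2]), if_neg (by linarith [hc.1.1])]
        linarith)
  linarith [hν1 E₁ E₂ a1 b2]

/-- Opposite order of choices: for fixed `n` the polynomial is nearly `1` on a sufficiently small
window, so its mean trace bounds the mass of the window, and hence the atom, from above; only then
does `n` tend to infinity. -/
theorem atom_le_vmean_obsEig [IsProbabilityMeasure P] (h : HasErgodicAverages P H₀ F I Y)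
    (hF : IsFiniteQuotient Γ F) (hI : IsFolner I) (hH : IsInvariantHopping Γ H₀)
    (hY : IsRandomSet Γ Y) (hν : IsIDS P H₀ Y (exhaustion F I) ν) (E : ℝ) (K : ℕ) :
    ν.real {E} ≤ vmean Γ P F (obsEig H₀ Y E K) + vmean Γ P F (obsHigh Y K) := by
  have := hν.1
  refine le_of_forall_pos_le_add fun δ hδ => ?_
  refine ge_of_tendsto (((tendsto_vmean_avgPoly hH hY E).add_const _).add_const δ) ?_
  filter_upwards [eventually_gt_atTop 0] with n hn
  obtain ⟨ε, hε, hp⟩ := exists_avgPoly_eval_ge E (specRadius H₀ K E) hn.ne' hδ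
  obtain ⟨E₁, hE₁, a1, a2⟩ := (dense_continuousAt_Iio ν).exists_between
    (show E - ε < E by linarith)
  obtain ⟨E₂, hE₂, b1, b2⟩ := (dense_continuousAt_Iio ν).exists_between
    (show E < E + ε by linarith)
  have h1 := le_trace_of_isIDS (K := K) h hF hI hH hY hν (a2.trans b1).le hE₁ hE₂ hδ.le
    (f := avgPoly E (specRadius H₀ K E) n) (fun x hx => by
      have h3 := (avgPoly_eval_mem_Icc (specRadius_pos H₀ K E)
        (abs_sub_le_specRadius (E := E) hx) n).1
      by_cases hc : |x - E| < ε
      · have h4 := hp x hc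
        have h5 : (if x < E₂ then (1 : ℝ) else 0) ≤ 1 := by split_ifs <;> norm_num
        have h6 : 0 ≤ (if x < E₁ then (1 : ℝ) else 0) := by split_ifs <;> norm_num
        linarith
      · rw [abs_lt, not_and_or, not_lt, not_lt] at hc
        split_ifs <;> rcases hc with hc | hc <;> linarith)
  refine le_trans (measureReal_mono ?_) h1
  rintro x rfl
  exact ⟨a2.le, b1⟩

end AtomMass

/-! ### From atoms to finitely supported eigenfunctions and back -/

section Eigenfunctions

variable {V : Type*} {H₀ : L2 V →L[ℂ] L2 V} {Y : (V → ℝ≥0∞) → Set V} {K : ℕ} {E : ℝ}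

theorem exists_mem_ne_zero_of_card_lt_of_fintype (U : Submodule ℂ (L2 V)) [CompleteSpace U]
    (A : Finset V) {ι : Type*} [Fintype ι] (Φ : (EuclideanSpace ℂ A) →ₗ[ℂ] (ι → ℂ))
    (h : (Fintype.card ι : ℝ) < ∑ k ∈ A, ‖U.starProjection (delta k)‖ ^ 2) :
    ∃ u ∈ U, restrictTo A u ≠ 0 ∧ Φ (restrictTo A u) = 0 := by
  obtain ⟨u, hu, h1, h2⟩ := exists_mem_ne_zero_of_card_lt U A
    ((LinearMap.funLeft ℂ ℂ (Fintype.equivFin ι).symm).comp Φ) h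
  refine ⟨u, hu, h1, ?_⟩
  ext i
  have := congrFun h2 (Fintype.equivFin ι i)
  simpa [LinearMap.funLeft_apply] using this

open Classical in
/-- If eigenfunctions of the cut off Hamiltonian are dense in a finite volume in comparison with the
boundary of the volume, there is an eigenfunction supported in the volume. -/
theorem mem_sigmaFin_of_card_lt (hH : IsHopping H₀) (ω : V → ℝ≥0∞) (Λ : Finset V)
    (h : ((Λ.filter fun k => ¬ nbh H₀ k 2 ⊆ Λ).card : ℝ) + ∑ k ∈ Λ, obsHigh Y K ω k <
      ∑ k ∈ Λ, obsEig H₀ Y E K ω k) :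
    E ∈ sigmaFin H₀ ω (Y ω) := by
  set Z := cutoff Y K ω with hZ
  set T := cutOp H₀ Z (pot ω) K (Nat.cast_nonneg K) (abs_pot_le ω) with hT
  set A := Λ.filter (· ∈ Z) with hA
  set B := A.filter fun k => ¬ nbh H₀ k 2 ⊆ Λ with hB
  set C := Λ.filter fun k => k ∈ Y ω ∧ k ∉ Z with hC
  set S := eigSpace T E with hS
  have hsum : ∑ k ∈ Λ, obsEig H₀ Y E K ω k = ∑ k ∈ A, ‖S.starProjection (delta k)‖ ^ 2 := by
    rw [hA, Finset.sum_filter]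
    refine Finset.sum_congr rfl fun k _ => ?_
    simp only [obsEig]
    split_ifs <;> rfl
  have hcard : (Fintype.card (B ⊕ C) : ℝ) < ∑ k ∈ A, ‖S.starProjection (delta k)‖ ^ 2 := by
    rw [← hsum]
    refine lt_of_le_of_lt ?_ h
    have h1 : ∑ k ∈ Λ, obsHigh Y K ω k = C.card := by
      simp only [obsHigh, Finset.sum_boole]
      rw [hC]
    rw [h1, Fintype.card_sum, Fintype.card_coe, Fintype.card_coe, Nat.cast_add]
    have h2 : (B.card : ℝ) ≤ (Λ.filter fun k => ¬ nbh H₀ k 2 ⊆ Λ).card :=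
      Nat.cast_le.2 (Finset.card_le_card (Finset.filter_subset_filter _ (Finset.filter_subset _ _)))
    linarith
  -- Two kinds of conditions: the function vanishes at vertices of `A` whose 2-neighbourhood leaves
  -- `Λ`, and hopping from `A` gives zero at the vertices of `Y ω` in `Λ` that the cutoff removed.
  -- The second kind is the eigenvalue equation of the original Hamiltonian there.
  let Φ : (EuclideanSpace ℂ A) →ₗ[ℂ] (B ⊕ C → ℂ) :=
    { toFun := fun w => Sum.elim (fun k => w ⟨k, (Finset.mem_filter.1 k.2).1⟩)
        (fun i => ∑ j : A, (hop H₀ i j : ℂ) * w j)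
      map_add' := fun w w' => by
        ext (k | k)
        · simp
        · simp [mul_add, Finset.sum_add_distrib]
      map_smul' := fun c w => by
        ext (k | k)
        · simp
        · simp [Finset.mul_sum, mul_left_comm] }
  obtain ⟨u, hu, hu0, hΦ⟩ := exists_mem_ne_zero_of_card_lt_of_fintype S A Φ hcard
  have hu1 : ∀ k ∈ A, ¬ nbh H₀ k 2 ⊆ Λ → u k = 0 := fun k hk hk' =>
    congrFun hΦ (Sum.inl ⟨k, Finset.mem_filter.2 ⟨hk, hk'⟩⟩)
  have hu2 : ∀ i ∈ C, ∑ j ∈ A, (hop H₀ i j : ℂ) * u j = 0 := fun i hi => by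
    have := congrFun hΦ (Sum.inr ⟨i, hi⟩)
    rw [← Finset.sum_coe_sort A]
    exact this
  -- A vertex outside `Λ` can only hop to points of `A` whose 1-neighbourhood leaves `Λ`, and `u`
  -- vanishes at those.
  have hu3 : ∀ i, i ∉ Λ → ∑ j ∈ A, (hop H₀ i j : ℂ) * u j = 0 := fun i hi => by
    refine Finset.sum_eq_zero fun j hj => ?_
    by_cases hij : j ∈ row H₀ i
    · rw [hu1 j hj fun hn => hi (hn (nbh_mono j one_le_two
        (mem_nbh_succ_of_mem_row (mem_nbh_self j 0) (hH.mem_row_comm.1 hij)))), mul_zero]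
    · rw [hH.hop_eq_zero hij, Complex.ofReal_zero, zero_mul]
  let f : V →₀ ℂ := Finsupp.onFinset A (fun k => if k ∈ A then u k else 0) fun k hk => by
    by_contra h'
    exact hk (if_neg h')
  have hfA : ∀ k ∈ A, f k = u k := fun k hk => if_pos hk
  have hfA' : ∀ k, k ∉ A → f k = 0 := fun k hk => if_neg hk
  have hsubA : f.support ⊆ A := Finsupp.support_onFinset_subset
  have hfs : ∀ i, f.sum (fun j z => (hop H₀ i j : ℂ) * z) = ∑ j ∈ A, (hop H₀ i j : ℂ) * u j := by
    intro i
    rw [Finsupp.sum_of_support_subset f hsubA _ fun j _ => mul_zero _]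
    exact Finset.sum_congr rfl fun j hj => by rw [hfA j hj]
  refine ⟨f, fun h0 => hu0 ?_, fun k hk => ?_, fun i hi => ?_⟩
  · ext k
    have := hfA k k.2
    rw [h0, Finsupp.zero_apply] at this
    exact this.symm
  · exact (Finset.mem_filter.1 (hsubA hk)).2.1
  rw [hfs]
  by_cases hiΛ : i ∈ Λ
  swap
  · rw [hu3 i hiΛ, hfA' i fun h => hiΛ (Finset.mem_filter.1 h).1, mul_zero, mul_zero, add_zero]
  by_cases hiZ : i ∈ Z
  swap
  · rw [hu2 i (Finset.mem_filter.2 ⟨hiΛ, hi, hiZ⟩),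
      hfA' i fun h => hiZ (Finset.mem_filter.1 h).2, mul_zero, mul_zero, add_zero]
  have hiA : i ∈ A := Finset.mem_filter.2 ⟨hiΛ, hiZ⟩
  rw [hfA i hiA]
  -- If the 1-neighbourhood of `i` stays in `Λ`, the truncation does not affect the equation at `i`.
  -- Otherwise `u` vanishes at `i` and at its neighbours in `A`, whose 2-neighbourhoods all contain
  -- the neighbour of `i` outside `Λ`; radius two was chosen for this.
  by_cases hi1 : nbh H₀ i 1 ⊆ Λ
  · have h1 := congrArg (fun g : L2 V => g i) (mem_eigSpace.1 hu)
    simp only [lp.coeFn_smul, Pi.smul_apply, smul_eq_mul] at h1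
    rw [← h1, hT, cutOp_apply hH, if_pos hiZ, add_comm]
    congr 1
    symm
    rw [← sum_ite_mem_eq (row H₀ i) A (p := (· ∈ A)) (fun _ => Iff.rfl)
      (fun j => (hop H₀ i j : ℂ) * u j)
      fun j hj => by rw [hH.hop_eq_zero hj, Complex.ofReal_zero, zero_mul]]
    refine Finset.sum_congr rfl fun j hj => ?_
    refine if_congr ?_ rfl rfl
    rw [hA, Finset.mem_filter, and_iff_right]
    exact hi1 (mem_nbh_succ_of_mem_row (mem_nbh_self i 0) hj)
  · rw [hu1 i hiA fun hn => hi1 ((nbh_mono i one_le_two).trans hn), mul_zero, mul_zero, zero_add]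
    obtain ⟨l, hl, hlΛ⟩ := Finset.not_subset.1 hi1
    refine Finset.sum_eq_zero fun j hj => ?_
    by_cases hij : j ∈ row H₀ i
    · have hli : l ∈ row H₀ i := by
        rcases Finset.mem_union.1 hl with h' | h'
        · rw [nbh, Finset.mem_singleton] at h'
          exact absurd (h' ▸ hiΛ) hlΛ
        · obtain ⟨x, hx, hlx⟩ := Finset.mem_biUnion.1 h'
          rw [nbh, Finset.mem_singleton] at hx
          exact hx ▸ hlx
      have h2 : l ∈ nbh H₀ j 2 := mem_nbh_succ_of_mem_row
        (mem_nbh_succ_of_mem_row (mem_nbh_self j 0) (hH.mem_row_comm.1 hij)) hli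
      rw [hu1 j hj fun hn => hlΛ (hn h2), mul_zero]
    · rw [hH.hop_eq_zero hij, Complex.ofReal_zero, zero_mul]

theorem obsEig_nonneg (ω : V → ℝ≥0∞) (k : V) : 0 ≤ obsEig H₀ Y E K ω k := by
  classical
  rw [obsEig]
  split_ifs <;> positivity

/-- An element of `ℓ²(V)` with finite support. -/
def ofFinsupp (f : V →₀ ℂ) : L2 V := ∑ k ∈ f.support, f k • delta k

theorem ofFinsupp_apply (f : V →₀ ℂ) (i : V) : ofFinsupp f i = f i := by
  classical
  rw [ofFinsupp, lp.coeFn_sum, Finset.sum_apply]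
  simp only [lp.coeFn_smul, Pi.smul_apply, delta_apply, smul_eq_mul, mul_ite, mul_one, mul_zero]
  rw [Finset.sum_ite_eq, ite_eq_left_iff]
  intro h
  exact (Finsupp.notMem_support_iff.1 h).symm

/-- The potential is bounded on a finite support, so for all large `K` the function `f` remains an
eigenvector of the cut off operator. Since `⟨p δ_k, f⟩ = f k`, the norm of `p δ_k` is at least `‖f
k‖ / ‖f‖`, uniformly in `K`. -/
theorem exists_le_obsEig (hH : IsHopping H₀) {ω : V → ℝ≥0∞} (hY : Y ω ⊆ active ω)
    (hE : E ∈ sigmaFin H₀ ω (Y ω)) :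
    ∃ k, ∃ c > 0, ∃ K₀, ∀ K ≥ K₀, c ≤ obsEig H₀ Y E K ω k := by
  classical
  obtain ⟨f, hf0, hfY, hf⟩ := hE
  obtain ⟨k, hk⟩ := Finsupp.ne_iff.1 hf0
  rw [Finsupp.zero_apply] at hk
  set u : L2 V := ofFinsupp f with hu
  have hui : ∀ i, u i = f i := ofFinsupp_apply f
  have hu0 : u ≠ 0 := fun h => hk (by rw [← hui, h]; rfl)
  have hbound : ∃ K₀ : ℕ, ∀ j ∈ f.support, ω j ≤ K₀ := by
    have : ∀ j, ∃ n : ℕ, j ∈ f.support → ω j ≤ n := fun j => by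
      by_cases hj : j ∈ f.support
      · obtain ⟨n, hn⟩ := ENNReal.exists_nat_gt (hY (hfY hj)).ne
        exact ⟨n, fun _ => hn.le⟩
      · exact ⟨0, fun h => absurd h hj⟩
    choose n hn using this
    exact ⟨f.support.sup n, fun j hj => (hn j hj).trans (Nat.cast_le.2 (Finset.le_sup hj))⟩
  obtain ⟨K₀, hK₀⟩ := hbound
  refine ⟨k, (‖f k‖ / ‖u‖) ^ 2, by positivity, K₀, fun K hK => ?_⟩
  have hcut : ∀ j ∈ f.support, j ∈ cutoff Y K ω := fun j hj =>
    ⟨hfY hj, (hK₀ j hj).trans (Nat.cast_le.2 hK)⟩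
  have hk' := hcut k (Finsupp.mem_support_iff.2 hk)
  rw [obsEig, if_pos hk']
  set T := cutOp H₀ (cutoff Y K ω) (pot ω) K (Nat.cast_nonneg K) (abs_pot_le ω) with hT
  have hmem : u ∈ eigSpace T E := by
    rw [mem_eigSpace]
    ext i
    rw [hT, cutOp_apply hH, lp.coeFn_smul, Pi.smul_apply, smul_eq_mul, hui]
    split_ifs with hi
    · rw [← hf i hi.1, add_comm]
      congr 1
      rw [Finsupp.sum_of_support_subset f (Finset.Subset.refl _) _ fun j _ => mul_zero _]
      simp_rw [hui]
      have h1 : ∀ j, (if j ∈ cutoff Y K ω then (hop H₀ i j : ℂ) * f j else 0) =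
          if j ∈ f.support then (hop H₀ i j : ℂ) * f j else 0 := by
        intro j
        by_cases hj : j ∈ f.support
        · rw [if_pos hj, if_pos (hcut j hj)]
        · rw [if_neg hj, Finsupp.notMem_support_iff.1 hj, mul_zero, ite_self]
      simp_rw [h1]
      exact sum_ite_mem_eq (row H₀ i) f.support (fun _ => Iff.rfl) _
        fun j hj => by rw [hH.hop_eq_zero hj, Complex.ofReal_zero, zero_mul]
    · rw [Finsupp.notMem_support_iff.1 fun h => hi (hcut i h), mul_zero]
  have h2 : ‖f k‖ ≤ ‖(eigSpace T E).starProjection (delta k)‖ * ‖u‖ := by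
    have h3 := Submodule.inner_starProjection_left_eq_right (eigSpace T E) (delta k) u
    rw [Submodule.starProjection_eq_self_iff.2 hmem, inner_delta_left, hui] at h3
    rw [← h3]
    exact norm_inner_le_norm _ _
  gcongr
  rwa [div_le_iff₀ (norm_pos_iff.2 hu0)]

variable {Γ : Type*} [Group Γ] [MulAction Γ V]
  {P : Measure (V → ℝ≥0∞)} {I : ℕ → Finset Γ} {F : Finset V} {ν : Measure ℝ}

/-- In a large volume the eigenspace is denser than the boundary conditions and the conditions at
removed vertices together, so `mem_sigmaFin_of_card_lt` applies. -/
theorem ae_mem_sigmaFin_of_atom [IsProbabilityMeasure P] (h : HasErgodicAverages P H₀ F I Y)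
    (hF : IsFiniteQuotient Γ F) (hI : IsFolner I) (hH : IsInvariantHopping Γ H₀)
    (hY : IsRandomSet Γ Y) (hν : IsIDS P H₀ Y (exhaustion F I) ν)
    (hE : ∀ K, AvgConv P I (siteFun Γ F (obsEig H₀ Y E K))) (hν0 : ν {E} ≠ 0) :
    ∀ᵐ ω ∂P, E ∈ sigmaFin H₀ ω (Y ω) := by
  classical
  have := hν.1
  have hc : 0 < ν.real {E} := (measureReal_nonneg).lt_of_ne' (by
    rwa [Ne, measureReal_eq_zero_iff])
  -- Half of the atom suffices: the removed density is lost once in the lower bound for the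
  -- eigenprojection and once more as the number of conditions.
  obtain ⟨K, hK⟩ := ((tendsto_order.1 (tendsto_vmean_obsHigh (P := P) (F := F) hY)).2
    (ν.real {E} / 2) (half_pos hc)).exists
  have h1 := atom_le_vmean_obsEig h hF hI hH hY hν E K
  filter_upwards [h.ae_isTypical hF hI hH hY,
    (isObservable_obsEig hH hY E K).tendsto_volAvg hF hI (hE K)] with ω hω hω'
  have h2 := (tendsto_card_not_subset hF hI (N := fun k => nbh H₀ k 2)
        (fun γ k j hj => smul_mem_nbh hH 2 γ k j hj)).add (hω.high K)
  have h3 := h2.eventually_lt hω' (by linarith)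
  obtain ⟨L, hL⟩ := h3.exists
  refine mem_sigmaFin_of_card_lt (K := K) hH.toIsHopping ω (exhaustion F I L) ?_
  rw [volAvg, volAvg, ← add_div, div_lt_div_iff_of_pos_right (card_exhaustion_pos hF hI L)] at hL
  convert hL

theorem IsObservable.integral_smul (hP : IsStationaryErgodic Γ P) {g : (V → ℝ≥0∞) → V → ℝ}
    (hg : IsObservable Γ g) (γ : Γ) (k : V) : ∫ ω, g ω (γ • k) ∂P = ∫ ω, g ω k ∂P := by
  have h1 : ∫ ω, g ω (γ • k) ∂(P.map (shift γ)) = ∫ ω, g (shift γ ω) (γ • k) ∂P :=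
    integral_map (hP.1 γ).measurable.aemeasurable (hg.measurable _).aestronglyMeasurable
  rw [(hP.1 γ).map_eq] at h1
  rw [h1]
  simp_rw [hg.equivariant]

theorem integral_div_mult_le_vmean [IsFiniteMeasure P] {g : (V → ℝ≥0∞) → V → ℝ}
    (hF : IsFiniteQuotient Γ F) (hg : IsObservable Γ g) (h0 : ∀ ω k, 0 ≤ g ω k) {x : V}
    (hx : x ∈ F) :
    ∫ ω, g ω x ∂P ≤ vmean Γ P F g * covolume Γ F * mult Γ F x := by
  have hm : (0 : ℝ) < mult Γ F x := Nat.cast_pos.2 (hF.mult_pos x)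
  rw [hg.vmean_eq, div_mul_cancel₀ _ hF.covolume_pos.ne', ← div_le_iff₀ hm]
  exact Finset.single_le_sum (f := fun x => (∫ ω, g ω x ∂P) / mult Γ F x)
    (fun y _ => div_nonneg (integral_nonneg fun ω => h0 ω y) (Nat.cast_nonneg _)) hx

/-- Without an atom the mean of `obsEig` is bounded by the density of removed vertices and tends to
zero with growing `K`. By Markov's inequality no vertex keeps a diagonal element bounded below for
all large `K`, except on a null set; `exists_le_obsEig` then excludes an eigenfunction. Only a
countable union of null sets is needed. -/
theorem ae_notMem_sigmaFin_of_not_atom [Countable V] [IsProbabilityMeasure P]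
    (hP : IsStationaryErgodic Γ P) (h : HasErgodicAverages P H₀ F I Y)
    (hF : IsFiniteQuotient Γ F) (hI : IsFolner I) (hH : IsInvariantHopping Γ H₀)
    (hY : IsRandomSet Γ Y) (hν : IsIDS P H₀ Y (exhaustion F I) ν) (hν0 : ν {E} = 0) :
    ∀ᵐ ω ∂P, E ∉ sigmaFin H₀ ω (Y ω) := by
  have hlim : Tendsto (fun K => vmean Γ P F (obsEig H₀ Y E K)) atTop (𝓝 0) := by
    refine squeeze_zero (fun K => ?_) (fun K => ?_) (tendsto_vmean_obsHigh (P := P) (F := F) hY)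
    · exact div_nonneg (integral_nonneg fun ω => Finset.sum_nonneg fun x _ =>
        div_nonneg (obsEig_nonneg ω x) (Nat.cast_nonneg _)) hF.covolume_pos.le
    · have := vmean_obsEig_le h hF hI hH hY hν E K
      rwa [measureReal_def, hν0, ENNReal.toReal_zero, zero_add] at this
  have hint : ∀ k, Tendsto (fun K => ∫ ω, obsEig H₀ Y E K ω k ∂P) atTop (𝓝 0) := by
    intro k
    obtain ⟨γ, hγ⟩ := hF.covers k
    have h1 := (hlim.mul_const (covolume Γ F)).mul_const (mult Γ F (γ • k) : ℝ)
    rw [zero_mul, zero_mul] at h1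
    refine squeeze_zero (fun K => integral_nonneg fun ω => obsEig_nonneg ω k) (fun K => ?_) h1
    rw [← (isObservable_obsEig hH hY E K).integral_smul hP γ k]
    exact integral_div_mult_le_vmean hF (isObservable_obsEig hH hY E K)
      (fun ω k => obsEig_nonneg ω k) hγ
  have hnull : ∀ k (n K₀ : ℕ), P {ω | ∀ K ≥ K₀, ((n : ℝ) + 1)⁻¹ ≤ obsEig H₀ Y E K ω k} = 0 := by
    intro k n K₀
    have hn : (0 : ℝ) < ((n : ℝ) + 1)⁻¹ := by positivity
    rw [← measureReal_eq_zero_iff]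
    refine le_antisymm (ge_of_tendsto ((hint k).div_const ((n : ℝ) + 1)⁻¹) ?_ |>.trans_eq
      (zero_div _)) measureReal_nonneg
    filter_upwards [eventually_ge_atTop K₀] with K hK
    rw [le_div_iff₀ hn, mul_comm]
    refine le_trans (mul_le_mul_of_nonneg_left (measureReal_mono fun ω hω => hω K hK) hn.le)
      (mul_meas_ge_le_integral_of_nonneg (Eventually.of_forall fun ω => obsEig_nonneg ω k)
        ((isObservable_obsEig hH hY E K).integrable k) _)
  have hae : ∀ᵐ ω ∂P, ∀ k (n K₀ : ℕ), ¬ ∀ K ≥ K₀, ((n : ℝ) + 1)⁻¹ ≤ obsEig H₀ Y E K ω k := by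
    simp_rw [ae_all_iff]
    intro k n K₀
    rw [ae_iff]
    simpa using hnull k n K₀
  filter_upwards [hae] with ω hω hE
  obtain ⟨k, c, hc, K₀, hK₀⟩ := exists_le_obsEig hH.toIsHopping (hY.subset ω) hE
  obtain ⟨n, hn⟩ := exists_nat_one_div_lt hc
  rw [one_div] at hn
  exact hω k n K₀ fun K hK => hn.le.trans (hK₀ K hK)

end Eigenfunctions

/-! ### Measurability and equivariance of the infinite clusters -/

section InfiniteCluster

variable {V : Type*} {H₀ : L2 V →L[ℂ] L2 V} {Γ : Type*} [Group Γ] [MulAction Γ V]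

/-- Reachability by a path of active vertices with a given number of steps. -/
def reaches (H₀ : L2 V →L[ℂ] L2 V) (ω : V → ℝ≥0∞) (k : V) : ℕ → V → Prop
  | 0, j => k = j
  | n + 1, j => ∃ i, reaches H₀ ω k n i ∧ j ∈ active ω ∧ hop H₀ i j ≠ 0

theorem reflTransGen_iff_reaches (ω : V → ℝ≥0∞) (k j : V) :
    Relation.ReflTransGen (fun a b => b ∈ active ω ∧ hop H₀ a b ≠ 0) k j ↔
      ∃ n, reaches H₀ ω k n j := by
  constructor
  · intro h
    induction h with
    | refl => exact ⟨0, rfl⟩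
    | tail _ hbc ih =>
      obtain ⟨n, hn⟩ := ih
      exact ⟨n + 1, _, hn, hbc⟩
  · rintro ⟨n, hn⟩
    induction n generalizing j with
    | zero => exact hn ▸ Relation.ReflTransGen.refl
    | succ n ih =>
      obtain ⟨i, hi, hij⟩ := hn
      exact (ih i hi).tail hij

theorem measurableSet_active (k : V) : MeasurableSet {ω : V → ℝ≥0∞ | k ∈ active ω} :=
  measurableSet_lt (measurable_pi_apply k) measurable_const

theorem measurableSet_reaches [Countable V] (k : V) (n : ℕ) (j : V) :
    MeasurableSet {ω | reaches H₀ ω k n j} := by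
  induction n generalizing j with
  | zero => exact MeasurableSet.const _
  | succ n ih =>
    simp only [reaches]
    exact measurableSet_setOfPred.2 (Measurable.exists fun i => measurableSet_setOfPred.1
      ((ih i).inter ((measurableSet_active j).inter (MeasurableSet.const _))))

theorem Set.infinite_iff_forall_finset {α : Type*} {s : Set α} :
    s.Infinite ↔ ∀ A : Finset α, ∃ j, j ∉ A ∧ j ∈ s := by
  constructor
  · intro h A
    obtain ⟨j, hj, hjA⟩ := h.exists_notMem_finset A
    exact ⟨j, hjA, hj⟩
  · intro h hs
    obtain ⟨j, hj, hjs⟩ := h hs.toFinset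
    exact hj (hs.mem_toFinset.2 hjs)

/-- Infinite means not exhausted by any finite set, a condition over the countably many finite sets
of vertices; reachability is split according to the number of steps. -/
theorem measurableSet_mem_infCluster [Countable V] (k : V) :
    MeasurableSet {ω | k ∈ infCluster H₀ ω} := by
  simp only [infCluster, Set.mem_ofPred_eq, Set.infinite_iff_forall_finset,
    reflTransGen_iff_reaches]
  refine (measurableSet_active k).inter (measurableSet_setOfPred.2 (Measurable.forall fun A =>
    Measurable.exists fun j => ?_))
  refine measurableSet_setOfPred.1 (MeasurableSet.inter (MeasurableSet.const _) ?_)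
  exact measurableSet_setOfPred.2 (Measurable.exists fun n => measurableSet_setOfPred.1
    (measurableSet_reaches k n j))

theorem smul_mem_infCluster (hH : IsInvariantHopping Γ H₀) (γ : Γ) {ω : V → ℝ≥0∞} {k : V}
    (hk : k ∈ infCluster H₀ ω) : γ • k ∈ infCluster H₀ (shift γ ω) := by
  have hact : ∀ j, γ • j ∈ active (shift γ ω) ↔ j ∈ active ω :=
    isRandomSet_active.equivariant γ ω
  refine ⟨(hact k).2 hk.1, (hk.2.image (MulAction.injective γ).injOn).mono ?_⟩
  rintro _ ⟨j, hj, rfl⟩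
  exact Relation.ReflTransGen.lift (r := fun a b => b ∈ active ω ∧ hop H₀ a b ≠ 0)
    (p := fun a b => b ∈ active (shift γ ω) ∧ hop H₀ a b ≠ 0) (γ • ·)
    (fun a b h => ⟨(hact b).2 h.1, by rw [hH.invariant]; exact h.2⟩) _ _ hj

theorem isRandomSet_infCluster [Countable V] (hH : IsInvariantHopping Γ H₀) :
    IsRandomSet Γ (infCluster H₀) where
  subset _ := fun _ hk => hk.1
  measurable := measurableSet_mem_infCluster
  equivariant γ ω k := by
    refine ⟨fun h => ?_, smul_mem_infCluster hH γ⟩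
    have := smul_mem_infCluster hH γ⁻¹ h
    rwa [inv_smul_smul, ← shift_mul, inv_mul_cancel, shift_one] at this

end InfiniteCluster

/-! ### The almost sure dichotomy for a single energy -/

section Dichotomy

variable {V : Type*} {H₀ : L2 V →L[ℂ] L2 V} {Γ : Type*} [Group Γ] [MulAction Γ V]
  {P : Measure (V → ℝ≥0∞)} {I : ℕ → Finset Γ} {F : Finset V} {Y : (V → ℝ≥0∞) → Set V}
  {ν : Measure ℝ}

theorem sigmaFin_eq_atoms [IsProbabilityMeasure P]
    (h1 : ∀ E, ν {E} ≠ 0 → ∀ᵐ ω ∂P, E ∈ sigmaFin H₀ ω (Y ω))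
    (h2 : ∀ E, ν {E} = 0 → ∀ᵐ ω ∂P, E ∉ sigmaFin H₀ ω (Y ω)) :
    NonrandomSigmaFin P H₀ Y ∧ SigmaFin P H₀ Y = atoms ν := by
  refine ⟨fun E => ?_, Set.ext fun E => ⟨fun hE h0 => ?_, fun hE => h1 E hE⟩⟩
  · by_cases h0 : ν {E} = 0
    · exact Or.inr (h2 E h0)
    · exact Or.inl (h1 E h0)
  · obtain ⟨ω, hω, hω'⟩ := (h2 E h0).and_frequently (Eventually.frequently hE) |>.exists
    exact hω hω'

theorem IsIDS.comp_strictMono (hν : IsIDS P H₀ Y (exhaustion F I) ν) {φ : ℕ → ℕ}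
    (hφ : StrictMono φ) : IsIDS P H₀ Y (exhaustion F (I ∘ φ)) ν :=
  ⟨hν.1, hν.2.mono fun _ hω E hE => (hω E hE).comp hφ.tendsto_atTop⟩

theorem exists_subseq_avgConv_siteFun [Countable Γ] [IsProbabilityMeasure P] (hI : IsFolner I)
    (hP : IsStationaryErgodic Γ P) {ι : Type*} [Countable ι] [Nonempty ι]
    {g : ι → (V → ℝ≥0∞) → V → ℝ} (hg : ∀ i, IsObservable Γ (g i)) :
    ∃ φ : ℕ → ℕ, StrictMono φ ∧ ∀ i, AvgConv P (I ∘ φ) (siteFun Γ F (g i)) := by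
  obtain ⟨e, he⟩ := exists_surjective_nat ι
  obtain ⟨φ, hφ, h⟩ := exists_subseq_avgConv hI hP (h := fun n => siteFun Γ F (g (e n)))
    (fun n => (hg (e n)).measurable_siteFun) fun n => (hg (e n)).bounded_siteFun
  refine ⟨φ, hφ, fun i => ?_⟩
  obtain ⟨n, rfl⟩ := he i
  exact h n

/-- The subsequence with almost sure convergence may depend on `E`: the conclusion concerns one
energy at a time and does not mention the subsequence, and `ν` remains the IDS along it. -/
theorem nonrandomSigmaFin_and_eq_atoms [Countable V] [Countable Γ] [IsProbabilityMeasure P]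
    (hP : IsStationaryErgodic Γ P) (hF : IsFiniteQuotient Γ F) (hI : IsFolner I)
    (hH : IsInvariantHopping Γ H₀) (hY : IsRandomSet Γ Y)
    (hν : IsIDS P H₀ Y (exhaustion F I) ν) :
    NonrandomSigmaFin P H₀ Y ∧ SigmaFin P H₀ Y = atoms ν := by
  have key : ∀ E : ℝ, ∃ φ : ℕ → ℕ, StrictMono φ ∧ HasErgodicAverages P H₀ F (I ∘ φ) Y ∧
      ∀ K, AvgConv P (I ∘ φ) (siteFun Γ F (obsEig H₀ Y E K)) := by
    intro E
    obtain ⟨φ, hφ, h⟩ := exists_subseq_avgConv_siteFun (F := F) hI hP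
      (g := Sum.elim (fun i : ℕ × ℕ => obsPow H₀ (cutoff Y i.1) i.2)
        (Sum.elim (fun K : ℕ => obsHigh Y K) fun K : ℕ => obsEig H₀ Y E K)) (by
        rintro (i | K | K)
        · exact isObservable_obsPow hH hY _ _
        · exact isObservable_obsHigh hY K
        · exact isObservable_obsEig hH hY E K)
    exact ⟨φ, hφ, ⟨fun K p => h (.inl (K, p)), fun K => h (.inr (.inl K))⟩,
      fun K => h (.inr (.inr K))⟩
  refine sigmaFin_eq_atoms (fun E hE => ?_) fun E hE => ?_
  · obtain ⟨φ, hφ, h1, h2⟩ := key E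
    exact ae_mem_sigmaFin_of_atom h1 hF (hI.comp_strictMono hφ) hH hY (hν.comp_strictMono hφ) h2 hE
  · obtain ⟨φ, hφ, h1, h2⟩ := key E
    exact ae_notMem_sigmaFin_of_not_atom hP h1 hF (hI.comp_strictMono hφ) hH hY
      (hν.comp_strictMono hφ) hE

/-- For each random set countably many observables determine the IDS; joining the two families gives
one subsequence for both. -/
theorem exists_subseq_isIDS [Countable Γ] [IsProbabilityMeasure P]
    (hP : IsStationaryErgodic Γ P) (hF : IsFiniteQuotient Γ F) (hI : IsFolner I)
    (hH : IsInvariantHopping Γ H₀) {Y' : (V → ℝ≥0∞) → Set V} (hY : IsRandomSet Γ Y)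
    (hY' : IsRandomSet Γ Y') :
    ∃ φ : ℕ → ℕ, StrictMono φ ∧ ∃ ν ν' : Measure ℝ, IsIDS P H₀ Y (exhaustion F (I ∘ φ)) ν ∧
      IsIDS P H₀ Y' (exhaustion F (I ∘ φ)) ν' := by
  obtain ⟨φ, hφ, h⟩ := exists_subseq_avgConv_siteFun (F := F) hI hP
    (g := Sum.elim (Sum.elim (fun i : ℕ × ℕ => obsPow H₀ (cutoff Y i.1) i.2)
      fun K : ℕ => obsHigh Y K) (Sum.elim (fun i : ℕ × ℕ => obsPow H₀ (cutoff Y' i.1) i.2)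
      fun K : ℕ => obsHigh Y' K)) (by
      rintro ((i | K) | (i | K))
      · exact isObservable_obsPow hH hY _ _
      · exact isObservable_obsHigh hY K
      · exact isObservable_obsPow hH hY' _ _
      · exact isObservable_obsHigh hY' K)
  have hI' := hI.comp_strictMono hφ
  obtain ⟨ν, hν⟩ := HasErgodicAverages.exists_isIDS (P := P) (I := I ∘ φ) (Y := Y)
    ⟨fun K p => h (.inl (.inl (K, p))), fun K => h (.inl (.inr K))⟩ hF hI' hH hY
  obtain ⟨ν', hν'⟩ := HasErgodicAverages.exists_isIDS (P := P) (I := I ∘ φ) (Y := Y')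
    ⟨fun K p => h (.inr (.inl (K, p))), fun K => h (.inr (.inr K))⟩ hF hI' hH hY'
  exact ⟨φ, hφ, ν, ν', hν, hν'⟩

end Dichotomy

/-! ### Eigenvalues of finite restrictions and potentials with values zero and infinity -/

section FiniteEigenvalues

variable {V : Type*} {H₀ : L2 V →L[ℂ] L2 V}

open Classical in
/-- The complex matrix of the restriction of `H₀` to a finite set. -/
def finMatrix (H₀ : L2 V →L[ℂ] L2 V) (A : Finset V) : Matrix A A ℂ :=
  Matrix.of fun k j : A => (hop H₀ k j : ℂ)

open Classical in
theorem eval_charpoly_finMatrix {A : Finset V} {f : A → ℂ} (hf : f ≠ 0) {E : ℝ}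
    (h : ∀ k : A, ∑ j : A, (hop H₀ k j : ℂ) * f j = (E : ℂ) * f k) :
    (finMatrix H₀ A).charpoly.eval (E : ℂ) = 0 := by
  rw [Matrix.eval_charpoly, ← Matrix.exists_mulVec_eq_zero_iff]
  refine ⟨f, hf, ?_⟩
  rw [Matrix.sub_mulVec, sub_eq_zero]
  ext k
  have h1 := h k
  simp only [Matrix.scalar_apply, Matrix.mulVec_diagonal]
  rw [← h1]
  rfl

theorem countable_finiteEigenvalues [Countable V] : (finiteEigenvalues H₀).Countable := by
  classical
  have h1 : finiteEigenvalues H₀ ⊆ ⋃ A : Finset V,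
      Complex.ofReal ⁻¹' ((finMatrix H₀ A).charpoly.roots.toFinset : Set ℂ) := by
    rintro E ⟨A, f, hf, h⟩
    rw [Set.mem_iUnion]
    refine ⟨A, ?_⟩
    rw [Set.mem_preimage, Finset.mem_coe, Multiset.mem_toFinset,
      Polynomial.mem_roots (Matrix.charpoly_monic _).ne_zero]
    exact eval_charpoly_finMatrix hf fun k => by convert h k
  exact (Set.countable_iUnion fun A =>
    (Finset.countable_toSet _).preimage Complex.ofReal_injective).mono h1

/-- `E` is a root of the characteristic polynomial of an integer matrix, which is monic. -/
theorem isIntegral_of_mem_finiteEigenvalues (h01 : ∀ k j, ∃ n : ℤ, hop H₀ k j = n) {E : ℝ}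
    (hE : E ∈ finiteEigenvalues H₀) : IsIntegral ℤ E := by
  classical
  obtain ⟨A, f, hf, h⟩ := hE
  choose n hn using h01
  have h1 := eval_charpoly_finMatrix hf fun k => by convert h k
  have h2 : finMatrix H₀ A =
      (Matrix.of fun k j : A => n k j).map (Int.castRingHom ℂ) := by
    ext k j
    simp [finMatrix, hn]
  rw [h2, Matrix.charpoly_map] at h1
  have h3 : IsIntegral ℤ (E : ℂ) := by
    refine ⟨(Matrix.of fun k j : A => n k j).charpoly, Matrix.charpoly_monic _, ?_⟩
    rw [← Polynomial.eval_map]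
    exact h1
  exact (isIntegral_algebraMap_iff (R := ℤ) (A := ℝ) (B := ℂ) Complex.ofReal_injective).1 h3

theorem sigmaFin_subset_finiteEigenvalues {q : V → ℝ≥0∞} {Y : Set V}
    (hq : ∀ k ∈ Y, q k = 0 ∨ q k = ∞) : sigmaFin H₀ q Y ⊆ finiteEigenvalues H₀ := by
  classical
  rintro E ⟨f, hf, hfY, h⟩
  refine ⟨f.support, fun k => f k, fun h0 => hf ?_, fun k => ?_⟩
  · ext k
    by_cases hk : k ∈ f.support
    · exact congrFun h0 ⟨k, hk⟩
    · exact Finsupp.notMem_support_iff.1 hk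
  · have h1 := h k (hfY k.2)
    have h2 : (q k).toReal = 0 := by rcases hq k (hfY k.2) with h | h <;> simp [h]
    rw [h2, Complex.ofReal_zero, zero_mul, zero_add] at h1
    rw [← h1, Finsupp.sum]
    exact Finset.sum_coe_sort f.support fun j => (hop H₀ k j : ℂ) * f j

open Classical in
-- If no vertex of `Y` outside `A` can hop to `A`, the eigenfunction of the finite matrix, extended
-- by zero, satisfies the equation everywhere on `Y`.
theorem mem_sigmaFin_of_pattern (hH : IsHopping H₀) {q : V → ℝ≥0∞} {Y : Set V} {A : Finset V}
    {f : A → ℂ} (hf : f ≠ 0) {E : ℝ}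
    (h : ∀ k : A, ∑ j : A, (hop H₀ k j : ℂ) * f j = (E : ℂ) * f k)
    (hA : ∀ k ∈ A, q k = 0 ∧ k ∈ Y) (hA' : ∀ k ∈ A.biUnion (row H₀), k ∉ A → k ∉ Y) :
    E ∈ sigmaFin H₀ q Y := by
  let g : V →₀ ℂ := Finsupp.onFinset A (fun k => if h : k ∈ A then f ⟨k, h⟩ else 0) fun k hk => by
    by_contra h'
    exact hk (dif_neg h')
  have hgA : ∀ k : A, g k = f k := fun k => dif_pos k.2
  have hgA' : ∀ k, k ∉ A → g k = 0 := fun k hk => dif_neg hk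
  have hsub : g.support ⊆ A := Finsupp.support_onFinset_subset
  have hsum : ∀ i, g.sum (fun j z => (hop H₀ i j : ℂ) * z) = ∑ j : A, (hop H₀ i j : ℂ) * f j := by
    intro i
    rw [Finsupp.sum_of_support_subset g hsub _ fun j _ => mul_zero _, ← Finset.sum_coe_sort A]
    exact Finset.sum_congr rfl fun j _ => by rw [hgA j]
  refine ⟨g, fun h0 => hf ?_, fun k hk => (hA k (hsub hk)).2, fun k hk => ?_⟩
  · ext k
    rw [← hgA k, h0]
    rfl
  · rw [hsum]
    by_cases hkA : k ∈ A
    · rw [(hA k hkA).1, ENNReal.toReal_zero, Complex.ofReal_zero, zero_mul, zero_add,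
        hgA ⟨k, hkA⟩]
      exact h ⟨k, hkA⟩
    · rw [hgA' k hkA, mul_zero, mul_zero, zero_add]
      refine Finset.sum_eq_zero fun j _ => ?_
      rw [hH.hop_eq_zero fun hj => hA' k (Finset.mem_biUnion.2 ⟨j, j.2, hH.mem_row_comm.1 hj⟩)
        hkA hk, Complex.ofReal_zero, zero_mul]

variable {P : Measure (V → ℝ≥0∞)}

open Classical in
theorem measure_pattern_ne_zero [IsProbabilityMeasure P]
    (hind : ProbabilityTheory.iIndepFun (fun (k : V) (ω : V → ℝ≥0∞) => ω k) P)
    {T : V → Set ℝ≥0∞} (hT : ∀ k, MeasurableSet (T k)) (hP : ∀ k, P {ω | ω k ∈ T k} ≠ 0)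
    (S : Finset V) : P {ω | ∀ k ∈ S, ω k ∈ T k} ≠ 0 := by
  have h1 := hind.measure_inter_preimage_eq_mul S (sets := T) fun k _ => hT k
  have h2 : {ω : V → ℝ≥0∞ | ∀ k ∈ S, ω k ∈ T k} =
      ⋂ k ∈ S, (fun ω : V → ℝ≥0∞ => ω k) ⁻¹' T k := by
    ext ω
    simp
  rw [h2, h1, Finset.prod_ne_zero_iff]
  exact fun k _ => hP k

/-- The pattern with `A` active and its hopping neighbours deleted has positive probability by
independence, so `E` cannot be almost surely absent; nonrandomness leaves only almost sure presence.
-/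
theorem finiteEigenvalues_subset_SigmaFin [IsProbabilityMeasure P] (hH : IsHopping H₀)
    (hind : ProbabilityTheory.iIndepFun (fun (k : V) (ω : V → ℝ≥0∞) => ω k) P)
    (h0 : ∀ k, P {ω | ω k = 0} ≠ 0) (h1 : ∀ k, P {ω | ω k = ∞} ≠ 0)
    (hN : NonrandomSigmaFin P H₀ active) : finiteEigenvalues H₀ ⊆ SigmaFin P H₀ active := by
  classical
  rintro E ⟨A, f, hf, h⟩
  refine (hN E).resolve_right fun hE => ?_
  refine measure_pattern_ne_zero hind (T := fun k => if k ∈ A then {0} else {∞})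
    (fun k => by split_ifs <;> exact measurableSet_singleton _)
    (fun k => by split_ifs; exacts [h0 k, h1 k]) (A ∪ A.biUnion (row H₀)) ?_
  refine measure_mono_null (fun ω hω => ?_) hE
  simp only [Set.mem_ofPred_eq] at hω
  simp only [Set.mem_compl_iff, Set.mem_ofPred_eq, not_not]
  refine mem_sigmaFin_of_pattern hH hf (fun k => by convert h k) (fun k hk => ?_) fun k hk hk' => ?_
  · have := hω k (Finset.mem_union_left _ hk)
    rw [if_pos hk, Set.mem_singleton_iff] at this
    exact ⟨this, by rw [active, Set.mem_ofPred_eq, this]; exact ENNReal.zero_lt_top⟩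
  · have := hω k (Finset.mem_union_right _ hk)
    rw [if_neg hk', Set.mem_singleton_iff] at this
    rw [active, Set.mem_ofPred_eq, this]
    exact lt_irrefl _

theorem SigmaFin_subset_finiteEigenvalues [IsProbabilityMeasure P]
    (hq : ∀ᵐ ω ∂P, ∀ k, ω k = 0 ∨ ω k = ∞) : SigmaFin P H₀ active ⊆ finiteEigenvalues H₀ := by
  intro E hE
  obtain ⟨ω, hω, hω'⟩ := (hq.and_frequently (Eventually.frequently hE)).exists
  exact sigmaFin_subset_finiteEigenvalues (fun k _ => hω k) hω'

/-- Almost sure statements for uncountably many energies do not combine, but only the countably many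
elements of `finiteEigenvalues H₀` can occur. -/
theorem ae_sigmaFin_eq [Countable V] [IsProbabilityMeasure P]
    (hq : ∀ᵐ ω ∂P, ∀ k, ω k = 0 ∨ ω k = ∞) (hN : NonrandomSigmaFin P H₀ active) :
    ∀ᵐ ω ∂P, sigmaFin H₀ ω (active ω) = SigmaFin P H₀ active := by
  have h1 : ∀ᵐ ω ∂P, ∀ E ∈ finiteEigenvalues H₀,
      (E ∈ sigmaFin H₀ ω (active ω) ↔ E ∈ SigmaFin P H₀ active) := by
    rw [ae_ball_iff countable_finiteEigenvalues]
    intro E _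
    rcases hN E with h | h
    · filter_upwards [h] with ω hω
      exact iff_of_true hω h
    · filter_upwards [h] with ω hω
      refine iff_of_false hω fun h' => ?_
      obtain ⟨ω', h2, h3⟩ := (h.and_frequently (Eventually.frequently h')).exists
      exact h2 h3
  filter_upwards [h1, hq] with ω hω hqω
  ext E
  exact ⟨fun h => (hω E (sigmaFin_subset_finiteEigenvalues (fun k _ => hqω k) h)).1 h,
    fun h => (hω E (SigmaFin_subset_finiteEigenvalues hq h)).2 h⟩

end FiniteEigenvalues

/-! ### The almost sure spectrum is the closure of the finite eigenvalues -/

section Spectrum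

theorem mul_norm_le_norm_sub_smul {H : Type*} [NormedAddCommGroup H] [InnerProductSpace ℂ H]
    [FiniteDimensional ℂ H] {T : H →ₗ[ℂ] H} (hT : T.IsSymmetric) {E δ : ℝ} (hδ : 0 ≤ δ)
    (h : ∀ t : ℝ, Module.End.HasEigenvalue T (t : ℂ) → δ ≤ |t - E|) (x : H) :
    δ * ‖x‖ ≤ ‖T x - (E : ℂ) • x‖ := by
  set b := hT.eigenvectorBasis rfl
  have h1 : ∀ i, inner ℂ (b i) (T x - (E : ℂ) • x) =
      ((hT.eigenvalues rfl i - E : ℝ) : ℂ) * inner ℂ (b i) x := by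
    intro i
    rw [inner_sub_right, inner_smul_right, ← hT (b i) x, hT.apply_eigenvectorBasis rfl i,
      inner_smul_left, ← sub_mul]
    congr 1
    simp
  refine (pow_le_pow_iff_left₀ (by positivity) (norm_nonneg _) two_ne_zero).1 ?_
  rw [mul_pow, ← b.sum_sq_norm_inner_right x, ← b.sum_sq_norm_inner_right, Finset.mul_sum]
  refine Finset.sum_le_sum fun i _ => ?_
  rw [h1, norm_mul, mul_pow, Complex.norm_real, Real.norm_eq_abs]
  gcongr
  exact h _ (hT.hasEigenvalue_eigenvalues rfl i)

/-- The lower bound gives injectivity and closed range; the orthogonal complement of the range is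
the kernel of the adjoint, which is again `T`, so the range is everything. -/
theorem isUnit_of_bounded_below {H : Type*} [NormedAddCommGroup H] [InnerProductSpace ℂ H]
    [CompleteSpace H] {T : H →L[ℂ] H} (hT : IsSelfAdjoint T) {δ : ℝ} (hδ : 0 < δ)
    (h : ∀ x, δ * ‖x‖ ≤ ‖T x‖) : IsUnit T := by
  have hker : ∀ x, T x = 0 → x = 0 := fun x hx => by
    have := h x
    rw [hx, norm_zero] at this
    exact norm_le_zero_iff.1 (nonpos_of_mul_nonpos_right this hδ)
  have hanti : AntilipschitzWith (Real.toNNReal δ⁻¹) T := by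
    refine AddMonoidHomClass.antilipschitz_of_bound T fun x => ?_
    rw [Real.coe_toNNReal _ (inv_nonneg.2 hδ.le), inv_mul_eq_div, le_div_iff₀ hδ, mul_comm]
    exact h x
  have hclosed : IsClosed (T.range : Set H) := by
    exact hanti.isClosed_range T.uniformContinuous
  have : CompleteSpace T.range := hclosed.completeSpace_coe
  have hrange : T.range = ⊤ := by
    rw [← Submodule.orthogonal_eq_bot_iff, ContinuousLinearMap.orthogonal_range,
      ContinuousLinearMap.isSelfAdjoint_iff'.1 hT, eq_bot_iff]
    exact fun x hx => hker x hx
  rw [ContinuousLinearMap.isUnit_iff_bijective]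
  refine ⟨hanti.injective, fun y => ?_⟩
  have : y ∈ T.range := hrange ▸ Submodule.mem_top
  exact this

theorem exists_approx_eigenvector {H : Type*} [NormedAddCommGroup H] [InnerProductSpace ℂ H]
    [CompleteSpace H] {T : H →L[ℂ] H} (hT : IsSelfAdjoint T) {z : ℂ} (hz : z ∈ spectrum ℂ T) :
    z = z.re ∧ ∀ δ > 0, ∃ x, ‖T x - (z.re : ℂ) • x‖ < δ * ‖x‖ := by
  have hre := hT.mem_spectrum_eq_re hz
  refine ⟨hre, fun δ hδ => ?_⟩
  by_contra! h2
  rw [hre] at hz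
  refine (spectrum.mem_iff.1 hz) ?_
  have h3 : IsSelfAdjoint (algebraMap ℂ (H →L[ℂ] H) (z.re : ℂ) - T) := by
    refine IsSelfAdjoint.sub (IsSelfAdjoint.algebraMap _ ?_) hT
    rw [isSelfAdjoint_iff]
    exact Complex.conj_ofReal _
  refine isUnit_of_bounded_below h3 hδ fun f => (h2 f).trans_eq ?_
  rw [_root_.sub_apply, Algebra.algebraMap_eq_smul_one, _root_.smul_apply]
  exact norm_sub_rev _ _

variable {V : Type*} {H₀ : L2 V →L[ℂ] L2 V} {Y : Set V}

theorem coe_restrictOp_apply (f : l2On Y) {i : V} (hi : i ∈ Y) :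
    (restrictOp H₀ Y f : L2 V) i = H₀ (f : L2 V) i := by
  have hδ : delta i ∈ l2On Y := fun k hk => by
    classical
    rw [delta_apply, if_neg]
    rintro rfl
    exact hk hi
  have h1 : (restrictOp H₀ Y f : L2 V) = (l2On Y).starProjection (H₀ (f : L2 V)) := rfl
  rw [h1, ← inner_delta_left, ← Submodule.inner_starProjection_left_eq_right,
    Submodule.starProjection_eq_self_iff.2 hδ, inner_delta_left]

theorem isSelfAdjoint_restrictOp (hH : IsSelfAdjoint H₀) : IsSelfAdjoint (restrictOp H₀ Y) := by
  rw [ContinuousLinearMap.isSelfAdjoint_iff_isSymmetric]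
  intro f g
  have hs := ContinuousLinearMap.isSelfAdjoint_iff_isSymmetric.1 hH
  have h1 : ∀ f g : l2On Y, inner ℂ f (restrictOp H₀ Y g) = inner ℂ (f : L2 V) (H₀ g) := by
    intro f g
    rw [Submodule.coe_inner]
    have h2 : (restrictOp H₀ Y g : L2 V) = (l2On Y).starProjection (H₀ (g : L2 V)) := rfl
    rw [h2, ← Submodule.inner_starProjection_left_eq_right,
      Submodule.starProjection_eq_self_iff.2 f.2]
  have h3 := h1 g f
  have h4 : inner ℂ (restrictOp H₀ Y f) g = inner ℂ (H₀ (f : L2 V)) (g : L2 V) := by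
    rw [← inner_conj_symm (𝕜 := ℂ) (restrictOp H₀ Y f) g, h3, inner_conj_symm]
  refine h4.trans (Eq.trans ?_ (h1 f g).symm)
  exact hs f g

theorem IsHopping.isSelfAdjoint (hH : IsHopping H₀) : IsSelfAdjoint H₀ :=
  isSelfAdjoint_of_entry hH.real hH.symm

open Classical in
/-- The restriction of `H₀` to a finite set, as a linear map. -/
def finOp (H₀ : L2 V →L[ℂ] L2 V) (A : Finset V) : EuclideanSpace ℂ A →ₗ[ℂ] EuclideanSpace ℂ A where
  toFun w := WithLp.toLp 2 fun k : A => ∑ j : A, (hop H₀ k j : ℂ) * w j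
  map_add' w w' := by
    ext k
    simp [mul_add, Finset.sum_add_distrib]
  map_smul' c w := by
    ext k
    simp [Finset.mul_sum, mul_left_comm]

theorem finOp_apply (A : Finset V) (w : EuclideanSpace ℂ A) (k : A) :
    finOp H₀ A w k = ∑ j : A, (hop H₀ k j : ℂ) * w j := rfl

theorem isSymmetric_finOp (hH : IsHopping H₀) (A : Finset V) : (finOp H₀ A).IsSymmetric := by
  intro w w'
  simp only [PiLp.inner_apply, finOp_apply, RCLike.inner_apply, map_sum, map_mul,
    Complex.conj_ofReal, Finset.mul_sum, Finset.sum_mul]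
  rw [Finset.sum_comm]
  refine Finset.sum_congr rfl fun k _ => Finset.sum_congr rfl fun j _ => ?_
  rw [hH.hop_symm]
  ring

theorem mem_finiteEigenvalues_of_hasEigenvalue {A : Finset V} {t : ℝ}
    (h : Module.End.HasEigenvalue (finOp H₀ A) (t : ℂ)) : t ∈ finiteEigenvalues H₀ := by
  classical
  obtain ⟨w, hw⟩ := h.exists_hasEigenvector
  refine ⟨A, w, fun h0 => hw.2 (by ext k; exact congrFun h0 k), fun k => ?_⟩
  have := congrArg (fun u : EuclideanSpace ℂ A => u k) hw.apply_eq_smul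
  exact this

/-- Restricting `(H - E) f` to a finite set `B` in `Y` that supports `f` does not increase its norm
and gives the finite matrix of `B`, minus `E`, applied to `f`. The spectral theorem for that matrix
gives the bound. -/
theorem mul_norm_le_of_finite_support (hH : IsHopping H₀) {E δ : ℝ} (hδ : 0 ≤ δ)
    (h : ∀ t ∈ finiteEigenvalues H₀, δ ≤ |t - E|) (f : l2On Y) {A : Finset V}
    (hA : ∀ k, k ∉ A → (f : L2 V) k = 0) :
    δ * ‖f‖ ≤ ‖restrictOp H₀ Y f - (E : ℂ) • f‖ := by
  classical
  set B := A.filter (· ∈ Y) with hB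
  have hfB : ∀ k, k ∉ B → (f : L2 V) k = 0 := fun k hk => by
    by_cases hkA : k ∈ A
    · exact f.2 k fun hY => hk (Finset.mem_filter.2 ⟨hkA, hY⟩)
    · exact hA k hkA
  set w := restrictTo B (f : L2 V) with hw
  have h1 := mul_norm_le_norm_sub_smul (isSymmetric_finOp hH B) (E := E) hδ
    (fun t ht => h t (mem_finiteEigenvalues_of_hasEigenvalue ht)) w
  set g := restrictOp H₀ Y f - (E : ℂ) • f with hg
  have h2 : finOp H₀ B w - (E : ℂ) • w = restrictTo B (g : L2 V) := by
    ext k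
    have hkY : (k : V) ∈ Y := (Finset.mem_filter.1 k.2).2
    have h3 : (g : L2 V) k = H₀ (f : L2 V) k - (E : ℂ) * (f : L2 V) k := by
      rw [← coe_restrictOp_apply f hkY]
      rfl
    rw [restrictTo_apply, h3, hH.apply_eq_sum]
    have h4 : (finOp H₀ B w - (E : ℂ) • w) k =
        (∑ j : B, (hop H₀ k j : ℂ) * (f : L2 V) j) - (E : ℂ) * (f : L2 V) k := rfl
    rw [h4]
    congr 1
    have h5 : ∑ j ∈ row H₀ (k : V), (if j ∈ B then (hop H₀ k j : ℂ) * (f : L2 V) j else 0) =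
        ∑ j ∈ B, (hop H₀ k j : ℂ) * (f : L2 V) j := sum_ite_mem_eq _ _ (fun _ => Iff.rfl) _
      fun j hj => by rw [hH.hop_eq_zero hj, Complex.ofReal_zero, zero_mul]
    rw [Finset.sum_coe_sort B fun j => (hop H₀ k j : ℂ) * (f : L2 V) j, ← h5]
    refine Finset.sum_congr rfl fun j _ => ?_
    split_ifs with hj
    · rfl
    · rw [hfB j hj, mul_zero]
  have hle : ∀ u : L2 V, ‖restrictTo B u‖ ≤ ‖u‖ := fun u => by
    rw [EuclideanSpace.norm_eq]
    apply Real.sqrt_le_iff.2 ⟨norm_nonneg _, ?_⟩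
    have := lp.sum_rpow_le_norm_rpow (p := 2) (by norm_num) u B
    simp only [ENNReal.toReal_ofNat, Real.rpow_ofNat] at this
    rw [← Finset.sum_coe_sort B] at this
    exact this
  have hge : ‖f‖ = ‖w‖ := by
    have h5 := lp.norm_rpow_eq_tsum (p := 2) (by norm_num) (f : L2 V)
    simp only [ENNReal.toReal_ofNat, Real.rpow_ofNat] at h5
    rw [tsum_eq_sum (s := B) fun k hk => by rw [hfB k hk]; simp] at h5
    rw [EuclideanSpace.norm_eq, Submodule.coe_norm, ← Real.sqrt_sq (norm_nonneg (f : L2 V)), h5,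
      ← Finset.sum_coe_sort B]
    rfl
  rw [hge]
  refine h1.trans ?_
  rw [h2, Submodule.coe_norm]
  exact hle _

theorem exists_tendsto_finite_support (f : l2On Y) :
    ∃ g : Finset V → l2On Y, Tendsto g atTop (𝓝 f) ∧ ∀ A, ∀ k, k ∉ A → (g A : L2 V) k = 0 := by
  classical
  have hmem : ∀ A : Finset V, ∑ j ∈ A, (f : L2 V) j • delta j ∈ l2On Y := fun A =>
    Submodule.sum_mem _ fun j _ => by
      by_cases hj : j ∈ Y
      · refine Submodule.smul_mem _ _ fun k hk => ?_
        rw [delta_apply, if_neg]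
        rintro rfl
        exact hk hj
      · rw [f.2 j hj, zero_smul]
        exact Submodule.zero_mem _
  refine ⟨fun A => ⟨_, hmem A⟩, ?_, fun A k hk => ?_⟩
  · rw [tendsto_subtype_rng]
    exact hasSum_smul_delta (f : L2 V)
  · simp only [lp.coeFn_sum, Finset.sum_apply, lp.coeFn_smul, Pi.smul_apply, delta_apply,
      smul_eq_mul, mul_ite, mul_one, mul_zero]
    exact Finset.sum_eq_zero fun j hj => if_neg fun h : k = j => hk (h ▸ hj)

/-- If `z` has distance `δ` from the finite eigenvalues, the lower bound on finitely supported
vectors extends by density to all vectors, contradicting the existence of an approximate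
eigenvector. -/
theorem spectrum_restrictOp_subset (hH : IsHopping H₀) :
    spectrum ℂ (restrictOp H₀ Y) ⊆ Complex.ofReal '' closure (finiteEigenvalues H₀) := by
  intro z hz
  obtain ⟨hre, hlt⟩ := exists_approx_eigenvector (isSelfAdjoint_restrictOp hH.isSelfAdjoint) hz
  refine ⟨z.re, ?_, hre.symm⟩
  by_contra hE
  obtain ⟨δ, hδ, hball⟩ := Metric.isOpen_iff.1 isClosed_closure.isOpen_compl z.re hE
  have h1 : ∀ t ∈ finiteEigenvalues H₀, δ ≤ |t - z.re| := by
    intro t ht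
    by_contra hlt
    exact hball (Metric.mem_ball.2 (not_le.1 hlt)) (subset_closure ht)
  obtain ⟨f, hf⟩ := hlt δ hδ
  refine hf.not_ge ?_
  obtain ⟨g, hg, hgA⟩ := exists_tendsto_finite_support f
  refine le_of_tendsto_of_tendsto (hg.norm.const_mul δ)
    ((((restrictOp H₀ Y).continuous.tendsto f).comp hg).sub (hg.const_smul (z.re : ℂ))).norm
    (Eventually.of_forall fun A => ?_)
  exact mul_norm_le_of_finite_support hH hδ.le h1 (g A) (hgA A)

theorem mem_spectrum_of_mem_sigmaFin (hH : IsHopping H₀) {q : V → ℝ≥0∞}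
    (hq : ∀ k ∈ Y, q k = 0 ∨ q k = ∞) {E : ℝ} (hE : E ∈ sigmaFin H₀ q Y) :
    (E : ℂ) ∈ spectrum ℂ (restrictOp H₀ Y) := by
  obtain ⟨f, hf0, hfY, hf⟩ := hE
  have hmem : ofFinsupp f ∈ l2On Y := fun k hk => by
    rw [ofFinsupp_apply]
    by_contra h
    exact hk (hfY (Finsupp.mem_support_iff.2 h))
  set g : l2On Y := ⟨ofFinsupp f, hmem⟩ with hg
  have hgk : ∀ k, (g : L2 V) k = f k := ofFinsupp_apply f
  have hg0 : g ≠ 0 := fun h => hf0 (by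
    ext k
    rw [← hgk k, h]
    rfl)
  have h1 : restrictOp H₀ Y g = (E : ℂ) • g := by
    ext k
    by_cases hk : k ∈ Y
    · rw [coe_restrictOp_apply g hk, hH.apply_eq_sum]
      have h2 := hf k hk
      have h3 : (q k).toReal = 0 := by rcases hq k hk with h | h <;> simp [h]
      rw [h3, Complex.ofReal_zero, zero_mul, zero_add, ← hgk k] at h2
      refine Eq.trans ?_ h2
      classical
      have h5 : ∑ j ∈ row H₀ k, (if j ∈ f.support then (hop H₀ k j : ℂ) * f j else 0) =
          ∑ j ∈ f.support, (hop H₀ k j : ℂ) * f j := sum_ite_mem_eq _ _ (fun _ => Iff.rfl) _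
        fun j hj => by rw [hH.hop_eq_zero hj, Complex.ofReal_zero, zero_mul]
      rw [Finsupp.sum, ← h5]
      refine Finset.sum_congr rfl fun j _ => ?_
      split_ifs with hj
      · rw [hgk]
      · rw [hgk, Finsupp.notMem_support_iff.1 hj, mul_zero]
    · rw [(restrictOp H₀ Y g).2 k hk]
      exact (((E : ℂ) • g).2 k hk).symm
  intro hu
  obtain ⟨S, hS⟩ := hu.exists_left_inv
  have h2 := congrArg (fun T : l2On Y →L[ℂ] l2On Y => T g) hS
  have h3 : (algebraMap ℂ (l2On Y →L[ℂ] l2On Y) (E : ℂ) - restrictOp H₀ Y) g = 0 := by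
    rw [_root_.sub_apply, h1, Algebra.algebraMap_eq_smul_one, _root_.smul_apply, sub_eq_zero]
    rfl
  apply hg0
  have h4 : (S * (algebraMap ℂ (l2On Y →L[ℂ] l2On Y) (E : ℂ) - restrictOp H₀ Y)) g = g := h2
  rw [← h4, mul_apply_eq_comp, h3, map_zero]

theorem spectrum_restrictOp_eq (hH : IsHopping H₀) {q : V → ℝ≥0∞}
    (hq : ∀ k ∈ Y, q k = 0 ∨ q k = ∞) (h : sigmaFin H₀ q Y = finiteEigenvalues H₀) :
    spectrum ℂ (restrictOp H₀ Y) = Complex.ofReal '' closure (finiteEigenvalues H₀) := by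
  refine (spectrum_restrictOp_subset hH).antisymm ?_
  have h1 : finiteEigenvalues H₀ ⊆ Complex.ofReal ⁻¹' spectrum ℂ (restrictOp H₀ Y) := by
    intro E hE
    rw [← h] at hE
    exact mem_spectrum_of_mem_sigmaFin hH hq hE
  have h2 := closure_minimal h1 ((spectrum.isClosed (𝕜 := ℂ) (restrictOp H₀ Y)).preimage
    Complex.continuous_ofReal)
  rintro _ ⟨E, hE, rfl⟩
  exact h2 hE

end Spectrum

/-! ### Cocompact actions on locally finite graphs -/

section Graphs

variable {V Γ : Type*} [Group Γ] [MulAction Γ V] {X : SimpleGraph V} {F : Finset V}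
  {H₀ : L2 V →L[ℂ] L2 V}

theorem finite_walk_length (hX : ∀ v, (X.neighborSet v).Finite) (n : ℕ) (v : V) :
    {w | ∃ p : X.Walk v w, p.length = n}.Finite := by
  induction n generalizing v with
  | zero =>
    refine (Set.finite_singleton v).subset ?_
    rintro w ⟨p, hp⟩
    exact (SimpleGraph.Walk.eq_of_length_eq_zero hp).symm
  | succ n ih =>
    refine ((hX v).biUnion fun u _ => ih u).subset ?_
    rintro w ⟨p, hp⟩
    cases p with
    | nil => simp at hp
    | cons h p => exact Set.mem_biUnion h ⟨p, by simpa using hp⟩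

theorem finite_dist_lt (hX : X.Connected) (hf : ∀ v, (X.neighborSet v).Finite) (R : ℕ) (v : V) :
    {w | X.dist v w < R}.Finite := by
  refine ((Finset.range R).finite_toSet.biUnion fun n _ => finite_walk_length hf n v).subset ?_
  intro w hw
  obtain ⟨p, hp⟩ := hX.exists_walk_length_eq_dist v w
  exact Set.mem_biUnion (Finset.mem_coe.2 (Finset.mem_range.2 hw)) ⟨p, hp⟩

theorem countable_of_connected (hX : X.Connected) (hf : ∀ v, (X.neighborSet v).Finite) :
    Countable V := by
  obtain ⟨v⟩ := hX.nonempty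
  rw [← Set.countable_univ_iff]
  refine (Set.countable_iUnion fun n => (finite_walk_length hf n v).countable).mono fun w _ => ?_
  obtain ⟨p⟩ := hX.preconnected v w
  exact Set.mem_iUnion.2 ⟨p.length, p, rfl⟩

theorem IsCocompactAction.isFiniteQuotient (h : IsCocompactAction X Γ F) :
    IsFiniteQuotient Γ F where
  finite_stabilizer := h.finite_stabilizer
  covers := h.covers
  nonempty := by
    obtain ⟨v⟩ := h.connected.nonempty
    obtain ⟨γ, hγ⟩ := h.covers v
    exact ⟨_, hγ⟩

/-- The orbit map `γ ↦ γ • x` goes to a countable set and has finite fibres. -/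
theorem IsFiniteQuotient.countable_group [Countable V] (hF : IsFiniteQuotient Γ F) :
    Countable Γ := by
  obtain ⟨x, -⟩ := hF.nonempty
  rw [← Set.countable_univ_iff]
  refine (Set.countable_iUnion fun k : V => (hF.finite_transporter x {k}).countable).mono
    fun γ _ => Set.mem_iUnion.2 ⟨γ • x, ?_⟩
  simp

theorem IsGraphHopping.isInvariantHopping (h : IsCocompactAction X Γ F)
    (hH : IsGraphHopping X Γ H₀) : IsInvariantHopping Γ H₀ where
  real := hH.real
  symm := hH.symm
  finite_row k := by
    obtain ⟨R, hR⟩ := hH.finite_range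
    refine (finite_dist_lt h.connected h.locally_finite R k).subset fun j hj => ?_
    by_contra hlt
    exact hj (by rw [hop, hR k j (not_lt.1 hlt), Complex.zero_re])
  invariant γ k j := by rw [hop, hop, hH.invariant]

theorem finiteEigenvalues_zero_infinity [Countable V] {P : Measure (V → ℝ≥0∞)}
    [IsProbabilityMeasure P] (hH : IsHopping H₀) (hN : NonrandomSigmaFin P H₀ active)
    (hq : ∀ᵐ ω ∂P, ∀ k, ω k = 0 ∨ ω k = ∞)
    (hind : ProbabilityTheory.iIndepFun (fun (k : V) (ω : V → ℝ≥0∞) => ω k) P)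
    (h0 : ∀ k, P {ω | ω k = 0} ≠ 0) (h1 : ∀ k, P {ω | ω k = ∞} ≠ 0) :
    SigmaFin P H₀ active = finiteEigenvalues H₀ ∧
      (∀ᵐ ω ∂P, spectrum ℂ (restrictOp H₀ (active ω)) =
        Complex.ofReal '' closure (finiteEigenvalues H₀)) := by
  have h2 := (SigmaFin_subset_finiteEigenvalues hq).antisymm
    (finiteEigenvalues_subset_SigmaFin hH hind h0 h1 hN)
  refine ⟨h2, ?_⟩
  filter_upwards [ae_sigmaFin_eq hq hN, hq] with ω h3 h4
  exact spectrum_restrictOp_eq hH (fun k _ => h4 k) (h3.trans h2)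

/-- Finitely supported eigenfunctions and the density of states on graphs with an amenable group
action. -/
theorem graph_percolation (hX : IsCocompactAction X Γ F) {I : ℕ → Finset Γ} (hI : IsFolner I)
    {P : Measure (V → ℝ≥0∞)} [IsProbabilityMeasure P] (hP : IsStationaryErgodic Γ P)
    (hH : IsGraphHopping X Γ H₀) :
    NonrandomSigmaFin P H₀ active ∧ NonrandomSigmaFin P H₀ (infCluster H₀) ∧
    (∃ φ : ℕ → ℕ, StrictMono φ ∧ ∃ ν νinf : Measure ℝ,
      IsIDS P H₀ active (exhaustion F (I ∘ φ)) ν ∧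
      IsIDS P H₀ (infCluster H₀) (exhaustion F (I ∘ φ)) νinf) ∧
    (∀ ν : Measure ℝ, IsIDS P H₀ active (exhaustion F I) ν →
      SigmaFin P H₀ active = atoms ν) ∧
    ((∀ᵐ ω ∂P, ∀ k, ω k = 0 ∨ ω k = ∞) →
      SigmaFin P H₀ active ⊆ finiteEigenvalues H₀ ∧
      (∀ᵐ ω ∂P, sigmaFin H₀ ω (active ω) = SigmaFin P H₀ active) ∧
      (ProbabilityTheory.iIndepFun (fun (k : V) (ω : V → ℝ≥0∞) => ω k) P →
        (∀ k, P {ω | ω k = 0} ≠ 0) → (∀ k, P {ω | ω k = ∞} ≠ 0) →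
        SigmaFin P H₀ active = finiteEigenvalues H₀ ∧
        (∀ᵐ ω ∂P, spectrum ℂ (restrictOp H₀ (active ω)) =
          Complex.ofReal '' closure (finiteEigenvalues H₀)) ∧
        (IsAdjacencyOperator X H₀ → ∀ E ∈ finiteEigenvalues H₀, IsIntegral ℤ E))) ∧
    (∀ νinf : Measure ℝ, IsIDS P H₀ (infCluster H₀) (exhaustion F I) νinf →
      SigmaFin P H₀ (infCluster H₀) = atoms νinf) := by
  have hV : Countable V := countable_of_connected hX.connected hX.locally_finite
  have hF := hX.isFiniteQuotient
  have hΓ : Countable Γ := hF.countable_group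
  have hH' := hH.isInvariantHopping hX
  have hact : IsRandomSet Γ (active (V := V)) := isRandomSet_active
  have hinf := isRandomSet_infCluster hH'
  obtain ⟨φ, hφ, ν, ν', hν, hν'⟩ := exists_subseq_isIDS hP hF hI hH' hact hinf
  -- Nonrandomness does not refer to the exhaustion, so an IDS along a subsequence is enough to
  -- derive it.
  have hN := (nonrandomSigmaFin_and_eq_atoms hP hF (hI.comp_strictMono hφ) hH' hact hν).1
  refine ⟨hN, (nonrandomSigmaFin_and_eq_atoms hP hF (hI.comp_strictMono hφ) hH' hinf hν').1,
    ⟨φ, hφ, ν, ν', hν, hν'⟩,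
    fun ν hν => (nonrandomSigmaFin_and_eq_atoms hP hF hI hH' hact hν).2, fun hq => ?_,
    fun ν hν => (nonrandomSigmaFin_and_eq_atoms hP hF hI hH' hinf hν).2⟩
  refine ⟨SigmaFin_subset_finiteEigenvalues hq, ae_sigmaFin_eq hq hN, fun hind h0 h1 => ?_⟩
  have h2 := finiteEigenvalues_zero_infinity hH'.toIsHopping hN hq hind h0 h1
  refine ⟨h2.1, h2.2, fun hadj E hE => isIntegral_of_mem_finiteEigenvalues (fun k j => ?_) hE⟩
  by_cases hkj : X.Adj k j
  · exact ⟨1, by rw [hop, hadj, if_pos hkj]; simp⟩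
  · exact ⟨0, by rw [hop, hadj, if_neg hkj]; simp⟩

end Graphs

/-! ### Boxes as a Følner sequence of the translation group -/

section Boxes

variable {d : ℕ}

theorem mem_box {L : ℕ} {k : Fin d → ℤ} : k ∈ box d L ↔ ∀ i, |k i| ≤ L := by
  rw [box, Finset.mem_Icc, Pi.le_def, Pi.le_def, ← forall_and]
  simp_rw [abs_le]

theorem card_box (L : ℕ) : (box d L).card = (2 * L + 1) ^ d := by
  rw [box, Pi.card_Icc]
  simp only [Int.card_Icc, Finset.prod_const, Finset.card_univ, Fintype.card_fin]
  congr 1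
  omega

theorem zero_mem_box (L : ℕ) : (0 : Fin d → ℤ) ∈ box d L := mem_box.2 (by simp)

theorem add_mem_box {L M : ℕ} {k j : Fin d → ℤ} (hk : k ∈ box d L) (hj : j ∈ box d M) :
    k + j ∈ box d (L + M) := by
  rw [mem_box] at *
  intro i
  push_cast
  exact (abs_add_le _ _).trans (add_le_add (hk i) (hj i))

theorem neg_mem_box {L : ℕ} {k : Fin d → ℤ} : -k ∈ box d L ↔ k ∈ box d L := by
  simp [mem_box]

theorem box_mono : Monotone (box d) := fun L M h k hk => by
  rw [mem_box] at *
  exact fun i => (hk i).trans (by exact_mod_cast h)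

theorem exists_mem_box (k : Fin d → ℤ) : ∃ L, k ∈ box d L := by
  refine ⟨∑ i, (k i).natAbs, mem_box.2 fun i => ?_⟩
  rw [Int.abs_eq_natAbs, Nat.cast_le]
  exact Finset.single_le_sum (f := fun i => (k i).natAbs) (fun _ _ => Nat.zero_le _)
    (Finset.mem_univ i)

theorem exists_subset_box (A : Finset (Fin d → ℤ)) : ∃ L, A ⊆ box d L := by
  choose L hL using exists_mem_box (d := d)
  exact ⟨A.sup L, fun k hk => box_mono (Finset.le_sup hk) (hL k)⟩

/-- The box as a subset of the group of translations. -/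
def boxGroup (d : ℕ) (L : ℕ) : Finset (Multiplicative (Fin d → ℤ)) :=
  (box d L).map Multiplicative.ofAdd.toEmbedding

theorem mem_boxGroup {L : ℕ} {γ : Multiplicative (Fin d → ℤ)} :
    γ ∈ boxGroup d L ↔ γ.toAdd ∈ box d L := by
  rw [boxGroup, Finset.mem_map]
  constructor
  · rintro ⟨k, hk, rfl⟩
    exact hk
  · intro h
    exact ⟨_, h, rfl⟩

theorem card_boxGroup (L : ℕ) : (boxGroup d L).card = (2 * L + 1) ^ d := by
  rw [boxGroup, Finset.card_map, card_box]

theorem smul_eq_add (γ : Multiplicative (Fin d → ℤ)) (k : Fin d → ℤ) : γ • k = γ.toAdd + k := rfl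

/-- The symmetry of the box absorbs the inverse in the definition of the exhaustion. The lattice
becomes the case `F = {0}` of the graph setting. -/
theorem exhaustion_boxGroup : exhaustion {0} (boxGroup d) = box d := by
  ext L k
  rw [mem_exhaustion]
  constructor
  · rintro ⟨γ, hγ, h⟩
    rw [Finset.mem_singleton, smul_eq_add] at h
    rw [eq_neg_of_add_eq_zero_right h, neg_mem_box]
    exact mem_boxGroup.1 hγ
  · intro hk
    exact ⟨Multiplicative.ofAdd (-k), mem_boxGroup.2 (neg_mem_box.2 hk), by simp [smul_eq_add]⟩

theorem isFiniteQuotient_lattice :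
    IsFiniteQuotient (Multiplicative (Fin d → ℤ)) ({0} : Finset (Fin d → ℤ)) where
  finite_stabilizer v := by
    refine (Set.finite_singleton 1).subset fun γ hγ => ?_
    have h : γ.toAdd + v = v := hγ
    rw [add_eq_right] at h
    exact h
  covers v := ⟨Multiplicative.ofAdd (-v), by simp [smul_eq_add]⟩
  nonempty := Finset.singleton_nonempty _

theorem tendsto_card_box_div (d m : ℕ) :
    Tendsto (fun L : ℕ => ((2 * (L + m) + 1 : ℝ) ^ d / (2 * L + 1 : ℝ) ^ d)) atTop (𝓝 1) := by
  have h1 : Tendsto (fun L : ℕ => 1 + 2 * m * ((2 * L + 1 : ℝ))⁻¹) atTop (𝓝 (1 + 2 * m * 0)) := by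
    refine Tendsto.const_add _ (Tendsto.const_mul _ (tendsto_inv_atTop_zero.comp ?_))
    exact tendsto_atTop_add_const_right _ _
      (tendsto_natCast_atTop_atTop.const_mul_atTop two_pos)
  rw [mul_zero, add_zero] at h1
  have h2 := h1.pow d
  rw [one_pow] at h2
  refine h2.congr fun L => ?_
  rw [← div_pow]
  congr 1
  have : (2 * L + 1 : ℝ) ≠ 0 := by positivity
  field_simp
  ring

/-- If `K` lies in the box of radius `m`, both `I (L + m)` and `K I (L + m)` contain the box of
radius `L` and lie in that of radius `L + 2m`. The shell between these has vanishing relative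
volume. -/
theorem isFolner_boxGroup : IsFolner (boxGroup d) := by
  classical
  refine ⟨fun L => ⟨1, mem_boxGroup.2 (zero_mem_box L)⟩, fun K hK ε hε => ?_⟩
  obtain ⟨m, hm⟩ := exists_subset_box (K.image Multiplicative.toAdd)
  have hKm : ∀ γ ∈ K, γ.toAdd ∈ box d m := fun γ hγ => hm (Finset.mem_image_of_mem _ hγ)
  obtain ⟨γ₀, hγ₀⟩ := hK
  have h1 : ∀ L, symmDiff (boxGroup d (L + m)) (K * boxGroup d (L + m)) ⊆
      boxGroup d (L + 2 * m) \ boxGroup d L := by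
    intro L γ hγ
    rw [Finset.mem_sdiff]
    rw [Finset.mem_symmDiff] at hγ
    have hinner : ∀ γ, γ ∈ boxGroup d L → γ ∈ boxGroup d (L + m) ∧ γ ∈ K * boxGroup d (L + m) := by
      intro γ hγ
      refine ⟨mem_boxGroup.2 (box_mono (by omega) (mem_boxGroup.1 hγ)),
        Finset.mem_mul.2 ⟨γ₀, hγ₀, γ₀⁻¹ * γ, mem_boxGroup.2 ?_, mul_inv_cancel_left _ _⟩⟩
      rw [add_comm L m]
      exact add_mem_box (neg_mem_box.2 (hKm γ₀ hγ₀)) (mem_boxGroup.1 hγ)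
    refine ⟨?_, fun h => ?_⟩
    · rcases hγ with ⟨h, -⟩ | ⟨h, -⟩
      · exact mem_boxGroup.2 (box_mono (by omega) (mem_boxGroup.1 h))
      · obtain ⟨κ, hκ, σ, hσ, rfl⟩ := Finset.mem_mul.1 h
        rw [mem_boxGroup, show L + 2 * m = m + (L + m) by ring]
        exact add_mem_box (hKm κ hκ) (mem_boxGroup.1 hσ)
    · have := hinner γ h
      tauto
  have h2 : ∀ L, ((symmDiff (boxGroup d (L + m)) (K * boxGroup d (L + m))).card : ℝ) ≤
      (2 * (L + (2 * m : ℕ)) + 1 : ℝ) ^ d - (2 * L + 1 : ℝ) ^ d := by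
    intro L
    refine (Nat.cast_le.2 (Finset.card_le_card (h1 L))).trans_eq ?_
    have hsub : boxGroup d L ⊆ boxGroup d (L + 2 * m) := fun γ hγ =>
      mem_boxGroup.2 (box_mono (by omega) (mem_boxGroup.1 hγ))
    rw [Finset.card_sdiff_of_subset hsub, Nat.cast_sub (Finset.card_le_card hsub), card_boxGroup,
      card_boxGroup]
    push_cast
    rfl
  have h3 := (tendsto_order.1 (tendsto_card_box_div d (2 * m))).2 (1 + ε) (by linarith)
  obtain ⟨N, hN⟩ := eventually_atTop.1 h3
  filter_upwards [eventually_ge_atTop (N + m)] with L hL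
  obtain ⟨L, rfl⟩ : ∃ L', L = L' + m := ⟨L - m, by omega⟩
  refine le_trans (b := (2 * (L + (2 * m : ℕ)) + 1 : ℝ) ^ d - (2 * L + 1 : ℝ) ^ d)
    (by convert h2 L <;> rfl) ?_
  have h4 := hN L (by omega)
  rw [div_lt_iff₀ (by positivity)] at h4
  have h5 : (2 * L + 1 : ℝ) ^ d ≤ ((boxGroup d (L + m)).card : ℝ) := by
    rw [card_boxGroup]
    push_cast
    gcongr
    linarith
  have h6 := mul_le_mul_of_nonneg_left h5 hε.le
  push_cast at h4 ⊢
  linarith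

end Boxes

/-! ### Ergodicity of product measures -/

section ProductMeasure

variable {V : Type*} {μ : Measure ℝ≥0∞} [IsProbabilityMeasure μ] {Γ : Type*} [Group Γ]
  [MulAction Γ V]

theorem iIndepFun_eval :
    ProbabilityTheory.iIndepFun (fun (k : V) (ω : V → ℝ≥0∞) => ω k)
      (Measure.infinitePi fun _ : V => μ) :=
  ProbabilityTheory.iIndepFun_infinitePi (X := fun _ => id) fun _ => measurable_id

theorem infinitePi_eval (k : V) {T : Set ℝ≥0∞} (hT : MeasurableSet T) :
    (Measure.infinitePi fun _ : V => μ) {ω | ω k ∈ T} = μ T := by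
  have h := Measure.map_apply (μ := Measure.infinitePi fun _ : V => μ) (measurable_pi_apply k) hT
  rw [Measure.infinitePi_map_eval] at h
  exact h.symm

theorem measurePreserving_shift_infinitePi (γ : Γ) :
    MeasurePreserving (shift (V := V) γ) (Measure.infinitePi fun _ : V => μ)
      (Measure.infinitePi fun _ : V => μ) := by
  refine ⟨measurable_shift γ, ?_⟩
  have h := Measure.infinitePi_map_piCongrLeft (fun _ : V => μ) (MulAction.toPerm γ)
  refine Eq.trans ?_ h
  congr 1
  ext ω k
  rw [MeasurableEquiv.coe_piCongrLeft]
  have := Equiv.piCongrLeft_apply_apply (P := fun _ : V => ℝ≥0∞) (MulAction.toPerm γ) ω (γ⁻¹ • k)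
  rw [MulAction.toPerm_apply, smul_inv_smul] at this
  rw [this]
  rfl

/-- The events that depend on the coordinates in `S` only. -/
abbrev eventsOn (S : Set V) : MeasurableSpace (V → ℝ≥0∞) :=
  ⨆ k ∈ S, MeasurableSpace.comap (fun ω : V → ℝ≥0∞ => ω k) inferInstance

theorem measurable_eval_eventsOn {S : Set V} {k : V} (hk : k ∈ S) :
    Measurable[eventsOn S] fun ω : V → ℝ≥0∞ => ω k :=
  (comap_measurable _).mono (le_biSup (fun k => MeasurableSpace.comap
    (fun ω : V → ℝ≥0∞ => ω k) inferInstance) hk) le_rfl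

theorem eventsOn_le (S : Set V) : eventsOn S ≤ (inferInstance : MeasurableSpace (V → ℝ≥0∞)) :=
  iSup₂_le fun k _ => (measurable_pi_apply k).comap_le

theorem measure_inter_eq_mul_of_disjoint {S T : Set V} (hST : Disjoint S T)
    {A B : Set (V → ℝ≥0∞)} (hA : MeasurableSet[eventsOn S] A) (hB : MeasurableSet[eventsOn T] B) :
    (Measure.infinitePi fun _ : V => μ) (A ∩ B) =
      (Measure.infinitePi fun _ : V => μ) A * (Measure.infinitePi fun _ : V => μ) B := by
  have h := ProbabilityTheory.indep_iSup_of_disjoint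
    (fun k : V => (measurable_pi_apply (X := fun _ : V => ℝ≥0∞) k).comap_le)
    (iIndepFun_eval (μ := μ)) hST
  exact (ProbabilityTheory.Indep_iff _ _ _).1 h A B hA hB

theorem measurableSet_eventsOn_of_cylinder {S : Finset V} {B : Set (S → ℝ≥0∞)}
    (hB : MeasurableSet B) {T : Set V} (f : V → V) (hf : ∀ k ∈ S, f k ∈ T) :
    MeasurableSet[eventsOn T] {ω : V → ℝ≥0∞ | (fun k : S => ω (f k)) ∈ B} := by
  have h : Measurable[eventsOn T] fun (ω : V → ℝ≥0∞) (k : S) => ω (f k) :=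
    @measurable_pi_lambda _ _ _ (eventsOn T) _ _ fun k => measurable_eval_eventsOn (hf k k.2)
  exact h hB

theorem eq_zero_or_one_of_forall_abs_sub_sq_le {p : ℝ} (h : ∀ ε > 0, |p - p ^ 2| ≤ 4 * ε) :
    p = 0 ∨ p = 1 := by
  have h1 : |p - p ^ 2| ≤ 0 := le_of_forall_pos_le_add fun ε hε => by
    have := h (ε / 4) (by positivity)
    linarith
  have h2 : p * (1 - p) = 0 := by
    have := abs_nonpos_iff.1 h1
    linarith
  rcases mul_eq_zero.1 h2 with h | h
  · exact Or.inl h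
  · exact Or.inr (by linarith)

/-- Approximate an invariant event `A` by a cylinder `C` over a finite set and translate that set
off itself. Then `P(A)` is close to `P(C ∩ γ⁻¹ C) = P(C)²`, hence to `P(A)²`, so it is `0` or `1`.
-/
theorem isStationaryErgodic_infinitePi
    (hΓ : ∀ S : Finset V, ∃ γ : Γ, ∀ k ∈ S, ∀ j ∈ S, γ • k ≠ j) :
    IsStationaryErgodic Γ (Measure.infinitePi fun _ : V => μ) := by
  classical
  refine ⟨measurePreserving_shift_infinitePi, fun A hA hinv => ?_⟩
  set P := Measure.infinitePi fun _ : V => μ with hP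
  have key : ∀ ε > 0, |P.real A - P.real A ^ 2| ≤ 4 * ε := by
    intro ε hε
    have hdense : P.MeasureDense (measurableCylinders fun _ : V => ℝ≥0∞) :=
      Measure.MeasureDense.of_generateFrom_isSetAlgebra_finite P isSetAlgebra_measurableCylinders
        generateFrom_measurableCylinders.symm
    obtain ⟨t, ht, hAt⟩ := hdense.approx A hA (measure_ne_top _ _) ε hε
    obtain ⟨S, B, hB, rfl⟩ := (mem_measurableCylinders _).1 ht
    obtain ⟨γ, hγ⟩ := hΓ S
    set C := cylinder (α := fun _ : V => ℝ≥0∞) S B with hC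
    have hCm : MeasurableSet C := hB.cylinder S
    have hdiff : P.real (symmDiff A C) ≤ ε :=
      ENNReal.toReal_le_of_le_ofReal hε.le hAt.le
    have hpre : ∀ D, MeasurableSet D → P.real (shift γ ⁻¹' D) = P.real D := fun D hD => by
      rw [measureReal_def, measureReal_def,
        (measurePreserving_shift_infinitePi (μ := μ) γ).measure_preimage hD.nullMeasurableSet]
    have hind : P.real (C ∩ shift γ ⁻¹' C) = P.real C * P.real C := by
      have h1 : P (C ∩ shift γ ⁻¹' C) = P C * P (shift γ ⁻¹' C) := by
        refine measure_inter_eq_mul_of_disjoint (S := (S : Set V)) (T := {j | γ • j ∈ S}) ?_ ?_ ?_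
        · rw [Set.disjoint_left]
          intro k hk hk'
          exact hγ k hk _ hk' rfl
        · exact measurableSet_eventsOn_of_cylinder hB id fun k hk => hk
        · refine measurableSet_eventsOn_of_cylinder hB (fun k => γ⁻¹ • k) fun k hk => ?_
          simpa using hk
      rw [measureReal_def, h1, ENNReal.toReal_mul, ← measureReal_def, ← measureReal_def,
        hpre C hCm]
    have hclose : |P.real A - P.real C| ≤ ε :=
      (abs_measureReal_sub_le_measureReal_symmDiff hA.nullMeasurableSet
        hCm.nullMeasurableSet).trans hdiff
    have hclose' : |P.real A - P.real (C ∩ shift γ ⁻¹' C)| ≤ 2 * ε := by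
      have h2 : P.real A = P.real (A ∩ shift γ ⁻¹' A) := by rw [hinv γ, Set.inter_self]
      have hSC := (measurable_shift (V := V) γ) hCm
      rw [h2]
      refine (abs_measureReal_sub_le_measureReal_symmDiff
        (hA.inter ((measurable_shift γ) hA)).nullMeasurableSet
        (hCm.inter hSC).nullMeasurableSet).trans ?_
      have h3 : symmDiff (A ∩ shift γ ⁻¹' A) (C ∩ shift γ ⁻¹' C) ⊆
          symmDiff A C ∪ shift γ ⁻¹' (symmDiff A C) := by
        intro ω
        simp only [Set.mem_symmDiff, Set.mem_inter_iff, Set.mem_preimage, Set.mem_union]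
        tauto
      refine (measureReal_mono h3).trans ((measureReal_union_le _ _).trans ?_)
      rw [hpre _ (hA.symmDiff hCm)]
      linarith
    rw [hind] at hclose'
    rw [abs_le] at hclose hclose' ⊢
    have hA1 : P.real A ≤ 1 := measureReal_le_one
    have hC1 : P.real C ≤ 1 := measureReal_le_one
    have hA0 : 0 ≤ P.real A := measureReal_nonneg
    have hC0 : 0 ≤ P.real C := measureReal_nonneg
    -- An error of `2ε` comes from replacing `A` by `C` in the intersection, and another `2ε` from
    -- the difference of the squares, both probabilities being at most `1`.
    constructor <;> nlinarith
  rcases eq_zero_or_one_of_forall_abs_sub_sq_le key with h | h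
  · exact Or.inl ((measureReal_eq_zero_iff).1 h)
  · right
    rw [measureReal_def] at h
    exact (ENNReal.toReal_eq_one_iff _).1 h

theorem isStationaryErgodic_lattice {d : ℕ} (hd : 1 ≤ d) :
    IsStationaryErgodic (Multiplicative (Fin d → ℤ))
      (Measure.infinitePi fun _ : Fin d → ℤ => μ) := by
  refine isStationaryErgodic_infinitePi fun S => ?_
  obtain ⟨L, hL⟩ := exists_subset_box S
  -- A translation by more than the width of a box containing `S` moves `S` off itself; a coordinate
  -- in which this is seen exists because `d ≥ 1`.
  refine ⟨Multiplicative.ofAdd fun _ => 2 * L + 1, fun k hk j hj h => ?_⟩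
  have h1 := abs_le.1 (mem_box.1 (hL hk) ⟨0, hd⟩)
  have h2 := abs_le.1 (mem_box.1 (hL hj) ⟨0, hd⟩)
  have h3 := congrFun h ⟨0, hd⟩
  rw [smul_eq_add, Pi.add_apply, toAdd_ofAdd] at h3
  omega

end ProductMeasure

/-! ### Vitali covering and the maximal inequality for boxes -/

section MaximalInequality

variable {d : ℕ}

theorem mem_closedBall_iff_sub_mem_box {x y : Fin d → ℤ} {L : ℕ} :
    y ∈ Metric.closedBall x (L : ℝ) ↔ y - x ∈ box d L := by
  rw [Metric.mem_closedBall, dist_pi_le_iff (Nat.cast_nonneg L), mem_box]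
  refine forall_congr' fun i => ?_
  rw [Int.dist_eq, Pi.sub_apply]
  exact_mod_cast Iff.rfl

theorem card_box_mul_le (L : ℕ) : (box d (5 * L)).card ≤ 5 ^ d * (box d L).card := by
  rw [card_box, card_box, ← mul_pow]
  exact Nat.pow_le_pow_left (by omega) d

/-- The translate of a box. -/
def boxAt (L : ℕ) (x : Fin d → ℤ) : Finset (Fin d → ℤ) := (box d L).map (addRightEmbedding x)

theorem mem_boxAt {L : ℕ} {x y : Fin d → ℤ} : y ∈ boxAt L x ↔ y - x ∈ box d L := by
  rw [boxAt, Finset.mem_map]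
  constructor
  · rintro ⟨z, hz, rfl⟩
    simpa using hz
  · intro h
    exact ⟨_, h, by simp⟩

open Classical in
/-- The Hardy–Littlewood maximal inequality for boxes in the lattice. -/
theorem card_maximal_le {W : (Fin d → ℤ) → ℝ} (hW : ∀ y, 0 ≤ W y) {t : ℝ} (N M : ℕ) :
    t * ((box d M).filter fun x => ∃ L ≤ N, t * (box d L).card < ∑ z ∈ box d L, W (z + x)).card ≤
      5 ^ d * ∑ y ∈ box d (M + N), W y := by
  rcases le_or_gt t 0 with ht | ht
  · exact (mul_nonpos_of_nonpos_of_nonneg ht (Nat.cast_nonneg _)).trans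
      (mul_nonneg (by positivity) (Finset.sum_nonneg fun y _ => hW y))
  set S := (box d M).filter fun x => ∃ L ≤ N, t * (box d L).card < ∑ z ∈ box d L, W (z + x)
    with hS
  have hex : ∀ x, ∃ L, x ∈ S → L ≤ N ∧ t * (box d L).card < ∑ z ∈ box d L, W (z + x) := by
    intro x
    by_cases hx : x ∈ S
    · obtain ⟨L, hL⟩ := (Finset.mem_filter.1 hx).2
      exact ⟨L, fun _ => hL⟩
    · exact ⟨0, fun h => absurd h hx⟩
  choose r hr using hex
  -- Boxes are closed balls of the sup metric. The chosen ones are disjoint, so the sums of `W` over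
  -- them add up, and their enlargements by the factor `5`, which cost `5 ^ d` in volume, cover all
  -- bad points.
  obtain ⟨u, huS, hdisj, hcov⟩ := Vitali.exists_disjoint_subfamily_covering_enlargement_closedBall
    (S : Set (Fin d → ℤ)) id (fun x => (r x : ℝ)) N
    (fun x hx => Nat.cast_le.2 (hr x hx).1) 5 (by norm_num)
  have hfin : u.Finite := S.finite_toSet.subset huS
  set U := hfin.toFinset with hU
  have hUS : ∀ b ∈ U, b ∈ S := fun b hb => huS (hfin.mem_toFinset.1 hb)
  have h1 : S ⊆ U.biUnion fun b => boxAt (5 * r b) b := by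
    intro x hx
    obtain ⟨b, hb, hsub⟩ := hcov x hx
    have h2 : x ∈ Metric.closedBall b (((5 * r b : ℕ) : ℝ)) := by
      push_cast
      exact hsub (Metric.mem_closedBall_self (Nat.cast_nonneg _))
    exact Finset.mem_biUnion.2 ⟨b, hfin.mem_toFinset.2 hb,
      mem_boxAt.2 (mem_closedBall_iff_sub_mem_box.1 h2)⟩
  have h2 : (S.card : ℝ) ≤ ∑ b ∈ U, 5 ^ d * ((box d (r b)).card : ℝ) := by
    refine (Nat.cast_le.2 ((Finset.card_le_card h1).trans Finset.card_biUnion_le)).trans ?_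
    rw [Nat.cast_sum]
    refine Finset.sum_le_sum fun b _ => ?_
    rw [boxAt, Finset.card_map]
    exact_mod_cast card_box_mul_le (r b)
  have h3 : ∀ b ∈ U, t * ((box d (r b)).card : ℝ) ≤ ∑ y ∈ boxAt (r b) b, W y := by
    intro b hb
    rw [boxAt, Finset.sum_map]
    exact (hr b (hUS b hb)).2.le
  have h4 : ∑ b ∈ U, ∑ y ∈ boxAt (r b) b, W y ≤ ∑ y ∈ box d (M + N), W y := by
    rw [← Finset.sum_biUnion]
    · refine Finset.sum_le_sum_of_subset_of_nonneg ?_ fun y _ _ => hW y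
      intro y hy
      obtain ⟨b, hb, hy⟩ := Finset.mem_biUnion.1 hy
      have h5 := add_mem_box (Finset.mem_filter.1 (hUS b hb)).1
        (box_mono (hr b (hUS b hb)).1 (mem_boxAt.1 hy))
      rwa [add_sub_cancel] at h5
    · intro b hb b' hb' hne
      rw [Function.onFun, Finset.disjoint_left]
      intro y hy hy'
      have h5 := hdisj (hfin.mem_toFinset.1 hb) (hfin.mem_toFinset.1 hb') hne
      exact Set.disjoint_left.1 h5 (mem_closedBall_iff_sub_mem_box.2 (mem_boxAt.1 hy))
        (mem_closedBall_iff_sub_mem_box.2 (mem_boxAt.1 hy'))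
  calc t * (S.card : ℝ) ≤ t * ∑ b ∈ U, 5 ^ d * ((box d (r b)).card : ℝ) := by gcongr
    _ = 5 ^ d * ∑ b ∈ U, t * ((box d (r b)).card : ℝ) := by
      rw [Finset.mul_sum, Finset.mul_sum]
      exact Finset.sum_congr rfl fun b _ => by ring
    _ ≤ 5 ^ d * ∑ b ∈ U, ∑ y ∈ boxAt (r b) b, W y := by
      gcongr with b hb
      exact h3 b hb
    _ ≤ 5 ^ d * ∑ y ∈ box d (M + N), W y := by gcongr

end MaximalInequality

/-! ### The pointwise ergodic theorem for the lattice -/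

section PointwiseErgodic

variable {d : ℕ} {P : Measure ((Fin d → ℤ) → ℝ≥0∞)} [IsProbabilityMeasure P]

theorem sum_boxGroup (f : Multiplicative (Fin d → ℤ) → ℝ) (L : ℕ) :
    ∑ γ ∈ boxGroup d L, f γ = ∑ z ∈ box d L, f (Multiplicative.ofAdd z) := by
  rw [boxGroup, Finset.sum_map]
  rfl

/-- Transference: the lattice inequality is applied to `y ↦ w (shift y ω)` along each orbit and
integrated. By stationarity every site contributes equally, and after division by the volume of the
box of radius `M` the enlargement from `M` to `M + N` disappears in the limit. -/
theorem measureReal_maximal_le_of_le (hP : IsStationaryErgodic (Multiplicative (Fin d → ℤ)) P)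
    {w : ((Fin d → ℤ) → ℝ≥0∞) → ℝ} (hw : Measurable w) (h0 : ∀ ω, 0 ≤ w ω) {C : ℝ}
    (hC : ∀ ω, |w ω| ≤ C) (t : ℝ) (N : ℕ) :
    t * P.real {ω | ∃ L ≤ N, t < ergAvg (boxGroup d) w L ω} ≤ 5 ^ d * ∫ ω, w ω ∂P := by
  classical
  set G := {ω | ∃ L ≤ N, t < ergAvg (boxGroup d) w L ω} with hG
  have hGm : MeasurableSet G := by
    have : G = ⋃ L ∈ Finset.range (N + 1), {ω | t < ergAvg (boxGroup d) w L ω} := by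
      ext ω
      simp [hG]
    rw [this]
    exact Finset.measurableSet_biUnion _ fun L _ =>
      measurableSet_lt measurable_const (measurable_ergAvg hw L)
  have hshift : ∀ γ : Multiplicative (Fin d → ℤ), ∫ ω, w (shift γ ω) ∂P = ∫ ω, w ω ∂P := by
    intro γ
    have h1 : ∫ ω, w ω ∂(P.map (shift γ)) = ∫ ω, w (shift γ ω) ∂P :=
      integral_map (hP.1 γ).measurable.aemeasurable hw.aestronglyMeasurable
    rw [(hP.1 γ).map_eq] at h1
    exact h1.symm
  have hint : ∀ γ : Multiplicative (Fin d → ℤ), Integrable (fun ω => w (shift γ ω)) P := fun γ =>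
    integrable_of_bounded (hw.comp (measurable_shift γ)) fun ω => hC _
  have hcount : ∀ M ω, t * ∑ x ∈ box d M, (G.indicator 1 (shift (Multiplicative.ofAdd x) ω) : ℝ) ≤
      5 ^ d * ∑ y ∈ box d (M + N), w (shift (Multiplicative.ofAdd y) ω) := by
    intro M ω
    have h1 := card_maximal_le (d := d) (W := fun y => w (shift (Multiplicative.ofAdd y) ω))
      (fun y => h0 _) (t := t) N M
    refine le_trans (le_of_eq ?_) h1
    congr 1
    rw [← Finset.sum_boole]
    refine Finset.sum_congr rfl fun x _ => ?_
    rw [Set.indicator_apply]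
    refine if_congr ?_ rfl rfl
    simp only [hG, Set.mem_ofPred_eq]
    refine exists_congr fun L => and_congr_right fun _ => ?_
    have hc : (0 : ℝ) < (box d L).card := Nat.cast_pos.2 (Finset.card_pos.2 ⟨0, zero_mem_box L⟩)
    rw [ergAvg, sum_boxGroup, boxGroup, Finset.card_map, lt_div_iff₀ hc]
    simp_rw [ofAdd_add, shift_mul]
  have hmeas : ∀ M, t * ((box d M).card * P.real G) ≤
      5 ^ d * ((box d (M + N)).card * ∫ ω, w ω ∂P) := by
    intro M
    have hi : ∀ x : Fin d → ℤ, Integrable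
        (fun ω => (G.indicator 1 (shift (Multiplicative.ofAdd x) ω) : ℝ)) P := fun x =>
      integrable_of_bounded (C := 1) ((measurable_one.indicator hGm).comp (measurable_shift _))
        fun ω => by
          rw [Set.indicator_apply]
          split_ifs <;> simp
    have h1 : ∫ ω, t * ∑ x ∈ box d M, (G.indicator 1 (shift (Multiplicative.ofAdd x) ω) : ℝ) ∂P ≤
        ∫ ω, 5 ^ d * ∑ y ∈ box d (M + N), w (shift (Multiplicative.ofAdd y) ω) ∂P :=
      integral_mono ((integrable_finsetSum _ fun x _ => hi x).const_mul t)
        ((integrable_finsetSum _ fun y _ => hint _).const_mul _) (hcount M)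
    rw [integral_const_mul, integral_const_mul, integral_finsetSum _ fun x _ => hi x,
      integral_finsetSum _ fun y _ => hint _] at h1
    simp_rw [hshift] at h1
    have h2 : ∀ x : Fin d → ℤ,
        ∫ ω, (G.indicator 1 (shift (Multiplicative.ofAdd x) ω) : ℝ) ∂P = P.real G := by
      intro x
      have h3 : ∀ ω : (Fin d → ℤ) → ℝ≥0∞,
          (G.indicator 1 (shift (Multiplicative.ofAdd x) ω) : ℝ) =
          (shift (Multiplicative.ofAdd x) ⁻¹' G).indicator 1 ω := fun ω => rfl
      simp_rw [h3]
      rw [integral_indicator_one ((measurable_shift _) hGm), measureReal_def,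
        (hP.1 _).measure_preimage hGm.nullMeasurableSet, ← measureReal_def]
    simp_rw [h2] at h1
    simpa using h1
  refine le_of_tendsto_of_tendsto (f := fun _ : ℕ => t * P.real G) tendsto_const_nhds
    (((tendsto_card_box_div d N).mul_const (∫ ω, w ω ∂P)).const_mul (5 ^ d) |>.trans_eq ?_)
    (Eventually.of_forall fun M => ?_)
  · rw [one_mul]
  · have h1 := hmeas M
    have hc : (0 : ℝ) < (2 * M + 1 : ℝ) ^ d := by positivity
    rw [card_box, card_box] at h1
    push_cast at h1
    dsimp only
    rw [div_mul_eq_mul_div, ← mul_div_assoc, le_div_iff₀ hc]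
    linarith

theorem measureReal_maximal_le (hP : IsStationaryErgodic (Multiplicative (Fin d → ℤ)) P)
    {w : ((Fin d → ℤ) → ℝ≥0∞) → ℝ} (hw : Measurable w) (h0 : ∀ ω, 0 ≤ w ω) {C : ℝ}
    (hC : ∀ ω, |w ω| ≤ C) (t : ℝ) :
    t * P.real {ω | ∃ L, t < ergAvg (boxGroup d) w L ω} ≤ 5 ^ d * ∫ ω, w ω ∂P := by
  have h1 : Tendsto (fun N : ℕ => P {ω | ∃ L ≤ N, t < ergAvg (boxGroup d) w L ω}) atTop
      (𝓝 (P (⋃ N : ℕ, {ω | ∃ L ≤ N, t < ergAvg (boxGroup d) w L ω}))) := by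
    refine tendsto_measure_iUnion_atTop fun N N' h ω => ?_
    rintro ⟨L, hL, hlt⟩
    exact ⟨L, hL.trans h, hlt⟩
  have h2 : ⋃ N : ℕ, {ω | ∃ L ≤ N, t < ergAvg (boxGroup d) w L ω} =
      {ω | ∃ L, t < ergAvg (boxGroup d) w L ω} := by
    ext ω
    simp only [Set.mem_iUnion, Set.mem_ofPred_eq]
    constructor
    · rintro ⟨N, L, -, h⟩
      exact ⟨L, h⟩
    · rintro ⟨L, h⟩
      exact ⟨L, L, le_rfl, h⟩
  rw [h2] at h1
  have h3 := (ENNReal.tendsto_toReal (measure_ne_top P _)).comp h1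
  exact le_of_tendsto (h3.const_mul t)
    (Eventually.of_forall fun N => measureReal_maximal_le_of_le hP hw h0 hC t N)

/-- The pointwise ergodic theorem along boxes. -/
theorem avgConv_boxGroup (hP : IsStationaryErgodic (Multiplicative (Fin d → ℤ)) P)
    {h : ((Fin d → ℤ) → ℝ≥0∞) → ℝ} (hh : Measurable h) {C : ℝ} (hC : ∀ ω, |h ω| ≤ C) :
    AvgConv P (boxGroup d) h := by
  have : Countable (Multiplicative (Fin d → ℤ)) := inferInstanceAs (Countable (Fin d → ℤ))
  set c := ∫ ω, h ω ∂P with hc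
  have key : ∀ n : ℕ, P {ω | ∃ᶠ L in atTop,
      2 * ((n : ℝ) + 1)⁻¹ < |ergAvg (boxGroup d) h L ω - c|} = 0 := by
    intro n
    set t : ℝ := ((n : ℝ) + 1)⁻¹ with ht
    have ht0 : 0 < t := by positivity
    set B := {ω | ∃ᶠ L in atTop, 2 * t < |ergAvg (boxGroup d) h L ω - c|} with hB
    rw [← measureReal_eq_zero_iff]
    refine le_antisymm (le_of_forall_pos_le_add fun ε hε => ?_) measureReal_nonneg
    -- The error in `L¹` is chosen so that the constant `5 ^ d / t` of the maximal inequality turns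
    -- it into `ε`.
    obtain ⟨u, hu, hdist⟩ := exists_isUnifNull_approx isFolner_boxGroup hP hh hC
      (ε := t * ε / 5 ^ d) (by positivity)
    obtain ⟨C', hC'⟩ := hu.bounded
    set w : ((Fin d → ℤ) → ℝ≥0∞) → ℝ := fun ω => |h ω - c - u ω| with hw
    have hwm : Measurable w := ((hh.sub_const c).sub hu.measurable).abs
    have hwC : ∀ ω, |w ω| ≤ C + |c| + C' := fun ω => by
      rw [hw, abs_abs]
      exact (abs_sub _ _).trans (add_le_add ((abs_sub _ _).trans (by linarith [hC ω])) (hC' ω))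
    have h1 := measureReal_maximal_le hP hwm (fun ω => abs_nonneg _) hwC t
    -- The averages of `u` are eventually at most `t`, so a deviation of `h` by more than `2 t`
    -- forces the maximal average of the remainder above `t`.
    have hsub : B ⊆ {ω | ∃ L, t < ergAvg (boxGroup d) w L ω} := by
      intro ω hω
      obtain ⟨L, hL, hL'⟩ := (hω.and_eventually (hu.null t ht0)).exists
      refine ⟨L, ?_⟩
      have hcard := IsFolner.card_pos (isFolner_boxGroup (d := d)) L
      have h2 : |ergAvg (boxGroup d) (fun ω => h ω - c - u ω) L ω| ≤
          ergAvg (boxGroup d) w L ω := by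
        rw [ergAvg, ergAvg, abs_div, abs_of_pos hcard]
        exact div_le_div_of_nonneg_right (Finset.abs_sum_le_sum_abs _ _) hcard.le
      have h3 : ergAvg (boxGroup d) (fun ω => h ω - c - u ω) L ω =
          ergAvg (boxGroup d) h L ω - c - ergAvg (boxGroup d) u L ω := by
        rw [ergAvg_sub, ergAvg_sub]
        congr 2
        rw [ergAvg, Finset.sum_const, nsmul_eq_mul, mul_div_cancel_left₀ _ hcard.ne']
      rw [h3] at h2
      have h4 := abs_sub_abs_le_abs_sub (ergAvg (boxGroup d) h L ω - c) (ergAvg (boxGroup d) u L ω)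
      linarith [hL' ω]
    have h2 := mul_le_mul_of_nonneg_left (measureReal_mono (μ := P) hsub) ht0.le
    have h3 : t * P.real B ≤ t * ε := by
      refine h2.trans (h1.trans ((mul_le_mul_of_nonneg_left hdist (by positivity)).trans_eq ?_))
      field_simp
    rw [zero_add]
    exact le_of_mul_le_mul_left h3 ht0
  have hae : ∀ᵐ ω ∂P, ∀ n : ℕ, ¬ ∃ᶠ L in atTop,
      2 * ((n : ℝ) + 1)⁻¹ < |ergAvg (boxGroup d) h L ω - c| := by
    rw [ae_all_iff]
    intro n
    rw [ae_iff]
    simp only [not_not]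
    exact key n
  filter_upwards [hae] with ω hω
  rw [Metric.tendsto_nhds]
  intro ε hε
  obtain ⟨n, hn⟩ := exists_nat_one_div_lt (half_pos hε)
  rw [one_div] at hn
  filter_upwards [not_frequently.1 (hω n)] with L hL
  rw [Real.dist_eq]
  linarith [not_lt.1 hL]

end PointwiseErgodic

/-! ### The lattice case of the general results -/

section Lattice

variable {d : ℕ} {H₀ : L2 (Fin d → ℤ) →L[ℂ] L2 (Fin d → ℤ)}

theorem natAbs_sub_le_l1dist (k j : Fin d → ℤ) (i : Fin d) : (k i - j i).natAbs ≤ l1dist k j :=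
  Finset.single_le_sum (f := fun i => (k i - j i).natAbs) (fun _ _ => Nat.zero_le _)
    (Finset.mem_univ i)

theorem sub_mem_box_l1dist (k j : Fin d → ℤ) : k - j ∈ box d (l1dist k j) := by
  rw [mem_box]
  intro i
  rw [Int.abs_eq_natAbs, Nat.cast_le]
  exact natAbs_sub_le_l1dist k j i

theorem IsLatticeHopping.isInvariantHopping (hH : IsLatticeHopping H₀) :
    IsInvariantHopping (Multiplicative (Fin d → ℤ)) H₀ where
  real := hH.real
  symm := hH.symm
  finite_row k := by
    obtain ⟨R, hR⟩ := hH.finite_range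
    refine (boxAt R k).finite_toSet.subset fun j hj => ?_
    rw [Finset.mem_coe, mem_boxAt, ← neg_mem_box, neg_sub]
    have h1 : l1dist k j < R := by
      by_contra hlt
      exact hj (by rw [hop, hR k j (not_lt.1 hlt), Complex.zero_re])
    exact box_mono h1.le (sub_mem_box_l1dist k j)
  invariant γ k j := by
    rw [smul_eq_add, smul_eq_add, add_comm, add_comm _ j, hop, hop, hH.invariant]

variable {μ : Measure ℝ≥0∞} [IsProbabilityMeasure μ] {Y : ((Fin d → ℤ) → ℝ≥0∞) → Set (Fin d → ℤ)}

theorem exists_isIDS_lattice (hd : 1 ≤ d) (hH : IsLatticeHopping H₀)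
    (hY : IsRandomSet (Multiplicative (Fin d → ℤ)) Y) :
    ∃ ν, IsIDS (Measure.infinitePi fun _ : Fin d → ℤ => μ) H₀ Y (box d) ν := by
  have hP := isStationaryErgodic_lattice (μ := μ) hd
  have hH' := hH.isInvariantHopping
  rw [← exhaustion_boxGroup]
  refine HasErgodicAverages.exists_isIDS ⟨fun K p => ?_, fun K => ?_⟩ isFiniteQuotient_lattice
    isFolner_boxGroup hH' hY
  · have hg := isObservable_obsPow hH' hY K p
    obtain ⟨C, hC⟩ := hg.bounded_siteFun (F := {0})
    exact avgConv_boxGroup hP hg.measurable_siteFun hC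
  · have hg := isObservable_obsHigh hY K
    obtain ⟨C, hC⟩ := hg.bounded_siteFun (F := {0})
    exact avgConv_boxGroup hP hg.measurable_siteFun hC

theorem nonrandomSigmaFin_lattice (hd : 1 ≤ d) (hH : IsLatticeHopping H₀)
    (hY : IsRandomSet (Multiplicative (Fin d → ℤ)) Y) {ν : Measure ℝ}
    (hν : IsIDS (Measure.infinitePi fun _ : Fin d → ℤ => μ) H₀ Y (box d) ν) :
    NonrandomSigmaFin (Measure.infinitePi fun _ : Fin d → ℤ => μ) H₀ Y ∧
      SigmaFin (Measure.infinitePi fun _ : Fin d → ℤ => μ) H₀ Y = atoms ν := by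
  have : Countable (Multiplicative (Fin d → ℤ)) := inferInstanceAs (Countable (Fin d → ℤ))
  rw [← exhaustion_boxGroup] at hν
  exact nonrandomSigmaFin_and_eq_atoms (isStationaryErgodic_lattice hd) isFiniteQuotient_lattice
    isFolner_boxGroup hH.isInvariantHopping hY hν

theorem ae_infinitePi_forall {V : Type*} [Countable V] {p : ℝ≥0∞ → Prop}
    (h : ∀ᵐ t ∂μ, p t) : ∀ᵐ ω ∂(Measure.infinitePi fun _ : V => μ), ∀ k, p (ω k) := by
  rw [ae_all_iff]
  intro k
  rw [← Measure.infinitePi_map_eval (fun _ : V => μ) k] at h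
  exact ae_of_ae_map (measurable_pi_apply k).aemeasurable h

theorem zero_infinity_lattice (hH : IsLatticeHopping H₀)
    (hN : NonrandomSigmaFin (Measure.infinitePi fun _ : Fin d → ℤ => μ) H₀ active)
    (hq : ∀ᵐ t ∂μ, t = 0 ∨ t = ∞) (h0 : μ {0} ≠ 0) (h1 : μ {∞} ≠ 0) :
    SigmaFin (Measure.infinitePi fun _ : Fin d → ℤ => μ) H₀ active = finiteEigenvalues H₀ ∧
      (∀ᵐ ω ∂(Measure.infinitePi fun _ : Fin d → ℤ => μ),
        sigmaFin H₀ ω (active ω) = finiteEigenvalues H₀) ∧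
      (∀ᵐ ω ∂(Measure.infinitePi fun _ : Fin d → ℤ => μ),
        spectrum ℂ (restrictOp H₀ (active ω)) =
          Complex.ofReal '' closure (finiteEigenvalues H₀)) ∧
      (IsLatticeAdjacencyOperator H₀ → ∀ E ∈ finiteEigenvalues H₀, IsIntegral ℤ E) := by
  have hq' := ae_infinitePi_forall (V := Fin d → ℤ) hq
  have h2 := finiteEigenvalues_zero_infinity hH.isInvariantHopping.toIsHopping hN hq'
    iIndepFun_eval
    (fun k => by
      have := infinitePi_eval (μ := μ) k (measurableSet_singleton 0)
      exact fun h => h0 (this.symm.trans h))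
    (fun k => by
      have := infinitePi_eval (μ := μ) k (measurableSet_singleton ∞)
      exact fun h => h1 (this.symm.trans h))
  refine ⟨h2.1, ?_, h2.2, fun hadj E hE => isIntegral_of_mem_finiteEigenvalues (fun k j => ?_) hE⟩
  · filter_upwards [ae_sigmaFin_eq hq' hN] with ω hω
    exact hω.trans h2.1
  · by_cases hkj : l1dist k j = 1
    · exact ⟨1, by rw [hop, hadj, if_pos hkj]; simp⟩
    · exact ⟨0, by rw [hop, hadj, if_neg hkj]; simp⟩

end Lattice

/-! ### Eigenfunctions on finite and infinite clusters -/

section Clusters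

variable {V : Type*} {H₀ : L2 V →L[ℂ] L2 V} {ω : V → ℝ≥0∞} {E : ℝ}

/-- `b` can be reached from `a` on a path of active vertices. -/
abbrev Conn (H₀ : L2 V →L[ℂ] L2 V) (ω : V → ℝ≥0∞) : V → V → Prop :=
  Relation.ReflTransGen fun a b => b ∈ active ω ∧ hop H₀ a b ≠ 0

theorem Conn.mem_active {a b : V} (h : Conn H₀ ω a b) (ha : a ∈ active ω) : b ∈ active ω := by
  cases h with
  | refl => exact ha
  | tail _ h => exact h.1

theorem Conn.symm {a b : V} (hH : IsHopping H₀) (h : Conn H₀ ω a b) (ha : a ∈ active ω) :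
    Conn H₀ ω b a := by
  induction h with
  | refl => exact .refl
  | tail h hbc ih => exact .head ⟨Conn.mem_active h ha, by rw [hH.hop_symm]; exact hbc.2⟩ ih

theorem Conn.mem_infCluster {a b : V} (h : Conn H₀ ω a b) (ha : a ∈ active ω)
    (hb : b ∈ infCluster H₀ ω) : a ∈ infCluster H₀ ω :=
  ⟨ha, hb.2.mono fun _ hj => h.trans hj⟩

theorem Conn.mem_infCluster_right {a b : V} (hH : IsHopping H₀) (h : Conn H₀ ω a b)
    (ha : a ∈ infCluster H₀ ω) : b ∈ infCluster H₀ ω :=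
  (h.symm hH ha.1).mem_infCluster (h.mem_active ha.1) ha

/-- An active vertex that can hop to an infinite cluster belongs to it, so the function satisfies
the equation with value zero at all other active vertices. -/
theorem sigmaFin_infCluster_subset :
    sigmaFin H₀ ω (infCluster H₀ ω) ⊆ sigmaFin H₀ ω (active ω) := by
  rintro E ⟨f, hf0, hfY, hf⟩
  refine ⟨f, hf0, fun k hk => (hfY hk).1, fun k hk => ?_⟩
  by_cases hki : k ∈ infCluster H₀ ω
  · exact hf k hki
  · have h1 : f k = 0 := by
      by_contra h
      exact hki (hfY (Finsupp.mem_support_iff.2 h))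
    rw [h1, mul_zero, mul_zero, zero_add]
    refine Finset.sum_eq_zero fun j hj => ?_
    have h2 : hop H₀ k j = 0 := by
      by_contra h
      exact hki (Conn.mem_infCluster (.single ⟨(hfY hj).1, h⟩) hk (hfY hj))
    dsimp only
    rw [h2, Complex.ofReal_zero, zero_mul]

theorem mem_sigmaFin_of_fun {Y : Set V} {A : Finset V} {g : V → ℂ} (hg : ∃ k, g k ≠ 0)
    (h0 : ∀ k, k ∉ A → g k = 0) (hA : ∀ k ∈ A, k ∈ Y)
    (heq : ∀ k ∈ Y, (pot ω k : ℂ) * g k + ∑ j ∈ A, (hop H₀ k j : ℂ) * g j = E * g k) :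
    E ∈ sigmaFin H₀ ω Y := by
  classical
  have hs : ∀ k, g k ≠ 0 → k ∈ A := fun k hk => by
    by_contra h
    exact hk (h0 k h)
  refine ⟨Finsupp.onFinset A g hs, fun h => ?_, fun k hk => hA k ?_, fun k hk => ?_⟩
  · obtain ⟨k, hk⟩ := hg
    exact hk (DFunLike.congr_fun h k)
  · exact Finsupp.support_onFinset_subset hk
  · rw [Finsupp.sum_of_support_subset _ Finsupp.support_onFinset_subset _ fun j _ => mul_zero _]
    exact heq k hk

/-- An eigenfunction of the Hamiltonian restricted to a finite set. -/
structure IsLocalEigenfunction (H₀ : L2 V →L[ℂ] L2 V) (ω : V → ℝ≥0∞) (C : Finset V) (E : ℝ)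
    (f : V → ℂ) : Prop where
  ne_zero : ∃ k, f k ≠ 0
  eq_zero : ∀ k, k ∉ C → f k = 0
  eigen : ∀ k ∈ C, (pot ω k : ℂ) * f k + ∑ j ∈ C, (hop H₀ k j : ℂ) * f j = E * f k

open Classical in
/-- The characteristic determinant of the Hamiltonian restricted to a finite set. -/
def locDet (H₀ : L2 V →L[ℂ] L2 V) (ω : V → ℝ≥0∞) (C : Finset V) (E : ℝ) : ℂ :=
  (Matrix.of fun i j : C => (if i = j then (pot ω i : ℂ) - E else 0) + hop H₀ i j).det

/-- The existence of an eigenfunction on `C` becomes the vanishing of a determinant, which is a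
measurable condition on the potential in `C`. -/
theorem locDet_eq_zero_iff {C : Finset V} :
    locDet H₀ ω C E = 0 ↔ ∃ f, IsLocalEigenfunction H₀ ω C E f := by
  classical
  rw [locDet, ← Matrix.exists_mulVec_eq_zero_iff]
  have key : ∀ (f : V → ℂ) (i : C), ((Matrix.of fun i j : C =>
      (if i = j then (pot ω i : ℂ) - E else 0) + (hop H₀ i j : ℂ)).mulVec fun j => f j) i =
      (pot ω i : ℂ) * f i + ∑ j ∈ C, (hop H₀ i j : ℂ) * f j - E * f i := by
    intro f i
    rw [Matrix.mulVec, dotProduct]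
    simp only [Matrix.of_apply, add_mul, ite_mul, zero_mul]
    rw [Finset.sum_add_distrib, Finset.sum_ite_eq, if_pos (Finset.mem_univ i),
      Finset.sum_coe_sort C fun j => (hop H₀ i j : ℂ) * f j]
    ring
  constructor
  · rintro ⟨v, hv, h⟩
    set f : V → ℂ := fun k => if hk : k ∈ C then v ⟨k, hk⟩ else 0 with hf
    have hfv : (fun j : C => f j) = v := by
      ext j
      exact dif_pos j.2
    refine ⟨f, ?_, fun k hk => dif_neg hk, fun k hk => ?_⟩
    · obtain ⟨i, hi⟩ := Function.ne_iff.1 hv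
      exact ⟨i, by rw [← hfv] at hi; exact hi⟩
    · have h1 := key f ⟨k, hk⟩
      rw [hfv, h, Pi.zero_apply] at h1
      exact (sub_eq_zero.1 h1.symm)
  · rintro ⟨f, ⟨k, hk⟩, h0, h⟩
    refine ⟨fun j => f j, fun hz => hk ?_, ?_⟩
    · by_cases hkC : k ∈ C
      · exact congrFun hz ⟨k, hkC⟩
      · exact h0 k hkC
    · ext i
      rw [key, h i i.2, sub_self, Pi.zero_apply]

theorem measurable_locDet {Ω : Type*} [MeasurableSpace Ω] {C : Finset V}
    {φ : Ω → V → ℝ≥0∞} (hφ : ∀ k ∈ C, Measurable fun x => φ x k) :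
    Measurable fun x => locDet H₀ (φ x) C E := by
  classical
  simp only [locDet, Matrix.det_apply]
  refine Finset.measurable_sum _ fun σ _ => Measurable.const_smul ?_ _
  refine Finset.measurable_prod _ fun i _ => ?_
  simp only [Matrix.of_apply]
  split_ifs with h
  · have h1 : Measurable fun x => pot (φ x) (σ i : C) := (hφ _ (σ i).2).ennreal_toReal
    exact ((Complex.measurable_ofReal.comp h1).sub_const _).add_const _
  · exact measurable_const

/-- The event that the Hamiltonian on the active set `C` has the eigenvalue `E`. -/
def locEvent (H₀ : L2 V →L[ℂ] L2 V) (C : Finset V) (E : ℝ) : Set (V → ℝ≥0∞) :=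
  {ω | (∀ k ∈ C, k ∈ active ω) ∧ locDet H₀ ω C E = 0}

/-- The general map `φ` covers the identity and the reflected configuration alike, each with the
σ-algebra of the sites it depends on. -/
theorem measurableSet_preimage_locEvent {Ω : Type*} [MeasurableSpace Ω] {C : Finset V}
    {φ : Ω → V → ℝ≥0∞} (hφ : ∀ k ∈ C, Measurable fun x => φ x k) :
    MeasurableSet (φ ⁻¹' locEvent H₀ C E) := by
  have h1 : φ ⁻¹' locEvent H₀ C E =
      (⋂ k ∈ C, {x | φ x k < ∞}) ∩ {x | locDet H₀ (φ x) C E = 0} := by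
    ext x
    simp [locEvent, active]
  rw [h1]
  refine MeasurableSet.inter (Finset.measurableSet_biInter C fun k hk => ?_) ?_
  · exact hφ k hk measurableSet_Iio
  · exact measurable_locDet hφ (measurableSet_singleton 0)

theorem measurableSet_locEvent (C : Finset V) :
    MeasurableSet[eventsOn (C : Set V)] (locEvent H₀ C E) :=
  @measurableSet_preimage_locEvent _ _ _ _ (eventsOn (C : Set V)) _ id
    fun _ hk => measurable_eval_eventsOn (Finset.mem_coe.2 hk)

theorem measurableSet_shift_locEvent {Γ : Type*} [Group Γ] [MulAction Γ V] (γ : Γ) {C C' : Finset V}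
    (hC : ∀ k ∈ C, γ⁻¹ • k ∈ C') :
    MeasurableSet[eventsOn (C' : Set V)] (shift γ ⁻¹' locEvent H₀ C E) :=
  @measurableSet_preimage_locEvent _ _ _ _ (eventsOn (C' : Set V)) _ (shift γ)
    fun k hk => measurable_eval_eventsOn (Finset.mem_coe.2 (hC k hk))

/-- `C` is connected through hops inside `C`. -/
def IsConnectedSet (H₀ : L2 V →L[ℂ] L2 V) (C : Finset V) : Prop :=
  ∀ k ∈ C, ∀ j ∈ C, Relation.ReflTransGen (fun a b => b ∈ C ∧ hop H₀ a b ≠ 0) k j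

/-- An eigenfunction lives on an infinite cluster or on a finite one. -/
theorem mem_sigmaFin_infCluster_or (hH : IsHopping H₀) (hE : E ∈ sigmaFin H₀ ω (active ω)) :
    E ∈ sigmaFin H₀ ω (infCluster H₀ ω) ∨ ∃ C : Finset V, C.Nonempty ∧ IsConnectedSet H₀ C ∧
      ω ∈ locEvent H₀ C E ∧ ∀ k ∈ C, ∀ j, j ∉ C → hop H₀ k j ≠ 0 → ω j = ∞ := by
  classical
  obtain ⟨f, hf0, hfY, hf⟩ := hE
  obtain ⟨k₀, hk₀⟩ := Finsupp.ne_iff.1 hf0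
  rw [Finsupp.zero_apply] at hk₀
  have hk₀a : k₀ ∈ active ω := hfY (Finsupp.mem_support_iff.2 hk₀)
  set D : Set V := {j | Conn H₀ ω k₀ j} with hD
  have hDa : ∀ j ∈ D, j ∈ active ω := fun j hj => Conn.mem_active hj hk₀a
  have hDstep : ∀ k ∈ D, ∀ j ∈ active ω, hop H₀ k j ≠ 0 → j ∈ D := fun k hk j hj h =>
    Relation.ReflTransGen.tail hk ⟨hj, h⟩
  set A := f.support.filter (· ∈ D) with hA
  -- No hop connects the cluster `D` with other active vertices, so the part of `f` on `D` is an
  -- eigenfunction by itself. If `D` is finite, then `D` serves as `C`.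
  set g : V → ℂ := fun k => if k ∈ D then f k else 0 with hg
  have hgA : ∀ k, k ∉ A → g k = 0 := fun k hk => by
    simp only [hg]
    split_ifs with h
    · by_contra h'
      exact hk (Finset.mem_filter.2 ⟨Finsupp.mem_support_iff.2 h', h⟩)
    · rfl
  have hg0 : g k₀ ≠ 0 := by
    simp only [hg]
    rwa [if_pos]
    exact Relation.ReflTransGen.refl
  have heq : ∀ k ∈ D, (pot ω k : ℂ) * g k + ∑ j ∈ A, (hop H₀ k j : ℂ) * g j = E * g k := by
    intro k hk
    have h1 := hf k (hDa k hk)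
    have h2 : g k = f k := if_pos hk
    rw [h2, ← h1]
    congr 1
    rw [Finsupp.sum, hA, Finset.sum_filter]
    refine Finset.sum_congr rfl fun j hj => ?_
    simp only [hg]
    split_ifs with hjD
    · rfl
    · have h3 : hop H₀ k j = 0 := by
        by_contra h
        exact hjD (hDstep k hk j (hfY hj) h)
      rw [h3, Complex.ofReal_zero, zero_mul]
  by_cases hfin : D.Finite
  · right
    set C := hfin.toFinset with hC
    have hmemC : ∀ j, j ∈ C ↔ j ∈ D := fun j => hfin.mem_toFinset
    have hconn : ∀ j, Conn H₀ ω k₀ j →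
        Relation.ReflTransGen (fun a b => b ∈ C ∧ hop H₀ a b ≠ 0) k₀ j := by
      intro j hj
      induction hj with
      | refl => exact .refl
      | tail h hbc ih => exact ih.tail ⟨(hmemC _).2 (Relation.ReflTransGen.tail h hbc), hbc.2⟩
    have hconn' : ∀ j, Conn H₀ ω k₀ j →
        Relation.ReflTransGen (fun a b => b ∈ C ∧ hop H₀ a b ≠ 0) j k₀ := by
      intro j hj
      induction hj with
      | refl => exact .refl
      | tail h hbc ih => exact .head ⟨(hmemC _).2 h, by rw [hH.hop_symm]; exact hbc.2⟩ ih
    refine ⟨C, ⟨k₀, (hmemC k₀).2 .refl⟩, fun k hk j hj =>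
      (hconn' k ((hmemC k).1 hk)).trans (hconn j ((hmemC j).1 hj)),
      ⟨fun k hk => hDa k ((hmemC k).1 hk), locDet_eq_zero_iff.2 ⟨g, ⟨k₀, hg0⟩, fun k hk =>
        if_neg fun h => hk ((hmemC k).2 h), fun k hk => ?_⟩⟩, fun k hk j hj h => ?_⟩
    · rw [← heq k ((hmemC k).1 hk)]
      congr 1
      symm
      refine Finset.sum_subset (fun j hj => (hmemC j).2 (Finset.mem_filter.1 hj).2)
        fun j _ hj => by rw [hgA j hj, mul_zero]
    · by_contra hj'
      exact hj ((hmemC j).2 (hDstep k ((hmemC k).1 hk) j (lt_top_iff_ne_top.2 hj') h))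
  · left
    have hk₀i : k₀ ∈ infCluster H₀ ω := ⟨hk₀a, hfin⟩
    refine mem_sigmaFin_of_fun ⟨k₀, hg0⟩ hgA
      (fun k hk => Conn.mem_infCluster_right hH (Finset.mem_filter.1 hk).2 hk₀i) fun k hk => ?_
    by_cases hkD : k ∈ D
    · exact heq k hkD
    · have h2 : g k = 0 := if_neg hkD
      rw [h2, mul_zero, mul_zero, zero_add]
      refine Finset.sum_eq_zero fun j hj => ?_
      have h3 : hop H₀ k j = 0 := by
        by_contra h
        exact hkD (hDstep j (Finset.mem_filter.1 hj).2 k hk.1 (by rwa [hH.hop_symm]))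
      rw [h3, Complex.ofReal_zero, zero_mul]

theorem IsConnectedSet.conn {C : Finset V} (hC : IsConnectedSet H₀ C)
    (hact : ∀ k ∈ C, k ∈ active ω) {k j : V} (hk : k ∈ C) (hj : j ∈ C) : Conn H₀ ω k j :=
  Relation.ReflTransGen.lift (p := fun a b => b ∈ active ω ∧ hop H₀ a b ≠ 0) id
    (fun _ _ h => ⟨hact _ h.1, h.2⟩) _ _ (hC k hk j hj)

/-- Eigenfunctions on two clusters that touch exactly one common vertex combine to an eigenfunction
of the infinite cluster. -/
theorem mem_sigmaFin_infCluster_of_two {C C' : Finset V} {f f' : V → ℂ} {m : V}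
    (hH : IsHopping H₀) (hf : IsLocalEigenfunction H₀ ω C E f)
    (hf' : IsLocalEigenfunction H₀ ω C' E f') (hdisj : Disjoint C C')
    (hCC : ∀ k ∈ C, ∀ j ∈ C', hop H₀ k j = 0)
    (hout : ∀ k ∈ active ω, k ∉ C → k ∉ C' → k ≠ m →
      (∀ j ∈ C, hop H₀ k j = 0) ∧ ∀ j ∈ C', hop H₀ k j = 0)
    (hC : ∀ k ∈ C, k ∈ infCluster H₀ ω) (hC' : ∀ k ∈ C', k ∈ infCluster H₀ ω) :
    E ∈ sigmaFin H₀ ω (infCluster H₀ ω) := by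
  classical
  set S : V → ℂ := fun k => ∑ j ∈ C, (hop H₀ k j : ℂ) * f j with hS
  set S' : V → ℂ := fun k => ∑ j ∈ C', (hop H₀ k j : ℂ) * f' j with hS'
  have hzero : ∀ k (A : Finset V) (h : V → ℂ), (∀ j ∈ A, hop H₀ k j = 0) →
      ∑ j ∈ A, (hop H₀ k j : ℂ) * h j = 0 := fun k A h hk =>
    Finset.sum_eq_zero fun j hj => by rw [hk j hj, Complex.ofReal_zero, zero_mul]
  have hfC' : ∀ k ∈ C', f k = 0 := fun k hk => hf.eq_zero k (Finset.disjoint_right.1 hdisj hk)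
  have hf'C : ∀ k ∈ C, f' k = 0 := fun k hk => hf'.eq_zero k (Finset.disjoint_left.1 hdisj hk)
  -- The equation at `m`, where both functions vanish, is one linear condition on two coefficients
  -- and has a nontrivial solution.
  obtain ⟨a, b, hab, hab0⟩ : ∃ a b : ℂ, a * S m + b * S' m = 0 ∧ (a ≠ 0 ∨ b ≠ 0) := by
    by_cases h : S m = 0
    · exact ⟨1, 0, by rw [h]; ring, Or.inl one_ne_zero⟩
    · exact ⟨-S' m, S m, by ring, Or.inr h⟩
  set g : V → ℂ := fun k => a * f k + b * f' k with hg
  refine mem_sigmaFin_of_fun (A := C ∪ C') (g := g) ?_ (fun k hk => ?_) (fun k hk => ?_)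
    fun k hk => ?_
  · rcases hab0 with ha | hb
    · obtain ⟨k, hk⟩ := hf.ne_zero
      have hkC : k ∈ C := by
        by_contra h
        exact hk (hf.eq_zero k h)
      exact ⟨k, by simp only [hg]; rw [hf'C k hkC, mul_zero, add_zero]; exact mul_ne_zero ha hk⟩
    · obtain ⟨k, hk⟩ := hf'.ne_zero
      have hkC : k ∈ C' := by
        by_contra h
        exact hk (hf'.eq_zero k h)
      exact ⟨k, by simp only [hg]; rw [hfC' k hkC, mul_zero, zero_add]; exact mul_ne_zero hb hk⟩
  · rw [Finset.mem_union, not_or] at hk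
    simp only [hg]
    rw [hf.eq_zero k hk.1, hf'.eq_zero k hk.2, mul_zero, mul_zero, add_zero]
  · exact (Finset.mem_union.1 hk).elim (hC k) (hC' k)
  · have hsum : ∑ j ∈ C ∪ C', (hop H₀ k j : ℂ) * g j = a * S k + b * S' k := by
      rw [Finset.sum_union hdisj, hS, hS', Finset.mul_sum, Finset.mul_sum]
      congr 1
      · refine Finset.sum_congr rfl fun j hj => ?_
        simp only [hg]
        rw [hf'C j hj]
        ring
      · refine Finset.sum_congr rfl fun j hj => ?_
        simp only [hg]
        rw [hfC' j hj]
        ring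
    rw [hsum]
    simp only [hg]
    by_cases hkC : k ∈ C
    · have h1 : S' k = 0 := hzero k C' f' (hCC k hkC)
      have h2 : (pot ω k : ℂ) * f k + S k = E * f k := hf.eigen k hkC
      rw [h1, hf'C k hkC]
      linear_combination a * h2
    · by_cases hkC' : k ∈ C'
      · have h1 : S k = 0 := hzero k C f fun j hj => by rw [hH.hop_symm]; exact hCC j hj k hkC'
        have h2 : (pot ω k : ℂ) * f' k + S' k = E * f' k := hf'.eigen k hkC'
        rw [h1, hfC' k hkC']
        linear_combination b * h2
      · rw [hf.eq_zero k hkC, hf'.eq_zero k hkC']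
        by_cases hkm : k = m
        · rw [hkm, hab]
          ring
        · obtain ⟨h1, h2⟩ := hout k hk.1 hkC hkC' hkm
          have h3 : S k = 0 := hzero k C f h1
          have h4 : S' k = 0 := hzero k C' f' h2
          rw [h3, h4]
          ring

theorem IsLocalEigenfunction.comp_perm {e : Equiv.Perm V}
    (he : ∀ k j, hop H₀ (e k) (e j) = hop H₀ k j) {C : Finset V} {f : V → ℂ}
    (hf : IsLocalEigenfunction H₀ (shift e ω) C E f) :
    IsLocalEigenfunction H₀ ω (C.map e.symm.toEmbedding) E (f ∘ e) where
  ne_zero := by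
    obtain ⟨k, hk⟩ := hf.ne_zero
    exact ⟨e.symm k, by simpa using hk⟩
  eq_zero k hk := hf.eq_zero _ fun h => hk (by
    rw [Finset.mem_map_equiv]
    simpa using h)
  eigen k hk := by
    rw [Finset.mem_map_equiv, Equiv.symm_symm] at hk
    have h1 := hf.eigen (e k) hk
    have h2 : pot (shift e ω) (e k) = pot ω k := by
      rw [pot, pot]
      exact congrArg ENNReal.toReal (shift_smul e ω k)
    rw [h2] at h1
    rw [Function.comp_apply, ← h1, Finset.sum_map]
    congr 1
    refine Finset.sum_congr rfl fun j _ => ?_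
    rw [Equiv.coe_toEmbedding, Function.comp_apply, Equiv.apply_symm_apply, ← he k,
      Equiv.apply_symm_apply]

theorem IsConnectedSet.map_perm {e : Equiv.Perm V}
    (he : ∀ k j, hop H₀ (e k) (e j) = hop H₀ k j) {C : Finset V} (hC : IsConnectedSet H₀ C) :
    IsConnectedSet H₀ (C.map e.symm.toEmbedding) := by
  intro k hk j hj
  rw [Finset.mem_map_equiv, Equiv.symm_symm] at hk hj
  have h := Relation.ReflTransGen.lift
    (p := fun a b => b ∈ C.map e.symm.toEmbedding ∧ hop H₀ a b ≠ 0) e.symm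
    (fun a b hab => ⟨Finset.mem_map_of_mem _ hab.1, by
      rw [← he, Equiv.apply_symm_apply, Equiv.apply_symm_apply]
      exact hab.2⟩) _ _ (hC _ hk _ hj)
  simpa only [Function.onFun, Equiv.symm_apply_apply] using h

/-- The configuration `ω` with all vertices of `B` made active. -/
def fill (B : Set V) (ω : V → ℝ≥0∞) : V → ℝ≥0∞ :=
  open Classical in fun k => if k ∈ B then 0 else ω k

/-- Measurability with respect to the sites outside `B` makes events about the filled configuration
independent of what happens in `B`. -/
theorem measurable_fill (B : Set V) : Measurable[eventsOn Bᶜ] (fill B) := by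
  classical
  refine @measurable_pi_lambda _ _ _ (eventsOn Bᶜ) _ _ fun k => ?_
  simp only [fill]
  split_ifs with h
  · exact measurable_const
  · exact measurable_eval_eventsOn h

theorem mem_active_fill {B : Set V} {k : V} : k ∈ active (fill B ω) ↔ k ∈ B ∨ k ∈ active ω := by
  classical
  rw [active, Set.mem_ofPred_eq, fill]
  split_ifs with h <;> simp [h, active]

theorem infCluster_mono {ω' : V → ℝ≥0∞} (h : active ω ⊆ active ω') :
    infCluster H₀ ω ⊆ infCluster H₀ ω' := fun _ hk =>
  ⟨h hk.1, hk.2.mono fun _ hj => Relation.ReflTransGen.lift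
    (p := fun a b => b ∈ active ω' ∧ hop H₀ a b ≠ 0) id (fun _ _ hab => ⟨h hab.1, hab.2⟩) _ _ hj⟩

/-- If the vertices of the inner boundary of a finite set `B` are active and some vertex of `B`
is in an infinite cluster after filling `B`, then the inner boundary meets an infinite cluster. -/
theorem exists_mem_infCluster_of_fill {B S : Finset V} (hS : ∀ k ∈ S, k ∈ active ω)
    (hBS : ∀ k ∈ B, ∀ j, j ∉ B → hop H₀ k j ≠ 0 → k ∈ S) {o : V} (ho : o ∈ B)
    (h : o ∈ infCluster H₀ (fill B ω)) : ∃ s ∈ S, s ∈ infCluster H₀ ω := by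
  -- Last exit decomposition: after the last visit to `B` a path uses only vertices active in `ω`,
  -- and it leaves `B` through `S`.
  have key : ∀ j, Conn H₀ (fill B ω) o j → j ∈ B ∨ ∃ s ∈ S, Conn H₀ ω s j := by
    intro j hj
    induction hj with
    | refl => exact Or.inl ho
    | @tail b c _ hbc ih =>
      by_cases hc : c ∈ B
      · exact Or.inl hc
      · have hcω : c ∈ active ω := (mem_active_fill.1 hbc.1).resolve_left hc
        rcases ih with hb | ⟨s, hs, hsb⟩
        · exact Or.inr ⟨b, hBS b hb c hc hbc.2, .single ⟨hcω, hbc.2⟩⟩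
        · exact Or.inr ⟨s, hs, hsb.tail ⟨hcω, hbc.2⟩⟩
  have hinf : ¬ (⋃ s ∈ S, {j | Conn H₀ ω s j}).Finite := by
    intro hfin
    refine h.2 ((B.finite_toSet.union hfin).subset fun j hj => ?_)
    rcases key j hj with hb | ⟨s, hs, hsj⟩
    · exact Or.inl hb
    · exact Or.inr (Set.mem_biUnion hs hsj)
  by_contra! hcon
  refine hinf (S.finite_toSet.biUnion fun s hs => ?_)
  by_contra hsinf
  exact hcon s hs ⟨hS s hs, hsinf⟩

end Clusters

/-! ### Paths in boxes and shells of the lattice -/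

section NearestNeighbours

variable {d : ℕ} {H₀ : L2 (Fin d → ℤ) →L[ℂ] L2 (Fin d → ℤ)} {ω : (Fin d → ℤ) → ℝ≥0∞}

theorem IsLatticeAdjacencyOperator.hop_ne_zero (hadj : IsLatticeAdjacencyOperator H₀)
    {k j : Fin d → ℤ} : hop H₀ k j ≠ 0 ↔ l1dist k j = 1 := by
  rw [hop, hadj k j]
  split_ifs with h <;> simp [h]

theorem IsLatticeAdjacencyOperator.hop_eq_zero (hadj : IsLatticeAdjacencyOperator H₀)
    {k j : Fin d → ℤ} (h : l1dist k j ≠ 1) : hop H₀ k j = 0 := by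
  by_contra h'
  exact h (hadj.hop_ne_zero.1 h')

theorem l1dist_update (x : Fin d → ℤ) (i : Fin d) (v w : ℤ) :
    l1dist (Function.update x i v) (Function.update x i w) = (v - w).natAbs := by
  rw [l1dist, Finset.sum_eq_single i (fun j _ hj => by simp [hj]) (by simp)]
  simp

theorem eq_of_l1dist_eq_one {k j : Fin d → ℤ} (h : l1dist k j = 1) {i i' : Fin d}
    (hi : k i ≠ j i) (hi' : i' ≠ i) : k i' = j i' := by
  have h1 := Finset.sum_le_univ_sum_of_nonneg (s := {i, i'})
    (f := fun i => (k i - j i).natAbs) fun _ => Nat.zero_le _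
  rw [Finset.sum_pair hi'.symm] at h1
  have h2 : (k i - j i).natAbs + (k i' - j i').natAbs ≤ 1 := h1.trans_eq h
  omega

theorem abs_sub_le_one {k j : Fin d → ℤ} (h : l1dist k j = 1) (i : Fin d) :
    k i - j i ≤ 1 ∧ j i - k i ≤ 1 := by
  have := natAbs_sub_le_l1dist k j i
  omega

theorem conn_update (hadj : IsLatticeAdjacencyOperator H₀) (x : Fin d → ℤ) (i : Fin d) {v v' : ℤ}
    (hv : v ≤ v') (hact : ∀ w, v ≤ w → w ≤ v' → Function.update x i w ∈ active ω) :
    Conn H₀ ω (Function.update x i v) (Function.update x i v') := by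
  induction v', hv using Int.leInduction with
  | base => exact .refl
  | succ n hn ih =>
    refine (ih fun w h1 h2 => hact w h1 (by omega)).tail
      ⟨hact _ (by omega) le_rfl, hadj.hop_ne_zero.2 ?_⟩
    rw [l1dist_update]
    omega

/-- The path raises the coordinates in `s` one after another to `n` and leaves the others unchanged,
so activity is needed only on such intermediate points. -/
theorem conn_piecewise (hadj : IsLatticeAdjacencyOperator H₀) {x : Fin d → ℤ} {n : ℤ}
    (hx : ∀ i, x i ≤ n) (s : Finset (Fin d))
    (hact : ∀ y : Fin d → ℤ, (∀ i, x i ≤ y i ∧ y i ≤ n) → (∀ i ∉ s, y i = x i) → y ∈ active ω) :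
    Conn H₀ ω x (s.piecewise (fun _ => n) x) := by
  induction s using Finset.induction_on with
  | empty => rw [Finset.piecewise_empty]
  | insert i s hi ih =>
    refine (ih fun y h1 h2 => hact y h1 fun i' hi' => h2 i' fun h =>
      hi' (Finset.mem_insert_of_mem h)).trans ?_
    rw [Finset.piecewise_insert]
    have h3 : s.piecewise (fun _ => n) x =
        Function.update (s.piecewise (fun _ => n) x) i (x i) := by
      rw [eq_comm, Function.update_eq_self_iff]
      exact (Finset.piecewise_eq_of_notMem _ _ _ hi).symm
    conv_lhs => rw [h3]
    refine conn_update hadj _ i (hx i) fun w hw1 hw2 => hact _ (fun i' => ?_) fun i' hi' => ?_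
    · by_cases h : i' = i
      · subst h
        simpa using ⟨hw1, hw2⟩
      · rw [Function.update_of_ne h]
        by_cases h' : i' ∈ s
        · rw [Finset.piecewise_eq_of_mem _ _ _ h']
          exact ⟨hx i', le_rfl⟩
        · rw [Finset.piecewise_eq_of_notMem _ _ _ h']
          exact ⟨le_rfl, hx i'⟩
    · rw [Finset.mem_insert, not_or] at hi'
      rw [Function.update_of_ne hi'.1, Finset.piecewise_eq_of_notMem _ _ _ hi'.2]

/-- The sites of the box `[-n, n]^d` with a coordinate `±n`. -/
def shell (d n : ℕ) : Finset (Fin d → ℤ) := (box d n).filter fun x => ∃ i, |x i| = n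

theorem mem_shell {n : ℕ} {x : Fin d → ℤ} : x ∈ shell d n ↔ x ∈ box d n ∧ ∃ i, |x i| = n :=
  Finset.mem_filter

theorem conn_corner_of_box (hadj : IsLatticeAdjacencyOperator H₀) {n : ℕ}
    (hact : ∀ y ∈ box d n, y ∈ active ω) {x : Fin d → ℤ} (hx : x ∈ box d n) :
    Conn H₀ ω x fun _ => n := by
  have h := conn_piecewise (ω := ω) hadj (n := n) (fun i => (abs_le.1 (mem_box.1 hx i)).2)
    Finset.univ fun y hy _ => hact y (mem_box.2 fun i =>
      abs_le.2 ⟨(abs_le.1 (mem_box.1 hx i)).1.trans (hy i).1, (hy i).2⟩)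
  rwa [Finset.piecewise_univ] at h

/-- In dimension at least two the path to the corner can stay in the shell: with a coordinate `±n`
fixed, a second one is raised to `n`; keeping the latter fixed, all the others are then raised. -/
theorem conn_corner_of_shell (hadj : IsLatticeAdjacencyOperator H₀) {n : ℕ} {i₀ i₁ : Fin d}
    (hi : i₀ ≠ i₁) (hact : ∀ y ∈ shell d n, y ∈ active ω) {x : Fin d → ℤ} (hx : x ∈ shell d n) :
    Conn H₀ ω x fun _ => n := by
  have key : ∀ x ∈ box d n, ∀ i, x i = n → Conn H₀ ω x fun _ => n := by
    intro x hx i hxi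
    have h := conn_piecewise (ω := ω) hadj (n := n) (fun i => (abs_le.1 (mem_box.1 hx i)).2)
      (Finset.univ.erase i) fun y hy hy' => hact y (mem_shell.2 ⟨mem_box.2 fun i =>
        abs_le.2 ⟨(abs_le.1 (mem_box.1 hx i)).1.trans (hy i).1, (hy i).2⟩, i, by
          rw [hy' i (Finset.notMem_erase i _), hxi, Nat.abs_cast]⟩)
    convert h using 1
    ext j
    by_cases hj : j = i
    · subst hj
      rw [Finset.piecewise_eq_of_notMem _ _ _ (Finset.notMem_erase j _), hxi]
    · rw [Finset.piecewise_eq_of_mem _ _ _ (Finset.mem_erase.2 ⟨hj, Finset.mem_univ j⟩)]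
  obtain ⟨hxb, i, hxi⟩ := mem_shell.1 hx
  obtain ⟨j, hj⟩ : ∃ j, j ≠ i := by
    by_cases h : i₀ = i
    · exact ⟨i₁, fun h' => hi (h.trans h'.symm)⟩
    · exact ⟨i₀, h⟩
  have hb : ∀ w, x j ≤ w → w ≤ n → Function.update x j w ∈ box d n := by
    intro w hw1 hw2
    refine mem_box.2 fun i' => ?_
    by_cases h : i' = j
    · subst h
      rw [Function.update_self]
      exact abs_le.2 ⟨(abs_le.1 (mem_box.1 hxb i')).1.trans hw1, hw2⟩
    · rw [Function.update_of_ne h]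
      exact mem_box.1 hxb i'
  have hxj := (abs_le.1 (mem_box.1 hxb j)).2
  have h1 := conn_update (ω := ω) hadj x j hxj fun w hw1 hw2 =>
    hact _ (mem_shell.2 ⟨hb w hw1 hw2, i, by rwa [Function.update_of_ne hj.symm]⟩)
  rw [Function.update_eq_self] at h1
  exact h1.trans (key _ (hb _ hxj le_rfl) j (Function.update_self ..))

theorem mem_shell_of_hop (hadj : IsLatticeAdjacencyOperator H₀) {n : ℕ} {k j : Fin d → ℤ}
    (hk : k ∈ box d n) (hj : j ∉ box d n) (h : hop H₀ k j ≠ 0) : k ∈ shell d n := by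
  rw [hadj.hop_ne_zero] at h
  rw [mem_box] at hj
  push Not at hj
  obtain ⟨i, hi⟩ := hj
  have h1 := abs_sub_le_one h i
  have h2 := mem_box.1 hk i
  refine mem_shell.2 ⟨hk, i, le_antisymm h2 ?_⟩
  rw [lt_abs] at hi
  rw [le_abs]
  omega

end NearestNeighbours

/-! ### Filled boxes, and dimension one -/

section ProductMeasure

variable {d : ℕ} {H₀ : L2 (Fin d → ℤ) →L[ℂ] L2 (Fin d → ℤ)} {μ : Measure ℝ≥0∞}
  [IsProbabilityMeasure μ]

/-- The event that the box is in an infinite cluster after it is filled. -/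
theorem exists_measure_fill_ne_zero (hadj : IsLatticeAdjacencyOperator H₀)
    (hH : IsHopping H₀)
    (hne : ∀ᵐ ω ∂(Measure.infinitePi fun _ : Fin d → ℤ => μ), (infCluster H₀ ω).Nonempty) (N : ℕ) :
    ∃ n ≥ N, (Measure.infinitePi fun _ : Fin d → ℤ => μ)
      (fill (box d n) ⁻¹' {ω | 0 ∈ infCluster H₀ ω}) ≠ 0 := by
  by_contra! hcon
  have h1 : ∀ᵐ ω ∂(Measure.infinitePi fun _ : Fin d → ℤ => μ), ∀ n ≥ N,
      0 ∉ infCluster H₀ (fill (box d n) ω) := by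
    rw [ae_all_iff]
    intro n
    by_cases hn : n ≥ N
    · filter_upwards [measure_eq_zero_iff_ae_notMem.1 (hcon n hn)] with ω hω _
      exact hω
    · exact ae_of_all _ fun ω h => absurd h hn
  obtain ⟨ω, ⟨k, hk⟩, hω⟩ := (hne.and h1).exists
  obtain ⟨L, hL⟩ := exists_mem_box k
  -- Once the filled box contains a vertex of an infinite cluster, it connects this vertex with the
  -- origin.
  refine hω (max N L) (le_max_left _ _) ?_
  set n := max N L
  have hact : ∀ y ∈ box d n, y ∈ active (fill (box d n : Set (Fin d → ℤ)) ω) := fun y hy =>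
    mem_active_fill.2 (Or.inl hy)
  have hk' : k ∈ infCluster H₀ (fill (box d n : Set (Fin d → ℤ)) ω) :=
    infCluster_mono (fun y hy => mem_active_fill.2 (Or.inr hy)) hk
  exact (conn_corner_of_box hadj hact (zero_mem_box n)).mem_infCluster (hact _ (zero_mem_box n))
    ((conn_corner_of_box hadj hact (box_mono (le_max_right _ _) hL)).mem_infCluster_right hH hk')

/-- In dimension one there is no infinite cluster if sites are deleted with positive
probability. -/
theorem measure_top_eq_zero_of_dim_one (hadj : IsLatticeAdjacencyOperator H₀) {i₀ : Fin d}
    (hd : ∀ i, i = i₀)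
    (hne : ∀ᵐ ω ∂(Measure.infinitePi fun _ : Fin d → ℤ => μ), (infCluster H₀ ω).Nonempty) :
    μ {∞} = 0 := by
  by_contra hμ
  set P := Measure.infinitePi fun _ : Fin d → ℤ => μ with hP
  -- On `W n` both sites next to the interval `[-n, n]` are deleted, so no cluster meeting the
  -- interval is infinite. All these events have the same probability, the square of `μ {∞}`.
  set W : ℕ → Set ((Fin d → ℤ) → ℝ≥0∞) := fun n =>
    {ω | ω (fun _ => n + 1) ∈ ({∞} : Set ℝ≥0∞)} ∩ {ω | ω (fun _ => -(n + 1)) ∈ ({∞} : Set ℝ≥0∞)}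
    with hW
  have hWm : ∀ n, MeasurableSet (W n) := fun n =>
    (measurable_pi_apply (fun _ => (n + 1 : ℤ)) (measurableSet_singleton _)).inter
      (measurable_pi_apply (fun _ => -(n + 1 : ℤ)) (measurableSet_singleton _))
  have hPW : ∀ n, P (W n) = μ {∞} * μ {∞} := by
    intro n
    have hm : ∀ k : Fin d → ℤ, MeasurableSet[eventsOn {k}]
        {ω : (Fin d → ℤ) → ℝ≥0∞ | ω k ∈ ({∞} : Set ℝ≥0∞)} := fun k =>
      measurable_eval_eventsOn (Set.mem_singleton k) (measurableSet_singleton ∞)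
    have hdisj : Disjoint ({fun _ => (n + 1 : ℤ)} : Set (Fin d → ℤ)) {fun _ => -(n + 1 : ℤ)} := by
      rw [Set.disjoint_singleton]
      intro h
      have := congrFun h i₀
      omega
    rw [hP, hW, measure_inter_eq_mul_of_disjoint hdisj (hm _) (hm _),
      infinitePi_eval _ (measurableSet_singleton ∞), infinitePi_eval _ (measurableSet_singleton ∞)]
  have htrap : ∀ n ω k, ω ∈ W n → k ∈ box d n → k ∉ infCluster H₀ ω := by
    intro n ω k hω hk hinf
    refine hinf.2 ((box d n).finite_toSet.subset fun j hj => ?_)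
    induction hj with
    | refl => exact hk
    | @tail b c _ hbc ih =>
      by_contra hc
      have hb := mem_box.1 ih i₀
      have h1 := abs_sub_le_one (hadj.hop_ne_zero.1 hbc.2) i₀
      have h2 : ¬ |c i₀| ≤ n := fun h => hc (mem_box.2 fun i => by rwa [hd i])
      rw [abs_le] at h2 hb
      have hcc : c = fun _ => c i₀ := funext fun i => by rw [hd i]
      have h3 : ω c = ∞ := by
        rcases (by omega : c i₀ = n + 1 ∨ c i₀ = -(n + 1)) with h | h
        · rw [hcc, h]; exact hω.1
        · rw [hcc, h]; exact hω.2
      exact (ne_of_lt hbc.1) h3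
  -- The intersection of the decreasing `U n`, where infinitely many `W m` occur, is null because
  -- almost surely there is an infinite cluster. Each `U n` contains `W n`, so the constant
  -- probability is zero; independence of different `W n` plays no role.
  set U : ℕ → Set ((Fin d → ℤ) → ℝ≥0∞) := fun n => ⋃ m ≥ n, W m with hU
  have hUlim : Tendsto (P ∘ U) atTop (𝓝 (P (⋂ n, U n))) :=
    tendsto_measure_iInter_atTop (fun n => (MeasurableSet.biUnion (Set.to_countable _)
      fun m _ => hWm m).nullMeasurableSet)
      (fun n n' h => Set.biUnion_subset_biUnion_left fun m hm => le_trans h hm)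
      ⟨0, measure_ne_top _ _⟩
  have hU0 : P (⋂ n, U n) = 0 := by
    rw [measure_eq_zero_iff_ae_notMem]
    filter_upwards [hne] with ω ⟨k, hk⟩ hω
    obtain ⟨L, hL⟩ := exists_mem_box k
    obtain ⟨m, hm, hωm⟩ := Set.mem_iUnion₂.1 (Set.mem_iInter.1 hω L)
    exact htrap m ω k hωm (box_mono hm hL) hk
  rw [hU0] at hUlim
  have h1 : μ {∞} * μ {∞} ≤ 0 := ge_of_tendsto' hUlim fun n => by
    rw [← hPW n]
    exact measure_mono (Set.subset_biUnion_of_mem (u := W) (le_refl n))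
  exact mul_ne_zero hμ hμ (le_antisymm h1 zero_le)

end ProductMeasure

/-! ### Attaching a cluster and its mirror image to an infinite cluster -/

section Reflection

variable {d : ℕ} {H₀ : L2 (Fin d → ℤ) →L[ℂ] L2 (Fin d → ℤ)} {ω : (Fin d → ℤ) → ℝ≥0∞} {E : ℝ}

/-- The reflection of `ℤ^d` at the hyperplane where the coordinate `i` is `c`. -/
def reflect (i : Fin d) (c : ℤ) : Equiv.Perm (Fin d → ℤ) :=
  Function.Involutive.toPerm (fun x => Function.update x i (2 * c - x i)) fun x => by simp

theorem reflect_apply (i : Fin d) (c : ℤ) (x : Fin d → ℤ) :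
    reflect i c x = Function.update x i (2 * c - x i) := rfl

theorem reflect_apply_self (i : Fin d) (c : ℤ) (x : Fin d → ℤ) :
    reflect i c x i = 2 * c - x i := Function.update_self ..

theorem reflect_reflect (i : Fin d) (c : ℤ) (x : Fin d → ℤ) :
    reflect i c (reflect i c x) = x := (reflect i c).apply_symm_apply x

theorem reflect_eq_self {i : Fin d} {c : ℤ} {x : Fin d → ℤ} (h : x i = c) : reflect i c x = x := by
  rw [reflect_apply, Function.update_eq_self_iff]
  omega

theorem l1dist_reflect (i : Fin d) (c : ℤ) (k j : Fin d → ℤ) :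
    l1dist (reflect i c k) (reflect i c j) = l1dist k j := by
  refine Finset.sum_congr rfl fun i' _ => ?_
  rw [reflect_apply, reflect_apply]
  by_cases h : i' = i
  · subst h
    rw [Function.update_self, Function.update_self]
    omega
  · rw [Function.update_of_ne h, Function.update_of_ne h]

theorem hop_reflect (hadj : IsLatticeAdjacencyOperator H₀) (i : Fin d) (c : ℤ)
    (k j : Fin d → ℤ) : hop H₀ (reflect i c k) (reflect i c j) = hop H₀ k j := by
  rw [hop, hop, hadj, hadj, l1dist_reflect]

/-- The shell of the box `[-n, n]^d` together with the ray from `m` to it. -/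
def handle (n : ℕ) (m : Fin d → ℤ) (i : Fin d) : Set (Fin d → ℤ) :=
  {k | k ∈ shell d n ∨ ∃ w, m i ≤ w ∧ w ≤ n ∧ k = Function.update m i w}

/-- `C` is a set of active sites whose Hamiltonian has the eigenvalue `E`, and so is its mirror
image. If both are connected with an infinite cluster through a single site `m` on the
mirror, then the infinite cluster has the eigenvalue `E`. -/
theorem mem_sigmaFin_infCluster_of_reflect (hadj : IsLatticeAdjacencyOperator H₀)
    (hH : IsHopping H₀) {i₀ i₁ : Fin d} (hi : i₀ ≠ i₁) {C C' : Finset (Fin d → ℤ)}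
    (hC : IsConnectedSet H₀ C) {a m : Fin d → ℤ} {c : ℤ} (ha : a ∈ C)
    (ha₀ : ∀ x ∈ C, x i₀ ≤ a i₀) (ha₁ : ∀ x ∈ C, x i₀ = a i₀ → x i₁ ≤ a i₁) (hc : c = a i₀ + 1)
    (hm : m = Function.update a i₀ c) (hC' : C' = C.map (reflect i₀ c).symm.toEmbedding)
    {N n : ℕ} (hCN : C ⊆ box d N) (hCN' : C' ⊆ box d N) (hmN : m ∈ box d N) (hNn : N + 2 ≤ n)
    (hR : ω ∈ locEvent H₀ C E) (hR' : shift (reflect i₀ c) ω ∈ locEvent H₀ C E)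
    (hQ : ∀ k ∈ box d n, k ∉ C → k ∉ C' →
      (k ∈ handle n m i₁ → k ∈ active ω) ∧ (k ∉ handle n m i₁ → ω k = ∞))
    (hT : 0 ∈ infCluster H₀ (fill (box d n) ω)) :
    E ∈ sigmaFin H₀ ω (infCluster H₀ ω) := by
  have hmemC' : ∀ k, k ∈ C' ↔ reflect i₀ c k ∈ C := fun k => by
    rw [hC', Finset.mem_map_equiv, Equiv.symm_symm]
  have hm₀ : m i₀ = c := by rw [hm, Function.update_self]
  have hm₁ : m i₁ = a i₁ := by rw [hm, Function.update_of_ne hi.symm]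
  have hC₀ : ∀ k ∈ C, k i₀ ≤ c - 1 := fun k hk => by
    have := ha₀ k hk
    omega
  have hC₀' : ∀ k ∈ C', c + 1 ≤ k i₀ := fun k hk => by
    have := hC₀ _ ((hmemC' k).1 hk)
    rw [reflect_apply_self] at this
    omega
  have hray₀ : ∀ w, Function.update m i₁ w i₀ = c := fun w => by rw [Function.update_of_ne hi, hm₀]
  have hmray : m = Function.update m i₁ (m i₁) := (Function.update_eq_self _ _).symm
  have hraybox : ∀ w, m i₁ ≤ w → w ≤ n → Function.update m i₁ w ∈ box d n := by
    intro w hw1 hw2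
    refine mem_box.2 fun i => ?_
    have h1 := abs_le.1 (mem_box.1 hmN i)
    rw [abs_le]
    by_cases h : i = i₁
    · subst h
      rw [Function.update_self]
      omega
    · rw [Function.update_of_ne h]
      omega
  have hray : ∀ w, m i₁ ≤ w → w ≤ n → Function.update m i₁ w ∈ active ω := by
    intro w hw1 hw2
    refine (hQ _ (hraybox w hw1 hw2) (fun h => ?_) fun h => ?_).1 (Or.inr ⟨w, hw1, hw2, rfl⟩)
    · have := hC₀ _ h
      rw [hray₀] at this
      omega
    · have := hC₀' _ h
      rw [hray₀] at this
      omega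
  have hshellbox : ∀ k ∈ shell d n, k ∉ box d N := by
    intro k hk hk'
    obtain ⟨-, i, h⟩ := mem_shell.1 hk
    have := mem_box.1 hk' i
    omega
  have hshell : ∀ k ∈ shell d n, k ∈ active ω := fun k hk =>
    (hQ k (mem_shell.1 hk).1 (fun h => hshellbox k hk (hCN h))
      fun h => hshellbox k hk (hCN' h)).1 (Or.inl hk)
  -- The margin `N + 2 ≤ n` keeps the shell and everything beyond it from being adjacent to sites of
  -- the box of radius `N`.
  have hfar : ∀ k, k ∉ box d n ∨ k ∈ shell d n → ∀ j ∈ box d N, l1dist k j ≠ 1 := by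
    intro k hk j hj h
    obtain ⟨i, hki⟩ : ∃ i, (n : ℤ) ≤ |k i| := by
      rcases hk with hk | hk
      · rw [mem_box] at hk
        push Not at hk
        exact hk.imp fun _ h => h.le
      · exact (mem_shell.1 hk).2.imp fun _ h => h.ge
    have h1 := abs_sub_le_one h i
    have h2 := abs_le.1 (mem_box.1 hj i)
    rw [le_abs] at hki
    omega
  -- The ray lies on the mirror, so a site of `C` adjacent to it has `i₀`-coordinate `a i₀` and the
  -- same `i₁`-coordinate as the ray site, at least `a i₁`. The lexicographic maximality of `a`
  -- leaves only `m`.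
  have htouch : ∀ w, m i₁ ≤ w → ∀ j ∈ C, l1dist (Function.update m i₁ w) j = 1 →
      Function.update m i₁ w = m := by
    intro w hw j hj h
    have h1 := hC₀ j hj
    have h2 := abs_sub_le_one h i₀
    have h3 := eq_of_l1dist_eq_one h (i := i₀) (i' := i₁) (by rw [hray₀]; omega) hi.symm
    rw [hray₀] at h2
    rw [Function.update_self] at h3
    have h4 := ha₁ j hj (by omega)
    rw [(by omega : w = m i₁), Function.update_eq_self]
  -- The event on the filled box guarantees an infinite cluster meeting the shell; since the shell
  -- is active and connected, its corner belongs to that cluster.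
  have hcorner : (fun _ => (n : ℤ)) ∈ infCluster H₀ ω := by
    obtain ⟨s, hs, hsi⟩ := exists_mem_infCluster_of_fill hshell
      (fun k hk j hj h => mem_shell_of_hop hadj hk hj h) (zero_mem_box n) hT
    exact (conn_corner_of_shell hadj hi hshell hs).mem_infCluster_right hH hsi
  have hmn : m i₁ ≤ n := by
    have := abs_le.1 (mem_box.1 hmN i₁)
    omega
  have hmact : m ∈ active ω := by
    rw [hmray]
    exact hray _ le_rfl hmn
  have hmcorner : Conn H₀ ω m fun _ => n := by
    have h1 := conn_update (ω := ω) hadj m i₁ hmn hray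
    rw [← hmray] at h1
    refine h1.trans (conn_corner_of_shell hadj hi hshell (mem_shell.2 ⟨hraybox _ hmn le_rfl,
      i₁, by rw [Function.update_self, Nat.abs_cast]⟩))
  have ham : l1dist a m = 1 := by
    have h := l1dist_update a i₀ (a i₀) c
    rw [Function.update_eq_self, ← hm] at h
    rw [h]
    omega
  have hact' : ∀ k ∈ C', k ∈ active ω := by
    intro k hk
    have h := hR'.1 _ ((hmemC' k).1 hk)
    rw [active, Set.mem_ofPred_eq] at h ⊢
    rwa [← shift_smul (reflect i₀ c) ω k]
  have hconn' : IsConnectedSet H₀ C' := by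
    rw [hC']
    exact hC.map_perm (hop_reflect hadj i₀ c)
  have ha' : reflect i₀ c a ∈ C' := by rwa [hmemC', reflect_reflect]
  obtain ⟨f, hf⟩ := locDet_eq_zero_iff.1 hR.2
  obtain ⟨f', hf'⟩ := locDet_eq_zero_iff.1 hR'.2
  have hf'' := hf'.comp_perm (hop_reflect hadj i₀ c)
  rw [← hC'] at hf''
  -- Active sites outside `C` and `C'` lie on the shell, beyond the box or on the ray; among them
  -- only `m` touches `C` or `C'`. Both sets reach the infinite cluster through `m`, the ray and the
  -- shell.
  refine mem_sigmaFin_infCluster_of_two (m := m) hH hf hf'' ?_ (fun k hk j hj => ?_)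
    (fun k hk hkC hkC' hkm => ?_) (fun k hk => ?_) fun k hk => ?_
  · rw [Finset.disjoint_left]
    intro k hk hk'
    have := hC₀ k hk
    have := hC₀' k hk'
    omega
  · refine hadj.hop_eq_zero fun h => ?_
    have := hC₀ k hk
    have := hC₀' j hj
    have := abs_sub_le_one h i₀
    omega
  · have hcases : (k ∉ box d n ∨ k ∈ shell d n) ∨
        ∃ w, m i₁ ≤ w ∧ w ≤ n ∧ k = Function.update m i₁ w := by
      by_cases hkn : k ∈ box d n
      · by_cases hkD : k ∈ handle n m i₁
        · exact hkD.imp Or.inr id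
        · exact absurd ((hQ k hkn hkC hkC').2 hkD) (ne_of_lt hk)
      · exact Or.inl (Or.inl hkn)
    rcases hcases with hk' | ⟨w, hw, -, rfl⟩
    · exact ⟨fun j hj => hadj.hop_eq_zero (hfar k hk' j (hCN hj)),
        fun j hj => hadj.hop_eq_zero (hfar k hk' j (hCN' hj))⟩
    · refine ⟨fun j hj => hadj.hop_eq_zero fun h => hkm (htouch w hw j hj h),
        fun j hj => hadj.hop_eq_zero fun h => hkm (htouch w hw _ ((hmemC' j).1 hj) ?_)⟩
      rw [← l1dist_reflect i₀ c, reflect_eq_self (hray₀ w)] at h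
      exact h
  · refine Conn.mem_infCluster ?_ (hR.1 k hk) hcorner
    exact ((hC.conn hR.1 hk ha).tail ⟨hmact, hadj.hop_ne_zero.2 ham⟩).trans hmcorner
  · refine Conn.mem_infCluster ?_ (hact' k hk) hcorner
    refine ((hconn'.conn hact' hk ha').tail ⟨hmact, hadj.hop_ne_zero.2 ?_⟩).trans hmcorner
    rw [← reflect_eq_self hm₀, l1dist_reflect, ham]

theorem exists_lexicographic_max (i₀ i₁ : Fin d) {C : Finset (Fin d → ℤ)} (hC : C.Nonempty) :
    ∃ a ∈ C, (∀ x ∈ C, x i₀ ≤ a i₀) ∧ ∀ x ∈ C, x i₀ = a i₀ → x i₁ ≤ a i₁ := by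
  obtain ⟨b, hb, hbmax⟩ := C.exists_max_image (fun x => x i₀) hC
  obtain ⟨a, ha, hamax⟩ := (C.filter fun x => x i₀ = b i₀).exists_max_image (fun x => x i₁)
    ⟨b, Finset.mem_filter.2 ⟨hb, rfl⟩⟩
  rw [Finset.mem_filter] at ha
  exact ⟨a, ha.1, fun x hx => (hbmax x hx).trans_eq ha.2.symm, fun x hx h =>
    hamax x (Finset.mem_filter.2 ⟨hx, h.trans ha.2⟩)⟩

end Reflection

/-! ### Equality of the almost sure eigenvalues of infinite and of all clusters -/

section ProductMeasure

variable {d : ℕ} {H₀ : L2 (Fin d → ℤ) →L[ℂ] L2 (Fin d → ℤ)} {μ : Measure ℝ≥0∞}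
  [IsProbabilityMeasure μ] {E : ℝ}

/-- Four events concern disjoint sets of sites: the eigenvalue on `C`, its mirror image on `C'`, the
prescribed handle in the rest of the box, and the infinite cluster outside the box after filling.
Each has positive probability, and by independence so has their intersection, on which the combined
eigenfunction exists. -/
theorem measure_sigmaFin_infCluster_ne_zero (hadj : IsLatticeAdjacencyOperator H₀)
    (hH : IsHopping H₀) {i₀ i₁ : Fin d} (hi : i₀ ≠ i₁)
    (hne : ∀ᵐ ω ∂(Measure.infinitePi fun _ : Fin d → ℤ => μ), (infCluster H₀ ω).Nonempty)
    {C : Finset (Fin d → ℤ)} (hC : C.Nonempty) (hCconn : IsConnectedSet H₀ C)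
    (hE : (Measure.infinitePi fun _ : Fin d → ℤ => μ) (locEvent H₀ C E) ≠ 0)
    (htop : μ {∞} ≠ 0) (hfin : μ (Set.Iio ∞) ≠ 0) :
    (Measure.infinitePi fun _ : Fin d → ℤ => μ)
      {ω | E ∈ sigmaFin H₀ ω (infCluster H₀ ω)} ≠ 0 := by
  classical
  obtain ⟨a, ha, ha₀, ha₁⟩ := exists_lexicographic_max i₀ i₁ hC
  set c := a i₀ + 1 with hc
  set m := Function.update a i₀ c with hm
  set C' := C.map (reflect i₀ c).symm.toEmbedding with hC'
  obtain ⟨N, hN⟩ := exists_subset_box (C ∪ C' ∪ {m})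
  have hCN : C ⊆ box d N := fun k hk => hN (by simp [hk])
  have hCN' : C' ⊆ box d N := fun k hk => hN (Finset.mem_union_left _
    (Finset.mem_union_right _ hk))
  have hmN : m ∈ box d N := hN (by simp)
  obtain ⟨n, hn, hPn⟩ := exists_measure_fill_ne_zero (μ := μ) hadj hH hne (N + 2)
  set P := Measure.infinitePi fun _ : Fin d → ℤ => μ with hP
  have hNn : box d N ⊆ box d n := box_mono (by omega)
  set S := box d n \ (C ∪ C') with hS
  set T : (Fin d → ℤ) → Set ℝ≥0∞ := fun k => if k ∈ handle n m i₁ then Set.Iio ∞ else {∞} with hT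
  have hTm : ∀ k, MeasurableSet (T k) := fun k => by
    simp only [hT]
    split_ifs
    exacts [measurableSet_Iio, measurableSet_singleton _]
  have hQ : P {ω | ∀ k ∈ S, ω k ∈ T k} ≠ 0 := by
    refine measure_pattern_ne_zero iIndepFun_eval hTm (fun k => ?_) S
    rw [infinitePi_eval k (hTm k)]
    simp only [hT]
    split_ifs
    exacts [hfin, htop]
  have hR' : P (shift (reflect i₀ c) ⁻¹' locEvent H₀ C E) ≠ 0 := by
    rwa [(measurePreserving_shift_infinitePi (μ := μ) (reflect i₀ c)).measure_preimage
      (eventsOn_le _ _ (measurableSet_locEvent C)).nullMeasurableSet]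
  have hmemC' : ∀ k, k ∈ C' ↔ reflect i₀ c k ∈ C := fun k => by
    rw [hC', Finset.mem_map_equiv, Equiv.symm_symm]
  have hdisj : Disjoint C C' := by
    rw [Finset.disjoint_left]
    intro k hk hk'
    have h1 := ha₀ k hk
    have h2 := ha₀ _ ((hmemC' k).1 hk')
    rw [reflect_apply_self] at h2
    omega
  have hQm : MeasurableSet[eventsOn (S : Set (Fin d → ℤ))] {ω | ∀ k ∈ S, ω k ∈ T k} := by
    have h : {ω : (Fin d → ℤ) → ℝ≥0∞ | ∀ k ∈ S, ω k ∈ T k} =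
        ⋂ k ∈ S, (fun ω : (Fin d → ℤ) → ℝ≥0∞ => ω k) ⁻¹' T k := by
      ext ω
      simp
    rw [h]
    exact Finset.measurableSet_biInter _ fun k hk =>
      measurable_eval_eventsOn (Finset.mem_coe.2 hk) (hTm k)
  have hFm : MeasurableSet[eventsOn ((box d n : Set (Fin d → ℤ))ᶜ)]
      (fill (box d n) ⁻¹' {ω | 0 ∈ infCluster H₀ ω}) :=
    measurable_fill _ (measurableSet_mem_infCluster 0)
  have hmono : ∀ {A B : Set (Fin d → ℤ)}, A ⊆ B → eventsOn A ≤ eventsOn B := fun h =>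
    biSup_mono fun _ hk => h hk
  have h1 : P ({ω | ∀ k ∈ S, ω k ∈ T k} ∩ fill (box d n) ⁻¹' {ω | 0 ∈ infCluster H₀ ω}) ≠ 0 := by
    rw [hP, measure_inter_eq_mul_of_disjoint ?_ hQm hFm]
    · exact mul_ne_zero hQ hPn
    · exact Set.disjoint_compl_right_iff_subset.2 fun k hk => (Finset.mem_sdiff.1 hk).1
  have hm1 : MeasurableSet[eventsOn ((C ∪ C' : Finset (Fin d → ℤ)) : Set (Fin d → ℤ))ᶜ]
      ({ω | ∀ k ∈ S, ω k ∈ T k} ∩ fill (box d n) ⁻¹' {ω | 0 ∈ infCluster H₀ ω}) := by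
    refine MeasurableSet.inter (hmono (fun k hk => ?_) _ hQm) (hmono (fun k hk => ?_) _ hFm)
    · exact fun h => (Finset.mem_sdiff.1 hk).2 h
    · exact fun h => hk (hNn ((Finset.union_subset hCN hCN') h))
  have hm2 : MeasurableSet[eventsOn (C' : Set (Fin d → ℤ))]
      (shift (reflect i₀ c) ⁻¹' locEvent H₀ C E) :=
    measurableSet_shift_locEvent _ fun k hk => by
      rw [hmemC']
      simpa using hk
  have hdisj' : Disjoint (C' : Set (Fin d → ℤ)) ((C ∪ C' : Finset (Fin d → ℤ)) : Set _)ᶜ :=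
    Set.disjoint_compl_right_iff_subset.2 fun k hk => Finset.mem_union_right _ hk
  have h2 := measure_inter_eq_mul_of_disjoint (μ := μ) hdisj' hm2 hm1
  have hm3 : MeasurableSet[eventsOn (C : Set (Fin d → ℤ))ᶜ]
      (shift (reflect i₀ c) ⁻¹' locEvent H₀ C E ∩
        ({ω | ∀ k ∈ S, ω k ∈ T k} ∩ fill (box d n) ⁻¹' {ω | 0 ∈ infCluster H₀ ω})) := by
    refine MeasurableSet.inter (hmono (fun k hk => ?_) _ hm2) (hmono (fun k hk => ?_) _ hm1)
    · exact fun h => Finset.disjoint_left.1 hdisj h hk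
    · exact fun h => hk (Finset.mem_union_left _ h)
  have h3 := measure_inter_eq_mul_of_disjoint (μ := μ) disjoint_compl_right
    (measurableSet_locEvent (H₀ := H₀) (E := E) C) hm3
  intro hzero
  have h4 : P (locEvent H₀ C E ∩ (shift (reflect i₀ c) ⁻¹' locEvent H₀ C E ∩
      ({ω | ∀ k ∈ S, ω k ∈ T k} ∩ fill (box d n) ⁻¹' {ω | 0 ∈ infCluster H₀ ω}))) ≠ 0 := by
    rw [hP, h3, h2]
    exact mul_ne_zero hE (mul_ne_zero hR' h1)
  refine h4 (measure_mono_null ?_ hzero)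
  rintro ω ⟨hωR, hωR', hωQ, hωT⟩
  refine mem_sigmaFin_infCluster_of_reflect hadj hH hi hCconn ha ha₀ ha₁ hc hm hC' hCN hCN' hmN hn
    hωR hωR' (fun k hk hkC hkC' => ?_) hωT
  have h5 := hωQ k (Finset.mem_sdiff.2 ⟨hk, by simp [hkC, hkC']⟩)
  simp only [hT] at h5
  constructor
  · intro hkD
    rwa [if_pos hkD] at h5
  · intro hkD
    rwa [if_neg hkD] at h5

/-- On the lattice with nearest neighbour hopping, the infinite clusters have the same almost sure
eigenvalues with finitely supported eigenfunctions as all clusters. -/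
theorem SigmaFin_infCluster_eq (hd : 1 ≤ d) (hadj : IsLatticeAdjacencyOperator H₀)
    (hH : IsLatticeHopping H₀)
    (hNinf : NonrandomSigmaFin (Measure.infinitePi fun _ : Fin d → ℤ => μ) H₀ (infCluster H₀))
    (hne : ∀ᵐ ω ∂(Measure.infinitePi fun _ : Fin d → ℤ => μ), (infCluster H₀ ω).Nonempty) :
    SigmaFin (Measure.infinitePi fun _ : Fin d → ℤ => μ) H₀ (infCluster H₀) =
      SigmaFin (Measure.infinitePi fun _ : Fin d → ℤ => μ) H₀ active := by
  have hhop : IsHopping H₀ := hH.isInvariantHopping.toIsHopping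
  set P := Measure.infinitePi fun _ : Fin d → ℤ => μ with hP
  refine Set.Subset.antisymm (fun E (hE : ∀ᵐ ω ∂P, _) => hE.mono fun ω hω =>
    sigmaFin_infCluster_subset hω) fun E (hE : ∀ᵐ ω ∂P, _) => ?_
  by_contra hcon
  have hnot : ∀ᵐ ω ∂P, E ∉ sigmaFin H₀ ω (infCluster H₀ ω) := (hNinf E).resolve_left hcon
  -- If `E` is almost surely absent from the infinite clusters, its eigenfunctions live on finite
  -- clusters; there are countably many finite sets, so one of them is such a cluster with positive
  -- probability.
  obtain ⟨C, hC, hCconn, hPC⟩ : ∃ C : Finset (Fin d → ℤ), C.Nonempty ∧ IsConnectedSet H₀ C ∧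
      P {ω | ω ∈ locEvent H₀ C E ∧
        ∀ k ∈ C, ∀ j, j ∉ C → hop H₀ k j ≠ 0 → ω j = ∞} ≠ 0 := by
    by_contra! h
    have h1 : ∀ᵐ ω ∂P, ∀ C : Finset (Fin d → ℤ), C.Nonempty → IsConnectedSet H₀ C →
        ¬ (ω ∈ locEvent H₀ C E ∧ ∀ k ∈ C, ∀ j, j ∉ C → hop H₀ k j ≠ 0 → ω j = ∞) := by
      rw [ae_all_iff]
      intro C
      by_cases hC : C.Nonempty ∧ IsConnectedSet H₀ C
      · filter_upwards [measure_eq_zero_iff_ae_notMem.1 (h C hC.1 hC.2)] with ω hω _ _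
        exact hω
      · exact ae_of_all _ fun ω h1 h2 => absurd ⟨h1, h2⟩ hC
    obtain ⟨ω, ⟨hω1, hω2⟩, hω3⟩ := ((hnot.and h1).and hE).exists
    rcases mem_sigmaFin_infCluster_or hhop hω3 with h | ⟨C, hC, hCc, h, h'⟩
    · exact hω1 h
    · exact hω2 C hC hCc ⟨h, h'⟩
  set i₀ : Fin d := ⟨0, hd⟩
  obtain ⟨a, ha, ha₀, -⟩ := exists_lexicographic_max i₀ i₀ hC
  -- The site next to a point of `C` with maximal `i₀`-coordinate lies outside `C` and is deleted
  -- whenever `C` is a cluster; this shows that deletion has positive probability.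
  have htop : μ {∞} ≠ 0 := by
    rw [← infinitePi_eval (μ := μ) (Function.update a i₀ (a i₀ + 1)) (measurableSet_singleton ∞)]
    refine fun h => hPC (measure_mono_null (fun ω hω => hω.2 a ha _ (fun h => ?_) ?_) h)
    · have := ha₀ _ h
      rw [Function.update_self] at this
      omega
    · rw [hadj.hop_ne_zero]
      have h1 := l1dist_update a i₀ (a i₀) (a i₀ + 1)
      rw [Function.update_eq_self] at h1
      rw [h1]
      omega
  have hfin : μ (Set.Iio ∞) ≠ 0 := by
    rw [← infinitePi_eval (μ := μ) a measurableSet_Iio]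
    exact fun h => hPC (measure_mono_null (fun ω hω => hω.1.1 a ha) h)
  -- A second coordinate exists because in dimension one infinite clusters and a positive deletion
  -- probability exclude each other.
  obtain ⟨i₁, hi⟩ : ∃ i₁, i₀ ≠ i₁ := by
    by_contra! h
    exact htop (measure_top_eq_zero_of_dim_one hadj (fun i => (h i).symm) hne)
  exact measure_sigmaFin_infCluster_ne_zero hadj hhop hi hne hC hCconn
    (fun h => hPC (measure_mono_null (fun ω hω => hω.1) h)) htop hfin
    (measure_eq_zero_iff_ae_notMem.2 hnot)

end ProductMeasure

end Percolation

end

open Percolation in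
theorem theorem2p2 :
    -- the lattice `ℤ^d` with an iid potential
    (∀ (d : ℕ), 1 ≤ d → ∀ (μ : Measure ℝ≥0∞) [IsProbabilityMeasure μ]
      (H₀ : L2 (Fin d → ℤ) →L[ℂ] L2 (Fin d → ℤ)), IsLatticeHopping H₀ →
      ∀ P : Measure ((Fin d → ℤ) → ℝ≥0∞), P = Measure.infinitePi (fun _ : Fin d → ℤ => μ) →
      NonrandomSigmaFin P H₀ active ∧ NonrandomSigmaFin P H₀ (infCluster H₀) ∧
      ∃ ν νinf : Measure ℝ,
        IsIDS P H₀ active (box d) ν ∧ IsIDS P H₀ (infCluster H₀) (box d) νinf ∧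
        SigmaFin P H₀ active = atoms ν ∧
        ((∀ᵐ t ∂μ, t = 0 ∨ t = ∞) → μ {0} ≠ 0 → μ {∞} ≠ 0 →
          SigmaFin P H₀ active = finiteEigenvalues H₀ ∧
          (∀ᵐ ω ∂P, sigmaFin H₀ ω (active ω) = finiteEigenvalues H₀) ∧
          (∀ᵐ ω ∂P, spectrum ℂ (restrictOp H₀ (active ω)) =
            Complex.ofReal '' closure (finiteEigenvalues H₀)) ∧
          (IsLatticeAdjacencyOperator H₀ → ∀ E ∈ finiteEigenvalues H₀, IsIntegral ℤ E)) ∧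
        ((∀ᵐ ω ∂P, (infCluster H₀ ω).Nonempty) →
          SigmaFin P H₀ (infCluster H₀) = atoms νinf ∧
          (IsLatticeAdjacencyOperator H₀ →
            SigmaFin P H₀ (infCluster H₀) = SigmaFin P H₀ active))) ∧
    -- a graph with the action of an amenable group and a stationary ergodic potential
    (∀ (V Γ : Type*) [Group Γ] [MulAction Γ V] (X : SimpleGraph V) (F : Finset V),
      IsCocompactAction X Γ F →
      ∀ I : ℕ → Finset Γ, IsFolner I →
      ∀ (P : Measure (V → ℝ≥0∞)) [IsProbabilityMeasure P], IsStationaryErgodic Γ P →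
      ∀ H₀ : L2 V →L[ℂ] L2 V, IsGraphHopping X Γ H₀ →
      NonrandomSigmaFin P H₀ active ∧ NonrandomSigmaFin P H₀ (infCluster H₀) ∧
      (∃ φ : ℕ → ℕ, StrictMono φ ∧ ∃ ν νinf : Measure ℝ,
        IsIDS P H₀ active (exhaustion F (I ∘ φ)) ν ∧
        IsIDS P H₀ (infCluster H₀) (exhaustion F (I ∘ φ)) νinf) ∧
      (∀ ν : Measure ℝ, IsIDS P H₀ active (exhaustion F I) ν →
        SigmaFin P H₀ active = atoms ν) ∧
      ((∀ᵐ ω ∂P, ∀ k, ω k = 0 ∨ ω k = ∞) →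
        SigmaFin P H₀ active ⊆ finiteEigenvalues H₀ ∧
        (∀ᵐ ω ∂P, sigmaFin H₀ ω (active ω) = SigmaFin P H₀ active) ∧
        (ProbabilityTheory.iIndepFun (fun (k : V) (ω : V → ℝ≥0∞) => ω k) P →
          (∀ k, P {ω | ω k = 0} ≠ 0) → (∀ k, P {ω | ω k = ∞} ≠ 0) →
          SigmaFin P H₀ active = finiteEigenvalues H₀ ∧
          (∀ᵐ ω ∂P, spectrum ℂ (restrictOp H₀ (active ω)) =
            Complex.ofReal '' closure (finiteEigenvalues H₀)) ∧
          (IsAdjacencyOperator X H₀ → ∀ E ∈ finiteEigenvalues H₀, IsIntegral ℤ E))) ∧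
      ((∀ᵐ ω ∂P, (infCluster H₀ ω).Nonempty) →
        ∀ νinf : Measure ℝ, IsIDS P H₀ (infCluster H₀) (exhaustion F I) νinf →
          SigmaFin P H₀ (infCluster H₀) = atoms νinf)) := by
  refine ⟨?_, ?_⟩
  · intro d hd μ _ H₀ hH P hP
    subst hP
    have hact : IsRandomSet (Multiplicative (Fin d → ℤ)) (active (V := Fin d → ℤ)) :=
      isRandomSet_active
    have hinf := isRandomSet_infCluster hH.isInvariantHopping
    obtain ⟨ν, hν⟩ := exists_isIDS_lattice (μ := μ) hd hH hact
    obtain ⟨νinf, hνinf⟩ := exists_isIDS_lattice (μ := μ) hd hH hinf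
    obtain ⟨hN, h1⟩ := nonrandomSigmaFin_lattice hd hH hact hν
    obtain ⟨hNinf, h2⟩ := nonrandomSigmaFin_lattice hd hH hinf hνinf
    refine ⟨hN, hNinf, ν, νinf, hν, hνinf, h1, zero_infinity_lattice hH hN, fun hne =>
      ⟨h2, fun hadj => ?_⟩⟩
    exact SigmaFin_infCluster_eq hd hadj hH hNinf hne
  · intro V Γ _ _ X F hX I hI P _ hP H₀ hH
    obtain ⟨h1, h2, h3, h4, h5, h6⟩ := graph_percolation hX hI hP hH
    exact ⟨h1, h2, h3, h4, h5, fun _ => h6⟩
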